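/- **Setting.** Let $\mathbb A=\mathbb R\times\mathbb A_f$ be the adele ring of $\mathbb Q$, $|\cdot|$ the idele norm, and $\psi$ a non-trivial continuous unitary character of $\mathbb Q\backslash\mathbb A$. *Groups.* $H_1$ is the group of pairs $(h_1,h_2)\in \mathrm{GL}_2\times\mathrm{GL}_2$ with $\det h_1=\det h_2$, modulo the pairs $(z,z)$ of equal scalars; it acts on $M_2$ by $v\mapsto h_1vh_2^{-1}$. $D\subset H_1$ is the image of $a\mapsto\left(\begin{pmatrix}a&\\&1\end{pmatrix},\begin{pmatrix}a&\\&1\end{pmatrix}\right)$. $\mathrm{GSp}_4$ is the group of $g\in \mathrm{GL}_4$ with ${}^tgJg=\nu(g)J$, $J=\begin{pmatrix}&I_2\\-I_2&\end{pmatrix}$. *Measures.* $\mathbb Q\backslash\mathbb A$ has the invariant measure of total mass $1$. Fix Haar measures on $\mathbb A^\times$ and on the unimodular group $H_1(\mathbb A)$. The spaces $\mathbb Q^\times\backslash\mathbb A^\times$, $H_1(\mathbb Q)\backslash H_1(\mathbb A)$ and $D(\mathbb A)\backslash H_1(\mathbb A)$ carry the quotient measures, with counting measure on $\mathbb Q^\times$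 and $H_1(\mathbb Q)$ and with $D(\mathbb A)\cong\mathbb A^\times$. *Cusp forms.* A cusp form on $\mathrm{GL}_2(\mathbb A)$ is a function that is left $\mathrm{GL}_2(\mathbb Q)$-invariant, has a central character, is right invariant under an open subgroup of $\mathrm{GL}_2(\mathbb A_f)$, is $C^\infty$ and of uniform moderate growth in the $\mathrm{GL}_2(\mathbb R)$-variable, and satisfies $\int_{\mathbb Q\backslash\mathbb A}\varphi\left(\begin{pmatrix}1&x\\&1\end{pmatrix}g\right)dx=0$ for all $g$. For a cusp form $\varphi$, $h\in\mathrm{GL}_2(\mathbb A)$ and a Hecke quasi-character $\chi$, put $$Z(\varphi,h,\chi)=\int_{\mathbb Q^\times\backslash\mathbb A^\times}\varphi\left(\begin{pmatrix}a&\\&1\end{pmatrix}h\right)\chi(a)|a|^{-1/2}\,d^\times a .$$ *Weil representation.* Let $f$ be a Bruhat–Schwartz function on $M_2(\mathbb A)^2$. For $h=(h_1,h_2)\in\mathrm{GL}_2(\mathbb A)^2$ let $\nu(h)=\det h_1/\det h_2$ and $L(h)f(x_1,x_2)=|\nu(h)|^{-2}f(h_1^{-1}x_1h_2,h_1^{-1}x_2h_2)$.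 Let $\omega$ be the Weil representation of $\mathrm{Sp}_4(\mathbb A)$, with respect to $\psi$, on functions on $V(\mathbb A)^2$, $V=(M_2,\det)$, so that, with $(v,v')=\det(v+v')-\det v-\det v'$, $$\omega\begin{pmatrix}a&\\&{}^ta^{-1}\end{pmatrix}f(x)=|\det a|^2f(xa),\quad \omega\begin{pmatrix}1&b\\&1\end{pmatrix}f(x)=\psi\left(\tfrac12\sum_{i,j}b_{ij}(x_i,x_j)\right)f(x),\quad \omega\begin{pmatrix}&1\\-1&\end{pmatrix}f=\hat f,$$ where $\hat f(x)=\int f(x')\psi(\sum_i(x_i,x_i'))dx'$ with self-dual measure. For $\nu(g)=\nu(h)$ put $\omega(g,h)f=\omega\left(g\begin{pmatrix}1&\\&\nu(g)\end{pmatrix}^{-1}\right)L(h)f$, and $\theta(g;h;f)=\sum_{M\in M_2(\mathbb Q)^2}\omega(g,h)f(M)$. *Theta lift and split Bessel period.* Let $\varphi_1,\varphi_2$ be cusp forms on $\mathrm{GL}_2(\mathbb A)$ whose central characters are inverse to each other. For $g\in\mathrm{GSp}_4(\mathbb A)$ choose any $h^1,h^2\in \mathrm{GL}_2(\mathbb A)$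 with $\det h^1(\det h^2)^{-1}=\nu(g)$ and put $$\theta(\varphi_1,\varphi_2;f)(g)=\int_{H_1(\mathbb Q)\backslash H_1(\mathbb A)}\theta(g;h_1h^1,h_2h^2;f)\,\varphi_1(h_1h^1)\varphi_2(h_2h^2)\,d(h_1,h_2).$$ For a function $\Phi$ on $\mathrm{GSp}_4(\mathbb A)$ put $$\Phi^U(g)=\int_{(\mathbb Q\backslash\mathbb A)^3}\Phi\left(\begin{pmatrix}1&&u&w\\&1&w&v\\&&1&\\&&&1\end{pmatrix}g\right)\psi^{-1}(w)\,du\,dv\,dw .$$ For a Hecke quasi-character $\mu$ of $\mathbb Q^\times\backslash\mathbb A^\times$ define $$\mathcal Z(\varphi_1,\varphi_2,f;\mu)=\int_{\mathbb Q^\times\backslash\mathbb A^\times}\theta(\varphi_1,\varphi_2;f)^U\left(\mathrm{diag}(y,1,1,y)\right)\mu(y)|y|^{-1/2}\,d^\times y .$$ **Proposition.** All the integrals involved converge absolutely (for $\theta(\varphi_1,\varphi_2;f)(g)$: at the $g=\begin{pmatrix}1&X\\&1\end{pmatrix}\mathrm{diag}(y,1,1,y)$ that occur), and $$\mathcal Z(\varphi_1,\varphi_2,f;\mu)=\int_{D(\mathbb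 A)\backslash H_1(\mathbb A)}Z(\varphi_1,h_1,\mu)\,Z(\varphi_2,h_2,\mu^{-1}|\cdot|)\;L(h_1,h_2)f\left(\begin{pmatrix}1&0\\0&0\end{pmatrix},\begin{pmatrix}0&0\\0&1\end{pmatrix}\right)dh_1\,dh_2 .$$ -/

import Mathlib

open MeasureTheory Matrix IsDedekindDomain
open scoped ENNReal ContDiff SchwartzMap

namespace ThetaBessel

noncomputable section

/-! ### Adeles and ideles of `ℚ` -/

/-- The finite adeles `𝔸_f` of `ℚ`. -/
abbrev FinAdele : Type := FiniteAdeleRing ℤ ℚ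

/-- The adele ring `𝔸 = ℝ × 𝔸_f` of `ℚ`; `ℚ` is embedded diagonally by `algebraMap ℚ Adele`. -/
abbrev Adele : Type := ℝ × FinAdele

instance : MeasurableSpace FinAdele := borel FinAdele
instance : BorelSpace FinAdele := ⟨rfl⟩

/-- The idele group carries the Borel `σ`-algebra of its own (idele) topology. -/
instance : MeasurableSpace Adeleˣ := borel Adeleˣ
instance : BorelSpace Adeleˣ := ⟨rfl⟩

/-- `|a| = |a_∞| ∏_p |a_p|_p`, with the usual normalization `|p|_p = p⁻¹`.  It is used for ideles
only, for which almost all factors are `1`. -/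
def adeleAbs (a : Adele) : ℝ :=
  |a.1| * ∏ᶠ v : HeightOneSpectrum ℤ, ‖Rat.HeightOneSpectrum.adicCompletion.padicEquiv v (a.2 v)‖

/-- `ℚ` as a subgroup of `𝔸`. -/
def ratAdeles : AddSubgroup Adele := (algebraMap ℚ Adele).range.toAddSubgroup

/-- The quotient `ℚ \ 𝔸`. -/
abbrev AdeleModRat : Type := Adele ⧸ ratAdeles

/-- `ℚˣ` as a subgroup of `𝔸ˣ`. -/
def ratIdeles : Subgroup Adeleˣ := (Units.map (algebraMap ℚ Adele).toMonoidHom).range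

/-! ### Spaces of right cosets and quotient measures -/

/-- The space `Γ \ G` of right cosets `Γ g`. -/
abbrev RightCosets {G : Type*} [Group G] (Γ : Subgroup G) : Type _ :=
  Quotient (QuotientGroup.rightRel Γ)

/-- `m` is the quotient on `Γ \ G` of the measure `dg` on `G` by the counting measure of the
discrete subgroup `Γ`: `∫_{Γ\G} ∑_{γ ∈ Γ} Φ(γ g) dm = ∫_G Φ(g) dg` for measurable `Φ ≥ 0`. -/
def IsDiscreteQuotientMeasure {G : Type*} [Group G] [MeasurableSpace G] (Γ : Subgroup G)
    (dg : Measure G) (m : Measure (RightCosets Γ)) : Prop :=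
  ∀ Φ : G → ℝ≥0∞, Measurable Φ →
    ∫⁻ x, ∑' γ : Γ, Φ (γ * x.out) ∂m = ∫⁻ g, Φ g ∂dg

/-- For an injective homomorphism `ι : N → G`, `m` is the quotient on `ι(N) \ G` of the
measure `dg` on `G` by the measure `dn` on `N`:
`∫_{ι(N)\G} ∫_N Φ(ι(n) g) dn dm = ∫_G Φ(g) dg` for measurable `Φ ≥ 0`. -/
def IsQuotientMeasure {N G : Type*} [Group N] [MeasurableSpace N] [Group G] [MeasurableSpace G]
    (ι : N →* G) (dn : Measure N) (dg : Measure G) (m : Measure (RightCosets ι.range)) : Prop :=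
  ∀ Φ : G → ℝ≥0∞, Measurable Φ →
    ∫⁻ x, ∫⁻ n, Φ (ι n * x.out) ∂dn ∂m = ∫⁻ g, Φ g ∂dg

/-! ### `GL(2)` and cusp forms -/

abbrev GL2 (R : Type*) [CommRing R] : Type _ := GL (Fin 2) R

/-- `a ↦ diag(a, 1)`. -/
def diagOne (R : Type*) [CommRing R] : Rˣ →* GL2 R where
  toFun a := ⟨!![(a : R), 0; 0, 1], !![((a⁻¹ : Rˣ) : R), 0; 0, 1],
    by simp [Matrix.one_fin_two],
    by simp [Matrix.one_fin_two]⟩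
  map_one' := by ext i j; fin_cases i <;> fin_cases j <;> simp
  map_mul' a b := by ext i j; fin_cases i <;> fin_cases j <;> simp [Matrix.mul_apply]

/-- The adelic matrix with real component `x` and finite component `k`. -/
def matProd (x : Matrix (Fin 2) (Fin 2) ℝ) (k : Matrix (Fin 2) (Fin 2) FinAdele) :
    Matrix (Fin 2) (Fin 2) Adele :=
  Matrix.of fun i j => (x i j, k i j)

theorem matProd_mul (x x' : Matrix (Fin 2) (Fin 2) ℝ) (k k' : Matrix (Fin 2) (Fin 2) FinAdele) :
    matProd x k * matProd x' k' = matProd (x * x') (k * k') := by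
  refine Matrix.ext fun i j => ?_
  simp [matProd, Matrix.mul_apply]

theorem matProd_one : matProd 1 1 = 1 := by
  refine Matrix.ext fun i j => ?_
  fin_cases i <;> fin_cases j <;> simp [matProd]

/-- The element of `GL₂(𝔸)` with real component `x` and finite component `k`. -/
def glProd (x : GL2 ℝ) (k : GL2 FinAdele) : GL2 Adele where
  val := matProd x.val k.val
  inv := matProd x⁻¹.val k⁻¹.val
  val_inv := by
    rw [matProd_mul, Units.mul_inv, Units.mul_inv, matProd_one]
  inv_val := by
    rw [matProd_mul, Units.inv_mul, Units.inv_mul, matProd_one]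

open Classical in
/-- For `φ` on `GL₂(𝔸)` and `k ∈ GL₂(𝔸_f)`, the function `y ↦ φ(y k)` of `y ∈ GL₂(ℝ)`, extended by
`0` to all real matrices. -/
def realSlice (φ : GL2 Adele → ℂ) (k : GL2 FinAdele) (y : Fin 2 → Fin 2 → ℝ) : ℂ :=
  if h : (Matrix.of y).det ≠ 0 then
    φ (glProd (Matrix.GeneralLinearGroup.mkOfDetNeZero (Matrix.of y) h) k)
  else 0

/-- A height on `GL₂(ℝ)`. -/
def realHeight (x : GL2 ℝ) : ℝ := ∑ i, ∑ j, (|x i j| + |x⁻¹ i j|)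

/-- `φ` is a (smooth) cusp form on `GL₂(𝔸)` with central character `χ`; here `dx` is the invariant
probability measure of `ℚ \ 𝔸`. -/
structure IsCuspForm (dx : Measure AdeleModRat) (χ : Adeleˣ →* ℂˣ) (φ : GL2 Adele → ℂ) : Prop where
  left_invariant : ∀ (γ : GL2 ℚ) (g : GL2 Adele),
    φ (Matrix.GeneralLinearGroup.map (algebraMap ℚ Adele) γ * g) = φ g
  central : ∀ (z : Adeleˣ) (g : GL2 Adele),
    φ (Matrix.GeneralLinearGroup.scalar (Fin 2) z * g) = (χ z : ℂ) * φ g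
  /-- right invariance under an open subgroup of `GL₂(𝔸_f)` -/
  finite_smooth : ∃ K : Subgroup (GL2 FinAdele), IsOpen (K : Set (GL2 FinAdele)) ∧
    ∀ k ∈ K, ∀ g, φ (g * glProd 1 k) = φ g
  /-- smoothness in the real variable -/
  real_smooth : ∀ k, ContDiffOn ℝ ∞ (realSlice φ k) {y | (Matrix.of y).det ≠ 0}
  /-- uniform moderate growth: the values at `x` of the left invariant derivatives of any order,
  which are the derivatives of `Y ↦ φ(x (1 + Y) k)` at `Y = 0`, are bounded by a power of the
  height of `x` that does not depend on the order -/
  growth : ∀ k, ∃ N : ℕ, ∀ n : ℕ, ∃ C : ℝ, ∀ x : GL2 ℝ,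
    ‖iteratedFDeriv ℝ n
      (fun Y : Fin 2 → Fin 2 → ℝ =>
        realSlice φ k (x.val * ((1 : Matrix (Fin 2) (Fin 2) ℝ) + Matrix.of Y))) 0‖
        ≤ C * realHeight x ^ N
  cuspidal : ∀ g, ∫ x, φ (Matrix.GeneralLinearGroup.upperRightHom (Quotient.out x) * g) ∂dx = 0

/-- `Z(φ, h, χ) = ∫_{ℚˣ\𝔸ˣ} φ(diag(a, 1) h) χ(a) |a|^{-1/2} dˣa`: the integrand. -/
def zetaIntegrand (φ : GL2 Adele → ℂ) (h : GL2 Adele) (χ : Adeleˣ → ℂ) (a : Adeleˣ) : ℂ :=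
  φ (diagOne Adele a * h) * χ a * ((adeleAbs a ^ (-(1 / 2) : ℝ) : ℝ) : ℂ)

/-- The Jacquet-Langlands integral `Z(φ, h, χ)`. -/
def zetaJL (da : Measure (RightCosets ratIdeles)) (φ : GL2 Adele → ℂ) (h : GL2 Adele)
    (χ : Adeleˣ → ℂ) : ℂ :=
  ∫ a, zetaIntegrand φ h χ a.out ∂da

/-! ### The group `H₁` -/

/-- Pairs `(h₁, h₂)` in `GL₂ × GL₂` with `det h₁ = det h₂`. -/
def PairsEqDet (R : Type*) [CommRing R] : Subgroup (GL2 R × GL2 R) :=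
  (Matrix.GeneralLinearGroup.det.comp (MonoidHom.fst (GL2 R) (GL2 R))).eqLocus
    (Matrix.GeneralLinearGroup.det.comp (MonoidHom.snd (GL2 R) (GL2 R)))

/-- `g ↦ (g, g)`. -/
def diagPair (R : Type*) [CommRing R] : GL2 R →* PairsEqDet R :=
  ((MonoidHom.id (GL2 R)).prod (MonoidHom.id (GL2 R))).codRestrict (PairsEqDet R) fun _ => rfl

/-- The pairs `(z, z)` of equal scalar matrices: the pairs that act trivially on `M₂` by
`v ↦ h₁ v h₂⁻¹`. -/
def scalarPairs (R : Type*) [CommRing R] : Subgroup (PairsEqDet R) :=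
  ((diagPair R).comp (Matrix.GeneralLinearGroup.scalar (Fin 2))).range

instance (R : Type*) [CommRing R] : (scalarPairs R).Normal where
  conj_mem := by
    rintro _ ⟨z, rfl⟩ g
    refine ⟨z, ?_⟩
    rw [eq_mul_inv_iff_mul_eq]
    apply Subtype.ext
    exact Prod.ext (Matrix.GeneralLinearGroup.scalar_commute z _)
      (Matrix.GeneralLinearGroup.scalar_commute z _)

/-- `H₁(𝔸)`: the pairs `(h₁, h₂)` with `det h₁ = det h₂`, acting on `M₂` by `v ↦ h₁ v h₂⁻¹`, that is,
modulo the scalar pairs `(z, z)`. -/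
def H1 : Type := PairsEqDet Adele ⧸ scalarPairs Adele

instance : Group H1 := inferInstanceAs (Group (PairsEqDet Adele ⧸ scalarPairs Adele))
instance : TopologicalSpace H1 :=
  inferInstanceAs (TopologicalSpace (PairsEqDet Adele ⧸ scalarPairs Adele))
instance : IsTopologicalGroup H1 :=
  inferInstanceAs (IsTopologicalGroup (PairsEqDet Adele ⧸ scalarPairs Adele))
instance : MeasurableSpace H1 := borel H1
instance : BorelSpace H1 := ⟨rfl⟩

/-- The class in `H₁(𝔸)` of a pair. -/
def H1.mk : PairsEqDet Adele →* H1 := QuotientGroup.mk' (scalarPairs Adele)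

/-- A pair `(h₁, h₂)` representing an element of `H₁(𝔸)`. -/
def H1.rep (h : H1) : GL2 Adele × GL2 Adele :=
  (Quotient.out (s := QuotientGroup.leftRel (scalarPairs Adele)) h).val

/-- `H₁(ℚ)` as a subgroup of `H₁(𝔸)`: the classes of pairs of rational matrices. -/
def H1rat : Subgroup H1 :=
  (((Matrix.GeneralLinearGroup.map (n := Fin 2) (algebraMap ℚ Adele)).prodMap
    (Matrix.GeneralLinearGroup.map (n := Fin 2) (algebraMap ℚ Adele))).range.comap
      (PairsEqDet Adele).subtype).map H1.mk

/-- `a ↦ (diag(a, 1), diag(a, 1))`, with image `D(𝔸)` in `H₁(𝔸)`. -/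
def torusD : Adeleˣ →* H1 := H1.mk.comp ((diagPair Adele).comp (diagOne Adele))

/-! ### `GSp(4)` -/

/-- `GSp₄(R)`: the `g` with `ᵗg J g = ν(g) J`. -/
def GSp4 (R : Type*) [CommRing R] : Subgroup (GL (Fin 2 ⊕ Fin 2) R) where
  carrier := {g | ∃ ν : Rˣ, g.valᵀ * Matrix.J (Fin 2) R * g.val = (ν : R) • Matrix.J (Fin 2) R}
  one_mem' := ⟨1, by simp⟩
  mul_mem' := by
    rintro a b ⟨ν, hν⟩ ⟨ν', hν'⟩
    refine ⟨ν * ν', ?_⟩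
    calc (a * b).valᵀ * Matrix.J (Fin 2) R * (a * b).val
        = b.valᵀ * (a.valᵀ * Matrix.J (Fin 2) R * a.val) * b.val := by
          simp [Matrix.transpose_mul, Matrix.mul_assoc]
      _ = _ := by
          rw [hν, Matrix.mul_smul, Matrix.smul_mul, hν', smul_smul, Units.val_mul]
  inv_mem' := by
    rintro a ⟨ν, hν⟩
    refine ⟨ν⁻¹, ?_⟩
    have h1 : a.val * a⁻¹.val = 1 := Units.mul_inv a
    have h2 : a⁻¹.valᵀ * a.valᵀ = 1 := by rw [← Matrix.transpose_mul, h1, Matrix.transpose_one]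
    have h3 : Matrix.J (Fin 2) R = (ν : R) • (a⁻¹.valᵀ * Matrix.J (Fin 2) R * a⁻¹.val) := by
      calc Matrix.J (Fin 2) R
          = (a⁻¹.valᵀ * a.valᵀ) * Matrix.J (Fin 2) R * (a.val * a⁻¹.val) := by
            rw [h1, h2, Matrix.one_mul, Matrix.mul_one]
        _ = a⁻¹.valᵀ * (a.valᵀ * Matrix.J (Fin 2) R * a.val) * a⁻¹.val := by
            simp only [Matrix.mul_assoc]
        _ = _ := by rw [hν, Matrix.mul_smul, Matrix.smul_mul]
    conv_rhs => rw [h3, smul_smul, Units.inv_mul, one_smul]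

/-- The similitude factor `ν(g)`. -/
def similitude {R : Type*} [CommRing R] (g : GSp4 R) : Rˣ := g.2.choose

/-- `u(X) = (1, X; 0, 1)` with `X = (u, w; w, v)`. -/
def unipU {R : Type*} [CommRing R] (u v w : R) : GSp4 R :=
  have h0 : (!![0, 0; 0, 0] : Matrix (Fin 2) (Fin 2) R) = 0 := by
    ext i j
    fin_cases i <;> fin_cases j <;> rfl
  ⟨⟨Matrix.fromBlocks 1 !![u, w; w, v] 0 1, Matrix.fromBlocks 1 (-!![u, w; w, v]) 0 1,
    by simp [Matrix.fromBlocks_multiply, h0], by simp [Matrix.fromBlocks_multiply, h0]⟩,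
    1, by
      have h : (!![u, w; w, v])ᵀ = !![u, w; w, v] := by
        ext i j
        fin_cases i <;> fin_cases j <;> rfl
      simp [Matrix.J, Matrix.fromBlocks_transpose, Matrix.fromBlocks_multiply, h, h0]⟩

/-- `diag(y, 1, 1, y)`. -/
def torusT {R : Type*} [CommRing R] (y : Rˣ) : GSp4 R :=
  ⟨⟨Matrix.fromBlocks !![(y : R), 0; 0, 1] 0 0 !![1, 0; 0, (y : R)],
    Matrix.fromBlocks !![((y⁻¹ : Rˣ) : R), 0; 0, 1] 0 0 !![1, 0; 0, ((y⁻¹ : Rˣ) : R)],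
    by simp [Matrix.fromBlocks_multiply, ← Matrix.one_fin_two],
    by simp [Matrix.fromBlocks_multiply, ← Matrix.one_fin_two]⟩,
    y, by
      have h (a b : R) : (!![a, 0; 0, b])ᵀ = !![a, 0; 0, b] := by
        ext i j
        fin_cases i <;> fin_cases j <;> rfl
      have h1 : (y : R) • (1 : Matrix (Fin 2) (Fin 2) R) = !![(y : R), 0; 0, y] := by
        ext i j
        fin_cases i <;> fin_cases j <;> simp
      simp [Matrix.J, Matrix.fromBlocks_transpose, Matrix.fromBlocks_multiply, h,
        Matrix.fromBlocks_smul, h1]⟩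

/-! ### The Weil representation on functions on `V(𝔸)²`, `V = M₂` with quadratic form `det` -/

/-- `V(R)²`. -/
abbrev V2 (R : Type*) : Type _ := Fin 2 → Matrix (Fin 2) (Fin 2) R

/-- Bruhat-Schwartz functions on `V(𝔸)²`: the span of the products of a Schwartz function on
`V(ℝ)²` and a locally constant function of compact support on `V(𝔸_f)²`. -/
def SchwartzBruhat : Submodule ℂ (V2 Adele → ℂ) :=
  Submodule.span ℂ {f | ∃ (a : 𝓢(Fin 2 → Fin 2 → Fin 2 → ℝ, ℂ)) (b : V2 FinAdele → ℂ),
    IsLocallyConstant b ∧ HasCompactSupport b ∧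
      ∀ x, f x = a (fun k i j => (x k i j).1) * b (fun k => Matrix.of fun i j => (x k i j).2)}

/-- The bilinear form `(v, v')` of `V`, with `(v, v) = 2 det v`. -/
def bilin {R : Type*} [CommRing R] (v v' : Matrix (Fin 2) (Fin 2) R) : R :=
  (v + v').det - v.det - v'.det

/-- The Gram matrix `((x_i, x_j))`. -/
def gramV {R : Type*} [CommRing R] (x : V2 R) : Matrix (Fin 2) (Fin 2) R :=
  Matrix.of fun i j => bilin (x i) (x j)

/-- The Haar measure of `𝔸` for which `[0, 1) × ∏_p ℤ_p`, a fundamental domain for `ℚ`, has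
volume `1`.  It is self-dual with respect to every non-trivial character of `ℚ \ 𝔸`. -/
def adeleVol : Measure Adele :=
  Classical.epsilon fun m => m.IsAddHaarMeasure ∧
    m {a | a.1 ∈ Set.Ico (0 : ℝ) 1 ∧ ∀ v, a.2 v ∈ v.adicCompletionIntegers ℚ} = 1

/-- `a ∧ b` for row vectors. -/
def wedge {R : Type*} [CommRing R] (a b : Fin 2 → R) : R := a 0 * b 1 - a 1 * b 0

/-- The partial Fourier transform of a function on `V(𝔸)²` in the second rows.  In terms of the rows,
`(v, v') = r ∧ s' + r' ∧ s` for `v = (r; s)` and `v' = (r'; s')`. -/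
def partialFourier (ψ : AddChar Adele Circle) (f : V2 Adele → ℂ)
    (z : Fin 2 ⊕ Fin 2 → Fin 2 → Adele) : ℂ :=
  ∫ s : Fin 2 → Fin 2 → Adele,
    f (fun i => Matrix.of ![z (Sum.inl i), s i]) * (ψ (∑ i, wedge (z (Sum.inr i)) (s i)) : ℂ)
    ∂(Measure.pi fun _ => Measure.pi fun _ => adeleVol)

/-- The inverse partial Fourier transform. -/
def partialFourierInv (ψ : AddChar Adele Circle) (F : (Fin 2 ⊕ Fin 2 → Fin 2 → Adele) → ℂ)
    (x : V2 Adele) : ℂ :=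
  ∫ t : Fin 2 → Fin 2 → Adele,
    F (Sum.elim (fun i => x i 0) t) * (ψ (-∑ i, wedge (t i) (x i 1)) : ℂ)
    ∂(Measure.pi fun _ => Measure.pi fun _ => adeleVol)

open Classical in
/-- The action `ω(g)` of `g ∈ Sp₄(𝔸)`.  For `g = (A, B; 0, ᵗA⁻¹) = (1, b; 0, 1)(A, 0; 0, ᵗA⁻¹)`,
`b = B ᵗA`, in the Siegel parabolic subgroup it is
`ω(g) f(x) = ψ(½ tr(b (x, x))) |det A|² f(x A)`.  For the other `g` it is the action
`F(z) ↦ F(z g)` on functions of `z = (r₁, r₂, t₁, t₂)`, transported by the partial Fourier transform;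
for `g = (0, 1; -1, 0)` this is the Fourier transform `∫ f(x') ψ(∑ (x_i, x'_i)) dx'`. -/
def weilSp (ψ : AddChar Adele Circle) (g : Matrix (Fin 2 ⊕ Fin 2) (Fin 2 ⊕ Fin 2) Adele)
    (f : V2 Adele → ℂ) (x : V2 Adele) : ℂ :=
  if g.toBlocks₂₁ = 0 then
    (ψ ((1 / 2 : ℚ) • (g.toBlocks₁₂ * g.toBlocks₁₁ᵀ * gramV x).trace) : ℂ) *
      ((adeleAbs g.toBlocks₁₁.det ^ 2 : ℝ) : ℂ) * f (fun j => ∑ i, g.toBlocks₁₁ i j • x i)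
  else
    partialFourierInv ψ (fun z => partialFourier ψ f fun j => ∑ i, g i j • z i) x

/-- `L(h₁, h₂) f (x) = |ν(h)|⁻² f(h₁⁻¹ x h₂)`, with `ν(h) = det h₁ / det h₂`. -/
def opL (h : GL2 Adele × GL2 Adele) (f : V2 Adele → ℂ) (x : V2 Adele) : ℂ :=
  ((adeleAbs (Matrix.GeneralLinearGroup.det h.1 / Matrix.GeneralLinearGroup.det h.2 : Adeleˣ)
    ^ (-2 : ℤ) : ℝ) : ℂ) * f (fun i => h.1⁻¹.val * x i * h.2.val)

/-- The extended Weil representation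
`ω(g, h) f = ω(g diag(1, ν(g))⁻¹) L(h) f`, for `ν(g) = ν(h)`. -/
def weil (ψ : AddChar Adele Circle) (g : GSp4 Adele) (h : GL2 Adele × GL2 Adele)
    (f : V2 Adele → ℂ) : V2 Adele → ℂ :=
  weilSp ψ (g.val.val *
    Matrix.fromBlocks 1 0 0 ((((similitude g)⁻¹ : Adeleˣ) : Adele) • 1)) (opL h f)

/-! ### Theta lifts and split Bessel periods -/

/-- `θ(g; h₁, h₂; f) = ∑_{M ∈ M₂(ℚ)²} ω(g, h₁, h₂) f (M)`. -/
def thetaKernel (ψ : AddChar Adele Circle) (f : V2 Adele → ℂ) (g : GSp4 Adele)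
    (h : GL2 Adele × GL2 Adele) : ℂ :=
  ∑' M : V2 ℚ, weil ψ g h f (fun k => (M k).map (algebraMap ℚ Adele))

/-- The integrand `θ(g; h₁h¹, h₂h²; f) φ₁(h₁h¹) φ₂(h₂h²)` of the theta lift, where
`(h¹, h²) = c(g)`. -/
def thetaIntegrand (ψ : AddChar Adele Circle) (c : GSp4 Adele → GL2 Adele × GL2 Adele)
    (φ₁ φ₂ : GL2 Adele → ℂ) (f : V2 Adele → ℂ) (g : GSp4 Adele) (h : H1) : ℂ :=
  thetaKernel ψ f g (h.rep * c g) * φ₁ (h.rep.1 * (c g).1) * φ₂ (h.rep.2 * (c g).2)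

/-- The theta lift `θ(φ₁, φ₂; f)`. -/
def thetaLift (ψ : AddChar Adele Circle) (dθ : Measure (RightCosets H1rat))
    (c : GSp4 Adele → GL2 Adele × GL2 Adele) (φ₁ φ₂ : GL2 Adele → ℂ) (f : V2 Adele → ℂ)
    (g : GSp4 Adele) : ℂ :=
  ∫ h, thetaIntegrand ψ c φ₁ φ₂ f g h.out ∂dθ

/-- The integrand of `Φ^U(g)`, as a function of `(u, v, w)`. -/
def unipIntegrand (ψ : AddChar Adele Circle) (Φ : GSp4 Adele → ℂ) (g : GSp4 Adele)
    (x : AdeleModRat × AdeleModRat × AdeleModRat) : ℂ :=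
  Φ (unipU (Quotient.out x.1) (Quotient.out x.2.1) (Quotient.out x.2.2) * g) *
    (((ψ (Quotient.out x.2.2))⁻¹ : Circle) : ℂ)

/-- `Φ^U(g) = ∫_{(ℚ\𝔸)³} Φ(u(X) g) ψ⁻¹(w) du dv dw`, `X = (u, w; w, v)`. -/
def unipCoeff (ψ : AddChar Adele Circle) (dx : Measure AdeleModRat) (Φ : GSp4 Adele → ℂ)
    (g : GSp4 Adele) : ℂ :=
  ∫ x, unipIntegrand ψ Φ g x ∂(dx.prod (dx.prod dx))

/-- The integrand of the split Bessel functional. -/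
def besselIntegrand (ψ : AddChar Adele Circle) (dx : Measure AdeleModRat) (χ : Adeleˣ → ℂ)
    (g : GSp4 Adele) (Φ : GSp4 Adele → ℂ) (y : Adeleˣ) : ℂ :=
  unipCoeff ψ dx Φ (torusT y * g) * χ y

/-- The split Bessel functional
`B_χ(g; Φ) = ∫_{ℚˣ\𝔸ˣ} Φ^U(diag(y, 1, 1, y) g) χ(y) dˣy`. -/
def besselSplit (ψ : AddChar Adele Circle) (dx : Measure AdeleModRat)
    (da : Measure (RightCosets ratIdeles)) (χ : Adeleˣ → ℂ) (g : GSp4 Adele)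
    (Φ : GSp4 Adele → ℂ) : ℂ :=
  ∫ y, besselIntegrand ψ dx χ g Φ y.out ∂da

/-- The point `((1, 0; 0, 0), (0, 0; 0, 1))` of `V(𝔸)²`. -/
def pointP : V2 Adele := ![!![1, 0; 0, 0], !![0, 0; 0, 1]]

/-- `Z(φ₁, h₁, μ) Z(φ₂, h₂, μ⁻¹|·|) L(h₁, h₂) f (P)`. -/
def unfoldedIntegrand (da : Measure (RightCosets ratIdeles)) (φ₁ φ₂ : GL2 Adele → ℂ)
    (f : V2 Adele → ℂ) (μ : Adeleˣ →* ℂˣ) (h : H1) : ℂ :=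
  zetaJL da φ₁ h.rep.1 (fun a => (μ a : ℂ)) *
    zetaJL da φ₂ h.rep.2 (fun a => ((μ a)⁻¹ : ℂˣ) * (adeleAbs a : ℂ)) * opL h.rep f pointP

end

end ThetaBessel

open ThetaBessel

/-! The argument is an unfolding. At `u(X) diag(y, 1, 1, y)` the Weil representation acts through
the Siegel parabolic subgroup. The term of the theta series at a rational point `M = (M₀, M₁)` is
`ψ(u det M₀ + v det M₁ + w (M₀, M₁)) f(h⁻¹(y M₀, M₁))`, because the factor `|y|²` of the parabolic
cancels the `|ν|⁻²` of `L`. Integrating against `ψ⁻¹(w)` over `(ℚ\𝔸)³` keeps only the `M` with `det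
M₀ = det M₁ = 0` and `(M₀, M₁) = 1` (`unipCoeff_eq`). For such `M` the sum `N = M₀ + M₁` has
determinant `1`, and `M₀ N⁻¹`, `M₁ N⁻¹` are complementary idempotents of rank one. Hence these `M`
form a single `H₁(ℚ)`-orbit, that of `P = (e₁₁, e₂₂)` (`exists_actInv_ratPoint_eq`), and the
stabilizer of `P` is `D(ℚ)` (`ratH1_eq_torusD`). The integral over `H₁(ℚ)\H₁(𝔸)` therefore becomes
one over `D(ℚ)\H₁(𝔸)` (`thetaCoeff_eq_integral`).

Conjugating the first component by `diag(y, 1)` preserves Haar measure and moves `y` out of `f`.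
Fibring over `D(𝔸)\H₁(𝔸)` then leaves `φ₁(diag(ay, 1) h₁) φ₂(diag(a, 1) h₂) f(h⁻¹P)`
(`thetaCoeff_eq_unfolded`). The substitution `ay = b` separates the two torus integrals. It is
compatible with the characters because `μ|·|^{-1/2}` and `μ⁻¹|·|·|·|^{-1/2}` are inverse to each
other (`integral_besselUnfolded`).

Absolute convergence rests on two majorants. Both use that the image in `H₁(𝔸)` of the pairs of
height at most `R` with bounded denominators has volume `O(R¹⁶)`, so that decay like `height⁻¹⁸` is
integrable (`exists_majorant_of_height_bound`). For the theta integral, reduction theory supplies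
representatives in Siegel domains. There cusp forms decay faster than any power of the height, while
the theta series grows at most polynomially (`lintegral_thetaNorm_lt_top`). For the unfolded
integral, `D(𝔸)` is used to normalize the bottom row of `h₂`; then the size and the denominators of
`h⁻¹P` control the height and the denominators of `h`, and the rapid decay of `f` prevails
(`exists_unfolded_majorant`). The decay of cusp forms comes from uniform moderate growth: along the
unipotent group a cusp form is periodic with mean zero, hence bounded by its derivatives of any
order, and these are small near the cusp.

Quotient measures are handled through weights: if the translates of `w` under a subgroup add up to
`1`, then the quotient measure is the image of `w dg`. For `ℚˣ\𝔸ˣ` the weight is the indicator of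
`ℝ_{>0} × Ẑˣ`. For `D(𝔸)\H₁(𝔸)` it is a multiple of the indicator of `boxH`, and a weight for `D(ℚ)`
is obtained by averaging the latter over the former. -/

namespace ThetaBessel

open Rat.HeightOneSpectrum

/-! ### Local absolute values -/

section Local

local instance (p : Nat.Primes) : Fact p.1.Prime := ⟨p.2⟩

/-- The normalized absolute value of `ℚ_v`. -/
noncomputable def vnorm (v : HeightOneSpectrum ℤ) (x : v.adicCompletion ℚ) : ℝ :=
  ‖adicCompletion.padicEquiv v x‖

/-- The prime number of a finite place. -/
noncomputable def placePrime (v : HeightOneSpectrum ℤ) : ℕ := (primesEquiv v).1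

theorem placePrime_prime (v : HeightOneSpectrum ℤ) : (placePrime v).Prime := (primesEquiv v).2

variable (v : HeightOneSpectrum ℤ)

theorem mem_integers_iff {x : v.adicCompletion ℚ} :
    x ∈ v.adicCompletionIntegers ℚ ↔ vnorm v x ≤ 1 := by
  constructor
  · intro h; exact (adicCompletion.padicEquiv_bijOn v).1 h
  · intro h
    obtain ⟨y, hy, hy'⟩ := (adicCompletion.padicEquiv_bijOn v).2.2 h
    rwa [← (adicCompletion.padicEquiv v).injective hy']

theorem vnorm_mul (x y : v.adicCompletion ℚ) : vnorm v (x * y) = vnorm v x * vnorm v y := by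
  simp [vnorm]

theorem vnorm_one : vnorm v 1 = 1 := by simp [vnorm]

theorem vnorm_nonneg (x : v.adicCompletion ℚ) : 0 ≤ vnorm v x := norm_nonneg _

theorem vnorm_eq_zero {x : v.adicCompletion ℚ} : vnorm v x = 0 ↔ x = 0 := by simp [vnorm]

theorem vnorm_inv (x : v.adicCompletion ℚ) : vnorm v x⁻¹ = (vnorm v x)⁻¹ := by simp [vnorm]

theorem vnorm_neg (x : v.adicCompletion ℚ) : vnorm v (-x) = vnorm v x := by simp [vnorm]

theorem vnorm_add_le (x y : v.adicCompletion ℚ) :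
    vnorm v (x + y) ≤ max (vnorm v x) (vnorm v y) := by
  rw [vnorm, map_add]; exact Padic.nonarchimedean _ _

theorem vnorm_coe (q : ℚ) :
    vnorm v (algebraMap ℚ (v.adicCompletion ℚ) q) = padicNorm (placePrime v) q := by
  rw [vnorm, AlgEquivClass.commutes]
  exact Padic.eq_padicNorm q

theorem vnorm_prime_of_ne {w : HeightOneSpectrum ℤ} (h : w ≠ v) :
    vnorm w (algebraMap ℚ _ (placePrime v : ℚ)) = 1 := by
  rw [vnorm_coe]
  have : Fact (placePrime w).Prime := ⟨placePrime_prime w⟩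
  have : Fact (placePrime v).Prime := ⟨placePrime_prime v⟩
  have : placePrime w ≠ placePrime v := fun h' => h (primesEquiv.injective (Subtype.ext h'))
  rw [padicNorm.padicNorm_of_prime_of_ne this]; simp

theorem vnorm_prime_self :
    vnorm v (algebraMap ℚ _ (placePrime v : ℚ)) = (placePrime v : ℝ)⁻¹ := by
  rw [vnorm_coe]
  have : Fact (placePrime v).Prime := ⟨placePrime_prime v⟩
  rw [padicNorm.padicNorm_p_of_prime]; simp

/-- The value group is discrete: the values are powers of the prime. -/
theorem vnorm_le_inv_prime {x : v.adicCompletion ℚ} (h : vnorm v x < 1) :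
    vnorm v x ≤ (placePrime v : ℝ)⁻¹ := by
  have := (Padic.norm_le_pow_iff_norm_lt_pow_add_one (adicCompletion.padicEquiv v x) (-1)).2
    (by simpa [vnorm] using h)
  simpa [placePrime, vnorm] using this

/-- The residue field of `ℤ_p` is represented by integers. -/
theorem exists_int_vnorm_sub_lt {x : v.adicCompletion ℚ} (h : vnorm v x ≤ 1) :
    ∃ n : ℤ, vnorm v (x - algebraMap ℚ _ (n : ℚ)) < 1 := by
  let y : ℤ_[(primesEquiv v).1] := ⟨adicCompletion.padicEquiv v x, h⟩
  obtain ⟨n, -, hn⟩ := PadicInt.exists_mem_range (p := (primesEquiv v).1) y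
  refine ⟨n, ?_⟩
  rw [vnorm, map_sub, AlgEquivClass.commutes]
  rw [IsLocalRing.mem_maximalIdeal, PadicInt.mem_nonunits, PadicInt.norm_def] at hn
  have e : ((y - (n : ℤ_[(primesEquiv v).1]) : ℤ_[(primesEquiv v).1]) : ℚ_[(primesEquiv v).1]) =
      adicCompletion.padicEquiv v x - (n : ℚ_[(primesEquiv v).1]) := by
    rw [PadicInt.coe_sub, PadicInt.coe_natCast]
  rw [e] at hn
  simpa using hn

theorem continuous_vnorm : Continuous (vnorm v) :=
  continuous_norm.comp (adicCompletion.padicEquiv v).continuous_toFun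

/-- The completion at a finite place is homeomorphic to a field of `p`-adic numbers. -/
noncomputable def padicHomeo : v.adicCompletion ℚ ≃ₜ ℚ_[(primesEquiv v).1] where
  toEquiv := (adicCompletion.padicEquiv v).toEquiv
  continuous_toFun := (adicCompletion.padicEquiv v).continuous_toFun
  continuous_invFun := (adicCompletion.padicEquiv v).continuous_invFun

/-- Transported from the closed unit ball of `ℚ_p`, which is a proper metric space. -/
instance compactSpace_adicCompletionIntegers : CompactSpace (v.adicCompletionIntegers ℚ) := by
  refine isCompact_iff_compactSpace.1 ?_
  have : (v.adicCompletionIntegers ℚ : Set (v.adicCompletion ℚ)) =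
      padicHomeo v ⁻¹' (Metric.closedBall 0 1) := by
    ext x
    rw [Set.mem_preimage, mem_closedBall_zero_iff]
    exact mem_integers_iff v
  rw [this]
  exact (padicHomeo v).isCompact_preimage.2 (isCompact_closedBall 0 1)

instance secondCountable_adicCompletion : SecondCountableTopology (v.adicCompletion ℚ) :=
  (padicHomeo v).secondCountableTopology

instance t2Space_adicCompletion : T2Space (v.adicCompletion ℚ) := (padicHomeo v).symm.t2Space

instance countable_places : Countable (HeightOneSpectrum ℤ) :=
  (primesEquiv (R := ℤ)).injective.countable

end Local

/-! ### Integral finite adeles -/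

/-- The ring of integral finite adeles. -/
def Zhat : Subring FinAdele where
  carrier := {a | ∀ v, a v ∈ v.adicCompletionIntegers ℚ}
  mul_mem' ha hb v := mul_mem (ha v) (hb v)
  one_mem' _ := one_mem _
  add_mem' ha hb v := add_mem (ha v) (hb v)
  zero_mem' _ := zero_mem _
  neg_mem' ha v := neg_mem (ha v)

theorem mem_Zhat {a : FinAdele} : a ∈ Zhat ↔ ∀ v, vnorm v (a v) ≤ 1 :=
  forall_congr' fun v => mem_integers_iff v

theorem FinAdele.mul_apply (a b : FinAdele) (v : HeightOneSpectrum ℤ) :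
    (a * b) v = a v * b v := rfl

theorem FinAdele.sub_apply (a b : FinAdele) (v : HeightOneSpectrum ℤ) :
    (a - b) v = a v - b v := rfl

theorem FinAdele.one_apply (v : HeightOneSpectrum ℤ) : (1 : FinAdele) v = 1 := rfl

theorem FinAdele.rat_apply (q : ℚ) (v : HeightOneSpectrum ℤ) :
    (algebraMap ℚ FinAdele q) v = algebraMap ℚ (v.adicCompletion ℚ) q := rfl

/-- The integral finite adeles as a product. -/
noncomputable def zhatMap (x : Π v : HeightOneSpectrum ℤ, v.adicCompletionIntegers ℚ) : FinAdele :=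
  RestrictedProduct.structureMap (fun v : HeightOneSpectrum ℤ => v.adicCompletion ℚ)
    (fun v => (v.adicCompletionIntegers ℚ : Set (v.adicCompletion ℚ))) Filter.cofinite x

theorem isOpenEmbedding_zhatMap : Topology.IsOpenEmbedding zhatMap :=
  RestrictedProduct.isOpenEmbedding_structureMap
    (fun v => Valued.isOpen_valuationSubring (v.adicCompletion ℚ))

theorem range_zhatMap : Set.range zhatMap = Zhat := by
  ext a
  constructor
  · rintro ⟨x, rfl⟩ v; exact (x v).2
  · intro h; exact ⟨fun v => ⟨a v, h v⟩, rfl⟩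

theorem isOpen_Zhat : IsOpen (Zhat : Set FinAdele) :=
  range_zhatMap ▸ isOpenEmbedding_zhatMap.isOpen_range

theorem isCompact_Zhat : IsCompact (Zhat : Set FinAdele) :=
  range_zhatMap ▸ isCompact_range isOpenEmbedding_zhatMap.continuous

theorem continuous_finAdele_apply (v : HeightOneSpectrum ℤ) :
    Continuous fun a : FinAdele => a v :=
  RestrictedProduct.continuous_eval v

instance : T2Space FinAdele :=
  inferInstanceAs (T2Space (RestrictedProduct (fun v : HeightOneSpectrum ℤ => v.adicCompletion ℚ)
    (fun v => (v.adicCompletionIntegers ℚ : Set (v.adicCompletion ℚ))) Filter.cofinite))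

instance : LocallyCompactSpace FinAdele :=
  isCompact_Zhat.locallyCompactSpace_of_mem_nhds_of_addGroup
    (isOpen_Zhat.mem_nhds Zhat.zero_mem)

theorem exists_mul_mem_integers (v : HeightOneSpectrum ℤ) (x : v.adicCompletion ℚ) :
    ∃ n : ℕ, n ≠ 0 ∧ vnorm v (x * algebraMap ℚ _ (n : ℚ)) ≤ 1 := by
  obtain ⟨b, hb, h⟩ :=
    HeightOneSpectrum.adicCompletion.mul_nonZeroDivisor_mem_adicCompletionIntegers v x
  refine ⟨b.natAbs, by simpa using nonZeroDivisors.ne_zero hb, ?_⟩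
  rw [mem_integers_iff, vnorm_mul] at h
  rw [vnorm_mul]
  have : vnorm v (algebraMap ℚ (v.adicCompletion ℚ) (b.natAbs : ℚ)) =
      vnorm v (algebraMap ℚ (v.adicCompletion ℚ) (b : ℚ)) := by
    rcases Int.natAbs_eq b with hb | hb
    · conv_rhs => rw [hb]
      simp
    · conv_rhs => rw [hb]
      simp [vnorm]
  rw [this]
  exact h

theorem vnorm_int_le (v : HeightOneSpectrum ℤ) (n : ℤ) :
    vnorm v (algebraMap ℚ _ (n : ℚ)) ≤ 1 := by
  rw [vnorm_coe]
  have : Fact (placePrime v).Prime := ⟨placePrime_prime v⟩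
  exact_mod_cast padicNorm.of_int n

theorem vnorm_nat_le (v : HeightOneSpectrum ℤ) (n : ℕ) :
    vnorm v (algebraMap ℚ _ (n : ℚ)) ≤ 1 := by
  simpa using vnorm_int_le v n

theorem intCast_mem_Zhat (n : ℤ) : algebraMap ℚ FinAdele (n : ℚ) ∈ Zhat :=
  mem_Zhat.2 fun v => vnorm_int_le v n

theorem natCast_mem_Zhat (n : ℕ) : algebraMap ℚ FinAdele (n : ℚ) ∈ Zhat :=
  mem_Zhat.2 fun v => vnorm_nat_le v n

/-- Every finite adele has a common denominator. -/
theorem exists_denominator (a : FinAdele) :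
    ∃ n : ℕ, n ≠ 0 ∧ algebraMap ℚ FinAdele (n : ℚ) * a ∈ Zhat := by
  classical
  have hfin : {v | ¬ a v ∈ v.adicCompletionIntegers ℚ}.Finite := by
    simpa [Filter.eventually_cofinite] using! a.2
  choose n hn0 hn using fun v => exists_mul_mem_integers v (a v)
  refine ⟨∏ v ∈ hfin.toFinset, n v, Finset.prod_ne_zero_iff.2 fun v _ => hn0 v, ?_⟩
  rw [mem_Zhat]
  intro v
  rw [FinAdele.mul_apply, FinAdele.rat_apply, vnorm_mul]
  by_cases hv : v ∈ hfin.toFinset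
  · rw [← Finset.prod_erase_mul _ _ hv, Nat.cast_mul, map_mul, vnorm_mul, mul_assoc,
      mul_comm (vnorm v (algebraMap _ _ (n v : ℚ))), ← vnorm_mul]
    exact mul_le_one₀ (vnorm_nat_le v _) (vnorm_nonneg _ _) (hn v)
  · exact mul_le_one₀ (vnorm_nat_le v _) (vnorm_nonneg _ _)
      ((mem_integers_iff v).1 (by simpa using hv))

/-- A rational number that is integral at all finite places is an integer. -/
theorem rat_mem_Zhat_iff {q : ℚ} : algebraMap ℚ FinAdele q ∈ Zhat ↔ ∃ n : ℤ, (n : ℚ) = q := by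
  constructor
  · intro h
    obtain ⟨n, hn⟩ := HeightOneSpectrum.mem_integers_of_valuation_le_one ℚ (R := ℤ) q fun v => by
      have := h v
      rwa [FinAdele.rat_apply, HeightOneSpectrum.mem_adicCompletionIntegers,
        HeightOneSpectrum.algebraMap_adicCompletion, Function.comp_apply,
        HeightOneSpectrum.valuedAdicCompletion_eq_valuation'] at this
    exact ⟨n, by simpa using hn⟩
  · rintro ⟨n, rfl⟩; exact intCast_mem_Zhat n

/-- Take `n` congruent to `x` modulo the prime at `v`. Then `(x - n) / p` is integral at `v`, and it
stays integral at the other places because `p` is a unit there. -/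
theorem Zhat_eq_int_add_prime_mul (v : HeightOneSpectrum ℤ) {x : FinAdele} (hx : x ∈ Zhat) :
    ∃ (n : ℤ) (y : FinAdele), y ∈ Zhat ∧
      x = algebraMap ℚ FinAdele n + algebraMap ℚ FinAdele (placePrime v : ℚ) * y := by
  obtain ⟨n, hn⟩ := exists_int_vnorm_sub_lt v (mem_Zhat.1 hx v)
  have hp : (placePrime v : ℚ) ≠ 0 := by exact_mod_cast (placePrime_prime v).ne_zero
  refine ⟨n, algebraMap ℚ FinAdele (placePrime v : ℚ)⁻¹ * (x - algebraMap ℚ FinAdele n), ?_, ?_⟩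
  · rw [mem_Zhat]
    intro w
    rw [FinAdele.mul_apply, FinAdele.rat_apply, vnorm_mul, map_inv₀, vnorm_inv]
    by_cases hw : w = v
    · subst hw
      rw [vnorm_prime_self, inv_inv]
      have h1 := vnorm_le_inv_prime w hn
      have h2 : (0 : ℝ) < placePrime w := by exact_mod_cast (placePrime_prime w).pos
      calc _ ≤ (placePrime w : ℝ) * (placePrime w : ℝ)⁻¹ := by
            gcongr; exact h1
        _ = 1 := mul_inv_cancel₀ h2.ne'
    · rw [vnorm_prime_of_ne v hw, inv_one, one_mul]
      exact mem_Zhat.1 (sub_mem hx (intCast_mem_Zhat n)) w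
  · rw [← mul_assoc, ← map_mul, mul_inv_cancel₀ hp, map_one, one_mul]; ring

theorem exists_place (p : ℕ) (hp : p.Prime) : ∃ v : HeightOneSpectrum ℤ, placePrime v = p :=
  ⟨primesEquiv.symm ⟨p, hp⟩, congrArg Subtype.val
    (primesEquiv.apply_symm_apply (⟨p, hp⟩ : Nat.Primes))⟩

/-- `ℤ` is dense in the integral finite adeles. -/
theorem Zhat_eq_int_add_mul (m : ℕ) (hm : m ≠ 0) : ∀ {x : FinAdele}, x ∈ Zhat →
    ∃ (n : ℤ) (y : FinAdele), y ∈ Zhat ∧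
      x = algebraMap ℚ FinAdele n + algebraMap ℚ FinAdele (m : ℚ) * y := by
  induction m using Nat.recOnMul with
  | zero => exact absurd rfl hm
  | one => intro x hx; exact ⟨0, x, hx, by simp⟩
  | prime p hp =>
    intro x hx
    obtain ⟨v, rfl⟩ := exists_place p hp
    exact Zhat_eq_int_add_prime_mul v hx
  | mul a b iha ihb =>
    intro x hx
    obtain ⟨n, y, hy, rfl⟩ := iha (left_ne_zero_of_mul hm) hx
    obtain ⟨n', z, hz, rfl⟩ := ihb (right_ne_zero_of_mul hm) hy
    refine ⟨n + a * n', z, hz, ?_⟩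
    rw [Nat.cast_mul, Int.cast_add, Int.cast_mul, map_add, map_mul, map_mul, Int.cast_natCast]
    ring

/-- `𝔸_f = ℚ + m Ẑ`. -/
theorem exists_rat_add_mul_Zhat (m : ℕ) (hm : m ≠ 0) (x : FinAdele) :
    ∃ (q : ℚ) (y : FinAdele), y ∈ Zhat ∧
      x = algebraMap ℚ FinAdele q + algebraMap ℚ FinAdele (m : ℚ) * y := by
  obtain ⟨n, hn, hx⟩ := exists_denominator x
  -- Approximating `n x` modulo `n m` leaves the remainder `m y` after division by `n`.
  obtain ⟨k, y, hy, h⟩ := Zhat_eq_int_add_mul (n * m) (mul_ne_zero hn hm) hx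
  have hn' : (n : ℚ) ≠ 0 := by exact_mod_cast hn
  refine ⟨k / n, y, hy, ?_⟩
  have h2 : x = algebraMap ℚ FinAdele (n : ℚ)⁻¹ * (algebraMap ℚ FinAdele (n : ℚ) * x) := by
    rw [← mul_assoc, ← map_mul, inv_mul_cancel₀ hn', map_one, one_mul]
  rw [h2, h, mul_add, ← map_mul, ← mul_assoc, ← map_mul]
  have e1 : (n : ℚ)⁻¹ * k = k / n := by field_simp
  have e2 : (n : ℚ)⁻¹ * ((n * m : ℕ) : ℚ) = m := by push_cast; field_simp
  rw [e1, e2]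

/-- The denominators `1/n` exhaust the finite adeles. -/
theorem iUnion_Zhat : ⋃ n : ℕ, {a : FinAdele | algebraMap ℚ FinAdele ((n + 1 : ℕ) : ℚ) * a ∈ Zhat}
    = Set.univ := by
  refine Set.eq_univ_of_forall fun a => ?_
  obtain ⟨n, hn, h⟩ := exists_denominator a
  exact Set.mem_iUnion.2 ⟨n - 1, by
    rw [Set.mem_ofPred_eq, Nat.sub_add_cancel (Nat.one_le_iff_ne_zero.2 hn)]; exact h⟩

/-- Multiplication by a rational number on the finite adeles. -/
noncomputable def ratMulHomeo (q : ℚ) (hq : q ≠ 0) : FinAdele ≃ₜ FinAdele where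
  toFun a := algebraMap ℚ FinAdele q * a
  invFun a := algebraMap ℚ FinAdele q⁻¹ * a
  left_inv a := by beta_reduce; rw [← mul_assoc, ← map_mul, inv_mul_cancel₀ hq, map_one, one_mul]
  right_inv a := by beta_reduce; rw [← mul_assoc, ← map_mul, mul_inv_cancel₀ hq, map_one, one_mul]
  continuous_toFun := by fun_prop
  continuous_invFun := by fun_prop

theorem isCompact_denominator {q : ℚ} (hq : q ≠ 0) :
    IsCompact {a : FinAdele | algebraMap ℚ FinAdele q * a ∈ Zhat} :=
  (ratMulHomeo q hq).isCompact_preimage.2 isCompact_Zhat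

instance : SecondCountableTopology FinAdele := by
  have hZ : SecondCountableTopology Zhat := by
    have := isOpenEmbedding_zhatMap.toIsEmbedding.toHomeomorph.symm.secondCountableTopology
    rw [range_zhatMap] at this
    exact this
  have (n : ℕ) : SecondCountableTopology
      {a : FinAdele | algebraMap ℚ FinAdele ((n + 1 : ℕ) : ℚ) * a ∈ Zhat} := by
    let e := ratMulHomeo ((n + 1 : ℕ) : ℚ) (by positivity)
    exact (e.subtype (p := fun a => algebraMap ℚ FinAdele ((n + 1 : ℕ) : ℚ) * a ∈ Zhat)
      (q := fun a => a ∈ Zhat) fun a => Iff.rfl).secondCountableTopology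
  exact TopologicalSpace.secondCountableTopology_of_countable_cover
    (U := fun n : ℕ => {a : FinAdele | algebraMap ℚ FinAdele ((n + 1 : ℕ) : ℚ) * a ∈ Zhat})
    (fun n => isOpen_Zhat.preimage (by fun_prop)) iUnion_Zhat

/-- An open subgroup of the finite adeles contains `m Ẑ` for some `m ≥ 1`. -/
theorem exists_mul_Zhat_subset (W : AddSubgroup FinAdele) (hW : IsOpen (W : Set FinAdele)) :
    ∃ m : ℕ, m ≠ 0 ∧ ∀ x ∈ Zhat, algebraMap ℚ FinAdele (m : ℚ) * x ∈ W := by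
  let Z : AddSubgroup FinAdele := Zhat.toAddSubgroup
  have : CompactSpace Z := isCompact_iff_compactSpace.1 isCompact_Zhat
  have hopen : IsOpen ((W.addSubgroupOf Z : AddSubgroup Z) : Set Z) :=
    hW.preimage continuous_subtype_val
  -- An open subgroup of a compact group has finite index, and the index annihilates the quotient.
  -- So the index serves as `m`.
  have hfin : Finite (Z ⧸ W.addSubgroupOf Z) := AddSubgroup.quotient_finite_of_isOpen _ hopen
  refine ⟨Nat.card (Z ⧸ W.addSubgroupOf Z), Nat.card_pos.ne', fun x hx => ?_⟩
  have h := card_nsmul_eq_zero' (x := ((⟨x, hx⟩ : Z) : Z ⧸ W.addSubgroupOf Z))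
  rw [← QuotientAddGroup.mk_nsmul, QuotientAddGroup.eq_zero_iff, AddSubgroup.mem_addSubgroupOf] at h
  rw [map_natCast]
  simpa [nsmul_eq_mul] using h

/-! ### Ideles -/

theorem vnorm_finite_idele (α : FinAdeleˣ) (v : HeightOneSpectrum ℤ) :
    vnorm v ((α : FinAdele) v) * vnorm v ((α⁻¹ : FinAdeleˣ).1 v) = 1 := by
  rw [← vnorm_mul, ← FinAdele.mul_apply, Units.mul_inv, FinAdele.one_apply, vnorm_one]

/-- Finite ideles are positive rational multiples of integral units. -/
theorem exists_rat_mul_unit (α : FinAdeleˣ) : ∃ q : ℚ, 0 < q ∧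
    ∀ v, vnorm v (algebraMap ℚ _ q * (α : FinAdele) v) = 1 := by
  classical
  obtain ⟨n, hn, hα⟩ := exists_denominator (α : FinAdele)
  obtain ⟨m, hm, hα'⟩ := exists_denominator (α⁻¹ : FinAdeleˣ).1
  have hm' : (m : ℚ) ≠ 0 := by exact_mod_cast hm
  -- Among the fractions `j / m` that make `α` integral, take the smallest numerator. If the result
  -- were not a unit at `v`, then `j` divided by the prime of `v` would also do.
  have hex : ∃ j : ℕ, 0 < j ∧ algebraMap ℚ FinAdele (j / m : ℚ) * α ∈ Zhat :=
    ⟨n * m, by positivity, by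
      rw [Nat.cast_mul, mul_div_assoc, div_self hm', mul_one]; exact hα⟩
  obtain ⟨hj, hjα⟩ := Nat.find_spec hex
  set j := Nat.find hex with hjdef
  have hj' : (j : ℚ) ≠ 0 := by exact_mod_cast hj.ne'
  refine ⟨j / m, by positivity, fun v => le_antisymm (mem_Zhat.1 hjα v) ?_⟩
  by_contra! hlt
  have hp : (placePrime v : ℚ) ≠ 0 := by exact_mod_cast (placePrime_prime v).ne_zero
  have key : algebraMap ℚ FinAdele (j / m / placePrime v : ℚ) * α ∈ Zhat := by
    rw [mem_Zhat]
    intro w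
    rw [div_eq_inv_mul _ (placePrime v : ℚ), map_mul, mul_assoc, FinAdele.mul_apply, FinAdele.rat_apply, vnorm_mul, map_inv₀, vnorm_inv]
    have h0 := mem_Zhat.1 hjα w
    by_cases hw : w = v
    · subst hw
      rw [vnorm_prime_self, inv_inv]
      have h1 := vnorm_le_inv_prime w hlt
      have h2 : (0 : ℝ) < placePrime w := by exact_mod_cast (placePrime_prime w).pos
      calc _ ≤ (placePrime w : ℝ) * (placePrime w : ℝ)⁻¹ := by gcongr; exact h1
        _ = 1 := mul_inv_cancel₀ h2.ne'
    · rw [vnorm_prime_of_ne v hw, inv_one, one_mul]; exact h0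
  -- Multiplication by the integral adele `m α⁻¹` eliminates `α`, so that `j / p` is integral at
  -- every place and hence an integer.
  have hint : algebraMap ℚ FinAdele (j / placePrime v : ℚ) ∈ Zhat := by
    have := mul_mem key hα'
    have e : algebraMap ℚ FinAdele (j / m / placePrime v : ℚ) * α *
        (algebraMap ℚ FinAdele (m : ℚ) * (α⁻¹ : FinAdeleˣ).1) =
        algebraMap ℚ FinAdele (j / m / placePrime v * m : ℚ) * (α * (α⁻¹ : FinAdeleˣ).1) := by
      rw [map_mul]; ring
    rw [e, Units.mul_inv, mul_one] at this
    convert this using 2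
    field_simp
  obtain ⟨l, hl⟩ := rat_mem_Zhat_iff.1 hint
  have hpos : 0 < l := by
    have : (0 : ℚ) < l := by
      rw [hl]
      have := (placePrime_prime v).pos
      positivity
    exact_mod_cast this
  lift l to ℕ using hpos.le
  have hlt' : l < j := by
    have h2 : (2 : ℚ) ≤ placePrime v := by exact_mod_cast (placePrime_prime v).two_le
    have h3 : (l : ℚ) * placePrime v = j := by
      rw [Int.cast_natCast] at hl
      rw [hl]; field_simp
    have h4 : (0 : ℚ) < l := by exact_mod_cast hpos
    have : (l : ℚ) < j := by nlinarith
    exact_mod_cast this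
  refine Nat.find_min hex hlt' ⟨by exact_mod_cast hpos, ?_⟩
  rw [Int.cast_natCast] at hl
  rw [hl]
  convert key using 3
  field_simp

open Rat.HeightOneSpectrum

/-! ### The idele norm -/

theorem adeleAbs_eq (a : Adele) : adeleAbs a = |a.1| * ∏ᶠ v, vnorm v (a.2 v) := rfl

/-- The finite component of an idele. -/
noncomputable def finIdele : Adeleˣ →* FinAdeleˣ := Units.map (RingHom.snd ℝ FinAdele).toMonoidHom

theorem finIdele_val (a : Adeleˣ) : (finIdele a : FinAdele) = (a : Adele).2 := rfl

theorem finIdele_inv_val (a : Adeleˣ) : ((finIdele a)⁻¹ : FinAdeleˣ).1 = (a⁻¹ : Adeleˣ).1.2 := rfl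

/-- At almost all places both `α` and `α⁻¹` are integral, which forces norm `1`. -/
theorem finite_mulSupport_vnorm (α : FinAdeleˣ) :
    (Function.mulSupport fun v => vnorm v ((α : FinAdele) v)).Finite := by
  have h1 : {v | ¬ (α : FinAdele) v ∈ v.adicCompletionIntegers ℚ}.Finite := by
    simpa [Filter.eventually_cofinite] using! (α : FinAdele).2
  have h2 : {v | ¬ (α⁻¹ : FinAdeleˣ).1 v ∈ v.adicCompletionIntegers ℚ}.Finite := by
    simpa [Filter.eventually_cofinite] using! (α⁻¹ : FinAdeleˣ).1.2
  refine (h1.union h2).subset fun v hv => ?_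
  by_contra h
  rw [Set.mem_union, not_or] at h
  have e1 : vnorm v ((α : FinAdele) v) ≤ 1 := (mem_integers_iff v).1 (not_not.1 h.1)
  have e2 : vnorm v ((α⁻¹ : FinAdeleˣ).1 v) ≤ 1 := (mem_integers_iff v).1 (not_not.1 h.2)
  have e3 := vnorm_finite_idele α v
  refine hv (le_antisymm e1 ?_)
  nlinarith [vnorm_nonneg v ((α : FinAdele) v)]

theorem adeleAbs_mul (a b : Adeleˣ) : adeleAbs (a * b : Adeleˣ) = adeleAbs a * adeleAbs b := by
  rw [adeleAbs_eq, adeleAbs_eq, adeleAbs_eq]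
  have : ∏ᶠ v, vnorm v ((a * b : Adeleˣ).1.2 v) =
      ∏ᶠ v, (vnorm v ((a : Adele).2 v) * vnorm v ((b : Adele).2 v)) := by
    refine finprod_congr fun v => ?_
    rw [← vnorm_mul]; rfl
  have h2 := finprod_mul_distrib (finite_mulSupport_vnorm (finIdele a))
    (finite_mulSupport_vnorm (finIdele b))
  simp only [finIdele_val] at h2
  rw [this, h2, Units.val_mul, Prod.fst_mul, abs_mul]
  ring

theorem adeleAbs_one : adeleAbs ((1 : Adeleˣ) : Adele) = 1 := by
  rw [adeleAbs_eq]
  have : ∀ v, vnorm v (((1 : Adeleˣ) : Adele).2 v) = 1 := fun v => vnorm_one v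
  rw [finprod_eq_one_of_forall_eq_one this, Units.val_one, Prod.fst_one, abs_one, mul_one]

theorem adeleAbs_ne_zero (a : Adeleˣ) : adeleAbs a ≠ 0 := fun h => by
  have := adeleAbs_mul a a⁻¹
  rw [mul_inv_cancel, adeleAbs_one, h, zero_mul] at this
  exact one_ne_zero this

theorem adeleAbs_nonneg (a : Adele) : 0 ≤ adeleAbs a := by
  rw [adeleAbs_eq]
  exact mul_nonneg (abs_nonneg _) (finprod_nonneg fun v => vnorm_nonneg _ _)

theorem adeleAbs_pos (a : Adeleˣ) : 0 < adeleAbs a :=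
  lt_of_le_of_ne (adeleAbs_nonneg _) (adeleAbs_ne_zero a).symm

/-- A nonzero rational number as an idele. -/
noncomputable def ratIdele : ℚˣ →* Adeleˣ := Units.map (algebraMap ℚ Adele).toMonoidHom

theorem ratIdele_val (q : ℚˣ) : (ratIdele q : Adele) = algebraMap ℚ Adele q := rfl

theorem mem_ratIdeles {a : Adeleˣ} : a ∈ ratIdeles ↔ ∃ q : ℚˣ, ratIdele q = a := Iff.rfl

theorem adeleAbs_nat (n : ℕ) (hn : n ≠ 0) : adeleAbs (algebraMap ℚ Adele (n : ℚ)) = 1 := by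
  induction n using Nat.recOnMul with
  | zero => exact absurd rfl hn
  | one =>
    rw [Nat.cast_one, map_one]; exact adeleAbs_one
  | prime p hp =>
    obtain ⟨v, rfl⟩ := exists_place p hp
    rw [adeleAbs_eq]
    have h1 : (algebraMap ℚ Adele (placePrime v : ℚ)).1 = (placePrime v : ℝ) := by
      simp
    have h2 : ∀ w, vnorm w ((algebraMap ℚ Adele (placePrime v : ℚ)).2 w) =
      vnorm w (algebraMap ℚ _ (placePrime v : ℚ)) := fun w => rfl
    rw [finprod_eq_single _ v fun w hw => by rw [h2, vnorm_prime_of_ne v hw], h2, vnorm_prime_self,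
      h1, abs_of_nonneg (by positivity)]
    exact mul_inv_cancel₀ (by exact_mod_cast hp.ne_zero)
  | mul a b iha ihb =>
    have ha := left_ne_zero_of_mul hn
    have hb := right_ne_zero_of_mul hn
    have ha' : (a : ℚ) ≠ 0 := by exact_mod_cast ha
    have hb' : (b : ℚ) ≠ 0 := by exact_mod_cast hb
    have := adeleAbs_mul (ratIdele (Units.mk0 _ ha')) (ratIdele (Units.mk0 _ hb'))
    rw [ratIdele_val, ratIdele_val, ← map_mul, ratIdele_val] at this
    simp only [Units.val_mul, Units.val_mk0] at this
    rw [Nat.cast_mul, this, iha ha, ihb hb, mul_one]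

/-- The product formula. -/
theorem adeleAbs_ratIdele (q : ℚˣ) : adeleAbs (ratIdele q) = 1 := by
  have key : ∀ n : ℕ, n ≠ 0 → ∀ r : ℚˣ, (r : ℚ) = n → adeleAbs (ratIdele r) = 1 := by
    intro n hn r hr
    rw [ratIdele_val, hr]; exact adeleAbs_nat n hn
  -- Squaring removes the sign and reduces the claim to natural numbers.
  have hsq : adeleAbs (ratIdele q) * adeleAbs (ratIdele q) = 1 := by
    rw [← adeleAbs_mul, ← map_mul]
    have hd : (q : ℚ).den ≠ 0 := (q : ℚ).den_nz
    have hd' : ((q : ℚ).den : ℚ) ≠ 0 := by exact_mod_cast hd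
    have h1 := key ((q : ℚ).den * (q : ℚ).den) (mul_ne_zero hd hd)
      (Units.mk0 _ hd' * Units.mk0 _ hd') (by simp)
    have h2 := key ((q : ℚ).num.natAbs * (q : ℚ).num.natAbs) (by simp)
      (q * q * (Units.mk0 _ hd' * Units.mk0 _ hd')) (by
        simp only [Units.val_mul, Units.val_mk0]
        have e : (q : ℚ) * ((q : ℚ).den : ℚ) = (q : ℚ).num := Rat.mul_den_eq_num _
        have e' : (((q : ℚ).num.natAbs * (q : ℚ).num.natAbs : ℕ) : ℚ) =
          (q : ℚ).num * (q : ℚ).num := by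
          rw [← Int.cast_natCast, Int.natAbs_mul_self, Int.cast_mul]
        rw [e', ← e]; ring)
    rw [map_mul, adeleAbs_mul, h1, mul_one] at h2
    exact h2
  nlinarith [adeleAbs_pos (ratIdele q)]

/-- The ideles whose finite components are units. -/
def unitIdeles : Subgroup Adeleˣ where
  carrier := {a | (a : Adele).2 ∈ Zhat ∧ (a⁻¹ : Adeleˣ).1.2 ∈ Zhat}
  mul_mem' {a b} ha hb := ⟨mul_mem ha.1 hb.1, by
    rw [mul_inv]; exact mul_mem ha.2 hb.2⟩
  one_mem' := ⟨Zhat.one_mem, by rw [inv_one]; exact Zhat.one_mem⟩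
  inv_mem' {a} ha := ⟨ha.2, by rw [inv_inv]; exact ha.1⟩

theorem mem_unitIdeles {a : Adeleˣ} :
    a ∈ unitIdeles ↔ (a : Adele).2 ∈ Zhat ∧ (a⁻¹ : Adeleˣ).1.2 ∈ Zhat := Iff.rfl

theorem mem_unitIdeles_iff_vnorm {a : Adeleˣ} :
    a ∈ unitIdeles ↔ ∀ v, vnorm v ((a : Adele).2 v) = 1 := by
  rw [mem_unitIdeles, mem_Zhat, mem_Zhat]
  have h := vnorm_finite_idele (finIdele a)
  constructor
  · rintro ⟨h1, h2⟩ v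
    have := h v
    rw [finIdele_val, finIdele_inv_val] at this
    refine le_antisymm (h1 v) ?_
    nlinarith [h1 v, h2 v, vnorm_nonneg v ((a : Adele).2 v)]
  · intro h1
    refine ⟨fun v => (h1 v).le, fun v => ?_⟩
    have := h v
    rw [finIdele_val, finIdele_inv_val, h1, one_mul] at this
    exact this.le

theorem isOpen_unitIdeles : IsOpen (unitIdeles : Set Adeleˣ) :=
  (isOpen_Zhat.preimage (continuous_snd.comp Units.continuous_val)).inter
    (isOpen_Zhat.preimage (continuous_snd.comp (Units.continuous_val.comp continuous_inv)))

theorem adeleAbs_of_mem_unitIdeles {a : Adeleˣ} (ha : a ∈ unitIdeles) :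
    adeleAbs a = |(a : Adele).1| := by
  rw [adeleAbs_eq, finprod_eq_one_of_forall_eq_one (mem_unitIdeles_iff_vnorm.1 ha), mul_one]

/-- Near `1` all finite components are units, so the norm is the real absolute value there.
Multiplicativity carries the continuity to any other point. -/
theorem continuous_adeleAbs : Continuous fun a : Adeleˣ => adeleAbs a := by
  rw [continuous_iff_continuousAt]
  intro a
  have h1 : ContinuousAt (fun b : Adeleˣ => adeleAbs b) 1 := by
    have : (fun b : Adeleˣ => adeleAbs b) =ᶠ[nhds 1] fun b => |(b : Adele).1| := by
      filter_upwards [isOpen_unitIdeles.mem_nhds unitIdeles.one_mem] with b hb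
      exact adeleAbs_of_mem_unitIdeles hb
    refine ContinuousAt.congr ?_ this.symm
    exact (continuous_abs.comp (continuous_fst.comp Units.continuous_val)).continuousAt
  have h2 : (fun b : Adeleˣ => adeleAbs b) = fun b => adeleAbs a * adeleAbs (a⁻¹ * b : Adeleˣ) := by
    funext b
    rw [← adeleAbs_mul, mul_inv_cancel_left]
  rw [h2]
  refine ContinuousAt.mul continuousAt_const ?_
  refine ContinuousAt.comp (f := fun b => a⁻¹ * b) (g := fun b : Adeleˣ => adeleAbs b) ?_ ?_
  · rw [inv_mul_cancel]; exact h1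
  · fun_prop

/-- The subgroup `ℝ_{>0} × Ẑˣ`, a strict fundamental domain for `ℚˣ` in the ideles. -/
def posIdeles : Subgroup Adeleˣ where
  carrier := {a | 0 < (a : Adele).1 ∧ a ∈ unitIdeles}
  mul_mem' ha hb := ⟨mul_pos ha.1 hb.1, mul_mem ha.2 hb.2⟩
  one_mem' := ⟨zero_lt_one, one_mem _⟩
  inv_mem' {a} ha := ⟨by
    have h : (a : Adele).1 * (a⁻¹ : Adeleˣ).1.1 = 1 := by rw [← Prod.fst_mul, Units.mul_inv]; rfl
    exact pos_of_mul_pos_right (by rw [h]; exact one_pos) ha.1.le, inv_mem ha.2⟩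

theorem isOpen_posIdeles : IsOpen (posIdeles : Set Adeleˣ) :=
  (isOpen_Ioi.preimage (continuous_fst.comp Units.continuous_val)).inter isOpen_unitIdeles

theorem fst_mul_inv (a : Adeleˣ) : (a : Adele).1 * (a⁻¹ : Adeleˣ).1.1 = 1 := by
  rw [← Prod.fst_mul, Units.mul_inv]; rfl

/-- `ℚ` has class number one; the sign of the rational number is used to make the real component
positive. -/
theorem exists_ratIdele_mul_mem (a : Adeleˣ) : ∃ q : ℚˣ, ratIdele q * a ∈ posIdeles := by
  obtain ⟨q, hq, h⟩ := exists_rat_mul_unit (finIdele a)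
  have hne : (a : Adele).1 ≠ 0 := left_ne_zero_of_mul_eq_one (fst_mul_inv a)
  rcases lt_or_gt_of_ne hne with hlt | hgt
  · refine ⟨Units.mk0 (-q) (by simpa using hq.ne'), ?_, mem_unitIdeles_iff_vnorm.2 fun v => ?_⟩
    · have : (0 : ℝ) < ((-q : ℚ) : ℝ) * (a : Adele).1 := by
        push_cast
        have : (0 : ℝ) < q := by exact_mod_cast hq
        nlinarith
      exact this
    · have h' := h v
      change vnorm v (algebraMap ℚ _ (-q) * (a : Adele).2 v) = 1
      rw [map_neg, neg_mul, vnorm_neg]; exact h'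
  · refine ⟨Units.mk0 q hq.ne', ?_, mem_unitIdeles_iff_vnorm.2 fun v => h v⟩
    have : (0 : ℝ) < (q : ℝ) * (a : Adele).1 := by
      have : (0 : ℝ) < q := by exact_mod_cast hq
      positivity
    exact this

/-- A rational number that is a unit at all primes is `±1`, and positivity fixes the sign. -/
theorem ratIdele_mem_posIdeles {q : ℚˣ} (h : ratIdele q ∈ posIdeles) : q = 1 := by
  obtain ⟨h0, h1, h2⟩ := h
  obtain ⟨n, hn⟩ := (rat_mem_Zhat_iff (q := (q : ℚ))).1 h1
  rw [← map_inv] at h2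
  obtain ⟨m, hm⟩ := (rat_mem_Zhat_iff (q := ((q⁻¹ : ℚˣ) : ℚ))).1 h2
  have h0' : (0 : ℝ) < ((q : ℚ) : ℝ) := h0
  have h0'' : (0 : ℚ) < q := by exact_mod_cast h0'
  have hmn : n * m = 1 := by
    have : (n * m : ℚ) = 1 := by rw [hn, hm, Units.mul_inv]
    exact_mod_cast this
  have hnpos : 0 < n := by rw [← hn] at h0''; exact_mod_cast h0''
  have : n = 1 := by
    rcases Int.eq_one_or_neg_one_of_mul_eq_one hmn with h | h
    · exact h
    · omega
  ext
  rw [← hn, this]; simp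

/-! ### Real and finite components in `GL₂` -/

/-- The real component. -/
noncomputable def realPart : GL2 Adele →* GL2 ℝ := Matrix.GeneralLinearGroup.map (RingHom.fst ℝ FinAdele)

/-- The finite component. -/
noncomputable def finPart : GL2 Adele →* GL2 FinAdele := Matrix.GeneralLinearGroup.map (RingHom.snd ℝ FinAdele)

theorem glProd_realPart_finPart (g : GL2 Adele) : glProd (realPart g) (finPart g) = g := by
  ext i j <;> rfl

theorem realPart_glProd (x : GL2 ℝ) (k : GL2 FinAdele) : realPart (glProd x k) = x := by
  ext i j; rfl

theorem finPart_glProd (x : GL2 ℝ) (k : GL2 FinAdele) : finPart (glProd x k) = k := by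
  apply Units.ext; rfl

theorem glProd_mul (x x' : GL2 ℝ) (k k' : GL2 FinAdele) :
    glProd x k * glProd x' k' = glProd (x * x') (k * k') := by
  apply Units.ext; exact matProd_mul _ _ _ _

theorem glProd_inv (x : GL2 ℝ) (k : GL2 FinAdele) : (glProd x k)⁻¹ = glProd x⁻¹ k⁻¹ := by
  apply Units.ext; rfl

/-- Rational matrices. -/
noncomputable abbrev ratGL : GL2 ℚ →* GL2 Adele :=
  Matrix.GeneralLinearGroup.map (algebraMap ℚ Adele)

noncomputable abbrev ratGLReal : GL2 ℚ →* GL2 ℝ :=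
  Matrix.GeneralLinearGroup.map (algebraMap ℚ ℝ)

noncomputable abbrev ratGLFin : GL2 ℚ →* GL2 FinAdele :=
  Matrix.GeneralLinearGroup.map (algebraMap ℚ FinAdele)

theorem ratGL_eq (γ : GL2 ℚ) : ratGL γ = glProd (ratGLReal γ) (ratGLFin γ) := by
  apply Units.ext; rfl

theorem det_glProd (x : GL2 ℝ) (k : GL2 FinAdele) :
    ((Matrix.GeneralLinearGroup.det (glProd x k) : Adeleˣ) : Adele) = (x.val.det, k.val.det) := by
  change (matProd x.val k.val).det = _
  simp only [matProd, Matrix.det_fin_two, Matrix.of_apply]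
  rfl

/-! ### Iwasawa decomposition over the finite adeles -/

/-- The matrices with integral entries whose inverses have integral entries. -/
def GLZhat : Subgroup (GL2 FinAdele) where
  carrier := {k | (∀ i j, k.val i j ∈ Zhat) ∧ ∀ i j, k⁻¹.val i j ∈ Zhat}
  mul_mem' {a b} ha hb := by
    refine ⟨fun i j => ?_, fun i j => ?_⟩
    · rw [Units.val_mul, Matrix.mul_apply]
      exact sum_mem fun l _ => mul_mem (ha.1 i l) (hb.1 l j)
    · rw [_root_.mul_inv_rev, Units.val_mul, Matrix.mul_apply]
      exact sum_mem fun l _ => mul_mem (hb.2 i l) (ha.2 l j)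
  one_mem' := by
    have : ∀ i j, (1 : GL2 FinAdele).val i j ∈ Zhat := fun i j => by
      rw [Units.val_one, Matrix.one_apply]; split_ifs
      · exact Zhat.one_mem
      · exact Zhat.zero_mem
    exact ⟨this, by rw [inv_one]; exact this⟩
  inv_mem' {a} ha := ⟨ha.2, by rw [inv_inv]; exact ha.1⟩

/-- The matrix with given entries and inverse determinant. -/
def glOfDet {R : Type*} [CommRing R] (a b c d : R) (u : Rˣ) (h : a * d - b * c = u) : GL2 R where
  val := !![a, b; c, d]
  inv := (u⁻¹ : Rˣ).1 • !![d, -b; -c, a]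
  val_inv := by
    rw [Matrix.mul_smul, Matrix.one_fin_two, Matrix.mul_fin_two, ← Units.inv_mul u, ← h]
    ext i j; fin_cases i <;> fin_cases j <;> simp <;> ring
  inv_val := by
    rw [Matrix.smul_mul, Matrix.one_fin_two, Matrix.mul_fin_two, ← Units.inv_mul u, ← h]
    ext i j; fin_cases i <;> fin_cases j <;> simp <;> ring

theorem glOfDet_val {R : Type*} [CommRing R] (a b c d : R) (u : Rˣ) (h : a * d - b * c = u) :
    (glOfDet a b c d u h).val = !![a, b; c, d] := rfl

theorem glOfDet_inv_val {R : Type*} [CommRing R] (a b c d : R) (u : Rˣ) (h : a * d - b * c = u) :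
    (glOfDet a b c d u h)⁻¹.val = (u⁻¹ : Rˣ).1 • !![d, -b; -c, a] := rfl

theorem det_apply_ne_zero (g : GL2 FinAdele) (v : HeightOneSpectrum ℤ) : g.val.det v ≠ 0 := by
  have : g.val.det * g⁻¹.val.det = 1 := by rw [← Matrix.det_mul, Units.mul_inv, Matrix.det_one]
  have h : g.val.det v * g⁻¹.val.det v = 1 := by
    rw [← FinAdele.mul_apply, this]; rfl
  exact left_ne_zero_of_mul_eq_one h

theorem mem_integers_div {v : HeightOneSpectrum ℤ} {x y : v.adicCompletion ℚ} (hy : y ≠ 0)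
    (h : vnorm v x ≤ vnorm v y) : x / y ∈ v.adicCompletionIntegers ℚ := by
  rw [mem_integers_iff, div_eq_mul_inv, vnorm_mul, vnorm_inv]
  have : 0 < vnorm v y := lt_of_le_of_ne (vnorm_nonneg _ _) fun h => hy ((vnorm_eq_zero v).1 h.symm)
  rw [← div_eq_mul_inv, div_le_one this]; exact h

/-- The larger of `c` and `d` divides the other in the integers of `ℚ_v`. So `(c, d)` is a multiple
of a primitive row, which completes to an integral matrix of determinant one. -/
theorem exists_local_iwasawa (v : HeightOneSpectrum ℤ) (c d : v.adicCompletion ℚ)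
    (h : c ≠ 0 ∨ d ≠ 0) : ∃ a' b' c' d' : v.adicCompletionIntegers ℚ,
      (a' : v.adicCompletion ℚ) * d' - b' * c' = 1 ∧
      c * (d' : v.adicCompletion ℚ) - d * c' = 0 := by
  by_cases hcd : vnorm v d ≤ vnorm v c
  · have hc : c ≠ 0 := by
      rintro rfl
      have h0 : vnorm v 0 = 0 := (vnorm_eq_zero v).2 rfl
      rw [h0] at hcd
      have : d = 0 := (vnorm_eq_zero v).1 (le_antisymm hcd (vnorm_nonneg _ _))
      simp [this] at h
    refine ⟨0, -1, 1, ⟨d / c, mem_integers_div hc hcd⟩, by simp, ?_⟩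
    simp; field_simp; simp
  · push Not at hcd
    have hd : d ≠ 0 := by
      rintro rfl
      have h0 : vnorm v 0 = 0 := (vnorm_eq_zero v).2 rfl
      rw [h0] at hcd
      exact absurd (vnorm_nonneg v c) (not_le.2 hcd)
    refine ⟨1, 0, ⟨c / d, mem_integers_div hd hcd.le⟩, 1, by simp, ?_⟩
    simp; field_simp; simp

/-- The Iwasawa decomposition of `GL₂(𝔸_f)`. -/
theorem exists_iwasawa (g : GL2 FinAdele) :
    ∃ k ∈ GLZhat, k.val.det = 1 ∧ (g * k⁻¹).val 1 0 = 0 := by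
  have hcd : ∀ v, g.val 1 0 v ≠ 0 ∨ g.val 1 1 v ≠ 0 := by
    intro v
    by_contra! h
    apply det_apply_ne_zero g v
    rw [Matrix.det_fin_two, FinAdele.sub_apply, FinAdele.mul_apply, FinAdele.mul_apply, h.1, h.2]
    simp
  choose a b c d hdet hz using fun v => exists_local_iwasawa v _ _ (hcd v)
  have hd1 : zhatMap a * zhatMap d - zhatMap b * zhatMap c = ((1 : FinAdeleˣ) : FinAdele) := by
    refine FiniteAdeleRing.ext _ fun v => ?_
    exact hdet v
  have hmem : ∀ x, zhatMap x ∈ Zhat := fun x => by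
    rw [← SetLike.mem_coe, ← range_zhatMap]; exact ⟨x, rfl⟩
  refine ⟨glOfDet _ _ _ _ 1 hd1, ⟨fun i j => ?_, fun i j => ?_⟩, ?_, ?_⟩
  · rw [glOfDet_val]; fin_cases i <;> fin_cases j <;> exact hmem _
  · rw [glOfDet_inv_val, inv_one, Units.val_one, one_smul]
    fin_cases i <;> fin_cases j
    · exact hmem _
    · exact neg_mem (hmem _)
    · exact neg_mem (hmem _)
    · exact hmem _
  · rw [glOfDet_val, Matrix.det_fin_two_of]; exact hd1
  · rw [Units.val_mul, glOfDet_inv_val, inv_one, Units.val_one, one_smul, Matrix.mul_apply,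
      Fin.sum_univ_two]
    refine FiniteAdeleRing.ext _ fun v => ?_
    have := hz v
    rw [sub_eq_add_neg, ← mul_neg] at this
    exact this

theorem det_mem_of_mem_GLZhat {k : GL2 FinAdele} (hk : k ∈ GLZhat) :
    k.val.det ∈ Zhat ∧ k⁻¹.val.det ∈ Zhat := by
  rw [Matrix.det_fin_two, Matrix.det_fin_two]
  exact ⟨sub_mem (mul_mem (hk.1 _ _) (hk.1 _ _)) (mul_mem (hk.1 _ _) (hk.1 _ _)),
    sub_mem (mul_mem (hk.2 _ _) (hk.2 _ _)) (mul_mem (hk.2 _ _) (hk.2 _ _))⟩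

/-- `GL₂(𝔸_f) = GL₂(ℚ)⁺ GL₂(Ẑ)`. -/
theorem exists_ratGLFin_mul_mem (g : GL2 FinAdele) :
    ∃ γ : GL2 ℚ, 0 < γ.val.det ∧ ratGLFin γ * g ∈ GLZhat := by
  obtain ⟨k, hk, -, hb⟩ := exists_iwasawa g
  set b := g * k⁻¹ with hbdef
  have hdet : b.val 0 0 * b.val 1 1 * b⁻¹.val.det = 1 := by
    have h := congrArg Matrix.det (Units.mul_inv b)
    rw [Matrix.det_mul, Matrix.det_one, Matrix.det_fin_two b.val, hb, mul_zero, sub_zero] at h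
    exact h
  let u1 : FinAdeleˣ := ⟨b.val 0 0, b.val 1 1 * b⁻¹.val.det, by rw [← mul_assoc, hdet],
    by rw [mul_comm, ← mul_assoc, hdet]⟩
  let u2 : FinAdeleˣ := ⟨b.val 1 1, b.val 0 0 * b⁻¹.val.det, by
    rw [← mul_assoc, mul_comm (b.val 1 1), hdet], by
    rw [mul_comm, ← mul_assoc, mul_comm (b.val 1 1), hdet]⟩
  -- After the Iwasawa decomposition only the upper triangular `b` remains. The rationals `q1` and
  -- `q2` make its diagonal entries units, and a rational unipotent with entry `s` makes the corner
  -- integral, since `𝔸_f = ℚ + Ẑ`.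
  obtain ⟨q1, hq1, h1⟩ := exists_rat_mul_unit u1
  obtain ⟨q2, hq2, h2⟩ := exists_rat_mul_unit u2
  let e1 : FinAdeleˣ := Units.map (algebraMap ℚ FinAdele).toMonoidHom (Units.mk0 q1 hq1.ne') * u1
  let e2 : FinAdeleˣ := Units.map (algebraMap ℚ FinAdele).toMonoidHom (Units.mk0 q2 hq2.ne') * u2
  have he1 : (e1 : FinAdele) = algebraMap ℚ FinAdele q1 * b.val 0 0 := rfl
  have he2 : (e2 : FinAdele) = algebraMap ℚ FinAdele q2 * b.val 1 1 := rfl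
  have hint : ∀ e : FinAdeleˣ, (∀ v, vnorm v ((e : FinAdele) v) = 1) →
      (e : FinAdele) ∈ Zhat ∧ (e⁻¹ : FinAdeleˣ).1 ∈ Zhat := fun e he => by
    refine ⟨mem_Zhat.2 fun v => (he v).le, mem_Zhat.2 fun v => ?_⟩
    have := vnorm_finite_idele e v
    rw [he v, one_mul] at this
    exact this.le
  obtain ⟨h1a, h1b⟩ := hint e1 h1
  obtain ⟨h2a, h2b⟩ := hint e2 h2
  obtain ⟨s, z, hz, hs⟩ := exists_rat_add_mul_Zhat 1 one_ne_zero
    (algebraMap ℚ FinAdele q1 * b.val 0 1 * (e2⁻¹ : FinAdeleˣ).1)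
  rw [Nat.cast_one, map_one, one_mul] at hs
  have hs' : algebraMap ℚ FinAdele q1 * b.val 0 1 = algebraMap ℚ FinAdele s * e2 + z * e2 := by
    rw [← add_mul, ← hs, mul_assoc, Units.inv_mul, mul_one]
  let γ : GL2 ℚ := glOfDet q1 (-s * q2) 0 q2 (Units.mk0 _ (mul_pos hq1 hq2).ne') (by simp)
  have hγb : (ratGLFin γ * b).val = !![(e1 : FinAdele), z * e2; 0, e2] := by
    have hγ : (ratGLFin γ).val = !![algebraMap ℚ FinAdele q1,
        -(algebraMap ℚ FinAdele s * algebraMap ℚ FinAdele q2); 0, algebraMap ℚ FinAdele q2] := by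
      ext i j
      fin_cases i <;> fin_cases j <;> simp [γ, glOfDet]
    rw [Units.val_mul, hγ]
    refine Matrix.ext fun i j => ?_
    rw [Matrix.mul_apply, Fin.sum_univ_two]
    fin_cases i <;> fin_cases j
    · simp [hb, he1]
    · simp only [Fin.zero_eta, Fin.mk_one, Fin.isValue, Matrix.of_apply, Matrix.cons_val', Matrix.cons_val_zero,
        Matrix.cons_val_one, Matrix.cons_val_fin_one]
      rw [hs', he2]; ring
    · simp [hb]
    · simp [he2]
  have hmem : ratGLFin γ * b ∈ GLZhat := by
    refine ⟨fun i j => ?_, fun i j => ?_⟩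
    · rw [hγb]
      fin_cases i <;> fin_cases j
      · exact h1a
      · exact mul_mem hz h2a
      · exact Zhat.zero_mem
      · exact h2a
    · have h : ratGLFin γ * b = glOfDet (e1 : FinAdele) (z * e2) 0 e2 (e1 * e2) (by simp) :=
        Units.ext hγb
      rw [h, glOfDet_inv_val, Matrix.smul_apply, smul_eq_mul]
      refine mul_mem (by rw [_root_.mul_inv]; exact mul_mem h1b h2b) ?_
      fin_cases i <;> fin_cases j
      · exact h2a
      · exact neg_mem (mul_mem hz h2a)
      · exact neg_mem Zhat.zero_mem
      · exact h1a
  refine ⟨γ, ?_, ?_⟩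
  · rw [glOfDet_val, Matrix.det_fin_two_of, mul_zero, sub_zero]; exact mul_pos hq1 hq2
  · have : ratGLFin γ * g = ratGLFin γ * b * k := by rw [hbdef]; group
    rw [this]; exact mul_mem hmem hk

theorem mem_GLZhat_of_int {γ : GL2 ℚ} (h : ∀ i j, ∃ n : ℤ, γ.val i j = n)
    (h' : ∀ i j, ∃ n : ℤ, γ⁻¹.val i j = n) : ratGLFin γ ∈ GLZhat := by
  refine ⟨fun i j => ?_, fun i j => ?_⟩
  · obtain ⟨n, hn⟩ := h i j
    have : (ratGLFin γ).val i j = algebraMap ℚ FinAdele (γ.val i j) := rfl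
    rw [this, hn]; exact intCast_mem_Zhat n
  · obtain ⟨n, hn⟩ := h' i j
    have : (ratGLFin γ)⁻¹.val i j = algebraMap ℚ FinAdele (γ⁻¹.val i j) := rfl
    rw [this, hn]; exact intCast_mem_Zhat n

/-- `GL₂(𝔸) = GL₂(ℚ) (GL₂(ℝ)⁺ × GL₂(Ẑ))`. -/
theorem exists_ratGL_mul (g : GL2 Adele) :
    ∃ γ : GL2 ℚ, 0 < (realPart (ratGL γ * g)).val.det ∧ finPart (ratGL γ * g) ∈ GLZhat := by
  obtain ⟨γ, hγ, h⟩ := exists_ratGLFin_mul_mem (finPart g)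
  have hfin : ∀ δ, finPart (ratGL δ * g) = ratGLFin δ * finPart g := fun δ => by
    rw [map_mul]; rfl
  have hreal : ∀ δ, (realPart (ratGL δ * g)).val.det =
      ((δ.val.det : ℚ) : ℝ) * (realPart g).val.det := fun δ => by
    rw [map_mul, Units.val_mul, Matrix.det_mul]
    congr 1
    exact (RingHom.map_det (algebraMap ℚ ℝ) δ.val).symm
  have hne : (realPart g).val.det ≠ 0 := Matrix.GeneralLinearGroup.det_ne_zero _
  have hγ' : (0 : ℝ) < ((γ.val.det : ℚ) : ℝ) := by exact_mod_cast hγ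
  rcases lt_or_gt_of_ne hne with hlt | hgt
  · let δ : GL2 ℚ := glOfDet (-1) 0 0 1 (-1) (by simp)
    refine ⟨δ * γ, ?_, ?_⟩
    · rw [hreal, Units.val_mul, Matrix.det_mul]
      have : δ.val.det = -1 := by simp [δ, glOfDet_val]
      rw [this, Rat.cast_mul, Rat.cast_neg, Rat.cast_one]
      nlinarith
    · rw [hfin, map_mul, mul_assoc]
      refine mul_mem (mem_GLZhat_of_int (fun i j => ?_) fun i j => ?_) h
      · rw [glOfDet_val]
        fin_cases i <;> fin_cases j
        exacts [⟨-1, by simp⟩, ⟨0, by simp⟩, ⟨0, by simp⟩, ⟨1, by simp⟩]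
      · rw [glOfDet_inv_val]
        fin_cases i <;> fin_cases j
        exacts [⟨-1, by simp⟩, ⟨0, by simp⟩, ⟨0, by simp⟩, ⟨1, by simp⟩]
  · exact ⟨γ, by rw [hreal]; positivity, by rw [hfin]; exact h⟩

/-! ### Continuity of cusp forms -/

section Continuity

theorem continuous_realPart : Continuous realPart :=
  Continuous.units_map _ (continuous_matrix fun i j =>
    continuous_fst.comp (continuous_id.matrix_elem i j))

theorem continuous_finPart : Continuous finPart :=
  Continuous.units_map _ (continuous_matrix fun i j =>
    continuous_snd.comp (continuous_id.matrix_elem i j))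

theorem realSlice_apply (φ : GL2 Adele → ℂ) (k : GL2 FinAdele) (x : GL2 ℝ) :
    realSlice φ k x.val = φ (glProd x k) := by
  have h : (Matrix.of x.val).det ≠ 0 := Matrix.GeneralLinearGroup.det_ne_zero x
  refine (dif_pos h).trans ?_
  congr 2
  apply Units.ext; rfl

theorem isOpen_det_ne_zero : IsOpen {y : Fin 2 → Fin 2 → ℝ | (Matrix.of y).det ≠ 0} := by
  have : Continuous fun y : Fin 2 → Fin 2 → ℝ => (Matrix.of y).det :=
    Continuous.matrix_det (continuous_matrix fun i j => by
      exact (continuous_apply j).comp (continuous_apply i))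
  exact isOpen_ne.preimage this

variable {dx : Measure AdeleModRat} {χ : Adeleˣ →* ℂˣ} {φ : GL2 Adele → ℂ}

theorem IsCuspForm.glProd_mul_of_mem (hφ : IsCuspForm dx χ φ) :
    ∃ K : Subgroup (GL2 FinAdele), IsOpen (K : Set (GL2 FinAdele)) ∧
      ∀ k ∈ K, ∀ x k', φ (glProd x (k' * k)) = φ (glProd x k') := by
  obtain ⟨K, hK, h⟩ := hφ.finite_smooth
  refine ⟨K, hK, fun k hk x k' => ?_⟩
  rw [← h k hk (glProd x k'), glProd_mul, mul_one]

/-- By invariance under an open subgroup of `GL₂(𝔸_f)`, near `g₀` the function depends on the real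
component alone, where it is smooth. -/
theorem IsCuspForm.continuous (hφ : IsCuspForm dx χ φ) : Continuous φ := by
  obtain ⟨K, hK, h⟩ := hφ.glProd_mul_of_mem
  rw [continuous_iff_continuousAt]
  intro g₀
  have hev : φ =ᶠ[nhds g₀] fun g => realSlice φ (finPart g₀) (realPart g).val := by
    have hc : Continuous fun g => (finPart g₀)⁻¹ * finPart g :=
      continuous_const.mul continuous_finPart
    have hmem : (fun g => (finPart g₀)⁻¹ * finPart g) ⁻¹' (K : Set (GL2 FinAdele)) ∈ nhds g₀ :=
      (hK.preimage hc).mem_nhds (by simp [K.one_mem])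
    filter_upwards [hmem] with g hg
    rw [realSlice_apply]
    conv_lhs => rw [← glProd_realPart_finPart g]
    rw [← h _ hg (realPart g) (finPart g₀), mul_inv_cancel_left]
  refine ContinuousAt.congr ?_ hev.symm
  have h1 : ContinuousAt (realSlice φ (finPart g₀)) (realPart g₀).val :=
    ((hφ.real_smooth _).continuousOn).continuousAt
      (isOpen_det_ne_zero.mem_nhds (Matrix.GeneralLinearGroup.det_ne_zero (realPart g₀)))
  have h2 : Continuous fun g => (realPart g).val := Units.continuous_val.comp continuous_realPart
  exact ContinuousAt.comp (f := fun g => (realPart g).val) h1 h2.continuousAt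

end Continuity

/-! ### Unipotent elements -/

/-- `n(x) = (1, x; 0, 1)`. -/
abbrev unip {R : Type*} [CommRing R] (x : R) : GL2 R := Matrix.GeneralLinearGroup.upperRightHom x

theorem unip_val {R : Type*} [CommRing R] (x : R) : (unip x).val = !![1, x; 0, 1] := rfl

theorem unip_inv {R : Type*} [CommRing R] (x : R) : (unip x)⁻¹ = unip (-x) :=
  (AddChar.map_neg_eq_inv _ _).symm

theorem unip_inv_val {R : Type*} [CommRing R] (x : R) : (unip x)⁻¹.val = !![1, -x; 0, 1] := rfl

theorem unip_add {R : Type*} [CommRing R] (x y : R) : unip (x + y) = unip x * unip y :=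
  AddChar.map_add_eq_mul _ _ _

theorem continuous_unip {R : Type*} [CommRing R] [TopologicalSpace R] [IsTopologicalRing R] :
    Continuous (unip : R → GL2 R) := by
  rw [Units.continuous_iff]
  constructor
  · refine continuous_matrix fun i j => ?_
    fin_cases i <;> fin_cases j <;> simp <;> fun_prop
  · refine continuous_matrix fun i j => ?_
    fin_cases i <;> fin_cases j <;> simp <;> fun_prop

theorem unip_adele (x : Adele) : unip x = glProd (unip x.1) (unip x.2) := by
  apply Units.ext
  refine Matrix.ext fun i j => ?_
  fin_cases i <;> fin_cases j <;> rfl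

/-! ### Periodic functions with mean zero -/

section Periodic

open intervalIntegral

/-- Mean zero makes `F s` the average of `F s - F t` over a period, and each difference is at most
`m B` by the mean value inequality. -/
theorem norm_le_mul_of_deriv_bound {F : ℝ → ℂ} {m B : ℝ} (hm : 0 < m) (hF : Differentiable ℝ F)
    (hper : Function.Periodic F m) (hmean : ∫ s in (0 : ℝ)..m, F s = 0)
    (hB : ∀ s, ‖deriv F s‖ ≤ B) (s : ℝ) : ‖F s‖ ≤ m * B := by
  have hcont := hF.continuous
  have hB0 : 0 ≤ B := (norm_nonneg _).trans (hB 0)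
  have hmean' : ∫ t in s..s + m, F t = 0 := by
    rw [hper.intervalIntegral_add_eq s 0, zero_add, hmean]
  have h1 : (m : ℂ) * F s = ∫ t in s..s + m, (F s - F t) := by
    rw [integral_sub (by simp) (hcont.intervalIntegrable _ _), hmean', sub_zero,
      intervalIntegral.integral_const]
    simp
  have h2 : ‖∫ t in s..s + m, (F s - F t)‖ ≤ (B * m) * |s + m - s| := by
    refine norm_integral_le_of_norm_le_const fun t ht => ?_
    rw [Set.uIoc_of_le (by linarith)] at ht
    have := Convex.norm_image_sub_le_of_norm_deriv_le (f := F) (C := B) (s := Set.univ)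
      (fun x _ => hF x) (fun x _ => hB x) convex_univ (Set.mem_univ t) (Set.mem_univ s)
    refine this.trans ?_
    have : ‖s - t‖ ≤ m := by
      rw [Real.norm_eq_abs, abs_le]; constructor <;> linarith [ht.1, ht.2]
    gcongr
  rw [← h1, norm_mul, Complex.norm_real, Real.norm_of_nonneg hm.le, add_sub_cancel_left,
    abs_of_pos hm] at h2
  nlinarith

/-- The derivative of a periodic function is again periodic with mean zero, so the previous estimate
can be iterated; each step costs a factor `m`. -/
theorem norm_le_pow_mul_of_iteratedDeriv_bound {m : ℝ} (hm : 0 < m) (M : ℕ) :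
    ∀ {F : ℝ → ℂ} {B : ℝ}, ContDiff ℝ ∞ F → Function.Periodic F m →
      ∫ s in (0 : ℝ)..m, F s = 0 → (∀ s, ‖iteratedDeriv M F s‖ ≤ B) → ∀ s, ‖F s‖ ≤ m ^ M * B := by
  induction M with
  | zero => intro F B _ _ _ hB s; simpa using hB s
  | succ M ih =>
    intro F B hF hper hmean hB s
    have hdiff : Differentiable ℝ F := hF.differentiable (by simp)
    have hF' : ContDiff ℝ ∞ (deriv F) := ((contDiff_infty_iff_deriv).1 hF).2
    have hper' : Function.Periodic (deriv F) m := fun t => by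
      rw [← deriv_comp_add_const]
      congr 1
      funext u; exact hper u
    have hmean' : ∫ s in (0 : ℝ)..m, deriv F s = 0 := by
      rw [integral_deriv_eq_sub (fun x _ => hdiff x) (hF'.continuous.intervalIntegrable _ _)]
      have := hper 0
      rw [zero_add] at this
      rw [this, sub_self]
    have h := ih hF' hper' hmean' (B := B) fun t => by
      rw [← iteratedDeriv_succ']; exact hB t
    have := norm_le_mul_of_deriv_bound hm hdiff hper hmean h s
    rw [pow_succ']; linarith

end Periodic

/-! ### The constant term -/

section ConstantTerm

variable {dx : Measure AdeleModRat} {χ : Adeleˣ →* ℂˣ} {φ : GL2 Adele → ℂ}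

/-- A cusp form is periodic along the finite unipotent adeles. -/
theorem IsCuspForm.exists_period (hφ : IsCuspForm dx χ φ) (k : GL2 FinAdele) :
    ∃ m : ℕ, m ≠ 0 ∧ ∀ z ∈ Zhat, ∀ x,
      φ (glProd x (unip (algebraMap ℚ FinAdele (m : ℚ) * z) * k)) = φ (glProd x k) := by
  obtain ⟨K, hK, h⟩ := hφ.glProd_mul_of_mem
  -- The `z` whose unipotent matrix is conjugated into `K` by `k` form an open subgroup, which
  -- contains some `m Ẑ`.
  let W : AddSubgroup FinAdele :=
    { carrier := {z | k⁻¹ * unip z * k ∈ K}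
      add_mem' := fun {a b} ha hb => by
        have : k⁻¹ * unip (a + b) * k = (k⁻¹ * unip a * k) * (k⁻¹ * unip b * k) := by
          rw [unip_add]; group
        rw [Set.mem_ofPred_eq, this]; exact mul_mem ha hb
      zero_mem' := by
        have : k⁻¹ * unip (0 : FinAdele) * k = 1 := by
          rw [unip, AddChar.map_zero_eq_one, mul_one, inv_mul_cancel]
        rw [Set.mem_ofPred_eq, this]; exact K.one_mem
      neg_mem' := fun {a} ha => by
        have : k⁻¹ * unip (-a) * k = (k⁻¹ * unip a * k)⁻¹ := by
          rw [← unip_inv]; group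
        rw [Set.mem_ofPred_eq, this]; exact inv_mem ha }
  have hW : IsOpen (W : Set FinAdele) :=
    hK.preimage ((continuous_const.mul continuous_unip).mul continuous_const)
  obtain ⟨m, hm, hmW⟩ := exists_mul_Zhat_subset W hW
  refine ⟨m, hm, fun z hz x => ?_⟩
  rw [← h _ (hmW z hz) x k]
  congr 2; group

/-- Measurability on the quotient is tested after pulling back to `𝔸`. This is what allows
invariance of `dx` under translations to be used in integrals. -/
instance : MeasurableAdd AdeleModRat where
  measurable_const_add c := by
    obtain ⟨t, rfl⟩ := QuotientAddGroup.mk_surjective c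
    refine QuotientAddGroup.measurable_from_quotient.2 ?_
    exact QuotientAddGroup.measurable_coe.comp (measurable_const_add t)
  measurable_add_const c := by
    obtain ⟨t, rfl⟩ := QuotientAddGroup.mk_surjective c
    refine QuotientAddGroup.measurable_from_quotient.2 ?_
    exact QuotientAddGroup.measurable_coe.comp (measurable_add_const t)

theorem out_sub_mem (t : Adele) : ∃ q : ℚ,
    Quotient.out (t : AdeleModRat) = t + algebraMap ℚ Adele q := by
  have h : ((Quotient.out (t : AdeleModRat) : Adele) : AdeleModRat) = t := Quotient.out_eq _
  have h' := (QuotientAddGroup.eq).1 h.symm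
  obtain ⟨q, hq⟩ := h'
  refine ⟨q, ?_⟩
  have hq' : algebraMap ℚ Adele q = -t + Quotient.out (t : AdeleModRat) := hq
  rw [hq']; abel

theorem ratGL_unip (q : ℚ) : unip (algebraMap ℚ Adele q) = ratGL (unip q) := by
  apply Units.ext
  refine Matrix.ext fun i j => ?_
  rw [Matrix.GeneralLinearGroup.map_apply, unip_val, unip_val]
  fin_cases i <;> fin_cases j <;> simp <;> rfl

theorem IsCuspForm.unip_add_rat (hφ : IsCuspForm dx χ φ) (g : GL2 Adele) (t : Adele) (q : ℚ) :
    φ (unip (t + algebraMap ℚ Adele q) * g) = φ (unip t * g) := by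
  rw [add_comm, unip_add, ratGL_unip, mul_assoc]
  exact hφ.left_invariant _ _

/-- A `ℚ`-invariant measurable function on the adeles descends. -/
theorem measurable_comp_out {β : Type*} [MeasurableSpace β] {f : Adele → β} (hf : Measurable f)
    (hinv : ∀ t q, f (t + algebraMap ℚ Adele q) = f t) :
    Measurable fun x : AdeleModRat => f (Quotient.out x) := by
  refine QuotientAddGroup.measurable_from_quotient.2 ?_
  convert hf using 1
  funext t
  obtain ⟨q, hq⟩ := out_sub_mem t
  simp only [Function.comp_apply]
  rw [hq, hinv]

open intervalIntegral in
/-- Averaging a function on `ℚ \ 𝔸` over real translations. -/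
theorem integral_average_real (dx : Measure AdeleModRat) [dx.IsAddHaarMeasure] [IsProbabilityMeasure dx] {H : Adele → ℂ}
    (hH : Continuous H) (hHq : ∀ t q, H (t + algebraMap ℚ Adele q) = H t) {B : ℝ}
    (hB : ∀ t, ‖H t‖ ≤ B) {m : ℝ} (hm : 0 < m) :
    ∫ x : AdeleModRat, (∫ s in (0 : ℝ)..m, H (Quotient.out x + (s, 0))) ∂dx =
      m * ∫ x : AdeleModRat, H (Quotient.out x) ∂dx := by
  have hmeas : ∀ s : ℝ, Measurable fun x : AdeleModRat => H (Quotient.out x + (s, 0)) := by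
    intro s
    refine measurable_comp_out (f := fun t => H (t + (s, 0)))
      (hH.measurable.comp (measurable_add_const _)) fun t q => ?_
    rw [← hHq (t + (s, 0)) q, add_right_comm]
  -- Continuity in `s` and measurability in `x` give joint measurability.
  have hjoint : Measurable (Function.uncurry fun (s : ℝ) (x : AdeleModRat) =>
      H (Quotient.out x + (s, 0))) :=
    measurable_uncurry_of_continuous_of_measurable (fun x => hH.comp (by fun_prop)) hmeas
  have hswap : ∫ x : AdeleModRat, (∫ s in (0 : ℝ)..m, H (Quotient.out x + (s, 0))) ∂dx =
      ∫ s in (0 : ℝ)..m, ∫ x : AdeleModRat, H (Quotient.out x + (s, 0)) ∂dx := by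
    simp_rw [integral_of_le hm.le]
    refine integral_integral_swap ?_
    exact Integrable.of_bound (hjoint.comp measurable_swap).aestronglyMeasurable B
      (Filter.Eventually.of_forall fun p => hB _)
  have htrans : ∀ s : ℝ, ∫ x : AdeleModRat, H (Quotient.out x + (s, 0)) ∂dx =
      ∫ x : AdeleModRat, H (Quotient.out x) ∂dx := by
    intro s
    rw [← integral_add_right_eq_self (fun y : AdeleModRat => H (Quotient.out y))
      (((s, 0) : Adele) : AdeleModRat)]
    refine integral_congr_ae (Filter.Eventually.of_forall fun x => ?_)
    obtain ⟨q, hq⟩ := out_sub_mem (Quotient.out x + (s, 0))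
    have h : (x + (((s, 0) : Adele) : AdeleModRat)) = ((Quotient.out x + (s, 0) : Adele)) := by
      rw [QuotientAddGroup.mk_add]
      congr 1
      exact (Quotient.out_eq x).symm
    have h' := hHq (Quotient.out x + (s, 0)) q
    rw [← hq, ← h] at h'
    exact h'.symm
  rw [hswap]
  simp_rw [htrans]
  rw [intervalIntegral.integral_const, sub_zero, Complex.real_smul]

/-- Since `𝔸 = ℚ + (ℝ × m Ẑ)`, averaging `t ↦ φ(n(t) g)` over a real period gives the same value at
every `t`, namely the integral of `F` over a period. The average over `ℚ\𝔸` vanishes by cuspidality,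
so that value is zero. -/
theorem IsCuspForm.period_and_mean (hφ : IsCuspForm dx χ φ) [dx.IsAddHaarMeasure]
    [IsProbabilityMeasure dx] (k : GL2 FinAdele) : ∃ m : ℕ, m ≠ 0 ∧ ∀ x : GL2 ℝ,
      Function.Periodic (fun s : ℝ => φ (glProd (unip s * x) k)) m ∧
      ∫ s in (0 : ℝ)..m, φ (glProd (unip s * x) k) = 0 := by
  obtain ⟨m, hm, hz⟩ := hφ.exists_period k
  refine ⟨m, hm, fun x => ?_⟩
  set F : ℝ → ℂ := fun s => φ (glProd (unip s * x) k) with hF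
  set H : Adele → ℂ := fun t => φ (unip t * glProd x k) with hH
  have hHF : ∀ r, ∀ z ∈ Zhat, H (r, algebraMap ℚ FinAdele (m : ℚ) * z) = F r := fun r z hz' => by
    rw [hH, hF]
    simp only
    rw [unip_adele, glProd_mul, hz z hz']
  have hHq : ∀ t q, H (t + algebraMap ℚ Adele q) = H t := fun t q => hφ.unip_add_rat _ t q
  have hm0 : (0 : ℝ) < m := by exact_mod_cast Nat.pos_of_ne_zero hm
  -- The rational number `m` moves `(s, -m)` to `(s + m, 0)`, and both finite components lie in `m
  -- Ẑ`.
  have hper : Function.Periodic F m := fun s => by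
    have e1 := hHF (s + m) 0 Zhat.zero_mem
    have e2 := hHF s (-1) (neg_mem Zhat.one_mem)
    rw [← e1, ← e2, ← hHq (s, algebraMap ℚ FinAdele (m : ℚ) * -1) m]
    congr 1
    refine Prod.ext ?_ ?_
    · simp
    · simp
  refine ⟨hper, ?_⟩
  have hHcont : Continuous H := hφ.continuous.comp (continuous_unip.mul continuous_const)
  have hFcont : Continuous F := by
    have : F = fun s => H (s, 0) := by
      funext s; rw [← hHF s 0 Zhat.zero_mem, mul_zero]
    rw [this]; exact hHcont.comp (by fun_prop)
  have hinner : ∀ t : Adele, ∫ s in (0 : ℝ)..m, H (t + (s, 0)) = ∫ s in (0 : ℝ)..m, F s := by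
    intro t
    obtain ⟨q, z, hz', hq⟩ := exists_rat_add_mul_Zhat m hm t.2
    have ht : ∀ s : ℝ, H (t + (s, 0)) = F (s + (t.1 - q)) := fun s => by
      rw [← hHF _ z hz', ← hHq (s + (t.1 - q), _) q]
      congr 1
      refine Prod.ext ?_ ?_
      · simp only [Prod.fst_add, Prod.algebraMap_apply, eq_ratCast]; ring
      · simp only [Prod.snd_add, Prod.algebraMap_apply, hq]; ring
    simp_rw [ht]
    rw [intervalIntegral.integral_comp_add_right, zero_add, add_comm, hper.intervalIntegral_add_eq _ 0, zero_add]
  obtain ⟨B, hB⟩ : ∃ B, ∀ t, ‖H t‖ ≤ B := by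
    obtain ⟨B, hB⟩ := (isCompact_Icc (a := (0 : ℝ)) (b := m)).exists_bound_of_continuousOn
      hFcont.continuousOn
    refine ⟨B, fun t => ?_⟩
    obtain ⟨q, z, hz', hq⟩ := exists_rat_add_mul_Zhat m hm t.2
    have ht : H t = F (t.1 - q) := by
      rw [← hHF _ z hz', ← hHq (t.1 - q, _) q]
      congr 1
      refine Prod.ext ?_ ?_
      · simp only [Prod.fst_add, Prod.algebraMap_apply, eq_ratCast]; ring
      · simp only [Prod.snd_add, Prod.algebraMap_apply, hq]; ring
    obtain ⟨y, hy, hy'⟩ := hper.exists_mem_Ico₀ hm0 (t.1 - q)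
    rw [ht, hy']
    exact hB y (Set.Ico_subset_Icc_self hy)
  have h1 := integral_average_real dx hHcont hHq hB hm0
  simp_rw [hinner] at h1
  rw [show ∫ y : AdeleModRat, H (Quotient.out y) ∂dx = 0 from hφ.cuspidal _, mul_zero] at h1
  simpa using h1

end ConstantTerm

/-! ### Rapid decay -/

section RapidDecay

/-- The direction of the unipotent group, moved to the right of `x`. -/
noncomputable def unipDir (x : GL2 ℝ) : Matrix (Fin 2) (Fin 2) ℝ :=
  x⁻¹.val * !![0, 1; 0, 0] * x.val

/-- `unipDir x` as a function of two indices. -/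
noncomputable def unipDirFun (x : GL2 ℝ) : Fin 2 → Fin 2 → ℝ := fun i j => unipDir x i j

/-- Left translation by the unipotent group becomes a right perturbation along a line through the
identity, which is the form in which uniform moderate growth is stated. -/
theorem unip_mul_val (s : ℝ) (x : GL2 ℝ) : (unip s * x).val = x.val * (1 + s • unipDir x) := by
  have h : (unip s).val = 1 + s • !![(0 : ℝ), 1; 0, 0] := by
    rw [unip_val]; ext i j; fin_cases i <;> fin_cases j <;> simp
  have h2 : x.val * x⁻¹.val = 1 := Units.mul_inv x
  rw [Units.val_mul, h, unipDir, mul_add, add_mul, mul_smul_comm, smul_mul_assoc, mul_one, one_mul,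
    ← mul_assoc, ← mul_assoc, h2, one_mul]

/-- `(c² + d²) / |det x|` for the bottom row `(c, d)` of `x`. -/
noncomputable def invIm (x : GL2 ℝ) : ℝ := (x.val 1 0 ^ 2 + x.val 1 1 ^ 2) / |x.val.det|

theorem invIm_nonneg (x : GL2 ℝ) : 0 ≤ invIm x := by unfold invIm; positivity

theorem inv_val_fin_two (x : GL2 ℝ) :
    x⁻¹.val = (x.val.det)⁻¹ • !![x.val 1 1, -x.val 0 1; -x.val 1 0, x.val 0 0] := by
  rw [Matrix.GeneralLinearGroup.coe_inv, Matrix.inv_def, Matrix.adjugate_fin_two,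
    Ring.inverse_eq_inv']

/-- The entries of `x⁻¹ E₁₂ x` are, up to sign, `c²`, `d²` and `cd` divided by `det x`. This is the
source of the decay: the direction shrinks as `x` approaches the cusp. -/
theorem norm_unipDir_le (x : GL2 ℝ) : ‖unipDirFun x‖ ≤ invIm x := by
  have h : unipDir x = (x.val.det)⁻¹ • !![x.val 1 1 * x.val 1 0, x.val 1 1 ^ 2;
      -x.val 1 0 ^ 2, -(x.val 1 0 * x.val 1 1)] := by
    rw [unipDir, inv_val_fin_two]
    ext i j
    fin_cases i <;> fin_cases j <;> simp [Matrix.mul_apply, Fin.sum_univ_two] <;> ring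
  have key : ∀ i j, ‖unipDir x i j‖ ≤ invIm x := by
    intro i j
    have hd : 0 < |x.val.det| := abs_pos.2 (Matrix.GeneralLinearGroup.det_ne_zero x)
    rw [h, Matrix.smul_apply, smul_eq_mul, Real.norm_eq_abs, abs_mul, abs_inv, invIm,
      div_eq_inv_mul]
    refine mul_le_mul_of_nonneg_left ?_ (by positivity)
    rw [abs_le]
    fin_cases i <;> fin_cases j <;> simp <;> constructor <;>
      nlinarith [sq_nonneg (x.val 1 0 + x.val 1 1), sq_nonneg (x.val 1 0 - x.val 1 1),
        sq_nonneg (x.val 1 0), sq_nonneg (x.val 1 1)]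
  rw [pi_norm_le_iff_of_nonneg (invIm_nonneg x)]
  intro i
  rw [pi_norm_le_iff_of_nonneg (invIm_nonneg x)]
  exact key i

theorem realHeight_nonneg (x : GL2 ℝ) : 0 ≤ realHeight x := by unfold realHeight; positivity

theorem realHeight_unip_mul_le (s : ℝ) (x : GL2 ℝ) :
    realHeight (unip s * x) ≤ (1 + |s|) * realHeight x := by
  have h1 : ∀ i j, |(unip s * x).val i j| ≤ |x.val i j| + (if i = 0 then |s| * |x.val 1 j| else 0) := by
    intro i j
    rw [Units.val_mul, unip_val, Matrix.mul_apply, Fin.sum_univ_two]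
    fin_cases i
    · simp only [Fin.zero_eta, Matrix.of_apply, Matrix.cons_val', Matrix.cons_val_zero,
        Matrix.cons_val_one, Matrix.cons_val_fin_one, one_mul, if_true]
      exact (abs_add_le _ _).trans (by rw [abs_mul])
    · simp
  have h2 : ∀ i j, |(unip s * x)⁻¹.val i j| ≤
      |x⁻¹.val i j| + (if j = 1 then |s| * |x⁻¹.val i 0| else 0) := by
    intro i j
    rw [_root_.mul_inv_rev, Units.val_mul, unip_inv_val, Matrix.mul_apply, Fin.sum_univ_two]
    fin_cases j
    · simp
    · simp only [Fin.mk_one, Matrix.of_apply, Matrix.cons_val', Matrix.cons_val_zero,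
        Matrix.cons_val_one, Matrix.cons_val_fin_one, mul_one, if_true]
      refine (abs_add_le _ _).trans ?_
      rw [abs_mul, abs_neg]; linarith
  have h3 := fun i j => add_le_add (h1 i j) (h2 i j)
  unfold realHeight
  refine (Finset.sum_le_sum fun i _ => Finset.sum_le_sum fun j _ => h3 i j).trans ?_
  simp only [Fin.sum_univ_two, Fin.isValue, if_true, one_ne_zero, if_false, zero_ne_one]
  have := abs_nonneg s
  nlinarith [abs_nonneg (x.val 0 0), abs_nonneg (x.val 0 1), abs_nonneg (x.val 1 0),
    abs_nonneg (x.val 1 1), abs_nonneg (x⁻¹.val 0 0), abs_nonneg (x⁻¹.val 0 1),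
    abs_nonneg (x⁻¹.val 1 0), abs_nonneg (x⁻¹.val 1 1)]

variable {dx : Measure AdeleModRat} {χ : Adeleˣ →* ℂˣ} {φ : GL2 Adele → ℂ}

/-- Left translates of the real slice, as functions near the identity matrix. -/
noncomputable def sliceAt (φ : GL2 Adele → ℂ) (k : GL2 FinAdele) (x : GL2 ℝ)
    (Y : Fin 2 → Fin 2 → ℝ) : ℂ :=
  realSlice φ k (x.val * ((1 : Matrix (Fin 2) (Fin 2) ℝ) + Matrix.of Y))

theorem isOpen_sliceDomain :
    IsOpen {Y : Fin 2 → Fin 2 → ℝ | ((1 : Matrix (Fin 2) (Fin 2) ℝ) + Matrix.of Y).det ≠ 0} := by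
  have : Continuous fun y : Fin 2 → Fin 2 → ℝ => ((1 : Matrix (Fin 2) (Fin 2) ℝ) + Matrix.of y).det :=
    Continuous.matrix_det (continuous_matrix fun i j =>
      continuous_const.add ((continuous_apply j).comp (continuous_apply i)))
  exact isOpen_ne.preimage this

theorem IsCuspForm.contDiffOn_sliceAt (hφ : IsCuspForm dx χ φ) (k : GL2 FinAdele) (x : GL2 ℝ) :
    ContDiffOn ℝ ∞ (sliceAt φ k x)
      {Y | ((1 : Matrix (Fin 2) (Fin 2) ℝ) + Matrix.of Y).det ≠ 0} := by
  have hg : ContDiff ℝ ∞ (fun (Y : Fin 2 → Fin 2 → ℝ) (i j : Fin 2) =>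
      (x.val * ((1 : Matrix (Fin 2) (Fin 2) ℝ) + Matrix.of Y)) i j) := by
    refine contDiff_pi.2 fun i => contDiff_pi.2 fun j => ?_
    simp only [Matrix.mul_apply, Matrix.add_apply, Matrix.of_apply]
    fun_prop
  refine (hφ.real_smooth k).comp hg.contDiffOn fun Y hY => ?_
  have : (x.val * ((1 : Matrix (Fin 2) (Fin 2) ℝ) + Matrix.of Y)).det ≠ 0 := by
    rw [Matrix.det_mul]
    exact mul_ne_zero (Matrix.GeneralLinearGroup.det_ne_zero x) hY
  exact this

theorem unip_eq_sliceAt (φ : GL2 Adele → ℂ) (x : GL2 ℝ) (k : GL2 FinAdele) (s : ℝ) :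
    φ (glProd (unip s * x) k) = sliceAt φ k x (s • unipDirFun x) := by
  rw [← realSlice_apply φ, unip_mul_val]; rfl

theorem det_one_add_smul_unipDir (x : GL2 ℝ) (s : ℝ) :
    ((1 : Matrix (Fin 2) (Fin 2) ℝ) + s • unipDir x).det ≠ 0 := by
  have h := congrArg Matrix.det (unip_mul_val s x)
  intro h0
  rw [Matrix.det_mul x.val, h0, mul_zero] at h
  exact Matrix.GeneralLinearGroup.det_ne_zero _ h

theorem IsCuspForm.contDiff_unip (hφ : IsCuspForm dx χ φ) (k : GL2 FinAdele) (x : GL2 ℝ) :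
    ContDiff ℝ ∞ fun s : ℝ => φ (glProd (unip s * x) k) := by
  simp_rw [unip_eq_sliceAt]
  rw [← contDiffOn_univ]
  refine (hφ.contDiffOn_sliceAt k x).comp (f := fun s : ℝ => s • unipDirFun x)
    (by fun_prop) fun s _ => ?_
  exact det_one_add_smul_unipDir x s

/-- Chain rule for a linear curve: the `M`-th derivative is the multilinear derivative evaluated on
`M` copies of the direction, each of norm at most `invIm x`. -/
theorem IsCuspForm.norm_iteratedDeriv_zero_le (hφ : IsCuspForm dx χ φ) (k : GL2 FinAdele)
    (x : GL2 ℝ) (M : ℕ) : ‖iteratedDeriv M (fun s : ℝ => φ (glProd (unip s * x) k)) 0‖ ≤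
      ‖iteratedFDeriv ℝ M (sliceAt φ k x) 0‖ * invIm x ^ M := by
  let L : ℝ →L[ℝ] (Fin 2 → Fin 2 → ℝ) :=
    ContinuousLinearMap.toSpanSingleton ℝ (unipDirFun x)
  have hL : (fun s : ℝ => φ (glProd (unip s * x) k)) = sliceAt φ k x ∘ L := by
    funext s
    rw [unip_eq_sliceAt φ]; rfl
  set D : Set (Fin 2 → Fin 2 → ℝ) := {Y | ((1 : Matrix (Fin 2) (Fin 2) ℝ) + Matrix.of Y).det ≠ 0}
  have hD : IsOpen D := isOpen_sliceDomain
  have h0 : L 0 ∈ D := by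
    simp [D]
  have hpre : IsOpen (L ⁻¹' D) := hD.preimage L.continuous
  have key := ContinuousLinearMap.iteratedFDerivWithin_comp_right L
    (hφ.contDiffOn_sliceAt k x) hD.uniqueDiffOn hpre.uniqueDiffOn h0 (i := M)
    (by exact_mod_cast le_top)
  rw [iteratedFDerivWithin_of_isOpen M hpre h0, iteratedFDerivWithin_of_isOpen M hD h0] at key
  rw [hL, iteratedDeriv_eq_iteratedFDeriv, key,
    ContinuousMultilinearMap.compContinuousLinearMap_apply, map_zero]
  refine (ContinuousMultilinearMap.le_opNorm _ _).trans ?_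
  refine mul_le_mul_of_nonneg_left ?_ (norm_nonneg _)
  have h1 : L 1 = unipDirFun x := one_smul ℝ _
  rw [Finset.prod_const, h1, Finset.card_fin]
  exact pow_le_pow_left₀ (norm_nonneg _) (norm_unipDir_le x) M

/-- Moving the base point along the unipotent group reduces derivatives at `s` to derivatives at
`0`. -/
theorem iteratedDeriv_unip (φ : GL2 Adele → ℂ) (x : GL2 ℝ) (k : GL2 FinAdele) (M : ℕ) (s : ℝ) :
    iteratedDeriv M (fun s : ℝ => φ (glProd (unip s * x) k)) s =
      iteratedDeriv M (fun t : ℝ => φ (glProd (unip t * (unip s * x)) k)) 0 := by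
  have h : (fun t : ℝ => φ (glProd (unip t * (unip s * x)) k)) =
      fun t => (fun s : ℝ => φ (glProd (unip s * x) k)) (t + s) := by
    funext t
    simp only
    rw [unip_add, mul_assoc]
  rw [h, iteratedDeriv_comp_add_const M (fun s : ℝ => φ (glProd (unip s * x) k)) s]
  simp only [zero_add]

/-- Cusp forms decrease rapidly at the cusp. -/
theorem IsCuspForm.rapid_decay (hφ : IsCuspForm dx χ φ) [dx.IsAddHaarMeasure]
    [IsProbabilityMeasure dx] (k : GL2 FinAdele) : ∃ N : ℕ, ∀ M : ℕ, ∃ C : ℝ, 0 ≤ C ∧ ∀ x : GL2 ℝ,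
      ‖φ (glProd x k)‖ ≤ C * realHeight x ^ N * invIm x ^ M := by
  obtain ⟨N, hN⟩ := hφ.growth k
  obtain ⟨m, hm, hper⟩ := hφ.period_and_mean k
  have hm0 : (0 : ℝ) < m := by exact_mod_cast Nat.pos_of_ne_zero hm
  refine ⟨N, fun M => ?_⟩
  obtain ⟨C, hC⟩ := hN M
  -- The factor `m ^ M` comes from the `M`-fold use of mean zero. The factor `(1 + m) ^ N` bounds
  -- the growth of the height while the base point runs through one period.
  refine ⟨m ^ M * (|C| * (1 + m) ^ N), by positivity, fun x => ?_⟩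
  have hb : ∀ s, ‖iteratedDeriv M (fun s : ℝ => φ (glProd (unip s * x) k)) s‖ ≤
      |C| * ((1 + m) * realHeight x) ^ N * invIm x ^ M := by
    intro s
    have hper' : Function.Periodic
        (iteratedDeriv M (fun s : ℝ => φ (glProd (unip s * x) k))) m := fun t => by
      have := congrFun (iteratedDeriv_comp_add_const M
        (fun s : ℝ => φ (glProd (unip s * x) k)) (m : ℝ)) t
      rw [← this]
      congr 1
      funext u
      exact (hper x).1 u
    obtain ⟨t, ht, hst⟩ := hper'.exists_mem_Ico₀ hm0 s
    rw [hst, iteratedDeriv_unip]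
    refine (hφ.norm_iteratedDeriv_zero_le k (unip t * x) M).trans ?_
    have e : invIm (unip t * x) = invIm x := by
      unfold invIm
      have h1 : ∀ j, (unip t * x).val 1 j = x.val 1 j := fun j => by
        rw [Units.val_mul, unip_val, Matrix.mul_apply, Fin.sum_univ_two]; simp
      rw [h1, h1, Units.val_mul, Matrix.det_mul, unip_val]; simp
    rw [e]
    refine mul_le_mul_of_nonneg_right ?_ (pow_nonneg (invIm_nonneg x) M)
    refine (hC (unip t * x)).trans ?_
    have hH := realHeight_unip_mul_le t x
    have h2 : realHeight (unip t * x) ≤ (1 + m) * realHeight x := by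
      refine hH.trans (mul_le_mul_of_nonneg_right ?_ (realHeight_nonneg x))
      rw [abs_of_nonneg ht.1]; linarith [ht.2]
    refine mul_le_mul (le_abs_self C) (pow_le_pow_left₀ (realHeight_nonneg _) h2 N)
      (pow_nonneg (realHeight_nonneg _) _) (abs_nonneg C)
  have := norm_le_pow_mul_of_iteratedDeriv_bound hm0 M (hφ.contDiff_unip k x) (hper x).1 (hper x).2
    hb 0
  have h0 : unip (0 : ℝ) * x = x := by rw [unip, AddChar.map_zero_eq_one, one_mul]
  rw [h0] at this
  refine this.trans (le_of_eq ?_)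
  rw [mul_pow]; ring

end RapidDecay

/-! ### Topology of the groups -/

section Topology

instance {R : Type*} [TopologicalSpace R] [SecondCountableTopology R] :
    SecondCountableTopology (Matrix (Fin 2) (Fin 2) R) :=
  inferInstanceAs (SecondCountableTopology (Fin 2 → Fin 2 → R))

instance {R : Type*} [TopologicalSpace R] [LocallyCompactSpace R] :
    LocallyCompactSpace (Matrix (Fin 2) (Fin 2) R) :=
  inferInstanceAs (LocallyCompactSpace (Fin 2 → Fin 2 → R))

instance {M : Type*} [Monoid M] [TopologicalSpace M] [SecondCountableTopology M] :
    SecondCountableTopology Mˣ := by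
  have : SecondCountableTopology Mᵐᵒᵖ := MulOpposite.opHomeomorph.symm.secondCountableTopology
  exact Units.isEmbedding_embedProduct.secondCountableTopology

theorem isClosed_PairsEqDet : IsClosed (PairsEqDet Adele : Set (GL2 Adele × GL2 Adele)) := by
  have hdet : Continuous fun g : GL2 Adele => (g.val.det : Adele) :=
    Units.continuous_val.matrix_det
  have : (PairsEqDet Adele : Set (GL2 Adele × GL2 Adele)) =
      {p | p.1.val.det = p.2.val.det} := by
    ext p
    constructor
    · intro h; exact congrArg Units.val h
    · intro h; exact Units.ext h
  rw [this]
  exact isClosed_eq (hdet.comp continuous_fst) (hdet.comp continuous_snd)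

instance : LocallyCompactSpace (GL2 Adele) :=
  inferInstanceAs (LocallyCompactSpace (Matrix (Fin 2) (Fin 2) Adele)ˣ)

instance : SecondCountableTopology (GL2 Adele) :=
  inferInstanceAs (SecondCountableTopology (Matrix (Fin 2) (Fin 2) Adele)ˣ)

instance : LocallyCompactSpace (PairsEqDet Adele) :=
  isClosed_PairsEqDet.isClosedEmbedding_subtypeVal.locallyCompactSpace

instance : SecondCountableTopology (PairsEqDet Adele) :=
  inferInstanceAs (SecondCountableTopology (PairsEqDet Adele : Set (GL2 Adele × GL2 Adele)))

instance : LocallyCompactSpace H1 :=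
  inferInstanceAs (LocallyCompactSpace (PairsEqDet Adele ⧸ scalarPairs Adele))

instance : SecondCountableTopology H1 :=
  inferInstanceAs (SecondCountableTopology (PairsEqDet Adele ⧸ scalarPairs Adele))

theorem continuous_H1mk : Continuous H1.mk := continuous_quotient_mk'

theorem H1mk_surjective : Function.Surjective H1.mk := QuotientGroup.mk'_surjective _

theorem isOpenQuotientMap_H1mk : IsOpenQuotientMap H1.mk :=
  MulAction.isOpenQuotientMap_quotientMk

/-- The topology of `GL₂` is that of a closed subset of `M₂ × M₂ᵒᵖ` under `g ↦ (g, g⁻¹)`, so both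
`g` and its inverse have to be confined. -/
theorem isCompact_entries {R : Type*} [CommRing R] [TopologicalSpace R] [IsTopologicalRing R]
    [T2Space R] {C : Set R} (hC : IsCompact C) :
    IsCompact {g : GL2 R | (∀ i j, g.val i j ∈ C) ∧ ∀ i j, g⁻¹.val i j ∈ C} := by
  have hM : IsCompact {A : Matrix (Fin 2) (Fin 2) R | ∀ i j, A i j ∈ C} := by
    have := isCompact_univ_pi fun _ : Fin 2 => isCompact_univ_pi fun _ : Fin 2 => hC
    have e : (Set.univ.pi fun _ : Fin 2 => Set.univ.pi fun _ : Fin 2 => C) =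
        {A : Fin 2 → Fin 2 → R | ∀ i j, A i j ∈ C} := by
      ext A; simp [Set.mem_pi]
    rw [e] at this
    exact this
  have hM' : IsCompact (MulOpposite.unop ⁻¹' {A : Matrix (Fin 2) (Fin 2) R | ∀ i j, A i j ∈ C}) :=
    (MulOpposite.opHomeomorph.symm.isCompact_preimage).2 hM
  have := (Units.isClosedEmbedding_embedProduct (α := Matrix (Fin 2) (Fin 2) R)).isCompact_preimage
    (hM.prod hM')
  exact this

theorem continuous_glProd : Continuous fun p : GL2 ℝ × GL2 FinAdele => glProd p.1 p.2 := by
  rw [Units.continuous_iff]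
  constructor
  · refine continuous_matrix fun i j => ?_
    exact ((Units.continuous_val.comp continuous_fst).matrix_elem i j).prodMk
      ((Units.continuous_val.comp continuous_snd).matrix_elem i j)
  · refine continuous_matrix fun i j => ?_
    exact ((Units.continuous_val.comp (continuous_inv.comp continuous_fst)).matrix_elem i j).prodMk
      ((Units.continuous_val.comp (continuous_inv.comp continuous_snd)).matrix_elem i j)

end Topology

/-! ### Bounded denominators -/

section Denominators

/-- The elements of `GL₂(𝔸_f)` such that `m` is a common denominator of the entries of the matrix and
of its inverse. -/
def denomSet (m : ℕ) : Set (GL2 FinAdele) :=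
  {g | (∀ i j, algebraMap ℚ FinAdele (m : ℚ) * g.val i j ∈ Zhat) ∧
    ∀ i j, algebraMap ℚ FinAdele (m : ℚ) * g⁻¹.val i j ∈ Zhat}

theorem isCompact_denomSet {m : ℕ} (hm : m ≠ 0) : IsCompact (denomSet m) :=
  isCompact_entries (isCompact_denominator (q := (m : ℚ)) (by exact_mod_cast hm))

theorem GLZhat_subset_denomSet (m : ℕ) {k : GL2 FinAdele} (hk : k ∈ GLZhat) : k ∈ denomSet m :=
  ⟨fun i j => mul_mem (natCast_mem_Zhat m) (hk.1 i j),
    fun i j => mul_mem (natCast_mem_Zhat m) (hk.2 i j)⟩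

theorem mul_mem_denomSet {m m' : ℕ} {k k' : GL2 FinAdele} (h : k ∈ denomSet m)
    (h' : k' ∈ denomSet m') : k * k' ∈ denomSet (m * m') := by
  refine ⟨fun i j => ?_, fun i j => ?_⟩
  · rw [Units.val_mul, Matrix.mul_apply, Finset.mul_sum]
    refine sum_mem fun l _ => ?_
    have := mul_mem (h.1 i l) (h'.1 l j)
    rw [Nat.cast_mul, map_mul]
    convert this using 1
    ring
  · rw [_root_.mul_inv_rev, Units.val_mul, Matrix.mul_apply, Finset.mul_sum]
    refine sum_mem fun l _ => ?_
    have := mul_mem (h.2 l j) (h'.2 i l)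
    rw [Nat.cast_mul, map_mul]
    convert this using 1
    ring

theorem inv_mem_denomSet {m : ℕ} {k : GL2 FinAdele} (h : k ∈ denomSet m) : k⁻¹ ∈ denomSet m :=
  ⟨h.2, by rw [inv_inv]; exact h.1⟩

theorem exists_common_denominator {ι : Type*} (s : Finset ι) (a : ι → FinAdele) :
    ∃ n : ℕ, n ≠ 0 ∧ ∀ i ∈ s, algebraMap ℚ FinAdele (n : ℚ) * a i ∈ Zhat := by
  classical
  choose n hn0 hn using fun i => exists_denominator (a i)
  refine ⟨∏ i ∈ s, n i, Finset.prod_ne_zero_iff.2 fun i _ => hn0 i, fun i hi => ?_⟩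
  rw [← Finset.prod_erase_mul _ _ hi, Nat.cast_mul, map_mul, mul_assoc]
  exact mul_mem (natCast_mem_Zhat _) (hn i)

theorem exists_mem_denomSet (k : GL2 FinAdele) : ∃ m : ℕ, m ≠ 0 ∧ k ∈ denomSet m := by
  obtain ⟨n, hn, h⟩ := exists_common_denominator Finset.univ
    fun p : Fin 2 × Fin 2 => k.val p.1 p.2
  obtain ⟨n', hn', h'⟩ := exists_common_denominator Finset.univ
    fun p : Fin 2 × Fin 2 => k⁻¹.val p.1 p.2
  refine ⟨n * n', mul_ne_zero hn hn', fun i j => ?_, fun i j => ?_⟩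
  · rw [mul_comm n, Nat.cast_mul, map_mul, mul_assoc]
    exact mul_mem (natCast_mem_Zhat _) (h (i, j) (Finset.mem_univ _))
  · rw [Nat.cast_mul, map_mul, mul_assoc]
    exact mul_mem (natCast_mem_Zhat _) (h' (i, j) (Finset.mem_univ _))

end Denominators

/-! ### Heights -/

section Heights

theorem abs_le_realHeight (x : GL2 ℝ) (i j : Fin 2) : |x.val i j| ≤ realHeight x := by
  unfold realHeight
  have h1 : |x.val i j| + |x⁻¹.val i j| ≤ ∑ j, (|x.val i j| + |x⁻¹.val i j|) :=
    Finset.single_le_sum (f := fun j => |x.val i j| + |x⁻¹.val i j|) (fun j _ => by positivity)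
      (Finset.mem_univ j)
  have h2 := Finset.single_le_sum (f := fun i => ∑ j, (|x.val i j| + |x⁻¹.val i j|))
    (fun i _ => by positivity) (Finset.mem_univ i)
  exact (le_add_of_nonneg_right (abs_nonneg _)).trans (h1.trans h2)

theorem realHeight_inv (x : GL2 ℝ) : realHeight x⁻¹ = realHeight x := by
  unfold realHeight
  refine Finset.sum_congr rfl fun i _ => Finset.sum_congr rfl fun j _ => ?_
  rw [inv_inv, add_comm]

theorem abs_inv_le_realHeight (x : GL2 ℝ) (i j : Fin 2) : |x⁻¹.val i j| ≤ realHeight x := by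
  rw [← realHeight_inv]; exact abs_le_realHeight _ _ _

theorem realHeight_le_of_entries {x : GL2 ℝ} {B : ℝ} (h : ∀ i j, |x.val i j| ≤ B)
    (h' : ∀ i j, |x⁻¹.val i j| ≤ B) : realHeight x ≤ 8 * B := by
  unfold realHeight
  simp only [Fin.sum_univ_two]
  linarith [h 0 0, h 0 1, h 1 0, h 1 1, h' 0 0, h' 0 1, h' 1 0, h' 1 1]

theorem two_le_realHeight (x : GL2 ℝ) : 2 ≤ realHeight x := by
  have h : (x.val * x⁻¹.val) 0 0 = 1 := by rw [Units.mul_inv]; simp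
  rw [Matrix.mul_apply, Fin.sum_univ_two] at h
  -- If `S` is the sum of the four numbers that occur, then the two products add up to at most `S² /
  -- 4`; hence `S ≥ 2`.
  have h1 : 1 ≤ |x.val 0 0| * |x⁻¹.val 0 0| + |x.val 0 1| * |x⁻¹.val 1 0| := by
    rw [← abs_mul, ← abs_mul, ← h]
    exact (le_abs_self _).trans (abs_add_le _ _)
  have h2 : |x.val 0 0| + |x⁻¹.val 0 0| + |x.val 0 1| + |x⁻¹.val 1 0| ≤ realHeight x := by
    unfold realHeight
    simp only [Fin.sum_univ_two]
    linarith [abs_nonneg (x.val 1 0), abs_nonneg (x.val 1 1), abs_nonneg (x⁻¹.val 0 1),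
      abs_nonneg (x⁻¹.val 1 1)]
  have h4 : 4 ≤ (|x.val 0 0| + |x⁻¹.val 0 0| + |x.val 0 1| + |x⁻¹.val 1 0|) ^ 2 := by
    nlinarith [abs_nonneg (x.val 0 0), abs_nonneg (x⁻¹.val 0 0), abs_nonneg (x.val 0 1),
      abs_nonneg (x⁻¹.val 1 0), sq_nonneg (|x.val 0 0| - |x⁻¹.val 0 0|),
      sq_nonneg (|x.val 0 1| - |x⁻¹.val 1 0|),
      mul_nonneg (abs_nonneg (x.val 0 0)) (abs_nonneg (x.val 0 1)),
      mul_nonneg (abs_nonneg (x.val 0 0)) (abs_nonneg (x⁻¹.val 1 0)),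
      mul_nonneg (abs_nonneg (x⁻¹.val 0 0)) (abs_nonneg (x.val 0 1)),
      mul_nonneg (abs_nonneg (x⁻¹.val 0 0)) (abs_nonneg (x⁻¹.val 1 0))]
  have h5 : 0 ≤ |x.val 0 0| + |x⁻¹.val 0 0| + |x.val 0 1| + |x⁻¹.val 1 0| := by positivity
  nlinarith

/-- The height has eight summands, and each entry of a product of two matrices is a sum of two
products; `16 = 8 · 2`. -/
theorem realHeight_mul_le (x y : GL2 ℝ) :
    realHeight (x * y) ≤ 16 * (realHeight x * realHeight y) := by
  have hx := realHeight_nonneg x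
  have hy := realHeight_nonneg y
  have h := realHeight_le_of_entries (x := x * y) (B := 2 * (realHeight x * realHeight y))
    (fun i j => ?_) fun i j => ?_
  · linarith
  · rw [Units.val_mul, Matrix.mul_apply, Fin.sum_univ_two]
    refine (abs_add_le _ _).trans ?_
    rw [abs_mul, abs_mul]
    have h0 := mul_le_mul (abs_le_realHeight x i 0) (abs_le_realHeight y 0 j) (abs_nonneg _) hx
    have h1 := mul_le_mul (abs_le_realHeight x i 1) (abs_le_realHeight y 1 j) (abs_nonneg _) hx
    linarith
  · rw [_root_.mul_inv_rev, Units.val_mul, Matrix.mul_apply, Fin.sum_univ_two]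
    refine (abs_add_le _ _).trans ?_
    rw [abs_mul, abs_mul]
    have h0 := mul_le_mul (abs_inv_le_realHeight y i 0) (abs_inv_le_realHeight x 0 j)
      (abs_nonneg _) hy
    have h1 := mul_le_mul (abs_inv_le_realHeight y i 1) (abs_inv_le_realHeight x 1 j)
      (abs_nonneg _) hy
    linarith

theorem isCompact_realHeight_le (R : ℝ) : IsCompact {x : GL2 ℝ | realHeight x ≤ R} := by
  refine (isCompact_entries (isCompact_Icc (a := -R) (b := R))).of_isClosed_subset ?_ ?_
  · have : Continuous realHeight := by
      unfold realHeight
      refine continuous_finsetSum _ fun i _ => continuous_finsetSum _ fun j _ => ?_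
      exact ((Units.continuous_val.matrix_elem i j).abs).add
        ((Units.continuous_val.comp continuous_inv).matrix_elem i j).abs
    exact isClosed_le this continuous_const
  · intro x hx
    exact ⟨fun i j => abs_le.1 ((abs_le_realHeight x i j).trans hx),
      fun i j => abs_le.1 ((abs_inv_le_realHeight x i j).trans hx)⟩

end Heights

/-! ### Volume growth in `H₁(𝔸)` -/

section Volume

/-- The pairs whose real components have height at most `R` and whose finite components have
denominator `m`. -/
def pairBox (R : ℝ) (m : ℕ) : Set (PairsEqDet Adele) :=
  {p | (realHeight (realPart p.1.1) ≤ R ∧ realHeight (realPart p.1.2) ≤ R) ∧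
    finPart p.1.1 ∈ denomSet m ∧ finPart p.1.2 ∈ denomSet m}

theorem isCompact_pairBox (R : ℝ) {m : ℕ} (hm : m ≠ 0) : IsCompact (pairBox R m) := by
  have h1 : IsCompact ((fun p : GL2 ℝ × GL2 FinAdele => glProd p.1 p.2) ''
      ({x : GL2 ℝ | realHeight x ≤ R} ×ˢ denomSet m)) :=
    ((isCompact_realHeight_le R).prod (isCompact_denomSet hm)).image continuous_glProd
  have h2 := isClosed_PairsEqDet.isClosedEmbedding_subtypeVal.isCompact_preimage (h1.prod h1)
  refine (congrArg IsCompact (Set.ext fun p => ?_)).mp h2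
  symm
  constructor
  · rintro ⟨⟨a, b⟩, c, d⟩
    exact ⟨⟨(realPart p.1.1, finPart p.1.1), ⟨a, c⟩, glProd_realPart_finPart _⟩,
      ⟨(realPart p.1.2, finPart p.1.2), ⟨b, d⟩, glProd_realPart_finPart _⟩⟩
  · rintro ⟨⟨q, hq, hq'⟩, ⟨r, hr, hr'⟩⟩
    refine ⟨⟨?_, ?_⟩, ?_, ?_⟩
    · rw [← hq', realPart_glProd]; exact hq.1
    · rw [← hr', realPart_glProd]; exact hr.1
    · rw [← hq', finPart_glProd]; exact hq.2
    · rw [← hr', finPart_glProd]; exact hr.2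

/-- The pair with the real components of `p` and trivial finite components. -/
noncomputable def realOnly (p : PairsEqDet Adele) : PairsEqDet Adele :=
  ⟨(glProd (realPart p.1.1) 1, glProd (realPart p.1.2) 1), by
    have h : Matrix.GeneralLinearGroup.det p.1.1 = Matrix.GeneralLinearGroup.det p.1.2 := p.2
    apply Units.ext
    change ((Matrix.GeneralLinearGroup.det (glProd (realPart p.1.1) 1) : Adeleˣ) : Adele) =
      (Matrix.GeneralLinearGroup.det (glProd (realPart p.1.2) 1) : Adeleˣ)
    rw [det_glProd, det_glProd]
    have h1 := congrArg (fun u : Adeleˣ => (u : Adele).1) h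
    have h2 := det_glProd (realPart p.1.1) (finPart p.1.1)
    have h3 := det_glProd (realPart p.1.2) (finPart p.1.2)
    rw [glProd_realPart_finPart] at h2 h3
    rw [h2, h3] at h1
    exact Prod.ext h1 rfl⟩

/-- From `z⁻¹ w = 1 - z⁻¹ (z - w)`, the entries are at most `1 + 2 R δ ≤ 2`. The same holds with the
roles of `x` and `y` exchanged, which treats the inverse. -/
theorem realHeight_inv_mul_le {x y : GL2 ℝ} {R δ : ℝ} (hx : realHeight x ≤ R)
    (hy : realHeight y ≤ R) (hδ : 4 * R * δ ≤ 1) (h : ∀ i j, |x.val i j - y.val i j| ≤ δ) :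
    realHeight (x⁻¹ * y) ≤ 16 := by
  have hR : 0 ≤ R := (realHeight_nonneg x).trans hx
  have hδ0 : 0 ≤ δ := (abs_nonneg _).trans (h 0 0)
  have h1 : ∀ z w : GL2 ℝ, realHeight z ≤ R → (∀ i j, |z.val i j - w.val i j| ≤ δ) →
      ∀ i j, |(z⁻¹ * w).val i j| ≤ 2 := by
    intro z w hz hzw i j
    have e : (z⁻¹ * w).val = 1 - z⁻¹.val * (z.val - w.val) := by
      rw [Units.val_mul, mul_sub, Units.inv_mul]; abel
    rw [e, Matrix.sub_apply, Matrix.mul_apply, Fin.sum_univ_two, Matrix.sub_apply, Matrix.sub_apply]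
    refine (abs_sub _ _).trans ?_
    have h1 : |(1 : Matrix (Fin 2) (Fin 2) ℝ) i j| ≤ 1 := by
      rw [Matrix.one_apply]; split_ifs <;> simp
    have h2 := abs_add_le (z⁻¹.val i 0 * (z.val 0 j - w.val 0 j)) (z⁻¹.val i 1 * (z.val 1 j - w.val 1 j))
    rw [abs_mul, abs_mul] at h2
    have h3 := mul_le_mul ((abs_inv_le_realHeight z i 0).trans hz) (hzw 0 j) (abs_nonneg _) hR
    have h4 := mul_le_mul ((abs_inv_le_realHeight z i 1).trans hz) (hzw 1 j) (abs_nonneg _) hR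
    nlinarith
  have := realHeight_le_of_entries (x := x⁻¹ * y) (B := 2) (h1 x y hx h) (by
    rw [_root_.mul_inv_rev, inv_inv]
    exact h1 y x hy fun i j => by rw [abs_sub_comm]; exact h i j)
  linarith

theorem realOnly_inv_mul_mem {p q : PairsEqDet Adele} {R δ : ℝ} {m : ℕ} (hp : p ∈ pairBox R m)
    (hq : q ∈ pairBox R m) (hδ : 4 * R * δ ≤ 1)
    (h1 : ∀ i j, |(realPart p.1.1).val i j - (realPart q.1.1).val i j| ≤ δ)
    (h2 : ∀ i j, |(realPart p.1.2).val i j - (realPart q.1.2).val i j| ≤ δ) :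
    (realOnly p)⁻¹ * q ∈ pairBox 16 m := by
  have e1 : ((realOnly p)⁻¹ * q).1.1 =
      glProd ((realPart p.1.1)⁻¹ * realPart q.1.1) (finPart q.1.1) := by
    change (glProd (realPart p.1.1) 1)⁻¹ * q.1.1 = _
    conv_lhs => rw [← glProd_realPart_finPart q.1.1]
    rw [glProd_inv, glProd_mul, inv_one, one_mul]
  have e2 : ((realOnly p)⁻¹ * q).1.2 =
      glProd ((realPart p.1.2)⁻¹ * realPart q.1.2) (finPart q.1.2) := by
    change (glProd (realPart p.1.2) 1)⁻¹ * q.1.2 = _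
    conv_lhs => rw [← glProd_realPart_finPart q.1.2]
    rw [glProd_inv, glProd_mul, inv_one, one_mul]
  refine ⟨⟨?_, ?_⟩, ?_, ?_⟩
  · rw [e1, realPart_glProd]; exact realHeight_inv_mul_le hp.1.1 hq.1.1 hδ h1
  · rw [e2, realPart_glProd]; exact realHeight_inv_mul_le hp.1.2 hq.1.2 hδ h2
  · rw [e1, finPart_glProd]; exact hq.2.1
  · rw [e2, finPart_glProd]; exact hq.2.2

/-- The entries of the real components, rounded to multiples of `1 / (4 R)`. -/
noncomputable def roundPair (R : ℕ) (p : PairsEqDet Adele) : Fin 2 × Fin 2 × Fin 2 → ℤ :=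
  fun l => ⌊(4 * R : ℝ) * (if l.1 = 0 then realPart p.1.1 else realPart p.1.2).val l.2.1 l.2.2⌋

theorem abs_sub_le_of_floor_eq {R : ℝ} (hR : 0 < R) {a b : ℝ} (h : ⌊4 * R * a⌋ = ⌊4 * R * b⌋) :
    |a - b| ≤ 1 / (4 * R) := by
  have := Int.abs_sub_lt_one_of_floor_eq_floor h
  rw [← mul_sub, abs_mul, abs_of_pos (by positivity)] at this
  rw [le_div_iff₀ (by positivity)]
  linarith

theorem roundPair_mem {R : ℕ} {m : ℕ} {p : PairsEqDet Adele} (hp : p ∈ pairBox R m) :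
    roundPair R p ∈ Fintype.piFinset fun _ : Fin 2 × Fin 2 × Fin 2 =>
      Finset.Icc (-(4 * R * R : ℤ)) (4 * R * R) := by
  rw [Fintype.mem_piFinset]
  intro l
  have hR0 : (0 : ℝ) ≤ R := by positivity
  have key : ∀ x : GL2 ℝ, realHeight x ≤ R → ∀ i j, ⌊(4 * R : ℝ) * x.val i j⌋ ∈
      Finset.Icc (-(4 * R * R : ℤ)) (4 * R * R) := by
    intro x hx i j
    have h := abs_le.1 ((abs_le_realHeight x i j).trans hx)
    rw [Finset.mem_Icc]
    constructor
    · rw [Int.le_floor]; push_cast; nlinarith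
    · have : (⌊(4 * R : ℝ) * x.val i j⌋ : ℝ) ≤ 4 * R * R := (Int.floor_le _).trans (by nlinarith)
      exact_mod_cast this
  unfold roundPair
  split_ifs
  · exact key _ hp.1.1 _ _
  · exact key _ hp.1.2 _ _

variable (dh : Measure H1) [dh.IsHaarMeasure]

/-- Rounding the eight real entries to multiples of `1 / (4R)` splits the box into at most `(8R² +
1)⁸` cells. Two members of one cell differ by an element of the box of height `16`, so each cell
lies in a left translate of that box. The translating element has trivial finite components, so
denominators are not affected. -/
theorem measure_box_le {R m : ℕ} (hR : 0 < R) :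
    dh (H1.mk '' pairBox R m) ≤ ((8 * R * R + 1) ^ 8 : ℕ) * dh (H1.mk '' pairBox 16 m) := by
  classical
  set I := Fintype.piFinset fun _ : Fin 2 × Fin 2 × Fin 2 =>
      Finset.Icc (-(4 * R * R : ℤ)) (4 * R * R) with hI
  have hR' : (0 : ℝ) < R := by exact_mod_cast hR
  -- One chosen member of each nonempty cell; the value at an empty cell plays no role.
  let c : (Fin 2 × Fin 2 × Fin 2 → ℤ) → PairsEqDet Adele := fun d =>
    if h : ∃ p ∈ pairBox R m, roundPair R p = d then h.choose else 1
  have hsub : H1.mk '' pairBox R m ⊆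
      ⋃ d ∈ I, (fun h => (H1.mk (realOnly (c d)))⁻¹ * h) ⁻¹' (H1.mk '' pairBox 16 m) := by
    rintro _ ⟨p, hp, rfl⟩
    refine Set.mem_biUnion (roundPair_mem hp) ?_
    have hex : ∃ q ∈ pairBox R m, roundPair R q = roundPair R p := ⟨p, hp, rfl⟩
    have hc : c (roundPair R p) = hex.choose := dif_pos hex
    obtain ⟨hq, hqp⟩ := hex.choose_spec
    rw [← hc] at hq hqp
    refine ⟨(realOnly (c (roundPair R p)))⁻¹ * p, ?_, by rw [map_mul, map_inv]⟩
    refine realOnly_inv_mul_mem (R := R) (δ := 1 / (4 * R)) hq hp ?_ (fun i j => ?_) fun i j => ?_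
    · rw [mul_one_div, div_self (by positivity)]
    · exact abs_sub_le_of_floor_eq hR' (by simpa [roundPair] using congrFun hqp (0, i, j))
    · exact abs_sub_le_of_floor_eq hR' (by simpa [roundPair] using congrFun hqp (1, i, j))
  calc dh (H1.mk '' pairBox R m)
      ≤ ∑ d ∈ I, dh ((fun h => (H1.mk (realOnly (c d)))⁻¹ * h) ⁻¹' (H1.mk '' pairBox 16 m)) :=
        (measure_mono hsub).trans (measure_biUnion_finset_le _ _)
    _ = ∑ d ∈ I, dh (H1.mk '' pairBox 16 m) := by
        refine Finset.sum_congr rfl fun d _ => measure_preimage_mul dh _ _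
    _ = _ := by
        have e : (4 * R * R + 1 - -(4 * R * R) : ℤ) = ((8 * R * R + 1 : ℕ) : ℤ) := by push_cast; ring
        rw [Finset.sum_const, nsmul_eq_mul, hI, Fintype.card_piFinset, Finset.prod_const,
          Int.card_Icc, e, Int.toNat_natCast]
        rfl

theorem measure_box_sixteen_lt_top {m : ℕ} (hm : m ≠ 0) : dh (H1.mk '' pairBox 16 m) < ⊤ :=
  ((isCompact_pairBox 16 hm).image continuous_H1mk).measure_lt_top

/-- Functions on `H₁(𝔸)` that decay like a large power of the height have an integrable
majorant. -/
theorem exists_majorant_of_height_bound {m : ℕ} (hm : m ≠ 0) {F : H1 → ℝ≥0∞} {C : ℝ}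
    (hF : ∀ h, F h = 0 ∨ ∃ p : PairsEqDet Adele, H1.mk p = h ∧
      (finPart p.1.1 ∈ denomSet m ∧ finPart p.1.2 ∈ denomSet m) ∧
      F h ≤ ENNReal.ofReal
        (C * ((realHeight (realPart p.1.1) * realHeight (realPart p.1.2)) ^ 18)⁻¹)) :
    ∃ Φ : H1 → ℝ≥0∞, Measurable Φ ∧ F ≤ Φ ∧ ∫⁻ h, Φ h ∂dh < ⊤ := by
  set B : ℕ → Set H1 := fun n => toMeasurable dh (H1.mk '' pairBox (n + 1 : ℕ) m) with hB
  -- The box of height `n + 1` has volume `O((n + 1)¹⁶)`, so the weight `(n + 1)⁻¹⁸` leaves the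
  -- convergent series of `(n + 1)⁻²`.
  set a : ℕ → ℝ≥0∞ := fun n => ENNReal.ofReal (|C| * (((n + 1 : ℕ) : ℝ) ^ 18)⁻¹) with ha
  have hle : ∀ h, F h ≤ ∑' n, (B n).indicator (fun _ => a n) h := by
    intro h
    rcases hF h with h0 | ⟨p, rfl, hfin, hp⟩
    · rw [h0]; exact zero_le
    set t1 := realHeight (realPart p.1.1)
    set t2 := realHeight (realPart p.1.2)
    have h1 : 2 ≤ t1 := two_le_realHeight _
    have h2 : 2 ≤ t2 := two_le_realHeight _
    set n := ⌊max t1 t2⌋₊ with hn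
    have hn1 : max t1 t2 ≤ (n + 1 : ℕ) := by
      push_cast; exact (Nat.lt_floor_add_one _).le
    have hmem : H1.mk p ∈ B n := subset_toMeasurable _ _
      ⟨p, ⟨⟨(le_max_left _ _).trans hn1, (le_max_right _ _).trans hn1⟩, hfin⟩, rfl⟩
    refine le_trans ?_ (ENNReal.le_tsum n)
    rw [Set.indicator_of_mem hmem]
    refine hp.trans (ENNReal.ofReal_le_ofReal ?_)
    -- With `n ≤ max t1 t2` and the smaller factor at least `2`, the product is at least `2 max t1
    -- t2 ≥ n + 1`.
    have hprod : ((n + 1 : ℕ) : ℝ) ≤ t1 * t2 := by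
      have : (n : ℝ) ≤ max t1 t2 := Nat.floor_le (by positivity)
      push_cast
      rcases le_total t1 t2 with h | h
      · rw [max_eq_right h] at this; nlinarith
      · rw [max_eq_left h] at this; nlinarith
    calc C * ((t1 * t2) ^ 18)⁻¹ ≤ |C| * ((t1 * t2) ^ 18)⁻¹ := by
          gcongr; exact le_abs_self C
      _ ≤ _ := by gcongr
  refine ⟨_, Measurable.tsum fun n =>
    measurable_const.indicator (measurableSet_toMeasurable _ _), hle, ?_⟩
  rw [lintegral_tsum fun n =>
    ((measurable_const.indicator (measurableSet_toMeasurable _ _))).aemeasurable]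
  have hterm : ∀ n, ∫⁻ h, (B n).indicator (fun _ => a n) h ∂dh ≤
      ENNReal.ofReal (|C| * 9 ^ 8 * (((n + 1 : ℕ) : ℝ) ^ 2)⁻¹) * dh (H1.mk '' pairBox 16 m) := by
    intro n
    rw [lintegral_indicator_const (measurableSet_toMeasurable _ _), measure_toMeasurable]
    refine (mul_le_mul_right (measure_box_le dh (Nat.succ_pos n)) _).trans ?_
    rw [← mul_assoc, ha]
    refine mul_le_mul_left ?_ _
    rw [← ENNReal.ofReal_natCast, ← ENNReal.ofReal_mul (by positivity)]
    refine ENNReal.ofReal_le_ofReal ?_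
    have hpos : (0 : ℝ) < ((n + 1 : ℕ) : ℝ) := by positivity
    have h9 : (((8 * (n + 1) * (n + 1) + 1) ^ 8 : ℕ) : ℝ) ≤ 9 ^ 8 * (((n + 1 : ℕ) : ℝ) ^ 16) := by
      have h1 : (1 : ℝ) ≤ ((n + 1 : ℕ) : ℝ) := by push_cast; linarith [(Nat.cast_nonneg n : (0:ℝ) ≤ n)]
      have : ((8 * (n + 1) * (n + 1) + 1 : ℕ) : ℝ) ≤ 9 * ((n + 1 : ℕ) : ℝ) ^ 2 := by
        push_cast at h1 ⊢; nlinarith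
      calc (((8 * (n + 1) * (n + 1) + 1) ^ 8 : ℕ) : ℝ)
          = ((8 * (n + 1) * (n + 1) + 1 : ℕ) : ℝ) ^ 8 := by push_cast; ring
        _ ≤ (9 * ((n + 1 : ℕ) : ℝ) ^ 2) ^ 8 := pow_le_pow_left₀ (by positivity) this 8
        _ = _ := by ring
    calc |C| * (((n + 1 : ℕ) : ℝ) ^ 18)⁻¹ * (((8 * (n + 1) * (n + 1) + 1) ^ 8 : ℕ) : ℝ)
        ≤ |C| * (((n + 1 : ℕ) : ℝ) ^ 18)⁻¹ * (9 ^ 8 * (((n + 1 : ℕ) : ℝ) ^ 16)) := by gcongr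
      _ = |C| * 9 ^ 8 * (((n + 1 : ℕ) : ℝ) ^ 2)⁻¹ := by field_simp
  refine (ENNReal.tsum_le_tsum hterm).trans_lt ?_
  rw [ENNReal.tsum_mul_right]
  refine ENNReal.mul_lt_top ?_ (measure_box_sixteen_lt_top dh hm)
  have hsum : Summable fun n : ℕ => |C| * 9 ^ 8 * (((n + 1 : ℕ) : ℝ) ^ 2)⁻¹ := by
    refine Summable.mul_left _ ?_
    have := (Real.summable_nat_pow_inv (p := 2)).2 (by norm_num)
    exact (summable_nat_add_iff 1).2 this
  rw [← ENNReal.ofReal_tsum_of_nonneg (fun n => by positivity) hsum]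
  exact ENNReal.ofReal_lt_top

end Volume

/-! ### Quotient measures -/

section QuotientMeasure

variable {G : Type*} [Group G] {Γ : Subgroup G}

/-- The right coset of an element. -/
abbrev rmk (Γ : Subgroup G) (g : G) : RightCosets Γ := Quotient.mk _ g

theorem exists_out_rmk (Γ : Subgroup G) (g : G) : ∃ γ : Γ, (rmk Γ g).out = γ * g := by
  have h : QuotientGroup.rightRel Γ g (rmk Γ g).out := Setoid.symm' _ (Quotient.mk_out g)
  rw [QuotientGroup.rightRel_apply] at h
  exact ⟨⟨_, h⟩, by simp⟩

theorem out_rmk_of_invariant {β : Sort*} {F : G → β} (hF : ∀ (γ : Γ) g, F (γ * g) = F g) (g : G) :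
    F (rmk Γ g).out = F g := by
  obtain ⟨γ, hγ⟩ := exists_out_rmk Γ g
  rw [hγ, hF]

theorem rmk_mul (γ : Γ) (g : G) : rmk Γ (γ * g) = rmk Γ g := by
  refine Quotient.sound ?_
  change QuotientGroup.rightRel Γ _ _
  rw [QuotientGroup.rightRel_apply]
  simp

theorem rmk_out (x : RightCosets Γ) : rmk Γ x.out = x := Quotient.out_eq x

theorem sum_mul_invariant {M : Type*} [AddCommMonoid M] [TopologicalSpace M] (Φ : G → M) (γ : Γ)
    (g : G) : ∑' δ : Γ, Φ (δ * (γ * g)) = ∑' δ : Γ, Φ (δ * g) := by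
  rw [← (Equiv.mulRight γ).tsum_eq fun δ : Γ => Φ (δ * g)]
  refine tsum_congr fun δ => ?_
  simp [mul_assoc]

variable [MeasurableSpace G]

theorem measurable_out_of_invariant {β : Type*} [MeasurableSpace β] {F : G → β}
    (hF : Measurable F) (hinv : ∀ (γ : Γ) g, F (γ * g) = F g) :
    Measurable fun x : RightCosets Γ => F x.out := by
  refine measurable_from_quotient.2 ?_
  convert hF using 1
  funext g
  exact out_rmk_of_invariant hinv g

theorem measurable_rmk (Γ : Subgroup G) : Measurable (rmk Γ) := fun _ hs => hs

/-- Every coset meets `S`, so the sum of `Φ` over a coset contains a term that is at least `F`. This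
is how reduction theory enters. -/
theorem IsDiscreteQuotientMeasure.lintegral_le {dg : Measure G}
    {m : Measure (RightCosets Γ)} (hm : IsDiscreteQuotientMeasure Γ dg m)
    {F Φ : G → ℝ≥0∞} (hF : ∀ (γ : Γ) g, F (γ * g) = F g) (hΦ : Measurable Φ) {S : Set G}
    (hS : ∀ g : G, ∃ γ : Γ, (γ : G) * g ∈ S) (hFΦ : ∀ g ∈ S, F g ≤ Φ g) :
    ∫⁻ x : RightCosets Γ, F x.out ∂m ≤ ∫⁻ g, Φ g ∂dg := by
  rw [← hm Φ hΦ]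
  refine lintegral_mono fun x => ?_
  obtain ⟨γ, hγ⟩ := hS x.out
  rw [← hF γ]
  exact (hFΦ _ hγ).trans (ENNReal.le_tsum γ)

section Discrete

variable [Countable Γ] [MeasurableMul G] {dg : Measure G} {m : Measure (RightCosets Γ)}

theorem measurable_sum {Φ : G → ℝ≥0∞} (hΦ : Measurable Φ) :
    Measurable fun x : RightCosets Γ => ∑' γ : Γ, Φ (γ * x.out) :=
  measurable_out_of_invariant (F := fun g => ∑' γ : Γ, Φ (γ * g))
    (Measurable.tsum fun _ => hΦ.comp (measurable_const_mul _)) (sum_mul_invariant Φ)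

theorem IsDiscreteQuotientMeasure.ae_sum_lt_top (hm : IsDiscreteQuotientMeasure Γ dg m)
    {Φ : G → ℝ≥0∞} (hΦ : Measurable Φ) (hfin : ∫⁻ g, Φ g ∂dg ≠ ⊤) :
    ∀ᵐ x ∂m, ∑' γ : Γ, Φ (γ * x.out) < ⊤ :=
  ae_lt_top (measurable_sum hΦ) (by rwa [hm Φ hΦ])

/-- The quotient measure is determined by its defining property. -/
theorem IsDiscreteQuotientMeasure.unique [SigmaFinite dg] {m' : Measure (RightCosets Γ)}
    (hm : IsDiscreteQuotientMeasure Γ dg m) (hm' : IsDiscreteQuotientMeasure Γ dg m') :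
    m = m' := by
  -- A strictly positive integrable function has coset sums that are nonzero, and finite almost
  -- everywhere. Dividing by them produces an indicator on the quotient from a function on the
  -- group, which determines the measure.
  obtain ⟨w, hw0, hwm, hwi⟩ := exists_pos_lintegral_lt_of_sigmaFinite dg one_ne_zero
  set W : G → ℝ≥0∞ := fun g => w g
  have hW : Measurable W := hwm.coe_nnreal_ennreal
  have hWi : ∫⁻ g, W g ∂dg ≠ ⊤ := (hwi.trans ENNReal.one_lt_top).ne
  set s : RightCosets Γ → ℝ≥0∞ := fun x => ∑' γ : Γ, W (γ * x.out)
  have hs : Measurable s := measurable_sum hW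
  have hs0 : ∀ x, s x ≠ 0 := fun x h => by
    have := (ENNReal.tsum_eq_zero.1 h) 1
    simp [W] at this
    exact (hw0 _).ne' this
  have key : ∀ n : Measure (RightCosets Γ), IsDiscreteQuotientMeasure Γ dg n → ∀ A,
      MeasurableSet A → n A = ∫⁻ g, W g * (A.indicator 1 (rmk Γ g) / s (rmk Γ g)) ∂dg := by
    intro n hn A hA
    have hmeas : Measurable fun g => A.indicator (1 : RightCosets Γ → ℝ≥0∞) (rmk Γ g) / s (rmk Γ g) :=
      ((measurable_one.indicator hA).comp (measurable_rmk Γ)).div (hs.comp (measurable_rmk Γ))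
    rw [← hn (fun g => W g * (A.indicator 1 (rmk Γ g) / s (rmk Γ g))) (hW.mul hmeas), ← lintegral_indicator_one hA]
    refine lintegral_congr_ae ?_
    filter_upwards [hn.ae_sum_lt_top hW hWi] with x hx
    simp_rw [rmk_mul, rmk_out]
    rw [ENNReal.tsum_mul_right]
    exact (ENNReal.mul_div_cancel (hs0 x) hx.ne).symm
  ext A hA
  rw [key m hm A hA, key m' hm' A hA]

/-- The image measure satisfies the same defining property because `dg` is right invariant, and that
property determines the measure. -/
theorem IsDiscreteQuotientMeasure.map_mul_right [SigmaFinite dg] [dg.IsMulRightInvariant]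
    (hm : IsDiscreteQuotientMeasure Γ dg m) (k : G) :
    MeasurePreserving (fun x : RightCosets Γ => rmk Γ (x.out * k)) m m := by
  have hmeas : Measurable (fun x : RightCosets Γ => rmk Γ (x.out * k)) :=
    measurable_out_of_invariant (F := fun g => rmk Γ (g * k))
      ((measurable_rmk Γ).comp (measurable_mul_const k)) fun γ g => by rw [mul_assoc, rmk_mul]
  refine ⟨hmeas, IsDiscreteQuotientMeasure.unique (dg := dg) (fun Φ hΦ => ?_) hm⟩
  rw [lintegral_map (measurable_sum hΦ) hmeas, ← lintegral_mul_right_eq_self Φ k,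
    ← hm (fun g => Φ (g * k)) (hΦ.comp (measurable_mul_const k))]
  refine lintegral_congr fun x => ?_
  have := out_rmk_of_invariant (F := fun g => ∑' γ : Γ, Φ (γ * g)) (sum_mul_invariant Φ) (x.out * k)
  rw [this]
  refine tsum_congr fun γ => ?_
  rw [mul_assoc]

theorem IsDiscreteQuotientMeasure.integral_comp_mul_right [SigmaFinite dg]
    [dg.IsMulRightInvariant] (hm : IsDiscreteQuotientMeasure Γ dg m) (k : G) {F : G → ℂ}
    (hF : Measurable F) (hinv : ∀ (γ : Γ) g, F (γ * g) = F g) :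
    ∫ x : RightCosets Γ, F (x.out * k) ∂m = ∫ x : RightCosets Γ, F x.out ∂m := by
  have h := (hm.map_mul_right k)
  have e : ∀ x : RightCosets Γ, F (x.out * k) = F (rmk Γ (x.out * k)).out := fun x =>
    (out_rmk_of_invariant hinv _).symm
  simp_rw [e]
  rw [← integral_map (φ := fun x : RightCosets Γ => rmk Γ (x.out * k)) (f := fun x => F x.out)
    h.measurable.aemeasurable (measurable_out_of_invariant hF hinv).aestronglyMeasurable, h.map_eq]

theorem IsDiscreteQuotientMeasure.integral_sum_of_nonneg (hm : IsDiscreteQuotientMeasure Γ dg m)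
    {Φ : G → ℝ} (hΦ : Measurable Φ) (h0 : ∀ g, 0 ≤ Φ g) (hi : Integrable Φ dg) :
    (∀ᵐ x ∂m, Summable fun γ : Γ => Φ (γ * x.out)) ∧
    Integrable (fun x : RightCosets Γ => ∑' γ : Γ, Φ (γ * x.out)) m ∧
    ∫ x : RightCosets Γ, ∑' γ : Γ, Φ (γ * x.out) ∂m = ∫ g, Φ g ∂dg := by
  set Φ' : G → ℝ≥0∞ := fun g => ENNReal.ofReal (Φ g)
  have hΦ' : Measurable Φ' := hΦ.ennreal_ofReal
  have hfin : ∫⁻ g, Φ' g ∂dg ≠ ⊤ := by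
    have := hi.2
    rw [hasFiniteIntegral_iff_ofReal (Filter.Eventually.of_forall h0)] at this
    exact this.ne
  have hae := hm.ae_sum_lt_top hΦ' hfin
  have e : ∀ x : RightCosets Γ, ∑' γ : Γ, Φ (γ * x.out) = (∑' γ : Γ, Φ' (γ * x.out)).toReal := by
    intro x
    rw [ENNReal.tsum_toReal_eq fun _ => ENNReal.ofReal_ne_top]
    exact tsum_congr fun γ => (ENNReal.toReal_ofReal (h0 _)).symm
  refine ⟨?_, ?_, ?_⟩
  · filter_upwards [hae] with x hx
    have := ENNReal.summable_toReal hx.ne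
    refine this.congr fun γ => ?_
    exact (ENNReal.toReal_ofReal (h0 _))
  · simp_rw [e]
    exact integrable_toReal_of_lintegral_ne_top (measurable_sum hΦ').aemeasurable
      (by rwa [hm Φ' hΦ'])
  · simp_rw [e]
    rw [integral_toReal (measurable_sum hΦ').aemeasurable hae, hm Φ' hΦ',
      integral_eq_lintegral_of_nonneg_ae (Filter.Eventually.of_forall h0)
        hΦ.aestronglyMeasurable]

theorem IsDiscreteQuotientMeasure.integral_sum_real (hm : IsDiscreteQuotientMeasure Γ dg m)
    {Φ : G → ℝ} (hΦ : Measurable Φ) (hi : Integrable Φ dg) :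
    (∀ᵐ x ∂m, Summable fun γ : Γ => Φ (γ * x.out)) ∧
    Integrable (fun x : RightCosets Γ => ∑' γ : Γ, Φ (γ * x.out)) m ∧
    ∫ x : RightCosets Γ, ∑' γ : Γ, Φ (γ * x.out) ∂m = ∫ g, Φ g ∂dg := by
  obtain ⟨s1, i1, e1⟩ := hm.integral_sum_of_nonneg (Φ := fun g => max (Φ g) 0)
    (hΦ.max measurable_const) (fun g => le_max_right _ _) hi.pos_part
  obtain ⟨s2, i2, e2⟩ := hm.integral_sum_of_nonneg (Φ := fun g => max (-Φ g) 0)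
    (hΦ.neg.max measurable_const) (fun g => le_max_right _ _) hi.neg_part
  have hsub : ∀ r : ℝ, r = max r 0 - max (-r) 0 := fun r => by
    rcases le_total r 0 with h | h
    · rw [max_eq_right h, max_eq_left (by linarith)]; ring
    · rw [max_eq_left h, max_eq_right (by linarith)]; ring
  have hsum : ∀ᵐ x ∂m, HasSum (fun γ : Γ => Φ (γ * x.out))
      (∑' γ : Γ, max (Φ (γ * x.out)) 0 - ∑' γ : Γ, max (-Φ (γ * x.out)) 0) := by
    filter_upwards [s1, s2] with x h1 h2
    have h := h1.hasSum.sub h2.hasSum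
    simp only [← hsub] at h
    exact h
  have hae : (fun x : RightCosets Γ => ∑' γ : Γ, Φ (γ * x.out)) =ᵐ[m] fun x =>
      ∑' γ : Γ, max (Φ (γ * x.out)) 0 - ∑' γ : Γ, max (-Φ (γ * x.out)) 0 := by
    filter_upwards [hsum] with x h using h.tsum_eq
  refine ⟨by filter_upwards [hsum] with x h using h.summable, (i1.sub i2).congr hae.symm, ?_⟩
  rw [integral_congr_ae hae, integral_sub i1 i2, e1, e2,
    ← integral_sub hi.pos_part hi.neg_part]
  refine integral_congr_ae (Filter.Eventually.of_forall fun g => (hsub _).symm)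

theorem IsDiscreteQuotientMeasure.integral_sum (hm : IsDiscreteQuotientMeasure Γ dg m)
    {Φ : G → ℂ} (hΦ : Measurable Φ) (hi : Integrable Φ dg) :
    ∫ x : RightCosets Γ, ∑' γ : Γ, Φ (γ * x.out) ∂m = ∫ g, Φ g ∂dg := by
  obtain ⟨s1, i1, e1⟩ := hm.integral_sum_real (Complex.measurable_re.comp hΦ) hi.re
  obtain ⟨s2, i2, e2⟩ := hm.integral_sum_real (Complex.measurable_im.comp hΦ) hi.im
  have hae : (fun x : RightCosets Γ => ∑' γ : Γ, Φ (γ * x.out)) =ᵐ[m] fun x =>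
      ((∑' γ : Γ, (Φ (γ * x.out)).re : ℝ) : ℂ) +
        ((∑' γ : Γ, (Φ (γ * x.out)).im : ℝ) : ℂ) * Complex.I := by
    filter_upwards [s1, s2] with x h1 h2
    have h := (Complex.hasSum_ofReal.2 h1.hasSum).add
      ((Complex.hasSum_ofReal.2 h2.hasSum).mul_right Complex.I)
    simp only [Function.comp_apply, Complex.re_add_im] at h
    exact h.tsum_eq
  have e1' : ∫ x : RightCosets Γ, ∑' γ : Γ, (Φ (γ * x.out)).re ∂m = ∫ g, (Φ g).re ∂dg := e1
  have e2' : ∫ x : RightCosets Γ, ∑' γ : Γ, (Φ (γ * x.out)).im ∂m = ∫ g, (Φ g).im ∂dg := e2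
  have i1' : Integrable (fun x : RightCosets Γ => ∑' γ : Γ, (Φ (γ * x.out)).re) m := i1
  have i2' : Integrable (fun x : RightCosets Γ => ∑' γ : Γ, (Φ (γ * x.out)).im) m := i2
  rw [integral_congr_ae hae, integral_add i1'.ofReal (i2'.ofReal.mul_const _),
    integral_mul_const, integral_complex_ofReal, integral_complex_ofReal, e1', e2']
  exact integral_re_add_im hi

end Discrete

section Weight

/-- The defining property is tested on `w` times the indicator of the preimage of `A`. The result
turns integrals over the quotient into weighted integrals over the group. -/
theorem eq_map_withDensity_of_discrete [Countable Γ] [MeasurableMul G] {dg : Measure G}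
    {m : Measure (RightCosets Γ)} (hm : IsDiscreteQuotientMeasure Γ dg m) {w : G → ℝ≥0∞}
    (hw : Measurable w) (h1 : ∀ g, ∑' γ : Γ, w (γ * g) = 1) :
    m = (dg.withDensity w).map (rmk Γ) := by
  ext A hA
  have hA' : MeasurableSet (rmk Γ ⁻¹' A) := measurable_rmk Γ hA
  rw [Measure.map_apply (measurable_rmk Γ) hA, withDensity_apply _ hA',
    ← lintegral_indicator hA', ← hm _ (hw.indicator hA'), ← lintegral_indicator_one hA]
  refine lintegral_congr fun x => ?_
  by_cases hx : x ∈ A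
  · rw [Set.indicator_of_mem hx, Pi.one_apply, ← h1 x.out]
    refine tsum_congr fun γ => ?_
    rw [Set.indicator_of_mem]
    rw [Set.mem_preimage, rmk_mul, rmk_out]; exact hx
  · rw [Set.indicator_of_notMem hx, eq_comm, ENNReal.tsum_eq_zero]
    intro γ
    rw [Set.indicator_of_notMem]
    rw [Set.mem_preimage, rmk_mul, rmk_out]; exact hx

theorem eq_map_withDensity_of_quotient {N : Type*} [Group N] [MeasurableSpace N] {ι : N →* G}
    {dn : Measure N} {dg : Measure G} {m : Measure (RightCosets ι.range)}
    (hm : IsQuotientMeasure ι dn dg m) {w : G → ℝ≥0∞} (hw : Measurable w)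
    (h1 : ∀ g, ∫⁻ n, w (ι n * g) ∂dn = 1) :
    m = (dg.withDensity w).map (rmk ι.range) := by
  ext A hA
  have hA' : MeasurableSet (rmk ι.range ⁻¹' A) := measurable_rmk _ hA
  rw [Measure.map_apply (measurable_rmk _) hA, withDensity_apply _ hA',
    ← lintegral_indicator hA', ← hm _ (hw.indicator hA'), ← lintegral_indicator_one hA]
  refine lintegral_congr fun x => ?_
  have hr : ∀ n, rmk ι.range (ι n * x.out) = x := fun n => by
    have := rmk_mul (Γ := ι.range) ⟨ι n, n, rfl⟩ x.out
    rw [rmk_out] at this; exact this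
  by_cases hx : x ∈ A
  · rw [Set.indicator_of_mem hx, Pi.one_apply, ← h1 x.out]
    refine lintegral_congr fun n => ?_
    rw [Set.indicator_of_mem]
    rw [Set.mem_preimage, hr]; exact hx
  · rw [Set.indicator_of_notMem hx]
    symm
    rw [lintegral_eq_zero_of_ae_eq_zero]
    refine Filter.Eventually.of_forall fun n => ?_
    simp only [Pi.zero_apply]
    rw [Set.indicator_of_notMem]
    rw [Set.mem_preimage, hr]; exact hx

variable {dg : Measure G} {w : G → ℝ≥0∞}

theorem integrable_map_rmk_iff (hw : Measurable w) (hfin : ∀ g, w g < ⊤) {F : G → ℂ}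
    (hF : Measurable F) (hinv : ∀ (γ : Γ) g, F (γ * g) = F g) :
    Integrable (fun x : RightCosets Γ => F x.out) ((dg.withDensity w).map (rmk Γ)) ↔
      Integrable (fun g => (w g).toReal • F g) dg := by
  rw [integrable_map_measure (measurable_out_of_invariant hF hinv).aestronglyMeasurable
    (measurable_rmk Γ).aemeasurable]
  have : (fun x : RightCosets Γ => F x.out) ∘ rmk Γ = F := by
    funext g; exact out_rmk_of_invariant hinv g
  rw [this]
  exact integrable_withDensity_iff_integrable_smul' hw (Filter.Eventually.of_forall hfin)

theorem integral_map_rmk (hw : Measurable w) (hfin : ∀ g, w g < ⊤) {F : G → ℂ}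
    (hF : Measurable F) (hinv : ∀ (γ : Γ) g, F (γ * g) = F g) :
    ∫ x : RightCosets Γ, F x.out ∂((dg.withDensity w).map (rmk Γ)) =
      ∫ g, (w g).toReal • F g ∂dg := by
  rw [integral_map (measurable_rmk Γ).aemeasurable
    (measurable_out_of_invariant hF hinv).aestronglyMeasurable]
  simp_rw [out_rmk_of_invariant hinv]
  exact integral_withDensity_eq_integral_toReal_smul hw (Filter.Eventually.of_forall hfin) F

end Weight

end QuotientMeasure

/-! ### Decay of cusp forms, uniformly in the finite variable -/

section UniformDecay

theorem inv_abs_det_le (x : GL2 ℝ) : |x.val.det|⁻¹ ≤ 2 * realHeight x ^ 2 := by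
  have h : |x.val.det|⁻¹ = |x⁻¹.val.det| := by
    have h1 : x.val.det * x⁻¹.val.det = 1 := by
      rw [← Matrix.det_mul, Units.mul_inv, Matrix.det_one]
    rw [← abs_inv, inv_eq_of_mul_eq_one_right h1]
  rw [h, Matrix.det_fin_two]
  refine (abs_sub _ _).trans ?_
  rw [abs_mul, abs_mul]
  have hh := realHeight_nonneg x
  have e := abs_inv_le_realHeight x
  nlinarith [mul_le_mul (e 0 0) (e 1 1) (abs_nonneg _) hh, mul_le_mul (e 0 1) (e 1 0) (abs_nonneg _) hh]

theorem invIm_le (x : GL2 ℝ) : invIm x ≤ 4 * realHeight x ^ 4 := by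
  have hh := realHeight_nonneg x
  have e : ∀ i j, x.val i j ^ 2 ≤ realHeight x ^ 2 := fun i j => by
    rw [← sq_abs (x.val i j)]
    exact pow_le_pow_left₀ (abs_nonneg _) (abs_le_realHeight x i j) 2
  unfold invIm
  rw [div_eq_mul_inv]
  calc _ ≤ (2 * realHeight x ^ 2) * (2 * realHeight x ^ 2) := by
        refine mul_le_mul ?_ (inv_abs_det_le x) (by positivity) (by positivity)
        linarith [e 1 0, e 1 1]
    _ = _ := by ring

theorem invIm_mul_le (x g : GL2 ℝ) : invIm (x * g) ≤ 8 * realHeight g ^ 4 * invIm x := by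
  have hh := realHeight_nonneg g
  have e : ∀ i j, g.val i j ^ 2 ≤ realHeight g ^ 2 := fun i j => by
    rw [← sq_abs (g.val i j)]
    exact pow_le_pow_left₀ (abs_nonneg _) (abs_le_realHeight g i j) 2
  unfold invIm
  rw [Units.val_mul, Matrix.det_mul, abs_mul]
  simp only [Matrix.mul_apply, Fin.sum_univ_two]
  set c := x.val 1 0
  set d := x.val 1 1
  rw [div_eq_mul_inv, mul_inv]
  calc _ ≤ ((c ^ 2 + d ^ 2) * (4 * realHeight g ^ 2)) * (|x.val.det|⁻¹ * (2 * realHeight g ^ 2)) := by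
        refine mul_le_mul ?_ (mul_le_mul_of_nonneg_left (inv_abs_det_le g) (by positivity))
          (by positivity) (by positivity)
        have h1 : (c * g.val 0 0 + d * g.val 1 0) ^ 2 + (c * g.val 0 1 + d * g.val 1 1) ^ 2 ≤
            (c ^ 2 + d ^ 2) * (g.val 0 0 ^ 2 + g.val 1 0 ^ 2 + g.val 0 1 ^ 2 + g.val 1 1 ^ 2) := by
          nlinarith [sq_nonneg (c * g.val 1 0 - d * g.val 0 0), sq_nonneg (c * g.val 1 1 - d * g.val 0 1)]
        refine h1.trans (mul_le_mul_of_nonneg_left ?_ (by positivity))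
        linarith [e 0 0, e 0 1, e 1 0, e 1 1]
    _ = _ := by rw [div_eq_mul_inv]; ring

/-- Rapid decay in the direction of the cusp, uniformly for bounded denominators. -/
def HasDecay (φ : GL2 Adele → ℂ) : Prop :=
  ∀ m : ℕ, m ≠ 0 → ∃ N : ℕ, ∀ M : ℕ, ∃ C : ℝ, 0 ≤ C ∧ ∀ x, ∀ k ∈ denomSet m,
    ‖φ (glProd x k)‖ ≤ C * realHeight x ^ N * invIm x ^ M

/-- The compact set `denomSet m` is covered by finitely many cosets of a subgroup under which `φ` is
right invariant. Exponents and constants of the finitely many estimates may be added up because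
heights are at least `1`. -/
theorem IsCuspForm.hasDecay {dx : Measure AdeleModRat} [dx.IsAddHaarMeasure]
    [IsProbabilityMeasure dx] {χ : Adeleˣ →* ℂˣ} {φ : GL2 Adele → ℂ} (hφ : IsCuspForm dx χ φ) :
    HasDecay φ := by
  intro m hm
  obtain ⟨K, hK, hφK⟩ := hφ.glProd_mul_of_mem
  obtain ⟨t, ht⟩ := (isCompact_denomSet hm).elim_finite_subcover
    (fun k : GL2 FinAdele => (fun l => k⁻¹ * l) ⁻¹' (K : Set (GL2 FinAdele)))
    (fun k => hK.preimage (continuous_const_mul _))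
    (fun k _ => Set.mem_iUnion.2 ⟨k, by simp [K.one_mem]⟩)
  choose N hN using hφ.rapid_decay
  refine ⟨∑ k ∈ t, N k, fun M => ?_⟩
  choose C hC0 hC using fun k => hN k M
  refine ⟨∑ k ∈ t, C k, Finset.sum_nonneg fun k _ => hC0 k, fun x k hk => ?_⟩
  obtain ⟨k₀, hk₀, hkk⟩ := Set.mem_iUnion₂.1 (ht hk)
  have e : k = k₀ * (k₀⁻¹ * k) := by group
  rw [e, hφK _ hkk]
  refine (hC k₀ x).trans ?_
  have h1 : (1 : ℝ) ≤ realHeight x := by linarith [two_le_realHeight x]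
  have := invIm_nonneg x
  gcongr
  · exact Finset.sum_nonneg fun k _ => hC0 k
  · exact Finset.single_le_sum (fun k _ => hC0 k) hk₀
  · exact Finset.single_le_sum (fun k _ => Nat.zero_le (N k)) hk₀

theorem HasDecay.mul_right {φ : GL2 Adele → ℂ} (hφ : HasDecay φ) (g : GL2 Adele) :
    HasDecay fun h => φ (h * g) := by
  intro m hm
  obtain ⟨m', hm', hg⟩ := exists_mem_denomSet (finPart g)
  obtain ⟨N, hN⟩ := hφ (m * m') (mul_ne_zero hm hm')
  refine ⟨N, fun M => ?_⟩
  obtain ⟨C, hC0, hC⟩ := hN M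
  set r := realHeight (realPart g)
  have hr : 0 ≤ r := realHeight_nonneg _
  refine ⟨C * (16 * r) ^ N * (8 * r ^ 4) ^ M, by positivity, fun x k hk => ?_⟩
  have e : glProd x k * g = glProd (x * realPart g) (k * finPart g) := by
    conv_lhs => rw [← glProd_realPart_finPart g]
    exact glProd_mul _ _ _ _
  beta_reduce
  rw [e]
  refine (hC _ _ (mul_mem_denomSet hk hg)).trans ?_
  have h1 := realHeight_mul_le x (realPart g)
  have h2 := invIm_mul_le x (realPart g)
  have h3 := realHeight_nonneg (x * realPart g)
  have h4 := invIm_nonneg (x * realPart g)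
  have h5 := realHeight_nonneg x
  calc _ ≤ C * (16 * (realHeight x * r)) ^ N * (8 * r ^ 4 * invIm x) ^ M := by gcongr
    _ = _ := by ring

end UniformDecay

/-! ### The functions `a ↦ φ(diag(a, 1) h)` -/

section Torus

/-- `t + t⁻¹` for the real component `t` of an idele. -/
noncomputable def spread (a : Adeleˣ) : ℝ := (a : Adele).1 + (a⁻¹ : Adeleˣ).1.1

theorem fst_inv (a : Adeleˣ) : (a⁻¹ : Adeleˣ).1.1 = ((a : Adele).1)⁻¹ :=
  (inv_eq_of_mul_eq_one_right (fst_mul_inv a)).symm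

theorem spread_pos {a : Adeleˣ} (ha : a ∈ posIdeles) : 0 < spread a := by
  unfold spread
  rw [fst_inv]
  have := ha.1
  positivity

theorem continuous_spread : Continuous spread :=
  (continuous_fst.comp Units.continuous_val).add
    (continuous_fst.comp (Units.continuous_val.comp continuous_inv))

/-- The real idele unit. -/
noncomputable def realUnit (a : Adeleˣ) : ℝˣ := Units.map (RingHom.fst ℝ FinAdele).toMonoidHom a

theorem realUnit_val (a : Adeleˣ) : (realUnit a : ℝ) = (a : Adele).1 := rfl

theorem diagOne_val {R : Type*} [CommRing R] (a : Rˣ) :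
    (diagOne R a).val = !![(a : R), 0; 0, 1] := rfl

theorem diagOne_inv_val {R : Type*} [CommRing R] (a : Rˣ) :
    (diagOne R a)⁻¹.val = !![((a⁻¹ : Rˣ) : R), 0; 0, 1] := rfl

theorem diagOne_adele (a : Adeleˣ) :
    diagOne Adele a = glProd (diagOne ℝ (realUnit a)) (diagOne FinAdele (finIdele a)) := by
  refine Units.ext (Matrix.ext fun i j => ?_)
  fin_cases i <;> fin_cases j <;> rfl

theorem diagOne_mem_GLZhat {a : Adeleˣ} (ha : a ∈ unitIdeles) :
    diagOne FinAdele (finIdele a) ∈ GLZhat := by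
  constructor
  · intro i j
    fin_cases i <;> fin_cases j
    exacts [ha.1, Zhat.zero_mem, Zhat.zero_mem, Zhat.one_mem]
  · intro i j
    fin_cases i <;> fin_cases j
    exacts [ha.2, Zhat.zero_mem, Zhat.zero_mem, Zhat.one_mem]

/-- The Weyl element. -/
def weyl : GL2 ℚ := glOfDet 0 1 (-1) 0 1 (by norm_num)

theorem ratGLFin_weyl_mem : ratGLFin weyl ∈ GLZhat := by
  refine mem_GLZhat_of_int ?_ ?_
  · intro i j
    fin_cases i <;> fin_cases j
    exacts [⟨0, by simp [weyl, glOfDet]⟩, ⟨1, by simp [weyl, glOfDet]⟩,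
      ⟨-1, by simp [weyl, glOfDet]⟩, ⟨0, by simp [weyl, glOfDet]⟩]
  · have h : weyl⁻¹.val = !![0, -1; 1, 0] := by
      rw [weyl, glOfDet_inv_val]
      ext i j
      fin_cases i <;> fin_cases j <;> simp
    intro i j
    rw [h]
    fin_cases i <;> fin_cases j
    exacts [⟨0, by simp⟩, ⟨-1, by simp⟩, ⟨1, by simp⟩, ⟨0, by simp⟩]

theorem ratGLReal_weyl_val : (ratGLReal weyl).val = !![0, 1; -1, 0] := by
  ext i j
  fin_cases i <;> fin_cases j <;> simp [ratGLReal, weyl, glOfDet]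

theorem ratGLReal_weyl_inv_val : (ratGLReal weyl)⁻¹.val = !![0, -1; 1, 0] := by
  rw [inv_val_fin_two, ratGLReal_weyl_val]
  ext i j
  fin_cases i <;> fin_cases j <;> simp [Matrix.det_fin_two]

theorem realHeight_diagOne_le (u : ℝˣ) (hu : 0 < (u : ℝ)) :
    realHeight (diagOne ℝ u) ≤ 8 * ((u : ℝ) + (u : ℝ)⁻¹) := by
  have hi : (0 : ℝ) < (u : ℝ)⁻¹ := inv_pos.2 hu
  have h1 : 1 ≤ (u : ℝ) + (u : ℝ)⁻¹ := by
    rcases le_total 1 (u : ℝ) with h | h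
    · linarith
    · linarith [(one_le_inv₀ hu).2 h]
  refine realHeight_le_of_entries ?_ ?_
  · intro i j
    rw [diagOne_val]
    fin_cases i <;> fin_cases j <;> simp <;> linarith [abs_of_pos hu]
  · intro i j
    rw [diagOne_inv_val]
    fin_cases i <;> fin_cases j <;> simp [abs_of_pos hu] <;> linarith

theorem invIm_diagOne_mul (u : ℝˣ) (hu : 0 < (u : ℝ)) (x : GL2 ℝ) :
    invIm (diagOne ℝ u * x) = (u : ℝ)⁻¹ * invIm x := by
  unfold invIm
  rw [Units.val_mul, Matrix.det_mul, diagOne_val]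
  simp [Matrix.mul_apply, Fin.sum_univ_two, Matrix.det_fin_two, abs_mul, abs_of_pos hu]
  field_simp

theorem invIm_weyl_mul_diagOne_mul (u : ℝˣ) (hu : 0 < (u : ℝ)) (x : GL2 ℝ) :
    invIm (ratGLReal weyl * (diagOne ℝ u * x)) = (u : ℝ) * invIm (ratGLReal weyl * x) := by
  unfold invIm
  rw [Units.val_mul, Matrix.det_mul, Units.val_mul, Matrix.det_mul, Units.val_mul, Matrix.det_mul,
    diagOne_val, ratGLReal_weyl_val]
  have e1 : !![0, 1; -1, 0] * (!![(u : ℝ), 0; 0, 1] * x.val) =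
      !![x.val 1 0, x.val 1 1; -(u * x.val 0 0), -(u * x.val 0 1)] := by
    ext i j
    fin_cases i <;> fin_cases j <;> simp [Matrix.vecMul, dotProduct, Fin.sum_univ_two]
  have e2 : !![0, 1; -1, 0] * x.val = !![x.val 1 0, x.val 1 1; -x.val 0 0, -x.val 0 1] := by
    ext i j
    fin_cases i <;> fin_cases j <;> simp [Matrix.mul_apply, Fin.sum_univ_two]
  rw [e1, e2]
  simp [Matrix.det_fin_two, abs_mul, abs_of_pos hu]
  field_simp

theorem realHeight_weyl_mul_le (x : GL2 ℝ) : realHeight (ratGLReal weyl * x) ≤ 128 * realHeight x := by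
  have h : realHeight (ratGLReal weyl) ≤ 8 * 1 := by
    refine realHeight_le_of_entries ?_ ?_
    · intro i j
      rw [ratGLReal_weyl_val]
      fin_cases i <;> fin_cases j <;> simp
    · intro i j
      rw [ratGLReal_weyl_inv_val]
      fin_cases i <;> fin_cases j <;> simp
  have := realHeight_mul_le (ratGLReal weyl) x
  nlinarith [realHeight_nonneg x]

/-- For `t ≥ 1` the factor `diag(t, 1)` pushes `x` towards the cusp. For `t ≤ 1` the rational Weyl
element, available by left invariance, exchanges the rows and turns `t → 0` into an approach to the
cusp. -/
theorem HasDecay.torus_bound {φ : GL2 Adele → ℂ} (hφ : HasDecay φ)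
    (hinv : ∀ (γ : GL2 ℚ) g, φ (ratGL γ * g) = φ g) {m : ℕ} (hm : m ≠ 0) (M : ℕ) :
    ∃ (N : ℕ) (C : ℝ), 0 ≤ C ∧ ∀ x, ∀ k ∈ denomSet m, ∀ a ∈ posIdeles,
      ‖φ (diagOne Adele a * glProd x k)‖ ≤ C * realHeight x ^ N * ((spread a) ^ M)⁻¹ := by
  obtain ⟨N, hN⟩ := hφ m hm
  -- `N` of the `M + N` orders of decay compensate the growth of the height of `diag(t, 1) x`, which
  -- is linear in the spread.
  obtain ⟨C, hC0, hC⟩ := hN (M + N)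
  refine ⟨N + 4 * (M + N), C * (2 ^ (M + N) * (128 * 128) ^ N * (4 * 128 ^ 4) ^ (M + N)),
    by positivity, fun x k hk a ha => ?_⟩
  have hh : (2 : ℝ) ≤ realHeight x := two_le_realHeight x
  have ht := ha.1
  have hs := spread_pos ha
  have hsp : spread a = (a : Adele).1 + ((a : Adele).1)⁻¹ := by rw [spread, fst_inv]
  set t : ℝ := (a : Adele).1 with htdef
  have hti : 0 < t⁻¹ := inv_pos.2 ht
  have hD : realHeight (diagOne ℝ (realUnit a)) ≤ 8 * spread a := by
    rw [hsp]; exact realHeight_diagOne_le (realUnit a) ht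
  have hfin : diagOne FinAdele (finIdele a) * k ∈ denomSet m := by
    have := mul_mem_denomSet (GLZhat_subset_denomSet 1 (diagOne_mem_GLZhat ha.2)) hk
    rwa [one_mul] at this
  have e : diagOne Adele a * glProd x k =
      glProd (diagOne ℝ (realUnit a) * x) (diagOne FinAdele (finIdele a) * k) := by
    rw [diagOne_adele, glProd_mul]
  have hh1 : realHeight (diagOne ℝ (realUnit a) * x) ≤ 128 * (spread a * realHeight x) := by
    refine (realHeight_mul_le _ _).trans ?_
    nlinarith [mul_le_mul_of_nonneg_right hD (realHeight_nonneg x)]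
  have key : ∀ z : GL2 ℝ, realHeight z ≤ 128 * 128 * (spread a * realHeight x) →
      invIm z ≤ 2 * (spread a)⁻¹ * (4 * 128 ^ 4 * realHeight x ^ 4) →
      C * realHeight z ^ N * invIm z ^ (M + N) ≤
        C * (2 ^ (M + N) * (128 * 128) ^ N * (4 * 128 ^ 4) ^ (M + N)) *
          realHeight x ^ (N + 4 * (M + N)) * ((spread a) ^ M)⁻¹ := by
    intro z h1 h2
    have h3 := realHeight_nonneg z
    have h4 := invIm_nonneg z
    calc _ ≤ C * (128 * 128 * (spread a * realHeight x)) ^ N *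
          (2 * (spread a)⁻¹ * (4 * 128 ^ 4 * realHeight x ^ 4)) ^ (M + N) := by gcongr
      _ = C * (2 ^ (M + N) * (128 * 128) ^ N * (4 * 128 ^ 4) ^ (M + N)) *
          realHeight x ^ (N + 4 * (M + N)) * ((spread a) ^ N * (spread a)⁻¹ ^ (M + N)) := by
          simp only [mul_pow]
          ring
      _ = _ := by
          congr 1
          rw [pow_add, inv_pow, inv_pow]
          field_simp
  rcases le_total 1 t with h1 | h1
  · rw [e]
    refine (hC _ _ hfin).trans (key _ ?_ ?_)
    · refine hh1.trans ?_
      have : 0 ≤ spread a * realHeight x := by positivity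
      linarith
    · rw [invIm_diagOne_mul _ ht, realUnit_val, ← htdef]
      have hti1 : t⁻¹ ≤ 1 := inv_le_one_of_one_le₀ h1
      have : t⁻¹ ≤ 2 * (spread a)⁻¹ := by
        rw [← div_eq_mul_inv, le_div_iff₀ hs, hsp, mul_add, inv_mul_cancel₀ ht.ne']
        nlinarith
      refine mul_le_mul this ((invIm_le x).trans ?_) (invIm_nonneg x) (by positivity)
      nlinarith [pow_nonneg (realHeight_nonneg x) 4]
  · rw [e, ← hinv weyl, ratGL_eq, glProd_mul]
    have hfin' : ratGLFin weyl * (diagOne FinAdele (finIdele a) * k) ∈ denomSet m := by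
      have := mul_mem_denomSet (GLZhat_subset_denomSet 1 ratGLFin_weyl_mem) hfin
      rwa [one_mul] at this
    refine (hC _ _ hfin').trans (key _ ?_ ?_)
    · refine (realHeight_weyl_mul_le _).trans ?_
      linarith
    · rw [invIm_weyl_mul_diagOne_mul _ ht, realUnit_val, ← htdef]
      have : t ≤ 2 * (spread a)⁻¹ := by
        rw [← div_eq_mul_inv, le_div_iff₀ hs, hsp, mul_add, mul_inv_cancel₀ ht.ne']
        nlinarith
      refine mul_le_mul this ((invIm_le _).trans ?_) (invIm_nonneg _) (by positivity)
      have h5 := realHeight_weyl_mul_le x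
      have h6 := realHeight_nonneg (ratGLReal weyl * x)
      calc _ ≤ 4 * (128 * realHeight x) ^ 4 := by gcongr
        _ = _ := by ring

end Torus

/-! ### Integration over the positive ideles -/

section PosIdeles

/-- The ideles with real component in `[1, 2]` that are units at all primes. -/
def unitBox : Set Adeleˣ := {a | a ∈ posIdeles ∧ 1 ≤ (a : Adele).1 ∧ (a : Adele).1 ≤ 2}

theorem isCompact_unitBox : IsCompact unitBox := by
  have hc : IsCompact ((Set.Icc (1 / 2 : ℝ) 2) ×ˢ (Zhat : Set FinAdele)) :=
    isCompact_Icc.prod isCompact_Zhat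
  have hemb : Topology.IsClosedEmbedding (Units.embedProduct Adele) :=
    Units.isClosedEmbedding_embedProduct
  have hcc := hc.prod (hc.image MulOpposite.continuous_op)
  have h1 := hemb.isCompact_preimage hcc
  refine h1.of_isClosed_subset ?_ ?_
  · have e : unitBox = (unitIdeles : Set Adeleˣ) ∩ ((fun a : Adeleˣ => (a : Adele).1) ⁻¹' Set.Icc 1 2) := by
      ext a
      constructor
      · rintro ⟨h, h1, h2⟩
        exact ⟨h.2, h1, h2⟩
      · rintro ⟨h, h1, h2⟩
        exact ⟨⟨lt_of_lt_of_le one_pos h1, h⟩, h1, h2⟩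
    rw [e]
    exact (Subgroup.isClosed_of_isOpen _ isOpen_unitIdeles).inter
      (isClosed_Icc.preimage (continuous_fst.comp Units.continuous_val))
  · rintro a ⟨h, h1, h2⟩
    refine ⟨⟨⟨(by linarith : (1 / 2 : ℝ) ≤ (a : Adele).1), h2⟩, h.2.1⟩, ⟨_, ⟨⟨?_, ?_⟩, h.2.2⟩, rfl⟩⟩
    · rw [fst_inv]
      rw [one_div]
      exact inv_anti₀ h.1 h2
    · rw [fst_inv]
      have := inv_le_one_of_one_le₀ h1
      linarith

/-- The idele with real component `2` and finite component `1`. -/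
noncomputable def realTwo : Adeleˣ := MulEquiv.prodUnits.symm (Units.mk0 2 two_ne_zero, 1)

theorem realTwo_zpow_fst (n : ℤ) : ((realTwo ^ n : Adeleˣ) : Adele).1 = 2 ^ n := by
  have h : realUnit (realTwo ^ n) = (Units.mk0 2 two_ne_zero) ^ n := by
    rw [realUnit, map_zpow]
    rfl
  rw [← realUnit_val, h]
  simp

theorem realTwo_mem : realTwo ∈ posIdeles := by
  refine ⟨?_, ?_, ?_⟩
  · change (0 : ℝ) < 2; norm_num
  · exact Zhat.one_mem
  · change (((1 : FinAdeleˣ)⁻¹ : FinAdeleˣ) : FinAdele) ∈ Zhat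
    rw [inv_one]; exact Zhat.one_mem

/-- Dyadic decomposition: the positive ideles are covered by the translates of a compact set under
powers of the real idele `2`. -/
theorem exists_realTwo_zpow_mul_mem {a : Adeleˣ} (ha : a ∈ posIdeles) :
    ∃ n : ℤ, realTwo ^ (-n) * a ∈ unitBox ∧ (2 : ℝ) ^ n.natAbs ≤ 2 * spread a := by
  obtain ⟨n, h1, h2⟩ := exists_mem_Ico_zpow ha.1 one_lt_two
  have hn : (0 : ℝ) < 2 ^ n := by positivity
  refine ⟨n, ⟨posIdeles.mul_mem (posIdeles.zpow_mem realTwo_mem _) ha, ?_, ?_⟩, ?_⟩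
  · change 1 ≤ ((realTwo ^ (-n) : Adeleˣ) : Adele).1 * (a : Adele).1
    rw [realTwo_zpow_fst, _root_.zpow_neg, ← div_eq_inv_mul, one_le_div hn]
    exact h1
  · change ((realTwo ^ (-n) : Adeleˣ) : Adele).1 * (a : Adele).1 ≤ 2
    rw [realTwo_zpow_fst, _root_.zpow_neg, ← div_eq_inv_mul, div_le_iff₀ hn, ← zpow_one_add₀ two_ne_zero,
      add_comm]
    exact h2.le
  · rw [spread, fst_inv]
    have ht := ha.1
    have hti := inv_pos.2 ht
    rcases le_total 0 n with h | h
    · rw [← zpow_natCast, Int.natAbs_of_nonneg h]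
      linarith
    · rw [← zpow_natCast, Int.ofNat_natAbs_of_nonpos h, _root_.zpow_neg]
      have : (2 ^ n)⁻¹ ≤ 2 * ((a : Adele).1)⁻¹ := by
        rw [← div_eq_mul_inv, le_div_iff₀ ht, inv_mul_le_iff₀ hn, mul_comm, ← zpow_one_add₀ two_ne_zero,
          add_comm]
        exact h2.le
      linarith

/-- All dyadic shells have the same finite volume, and on the `n`-th one the integrand is at most `2
· 2^{-|n|}`. -/
theorem lintegral_spread_lt_top (da : Measure Adeleˣ) [da.IsHaarMeasure] :
    ∫⁻ a in (posIdeles : Set Adeleˣ), ENNReal.ofReal ((spread a)⁻¹) ∂da < ⊤ := by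
  set B : ℤ → Set Adeleˣ := fun n => (fun a => realTwo ^ (-n) * a) ⁻¹' unitBox
  have hBm : ∀ n, MeasurableSet (B n) := fun n =>
    (isCompact_unitBox.isClosed.preimage (continuous_const_mul _)).measurableSet
  have hB : ∀ n, da (B n) = da unitBox := fun n => measure_preimage_mul _ _ _
  have hmeas : ∀ n : ℤ, Measurable ((B n).indicator fun _ => ENNReal.ofReal (2 * (2 : ℝ)⁻¹ ^ n.natAbs)) :=
    fun n => measurable_const.indicator (hBm n)
  calc _ ≤ ∫⁻ a, ∑' n : ℤ, (B n).indicator (fun _ => ENNReal.ofReal (2 * (2 : ℝ)⁻¹ ^ n.natAbs)) a ∂da := by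
        rw [← lintegral_indicator isOpen_posIdeles.measurableSet]
        refine lintegral_mono fun a => ?_
        by_cases ha : a ∈ posIdeles
        · rw [Set.indicator_of_mem ha]
          obtain ⟨n, hn, h2⟩ := exists_realTwo_zpow_mul_mem ha
          refine le_trans ?_ (ENNReal.le_tsum n)
          rw [Set.indicator_of_mem (show a ∈ B n from hn)]
          refine ENNReal.ofReal_le_ofReal ?_
          have hs := spread_pos ha
          rw [inv_pow, ← div_eq_mul_inv, inv_eq_one_div, div_le_div_iff₀ hs (by positivity)]
          linarith
        · rw [Set.indicator_of_notMem ha]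
          exact bot_le
    _ = ∑' n : ℤ, ENNReal.ofReal (2 * (2 : ℝ)⁻¹ ^ n.natAbs) * da unitBox := by
        rw [lintegral_tsum fun n => (hmeas n).aemeasurable]
        refine tsum_congr fun n => ?_
        rw [lintegral_indicator (hBm n), lintegral_const, Measure.restrict_apply_univ, hB]
    _ < ⊤ := by
        rw [ENNReal.tsum_mul_right]
        refine ENNReal.mul_lt_top ?_ isCompact_unitBox.measure_lt_top
        have hs : Summable fun n : ℤ => 2 * (2 : ℝ)⁻¹ ^ n.natAbs := by
          refine Summable.mul_left _ ?_
          have hg := summable_geometric_of_lt_one (r := (2 : ℝ)⁻¹) (by norm_num) (by norm_num)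
          refine Summable.of_nat_of_neg ?_ ?_ <;> simpa using hg
        rw [← ENNReal.ofReal_tsum_of_nonneg (fun n => by positivity) hs]
        exact ENNReal.ofReal_lt_top

/-- The character is bounded on the compact set `unitBox` and grows geometrically along powers of
`2`, that is, polynomially in the spread. Unitarity is not needed. -/
theorem exists_character_bound {μ : Adeleˣ →* ℂˣ} (hμ : Continuous μ) :
    ∃ (s : ℕ) (C : ℝ), 0 ≤ C ∧ ∀ a ∈ posIdeles, ‖(μ a : ℂ)‖ ≤ C * spread a ^ s := by
  have hcont : Continuous fun a => ‖(μ a : ℂ)‖ := (Units.continuous_val.comp hμ).norm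
  obtain ⟨C, hC⟩ := isCompact_unitBox.exists_bound_of_continuousOn (Units.continuous_val.comp hμ).continuousOn
  set r : ℝ := max ‖(μ realTwo : ℂ)‖ ‖((μ realTwo)⁻¹ : ℂˣ).1‖
  have hr0 : 0 ≤ r := (norm_nonneg _).trans (le_max_left _ _)
  obtain ⟨s, hs⟩ := pow_unbounded_of_one_lt r one_lt_two
  refine ⟨s, max C 0 * 2 ^ s, by positivity, fun a ha => ?_⟩
  obtain ⟨n, hn, h2⟩ := exists_realTwo_zpow_mul_mem ha
  have e : a = realTwo ^ n * (realTwo ^ (-n) * a) := by group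
  have h1 : ‖((μ realTwo ^ n : ℂˣ) : ℂ)‖ ≤ r ^ n.natAbs := by
    rcases Int.natAbs_eq n with h | h
    · rw [h, zpow_natCast, Units.val_pow_eq_pow_val, norm_pow, Int.natAbs_natCast]
      exact pow_le_pow_left₀ (norm_nonneg _) (le_max_left _ _) _
    · rw [h, _root_.zpow_neg, zpow_natCast, ← inv_pow, Units.val_pow_eq_pow_val, norm_pow, Int.natAbs_neg,
        Int.natAbs_natCast]
      exact pow_le_pow_left₀ (norm_nonneg _) (le_max_right _ _) _
  have hb : ‖(μ (realTwo ^ (-n) * a) : ℂ)‖ ≤ C := hC _ hn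
  have hsp := spread_pos ha
  rw [e, map_mul, map_zpow, Units.val_mul, norm_mul, ← e]
  calc _ ≤ (2 ^ s) ^ n.natAbs * max C 0 := by
        refine mul_le_mul (h1.trans (pow_le_pow_left₀ hr0 hs.le _)) (hb.trans (le_max_left _ _))
          (norm_nonneg _) (by positivity)
    _ = max C 0 * (2 ^ n.natAbs) ^ s := by rw [← pow_mul, ← pow_mul, mul_comm s, mul_comm]
    _ ≤ max C 0 * (2 * spread a) ^ s := by gcongr
    _ = _ := by ring

end PosIdeles

/-! ### Integration over the idele class group -/

section IdeleClass

instance : Countable ℚˣ := Units.val_injective.countable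

instance : Countable ratIdeles :=
  (MonoidHom.rangeRestrict_surjective (Units.map (algebraMap ℚ Adele).toMonoidHom)).countable

/-- Exactly one rational multiple of an idele lies in `ℝ_{>0} × Ẑˣ`. -/
theorem sum_indicator_posIdeles (a : Adeleˣ) :
    ∑' q : ratIdeles, (posIdeles : Set Adeleˣ).indicator (1 : Adeleˣ → ℝ≥0∞) (q * a) = 1 := by
  obtain ⟨q, hq⟩ := exists_ratIdele_mul_mem a
  rw [tsum_eq_single (⟨ratIdele q, q, rfl⟩ : ratIdeles)]
  · exact Set.indicator_of_mem (show _ ∈ (posIdeles : Set Adeleˣ) from hq) _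
  · rintro ⟨_, r, rfl⟩ hr
    refine Set.indicator_of_notMem (fun h => hr ?_) _
    change ratIdele r * a ∈ posIdeles at h
    have h1 : ratIdele (r * q⁻¹) ∈ posIdeles := by
      have := posIdeles.mul_mem h (posIdeles.inv_mem hq)
      rwa [_root_.mul_inv_rev, mul_assoc, mul_inv_cancel_left, ← map_inv, ← map_mul] at this
    have := ratIdele_mem_posIdeles h1
    rw [mul_inv_eq_one] at this
    subst this
    rfl

variable {da : Measure Adeleˣ} {dc : Measure (RightCosets ratIdeles)}

theorem IsDiscreteQuotientMeasure.eq_map_posIdeles (hdc : IsDiscreteQuotientMeasure ratIdeles da dc) :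
    dc = (da.restrict (posIdeles : Set Adeleˣ)).map (rmk ratIdeles) := by
  rw [← withDensity_indicator_one isOpen_posIdeles.measurableSet]
  exact eq_map_withDensity_of_discrete hdc (measurable_one.indicator isOpen_posIdeles.measurableSet)
    sum_indicator_posIdeles

theorem IsDiscreteQuotientMeasure.integrable_iff_integrableOn_posIdeles
    (hdc : IsDiscreteQuotientMeasure ratIdeles da dc) {F : Adeleˣ → ℂ} (hF : Measurable F)
    (hinv : ∀ (q : ratIdeles) a, F (q * a) = F a) :
    Integrable (fun x : RightCosets ratIdeles => F x.out) dc ↔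
      IntegrableOn F (posIdeles : Set Adeleˣ) da := by
  rw [hdc.eq_map_posIdeles, integrable_map_measure
    (measurable_out_of_invariant hF hinv).aestronglyMeasurable (measurable_rmk _).aemeasurable]
  have : (fun x : RightCosets ratIdeles => F x.out) ∘ rmk ratIdeles = F := by
    funext g; exact out_rmk_of_invariant hinv g
  rw [this, IntegrableOn]

theorem IsDiscreteQuotientMeasure.integral_eq_setIntegral_posIdeles
    (hdc : IsDiscreteQuotientMeasure ratIdeles da dc) {F : Adeleˣ → ℂ} (hF : Measurable F)
    (hinv : ∀ (q : ratIdeles) a, F (q * a) = F a) :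
    ∫ x : RightCosets ratIdeles, F x.out ∂dc = ∫ a in (posIdeles : Set Adeleˣ), F a ∂da := by
  rw [hdc.eq_map_posIdeles, integral_map (measurable_rmk _).aemeasurable
    (measurable_out_of_invariant hF hinv).aestronglyMeasurable]
  simp_rw [out_rmk_of_invariant hinv]

/-- A quasi-character of polynomial growth on the positive ideles. -/
structure IsModerate (κ : Adeleˣ → ℂ) : Prop where
  continuous : Continuous κ
  rat_mul : ∀ (q : ratIdeles) a, κ (q * a) = κ a
  bound : ∃ (s : ℕ) (C : ℝ), 0 ≤ C ∧ ∀ a ∈ posIdeles, ‖κ a‖ ≤ C * spread a ^ s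

theorem adeleAbs_rat_mul (q : ratIdeles) (a : Adeleˣ) :
    adeleAbs ((q * a : Adeleˣ) : Adele) = adeleAbs a := by
  obtain ⟨_, r, rfl⟩ := q
  have h := adeleAbs_mul (ratIdele r) a
  rwa [adeleAbs_ratIdele, one_mul] at h

theorem adeleAbs_le_spread {a : Adeleˣ} (ha : a ∈ posIdeles) : adeleAbs a ≤ spread a := by
  rw [adeleAbs_of_mem_unitIdeles ha.2, spread, fst_inv, abs_of_pos ha.1]
  have := inv_pos.2 ha.1
  linarith

theorem adeleAbs_rpow_le_spread {a : Adeleˣ} (ha : a ∈ posIdeles) :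
    adeleAbs a ^ (-(1 / 2) : ℝ) ≤ spread a := by
  rw [adeleAbs_of_mem_unitIdeles ha.2, spread, fst_inv, abs_of_pos ha.1]
  have h0 := ha.1
  have h1 := inv_pos.2 ha.1
  rcases le_total 1 (a : Adele).1 with h | h
  · have := Real.rpow_le_one_of_one_le_of_nonpos h (by norm_num : (-(1 / 2) : ℝ) ≤ 0)
    linarith
  · have := Real.rpow_le_rpow_of_exponent_ge h0 h (by norm_num : (-1 : ℝ) ≤ -(1 / 2))
    rw [Real.rpow_neg_one] at this
    linarith

theorem continuous_adeleAbs_rpow : Continuous fun a : Adeleˣ => adeleAbs a ^ (-(1 / 2) : ℝ) :=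
  continuous_adeleAbs.rpow_const fun a => Or.inl (adeleAbs_ne_zero a)

theorem IsModerate.of_character {μ : Adeleˣ →* ℂˣ} (hμ : Continuous μ)
    (hμr : ∀ a ∈ ratIdeles, μ a = 1) : IsModerate fun a => (μ a : ℂ) where
  continuous := Units.continuous_val.comp hμ
  rat_mul q a := by rw [map_mul, hμr _ q.2, one_mul]
  bound := exists_character_bound hμ

theorem IsModerate.mul {κ κ' : Adeleˣ → ℂ} (h : IsModerate κ) (h' : IsModerate κ') :
    IsModerate fun a => κ a * κ' a where
  continuous := h.continuous.mul h'.continuous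
  rat_mul q a := by rw [h.rat_mul, h'.rat_mul]
  bound := by
    obtain ⟨s, C, hC, hs⟩ := h.bound
    obtain ⟨s', C', hC', hs'⟩ := h'.bound
    refine ⟨s + s', C * C', by positivity, fun a ha => ?_⟩
    have := spread_pos ha
    rw [norm_mul]
    calc _ ≤ (C * spread a ^ s) * (C' * spread a ^ s') :=
          mul_le_mul (hs a ha) (hs' a ha) (norm_nonneg _) (by positivity)
      _ = _ := by ring

theorem isModerate_abs : IsModerate fun a => (adeleAbs a : ℂ) where
  continuous := Complex.continuous_ofReal.comp continuous_adeleAbs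
  rat_mul q a := by rw [adeleAbs_rat_mul]
  bound := ⟨1, 1, zero_le_one, fun a ha => by
    rw [Complex.norm_real, Real.norm_of_nonneg (adeleAbs_nonneg _), one_mul, pow_one]
    exact adeleAbs_le_spread ha⟩

theorem isModerate_abs_rpow : IsModerate fun a => ((adeleAbs a ^ (-(1 / 2) : ℝ) : ℝ) : ℂ) where
  continuous := Complex.continuous_ofReal.comp continuous_adeleAbs_rpow
  rat_mul q a := by rw [adeleAbs_rat_mul]
  bound := ⟨1, 1, zero_le_one, fun a ha => by
    rw [Complex.norm_real, Real.norm_of_nonneg (Real.rpow_nonneg (adeleAbs_nonneg _) _), one_mul,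
      pow_one]
    exact adeleAbs_rpow_le_spread ha⟩

theorem continuous_diagOne : Continuous (diagOne Adele) := by
  refine Units.continuous_iff.2 ⟨?_, ?_⟩
  · refine continuous_matrix fun i j => ?_
    have h : Continuous fun a : Adeleˣ => (a : Adele) := Units.continuous_val
    fin_cases i <;> fin_cases j
    exacts [h, continuous_const, continuous_const, continuous_const]
  · refine continuous_matrix fun i j => ?_
    have h : Continuous fun a : Adeleˣ => ((a⁻¹ : Adeleˣ) : Adele) :=
      Units.continuous_val.comp continuous_inv
    fin_cases i <;> fin_cases j
    exacts [h, continuous_const, continuous_const, continuous_const]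

theorem diagOne_ratIdele (q : ℚˣ) : diagOne Adele (ratIdele q) = ratGL (diagOne ℚ q) := by
  refine Units.ext (Matrix.ext fun i j => ?_)
  fin_cases i <;> fin_cases j
  · rfl
  · exact (map_zero (algebraMap ℚ Adele)).symm
  · exact (map_zero (algebraMap ℚ Adele)).symm
  · exact (map_one (algebraMap ℚ Adele)).symm

variable {φ : GL2 Adele → ℂ} {κ : Adeleˣ → ℂ}

theorem torus_mul_rat_mul (hinv : ∀ (γ : GL2 ℚ) g, φ (ratGL γ * g) = φ g) (hκ : IsModerate κ)
    (h : GL2 Adele) (q : ratIdeles) (a : Adeleˣ) :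
    φ (diagOne Adele (q * a) * h) * κ (q * a) = φ (diagOne Adele a * h) * κ a := by
  rw [hκ.rat_mul]
  obtain ⟨_, r, rfl⟩ := q
  rw [map_mul, mul_assoc]
  change φ (diagOne Adele (ratIdele r) * _) * _ = _
  rw [diagOne_ratIdele, hinv]

/-- Decay of order `s + 1` against growth of order `s` leaves the inverse of the spread, which is
integrable. The bound is uniform over `denomSet m` and polynomial in the height, as the majorant of
the unfolded integral requires. -/
theorem HasDecay.exists_lintegral_torus_le [da.IsHaarMeasure] (hφ : HasDecay φ)
    (hinv : ∀ (γ : GL2 ℚ) g, φ (ratGL γ * g) = φ g) (hκ : IsModerate κ) {m : ℕ} (hm : m ≠ 0) :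
    ∃ (N : ℕ) (C : ℝ), 0 ≤ C ∧ ∀ x, ∀ k ∈ denomSet m,
      ∫⁻ a in (posIdeles : Set Adeleˣ), ‖φ (diagOne Adele a * glProd x k) * κ a‖ₑ ∂da ≤
        ENNReal.ofReal (C * realHeight x ^ N) := by
  obtain ⟨s, C, hC, hs⟩ := hκ.bound
  obtain ⟨N, C', hC', hN⟩ := hφ.torus_bound hinv hm (s + 1)
  have hfin := lintegral_spread_lt_top da
  set I := ∫⁻ a in (posIdeles : Set Adeleˣ), ENNReal.ofReal ((spread a)⁻¹) ∂da with hI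
  refine ⟨N, C' * C * I.toReal, by positivity, fun x k hk => ?_⟩
  have hh := realHeight_nonneg x
  calc _ ≤ ∫⁻ a in (posIdeles : Set Adeleˣ),
        ENNReal.ofReal (C' * C * realHeight x ^ N) * ENNReal.ofReal ((spread a)⁻¹) ∂da := by
        refine setLIntegral_mono' isOpen_posIdeles.measurableSet fun a ha => ?_
        rw [← ENNReal.ofReal_mul (by positivity), ← ofReal_norm]
        refine ENNReal.ofReal_le_ofReal ?_
        have hsp := spread_pos ha
        rw [norm_mul]
        calc _ ≤ (C' * realHeight x ^ N * ((spread a) ^ (s + 1))⁻¹) * (C * spread a ^ s) :=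
              mul_le_mul (hN x k hk a ha) (hs a ha) (norm_nonneg _) (by positivity)
          _ = _ := by
              rw [pow_succ]
              field_simp
    _ = ENNReal.ofReal (C' * C * realHeight x ^ N) * I := by
        have hm : Measurable fun a : Adeleˣ => ENNReal.ofReal ((spread a)⁻¹) :=
          continuous_spread.measurable.inv.ennreal_ofReal
        rw [lintegral_const_mul _ hm]
    _ = _ := by
        rw [← ENNReal.ofReal_toReal hfin.ne, ← ENNReal.ofReal_mul (by positivity)]
        congr 1
        rw [ENNReal.toReal_ofReal ENNReal.toReal_nonneg]
        ring

theorem HasDecay.integrableOn_torus [da.IsHaarMeasure] (hφ : HasDecay φ) (hφc : Continuous φ)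
    (hinv : ∀ (γ : GL2 ℚ) g, φ (ratGL γ * g) = φ g) (hκ : IsModerate κ) (h : GL2 Adele) :
    IntegrableOn (fun a => φ (diagOne Adele a * h) * κ a) (posIdeles : Set Adeleˣ) da := by
  obtain ⟨m, hm, hk⟩ := exists_mem_denomSet (finPart h)
  obtain ⟨N, C, -, hN⟩ := hφ.exists_lintegral_torus_le (da := da) hinv hκ hm
  have hc : Continuous fun a => φ (diagOne Adele a * h) * κ a :=
    (hφc.comp (continuous_diagOne.mul continuous_const)).mul hκ.continuous
  refine ⟨hc.measurable.aestronglyMeasurable, ?_⟩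
  have := hN (realPart h) _ hk
  rw [glProd_realPart_finPart] at this
  exact this.trans_lt ENNReal.ofReal_lt_top

end IdeleClass

/-! ### Bounds for Bruhat-Schwartz functions -/

section Schwartz

/-- A size function for the real component of a point of `V(𝔸)²`. -/
def sizeV (x : V2 Adele) : ℝ := 1 + ∑ k, ∑ i, ∑ j, |(x k i j).1|

theorem one_le_sizeV (x : V2 Adele) : 1 ≤ sizeV x := by
  unfold sizeV
  have : 0 ≤ ∑ k, ∑ i, ∑ j, |(x k i j).1| := by positivity
  linarith

theorem one_add_abs_le_sizeV (x : V2 Adele) (k i j : Fin 2) : 1 + |(x k i j).1| ≤ sizeV x := by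
  unfold sizeV
  have h1 : |(x k i j).1| ≤ ∑ j, |(x k i j).1| :=
    Finset.single_le_sum (f := fun j => |(x k i j).1|) (fun _ _ => abs_nonneg _) (Finset.mem_univ j)
  have h2 : ∑ j, |(x k i j).1| ≤ ∑ i, ∑ j, |(x k i j).1| :=
    Finset.single_le_sum (f := fun i => ∑ j, |(x k i j).1|) (fun _ _ => by positivity)
      (Finset.mem_univ i)
  have h3 : ∑ i, ∑ j, |(x k i j).1| ≤ ∑ k, ∑ i, ∑ j, |(x k i j).1| :=
    Finset.single_le_sum (f := fun k => ∑ i, ∑ j, |(x k i j).1|) (fun _ _ => by positivity)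
      (Finset.mem_univ k)
  linarith

theorem abs_le_sizeV (x : V2 Adele) (k i j : Fin 2) : |(x k i j).1| ≤ sizeV x := by
  linarith [one_add_abs_le_sizeV x k i j]

theorem sizeV_le {x : V2 Adele} {B : ℝ} (h : ∀ k i j, |(x k i j).1| ≤ B) : sizeV x ≤ 1 + 8 * B := by
  unfold sizeV
  simp only [Fin.sum_univ_two]
  linarith [h 0 0 0, h 0 0 1, h 0 1 0, h 0 1 1, h 1 0 0, h 1 0 1, h 1 1 0, h 1 1 1]

/-- Continuity, rapid decay in the real variable, bounded denominators on the support. -/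
structure IsRapid (f : V2 Adele → ℂ) : Prop where
  continuous : Continuous f
  support : ∃ n : ℕ, n ≠ 0 ∧ ∀ x, f x ≠ 0 → ∀ k i j, algebraMap ℚ FinAdele (n : ℚ) * (x k i j).2 ∈ Zhat
  decay : ∀ N : ℕ, ∃ C : ℝ, 0 ≤ C ∧ ∀ x, ‖f x‖ ≤ C * (sizeV x ^ N)⁻¹

theorem exists_denominator_of_isCompact {K : Set (V2 FinAdele)} (hK : IsCompact K) :
    ∃ n : ℕ, n ≠ 0 ∧ ∀ x ∈ K, ∀ k i j, algebraMap ℚ FinAdele (n : ℚ) * x k i j ∈ Zhat := by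
  -- Factorials are used because they are directed for divisibility and every denominator divides
  -- one of them.
  have h := hK.elim_directed_cover
    (fun n : ℕ => {x : V2 FinAdele | ∀ k i j, algebraMap ℚ FinAdele ((n.factorial : ℕ) : ℚ) * x k i j ∈ Zhat})
    (fun n => by
      simp only [Set.ofPred_forall]
      refine isOpen_iInter_of_finite fun k => isOpen_iInter_of_finite fun i =>
        isOpen_iInter_of_finite fun j => ?_
      have hc : Continuous fun x : V2 FinAdele =>
          algebraMap ℚ FinAdele ((n.factorial : ℕ) : ℚ) * x k i j :=
        continuous_const.mul
          ((continuous_apply j).comp ((continuous_apply i).comp (continuous_apply k)))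
      exact isOpen_Zhat.preimage hc)
    (fun x _ => by
      obtain ⟨n, hn, h⟩ := exists_common_denominator (Finset.univ : Finset (Fin 2 × Fin 2 × Fin 2))
        fun t => x t.1 t.2.1 t.2.2
      refine Set.mem_iUnion.2 ⟨n, fun k i j => ?_⟩
      obtain ⟨d, hd⟩ := Nat.dvd_factorial (Nat.pos_of_ne_zero hn) le_rfl
      have := Zhat.mul_mem (natCast_mem_Zhat d) (h (k, i, j) (Finset.mem_univ _))
      rw [← mul_assoc, ← map_mul] at this
      convert this using 3
      rw [hd]; push_cast; ring)
    (directed_of_isDirected_le fun a b hab x hx k i j => by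
      obtain ⟨d, hd⟩ := Nat.factorial_dvd_factorial hab
      have := Zhat.mul_mem (natCast_mem_Zhat d) (hx k i j)
      rw [← mul_assoc, ← map_mul] at this
      convert this using 3
      rw [hd]; push_cast; ring)
  obtain ⟨n, hn⟩ := h
  exact ⟨n.factorial, n.factorial_ne_zero, fun x hx => hn hx⟩

theorem isRapid_zero : IsRapid 0 where
  continuous := continuous_const
  support := ⟨1, one_ne_zero, fun x hx => absurd rfl hx⟩
  decay N := ⟨0, le_rfl, fun x => by simp⟩

theorem IsRapid.add {f g : V2 Adele → ℂ} (hf : IsRapid f) (hg : IsRapid g) : IsRapid (f + g) where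
  continuous := hf.continuous.add hg.continuous
  support := by
    obtain ⟨n, hn, h⟩ := hf.support
    obtain ⟨n', hn', h'⟩ := hg.support
    refine ⟨n * n', mul_ne_zero hn hn', fun x hx k i j => ?_⟩
    by_cases hfx : f x = 0
    · have hgx : g x ≠ 0 := fun hgx => hx (by simp [hfx, hgx])
      have := Zhat.mul_mem (natCast_mem_Zhat n) (h' x hgx k i j)
      rwa [← mul_assoc, ← map_mul, ← Nat.cast_mul] at this
    · have := Zhat.mul_mem (natCast_mem_Zhat n') (h x hfx k i j)
      rwa [← mul_assoc, ← map_mul, ← Nat.cast_mul, mul_comm n'] at this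
  decay N := by
    obtain ⟨C, hC, h⟩ := hf.decay N
    obtain ⟨C', hC', h'⟩ := hg.decay N
    refine ⟨C + C', by positivity, fun x => ?_⟩
    refine (norm_add_le _ _).trans ?_
    rw [add_mul]
    exact add_le_add (h x) (h' x)

theorem IsRapid.smul {f : V2 Adele → ℂ} (hf : IsRapid f) (c : ℂ) : IsRapid (c • f) where
  continuous := hf.continuous.const_smul c
  support := by
    obtain ⟨n, hn, h⟩ := hf.support
    exact ⟨n, hn, fun x hx => h x fun h0 => hx (by simp [h0])⟩
  decay N := by
    obtain ⟨C, hC, h⟩ := hf.decay N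
    refine ⟨‖c‖ * C, by positivity, fun x => ?_⟩
    rw [Pi.smul_apply, norm_smul, mul_assoc]
    exact mul_le_mul_of_nonneg_left (h x) (norm_nonneg _)

theorem isRapid_of_mem {f : V2 Adele → ℂ} (hf : f ∈ SchwartzBruhat) : IsRapid f := by
  refine Submodule.span_induction ?_ isRapid_zero (fun _ _ _ _ h h' => h.add h')
    (fun c _ _ h => h.smul c) hf
  rintro f ⟨a, b, hb, hbc, hfab⟩
  have hfe : f = fun x => a (fun k i j => (x k i j).1) * b (fun k => Matrix.of fun i j => (x k i j).2) :=
    funext hfab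
  refine ⟨?_, ?_, fun N => ?_⟩
  · rw [hfe]
    refine (a.continuous.comp ?_).mul (hb.continuous.comp ?_)
    · exact continuous_pi fun k => continuous_pi fun i => continuous_pi fun j =>
        continuous_fst.comp ((continuous_apply j).comp ((continuous_apply i).comp (continuous_apply k)))
    · exact continuous_pi fun k => continuous_pi fun i => continuous_pi fun j =>
        continuous_snd.comp ((continuous_apply j).comp ((continuous_apply i).comp (continuous_apply k)))
  · obtain ⟨n, hn, h⟩ := exists_denominator_of_isCompact hbc
    refine ⟨n, hn, fun x hx k i j => ?_⟩
    have hbx : b (fun k => Matrix.of fun i j => (x k i j).2) ≠ 0 := fun h0 => hx (by rw [hfab, h0, mul_zero])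
    exact h _ (subset_tsupport _ hbx) k i j
  · obtain ⟨Cb, hCb⟩ : ∃ C, ∀ y, ‖b y‖ ≤ C := hbc.exists_bound_of_continuous hb.continuous
    have hCb0 : 0 ≤ Cb := (norm_nonneg _).trans (hCb 0)
    have hs := a.one_add_le_sup_seminorm_apply (𝕜 := ℝ) (m := (N, 0)) (k := N) (n := 0) le_rfl le_rfl
    set S : ℝ := 2 ^ (N, 0).1 * (Finset.Iic (N, 0)).sup (fun m => SchwartzMap.seminorm ℝ m.1 m.2) a
    -- `8 ^ N` compares the sum of the eight coordinates with the supremum norm.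
    refine ⟨8 ^ N * max S 0 * Cb, by positivity, fun x => ?_⟩
    have hx := hs fun k i j => (x k i j).1
    rw [norm_iteratedFDeriv_zero] at hx
    set z : Fin 2 → Fin 2 → Fin 2 → ℝ := fun k i j => (x k i j).1 with hz
    have h1 : sizeV x ≤ 8 * (1 + ‖z‖) := by
      have : sizeV x ≤ 1 + 8 * ‖z‖ := sizeV_le fun k i j =>
        ((norm_le_pi_norm (z k i) j).trans (norm_le_pi_norm (z k) i)).trans (norm_le_pi_norm z k)
      linarith
    have h0 := one_le_sizeV x
    rw [hfab, norm_mul, ← div_eq_mul_inv, le_div_iff₀ (by positivity)]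
    calc _ ≤ ‖a z‖ * Cb * (8 * (1 + ‖z‖)) ^ N := by
          refine mul_le_mul (mul_le_mul_of_nonneg_left (hCb _) (norm_nonneg _)) ?_ (by positivity)
            (by positivity)
          exact pow_le_pow_left₀ (by positivity) h1 N
      _ = 8 ^ N * ((1 + ‖z‖) ^ N * ‖a z‖) * Cb := by rw [mul_pow]; ring
      _ ≤ _ := by
          gcongr
          exact hx.trans (le_max_left _ _)

end Schwartz

/-! ### Functions on `H₁(𝔸)` -/

section Representatives

noncomputable abbrev scalarGL (z : Adeleˣ) : GL2 Adele := Matrix.GeneralLinearGroup.scalar (Fin 2) z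

theorem scalarGL_val_apply (z : Adeleˣ) (g : GL2 Adele) (i j : Fin 2) :
    (scalarGL z * g).val i j = (z : Adele) * g.val i j := by
  change (Matrix.scalar (Fin 2) (z : Adele) * g.val) i j = _
  simp

theorem scalarGL_mul_comm (z : Adeleˣ) (g : GL2 Adele) : scalarGL z * g = g * scalarGL z :=
  Matrix.GeneralLinearGroup.scalar_commute z g

/-- The chosen representative is known only up to a common scalar; hence every function evaluated at
`H1.rep` below is shown to be invariant under such scalars. -/
theorem exists_rep_mk (p : PairsEqDet Adele) :
    ∃ z : Adeleˣ, H1.rep (H1.mk p) = (scalarGL z * p.1.1, scalarGL z * p.1.2) := by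
  have h : QuotientGroup.leftRel (scalarPairs Adele) p (Quotient.out (H1.mk p)) :=
    Setoid.symm' _ (Quotient.mk_out p)
  rw [QuotientGroup.leftRel_apply] at h
  obtain ⟨z, hz⟩ := h
  refine ⟨z, ?_⟩
  have e : Quotient.out (H1.mk p) = p * (diagPair Adele) (scalarGL z) := by
    rw [eq_comm, ← eq_inv_mul_iff_mul_eq]
    exact hz
  have e2 : H1.rep (H1.mk p) = (p * (diagPair Adele) (scalarGL z)).1 := congrArg Subtype.val e
  rw [e2, scalarGL_mul_comm, scalarGL_mul_comm]
  rfl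

theorem exists_mk_eq (h : H1) : ∃ p : PairsEqDet Adele, p.1 = h.rep ∧ H1.mk p = h :=
  ⟨Quotient.out (s := QuotientGroup.leftRel (scalarPairs Adele)) h, rfl, Quotient.out_eq h⟩

theorem mk_scalar_mul (z : Adeleˣ) (p : PairsEqDet Adele) :
    H1.mk (diagPair Adele (scalarGL z) * p) = H1.mk p := by
  rw [map_mul, mul_eq_right]
  exact (QuotientGroup.eq_one_iff _).2 ⟨z, rfl⟩

variable {β : Type*}

theorem rep_mk_of_invariant {F : GL2 Adele × GL2 Adele → β}
    (hF : ∀ z g g', F (scalarGL z * g, scalarGL z * g') = F (g, g')) (p : PairsEqDet Adele) :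
    F (H1.rep (H1.mk p)) = F p.1 := by
  obtain ⟨z, hz⟩ := exists_rep_mk p
  rw [hz, hF]

/-- `H1.rep` itself need not be continuous, but an invariant function descends along the quotient
map. Openness of that map keeps the product with `X` a quotient map. -/
theorem continuous_rep_of_invariant {X : Type*} [TopologicalSpace X] [TopologicalSpace β]
    {F : X → GL2 Adele × GL2 Adele → β} (hc : Continuous fun t : X × (GL2 Adele × GL2 Adele) => F t.1 t.2)
    (hF : ∀ x z g g', F x (scalarGL z * g, scalarGL z * g') = F x (g, g')) :
    Continuous fun t : X × H1 => F t.1 t.2.rep := by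
  have hq : IsOpenQuotientMap (Prod.map (id : X → X) H1.mk) :=
    IsOpenQuotientMap.id.prodMap isOpenQuotientMap_H1mk
  rw [hq.isQuotientMap.continuous_iff]
  have : (fun t : X × H1 => F t.1 t.2.rep) ∘ Prod.map id H1.mk = fun t => F t.1 t.2.1 := by
    funext t
    exact rep_mk_of_invariant (hF t.1) t.2
  rw [this]
  exact hc.comp (continuous_fst.prodMk (continuous_subtype_val.comp continuous_snd))

theorem continuous_rep_of_invariant' [TopologicalSpace β] {F : GL2 Adele × GL2 Adele → β}
    (hc : Continuous F) (hF : ∀ z g g', F (scalarGL z * g, scalarGL z * g') = F (g, g')) :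
    Continuous fun h : H1 => F h.rep :=
  (continuous_rep_of_invariant (X := Unit) (F := fun _ => F) (hc.comp continuous_snd)
    fun _ => hF).comp (continuous_const.prodMk continuous_id : Continuous fun h : H1 => ((), h))

theorem rep_mul_of_invariant {F : GL2 Adele × GL2 Adele → β}
    (hF : ∀ z g g', F (scalarGL z * g, scalarGL z * g') = F (g, g')) (p : PairsEqDet Adele) (h : H1) :
    F (H1.rep (H1.mk p * h)) = F (p.1.1 * h.rep.1, p.1.2 * h.rep.2) := by
  obtain ⟨q, hq, rfl⟩ := exists_mk_eq h
  rw [← map_mul, rep_mk_of_invariant hF, ← hq]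
  rfl

theorem rep_mul_of_invariant' {F : GL2 Adele × GL2 Adele → β}
    (hF : ∀ z g g', F (scalarGL z * g, scalarGL z * g') = F (g, g')) (p : PairsEqDet Adele) (h : H1) :
    F (H1.rep (h * H1.mk p)) = F (h.rep.1 * p.1.1, h.rep.2 * p.1.2) := by
  obtain ⟨q, hq, rfl⟩ := exists_mk_eq h
  rw [← map_mul, rep_mk_of_invariant hF, ← hq]
  rfl

theorem torusD_eq (a : Adeleˣ) : torusD a = H1.mk (diagPair Adele (diagOne Adele a)) := rfl

theorem diagPair_fst (g : GL2 Adele) : ((diagPair Adele) g).1.1 = g := rfl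

theorem diagPair_snd (g : GL2 Adele) : ((diagPair Adele) g).1.2 = g := rfl

theorem continuous_torusD : Continuous torusD := by
  refine continuous_H1mk.comp ?_
  exact Continuous.subtype_mk (continuous_diagOne.prodMk continuous_diagOne) _

end Representatives

/-- The properties of cusp forms that are used: continuity, invariance, and decay. -/
structure IsDecaying (χ : Adeleˣ →* ℂˣ) (φ : GL2 Adele → ℂ) : Prop where
  continuous : Continuous φ
  left_invariant : ∀ (γ : GL2 ℚ) g, φ (ratGL γ * g) = φ g
  central : ∀ z g, φ (scalarGL z * g) = (χ z : ℂ) * φ g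
  hasDecay : HasDecay φ

theorem IsCuspForm.isDecaying {dx : Measure AdeleModRat} [dx.IsAddHaarMeasure]
    [IsProbabilityMeasure dx] {χ : Adeleˣ →* ℂˣ} {φ : GL2 Adele → ℂ} (hφ : IsCuspForm dx χ φ) :
    IsDecaying χ φ :=
  ⟨hφ.continuous, hφ.left_invariant, hφ.central, hφ.hasDecay⟩

theorem IsDecaying.mul_right {χ : Adeleˣ →* ℂˣ} {φ : GL2 Adele → ℂ} (hφ : IsDecaying χ φ)
    (g : GL2 Adele) : IsDecaying χ fun h => φ (h * g) :=
  ⟨hφ.continuous.comp (continuous_mul_const g), fun γ h => by rw [mul_assoc, hφ.left_invariant],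
    fun z h => by rw [mul_assoc, hφ.central], hφ.hasDecay.mul_right g⟩

/-! ### A set of representatives for `D(𝔸) \ H₁(𝔸)`, up to a compact set -/

section CuspBox

/-- The square of the norm of the bottom row at a prime. -/
noncomputable def rowSq (v : HeightOneSpectrum ℤ) (g : GL2 Adele) : ℝ :=
  max (vnorm v ((g.val 1 0).2 v)) (vnorm v ((g.val 1 1).2 v)) ^ 2

noncomputable def detNorm (v : HeightOneSpectrum ℤ) (g : GL2 Adele) : ℝ := vnorm v ((g.val.det).2 v)

/-- All conditions are invariant under scalars. Multiplication by `diag(a, 1)` leaves `rowSq`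
unchanged, multiplies `detNorm` by `|a_v|` and `invIm` by `|a_∞|⁻¹`, so the conditions confine `a`
to a compact set. The interval `[1, 2]` instead of a point makes that set one of positive measure.
-/
def cuspBox : Set (GL2 Adele) :=
  {g | (1 ≤ invIm (realPart g) ∧ invIm (realPart g) ≤ 2) ∧ ∀ v, rowSq v g = detNorm v g}

theorem vnorm_idele_ne_zero (a : Adeleˣ) (v : HeightOneSpectrum ℤ) : vnorm v ((a : Adele).2 v) ≠ 0 :=
  fun h => by
    have := vnorm_finite_idele (finIdele a) v
    rw [finIdele_val, h, zero_mul] at this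
    exact zero_ne_one this

theorem detNorm_ne_zero (v : HeightOneSpectrum ℤ) (g : GL2 Adele) : detNorm v g ≠ 0 :=
  vnorm_idele_ne_zero (Matrix.GeneralLinearGroup.det g) v

theorem detNorm_mul (v : HeightOneSpectrum ℤ) (g g' : GL2 Adele) :
    detNorm v (g * g') = detNorm v g * detNorm v g' := by
  rw [detNorm, Units.val_mul, Matrix.det_mul]
  exact vnorm_mul _ _ _

theorem rowSq_scalar_mul (v : HeightOneSpectrum ℤ) (z : Adeleˣ) (g : GL2 Adele) :
    rowSq v (scalarGL z * g) = vnorm v ((z : Adele).2 v) ^ 2 * rowSq v g := by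
  rw [rowSq, scalarGL_val_apply, scalarGL_val_apply]
  change max (vnorm v ((z : Adele).2 v * (g.val 1 0).2 v)) (vnorm v ((z : Adele).2 v * (g.val 1 1).2 v)) ^ 2 = _
  rw [vnorm_mul, vnorm_mul, ← mul_max_of_nonneg _ _ (vnorm_nonneg _ _), mul_pow, rowSq]

theorem detNorm_scalar (v : HeightOneSpectrum ℤ) (z : Adeleˣ) :
    detNorm v (scalarGL z) = vnorm v ((z : Adele).2 v) ^ 2 := by
  have : (scalarGL z).val.det = z * z := by
    change (Matrix.scalar (Fin 2) (z : Adele)).det = _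
    simp [sq]
  rw [detNorm, this, sq]
  exact vnorm_mul _ _ _

theorem rowSq_diagOne_mul (v : HeightOneSpectrum ℤ) (a : Adeleˣ) (g : GL2 Adele) :
    rowSq v (diagOne Adele a * g) = rowSq v g := by
  have h : ∀ j, (diagOne Adele a * g).val 1 j = g.val 1 j := fun j => by
    rw [Units.val_mul, diagOne_val, Matrix.mul_apply, Fin.sum_univ_two]
    simp
  rw [rowSq, h, h, rowSq]

theorem detNorm_diagOne (v : HeightOneSpectrum ℤ) (a : Adeleˣ) :
    detNorm v (diagOne Adele a) = vnorm v ((a : Adele).2 v) := by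
  have : (diagOne Adele a).val.det = a := by
    rw [diagOne_val]
    simp [Matrix.det_fin_two]
  rw [detNorm, this]

theorem invIm_scalar_mul (z : Adeleˣ) (g : GL2 Adele) :
    invIm (realPart (scalarGL z * g)) = invIm (realPart g) := by
  have h : ∀ i j, (realPart (scalarGL z * g)).val i j = (z : Adele).1 * (realPart g).val i j :=
    fun i j => congrArg Prod.fst (scalarGL_val_apply z g i j)
  have hz : (z : Adele).1 ≠ 0 := (realUnit z).ne_zero
  unfold invIm
  rw [Matrix.det_fin_two, Matrix.det_fin_two]
  simp only [h]
  rw [show ∀ a b c d t : ℝ, t * a * (t * d) - t * b * (t * c) = t ^ 2 * (a * d - b * c) by intros; ring,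
    abs_mul, abs_of_nonneg (sq_nonneg _), mul_pow, mul_pow, ← mul_add,
    mul_div_mul_left _ _ (pow_ne_zero 2 hz)]

theorem invIm_diagOne_mul' (a : Adeleˣ) (g : GL2 Adele) :
    invIm (realPart (diagOne Adele a * g)) = |(a : Adele).1|⁻¹ * invIm (realPart g) := by
  have hz : (a : Adele).1 ≠ 0 := (realUnit a).ne_zero
  have e : realPart (diagOne Adele a * g) = diagOne ℝ (realUnit a) * realPart g := by
    rw [map_mul, diagOne_adele, realPart_glProd]
  rw [e]
  unfold invIm
  rw [Units.val_mul, Matrix.det_mul, diagOne_val, realUnit_val]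
  simp [Matrix.mul_apply, Fin.sum_univ_two, Matrix.det_fin_two, abs_mul]
  field_simp

theorem scalar_mul_mem_cuspBox (z : Adeleˣ) (g : GL2 Adele) : scalarGL z * g ∈ cuspBox ↔ g ∈ cuspBox := by
  unfold cuspBox
  simp only [Set.mem_ofPred_eq, invIm_scalar_mul, rowSq_scalar_mul, detNorm_mul, detNorm_scalar]
  refine and_congr_right fun _ => forall_congr' fun v => ?_
  rw [mul_right_inj' (pow_ne_zero 2 (vnorm_idele_ne_zero z v))]

theorem continuous_entry (i j : Fin 2) : Continuous fun g : GL2 Adele => g.val i j :=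
  Units.continuous_val.matrix_elem i j

theorem continuous_entry_place (v : HeightOneSpectrum ℤ) (i j : Fin 2) :
    Continuous fun g : GL2 Adele => vnorm v ((g.val i j).2 v) :=
  (continuous_vnorm v).comp ((continuous_finAdele_apply v).comp (continuous_snd.comp (continuous_entry i j)))

theorem continuous_rowSq (v : HeightOneSpectrum ℤ) : Continuous (rowSq v) :=
  ((continuous_entry_place v 1 0).max (continuous_entry_place v 1 1)).pow 2

theorem continuous_detNorm (v : HeightOneSpectrum ℤ) : Continuous (detNorm v) :=
  (continuous_vnorm v).comp ((continuous_finAdele_apply v).comp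
    (continuous_snd.comp (Continuous.matrix_det Units.continuous_val)))

theorem continuous_invIm : Continuous invIm := by
  have h : ∀ i j, Continuous fun x : GL2 ℝ => x.val i j := fun i j =>
    Units.continuous_val.matrix_elem i j
  have hd : Continuous fun x : GL2 ℝ => x.val.det := Continuous.matrix_det Units.continuous_val
  refine (((h 1 0).pow 2).add ((h 1 1).pow 2)).div hd.abs fun x => ?_
  exact abs_ne_zero.2 (Matrix.GeneralLinearGroup.det x).ne_zero

theorem isClosed_cuspBox : IsClosed cuspBox := by
  have hc := continuous_invIm.comp continuous_realPart
  have e : cuspBox = (invIm ∘ realPart) ⁻¹' Set.Icc 1 2 ∩ ⋂ v, {g | rowSq v g = detNorm v g} := by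
    ext g
    simp only [cuspBox, Set.mem_inter_iff, Set.mem_iInter, Set.mem_preimage, Set.mem_Icc,
      Function.comp_apply, Set.mem_ofPred_eq]
  rw [e]
  exact (isClosed_Icc.preimage hc).inter
    (isClosed_iInter fun v => isClosed_eq (continuous_rowSq v) (continuous_detNorm v))

/-- The elements of `H₁(𝔸)` whose second component lies in `cuspBox`. -/
def boxH : Set H1 := {h | h.rep.2 ∈ cuspBox}

theorem mk_mem_boxH (p : PairsEqDet Adele) : H1.mk p ∈ boxH ↔ p.1.2 ∈ cuspBox :=
  iff_of_eq (rep_mk_of_invariant (F := fun g => g.2 ∈ cuspBox)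
    (fun z _ g' => propext (scalar_mul_mem_cuspBox z g')) p)

theorem isClosed_boxH : IsClosed boxH := by
  rw [← isOpenQuotientMap_H1mk.isQuotientMap.isClosed_preimage]
  have : H1.mk ⁻¹' boxH = (fun p : PairsEqDet Adele => p.1.2) ⁻¹' cuspBox := by
    ext p
    exact mk_mem_boxH p
  rw [this]
  exact isClosed_cuspBox.preimage (continuous_snd.comp continuous_subtype_val)

theorem torusD_mul_mem_boxH (a : Adeleˣ) (h : H1) :
    torusD a * h ∈ boxH ↔ diagOne Adele a * h.rep.2 ∈ cuspBox :=
  iff_of_eq (rep_mul_of_invariant (F := fun g => g.2 ∈ cuspBox)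
    (fun z _ g' => propext (scalar_mul_mem_cuspBox z g')) _ h)

/-- Rows of an invertible integral matrix are primitive: the bottom row pairs with a column of the
inverse to give `1`. -/
theorem max_vnorm_row_eq_one {k : GL2 FinAdele} (hk : k ∈ GLZhat) (v : HeightOneSpectrum ℤ) :
    max (vnorm v (k.val 1 0 v)) (vnorm v (k.val 1 1 v)) = 1 := by
  have hi : ∀ i j, vnorm v (k.val i j v) ≤ 1 := fun i j => mem_Zhat.1 (hk.1 i j) v
  refine le_antisymm (max_le (hi 1 0) (hi 1 1)) ?_
  have h1 : (k.val * k⁻¹.val) 1 1 = 1 := by rw [Units.mul_inv]; rfl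
  rw [Matrix.mul_apply, Fin.sum_univ_two] at h1
  have h2 : k.val 1 0 v * k⁻¹.val 0 1 v + k.val 1 1 v * k⁻¹.val 1 1 v = 1 :=
    congrArg (fun a : FinAdele => a v) h1
  have h3 := vnorm_add_le v (k.val 1 0 v * k⁻¹.val 0 1 v) (k.val 1 1 v * k⁻¹.val 1 1 v)
  rw [h2, vnorm_one, vnorm_mul, vnorm_mul] at h3
  refine h3.trans (max_le_max ?_ ?_)
  · exact mul_le_of_le_one_right (vnorm_nonneg _ _) (mem_Zhat.1 (hk.2 0 1) v)
  · exact mul_le_of_le_one_right (vnorm_nonneg _ _) (mem_Zhat.1 (hk.2 1 1) v)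

/-- Iwasawa decomposition at the finite places, in terms of entries. -/
theorem exists_iwasawa_entries (g : GL2 FinAdele) : ∃ (α δ : FinAdeleˣ) (β : FinAdele),
    ∃ k ∈ GLZhat, g.val = !![(α : FinAdele), β; 0, (δ : FinAdele)] * k.val ∧
      g.val.det = (α * δ : FinAdeleˣ) := by
  obtain ⟨k, hk, hdet, h0⟩ := exists_iwasawa g
  set t := g * k⁻¹ with ht
  have hd : t.val 0 0 * t.val 1 1 = (Matrix.GeneralLinearGroup.det t : FinAdeleˣ) := by
    change _ = t.val.det
    rw [Matrix.det_fin_two, h0]; ring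
  have hu : IsUnit (t.val 0 0 * t.val 1 1) := hd ▸ Units.isUnit _
  obtain ⟨⟨α, hα⟩, ⟨δ, hδ⟩⟩ := IsUnit.mul_iff.1 hu
  have htv : t.val = !![(α : FinAdele), t.val 0 1; 0, (δ : FinAdele)] := by
    rw [hα, hδ, ← h0]
    exact Matrix.eta_fin_two _
  refine ⟨α, δ, t.val 0 1, k, hk, ?_, ?_⟩
  · rw [← htv, ← Units.val_mul, ht, inv_mul_cancel_right]
  · have : g.val = t.val * k.val := by rw [← Units.val_mul, ht, inv_mul_cancel_right]
    rw [this, Matrix.det_mul, hdet, mul_one, htv]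
    simp [Matrix.det_fin_two]

theorem rowSq_of_iwasawa {g : GL2 Adele} {α δ : FinAdeleˣ} {β : FinAdele} {k : GL2 FinAdele}
    (hk : k ∈ GLZhat) (h : (finPart g).val = !![(α : FinAdele), β; 0, (δ : FinAdele)] * k.val)
    (v : HeightOneSpectrum ℤ) : rowSq v g = vnorm v ((δ : FinAdele) v) ^ 2 := by
  have e : ∀ j, (g.val 1 j).2 = δ * k.val 1 j := fun j => by
    change (finPart g).val 1 j = _
    rw [h, Matrix.mul_apply, Fin.sum_univ_two]
    simp
  rw [rowSq, e, e, FinAdele.mul_apply, FinAdele.mul_apply, vnorm_mul, vnorm_mul,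
    ← mul_max_of_nonneg _ _ (vnorm_nonneg _ _), max_vnorm_row_eq_one hk, mul_one]

theorem det_finPart (g : GL2 Adele) : (finPart g).val.det = (g.val.det).2 := by
  rw [Matrix.det_fin_two, Matrix.det_fin_two]
  rfl

/-- The idele with given components. -/
noncomputable def ideleOf (r : ℝˣ) (s : FinAdeleˣ) : Adeleˣ := MulEquiv.prodUnits.symm (r, s)

theorem ideleOf_val (r : ℝˣ) (s : FinAdeleˣ) : (ideleOf r s : Adele) = ((r : ℝ), (s : FinAdele)) := rfl

theorem invIm_pos (x : GL2 ℝ) : 0 < invIm x := by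
  have hd : x.val.det ≠ 0 := (Matrix.GeneralLinearGroup.det x).ne_zero
  refine div_pos ?_ (abs_pos.2 hd)
  by_contra h
  have h0 : x.val 1 0 = 0 := by nlinarith [sq_nonneg (x.val 1 0), sq_nonneg (x.val 1 1)]
  have h1 : x.val 1 1 = 0 := by nlinarith [sq_nonneg (x.val 1 0), sq_nonneg (x.val 1 1)]
  exact hd (by rw [Matrix.det_fin_two, h0, h1]; ring)

/-- In terms of the Iwasawa diagonal `(α, δ)`, the conditions `|δ|² = |a α δ|` at all primes are
solved by `a = δ α⁻¹`; the real component is `invIm`. -/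
theorem exists_torus_normalization (g : GL2 Adele) : ∃ a : Adeleˣ,
    invIm (realPart (diagOne Adele a * g)) = 1 ∧
      ∀ v, rowSq v (diagOne Adele a * g) = detNorm v (diagOne Adele a * g) := by
  obtain ⟨α, δ, β, k, hk, hg, hdet⟩ := exists_iwasawa_entries (finPart g)
  have hI := invIm_pos (realPart g)
  refine ⟨ideleOf (Units.mk0 _ hI.ne') (δ * α⁻¹), ?_, fun v => ?_⟩
  · rw [invIm_diagOne_mul', ideleOf_val]
    simp only [Units.val_mk0]
    rw [abs_of_pos hI, inv_mul_cancel₀ hI.ne']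
  · rw [rowSq_diagOne_mul, detNorm_mul, detNorm_diagOne, rowSq_of_iwasawa hk hg, ideleOf_val]
    have e : detNorm v g = vnorm v ((α : FinAdele) v) * vnorm v ((δ : FinAdele) v) := by
      rw [detNorm, ← det_finPart, hdet, Units.val_mul, FinAdele.mul_apply, vnorm_mul]
    rw [e]
    change _ = vnorm v (((δ : FinAdele) * (α⁻¹ : FinAdeleˣ)) v) * _
    rw [FinAdele.mul_apply, vnorm_mul]
    have := vnorm_finite_idele α v
    linear_combination (-(vnorm v ((δ : FinAdele) v) ^ 2)) * this

/-- The torus elements that preserve the normalization up to the factor `[1, 2]`. -/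
def torusBox : Set Adeleˣ :=
  {a | a ∈ unitIdeles ∧ 1 ≤ |(a : Adele).1|⁻¹ ∧ |(a : Adele).1|⁻¹ ≤ 2}

theorem measure_torusBox_ne_zero (da : Measure Adeleˣ) [da.IsHaarMeasure] : da torusBox ≠ 0 := by
  set O : Set Adeleˣ := (unitIdeles : Set Adeleˣ) ∩ (fun a : Adeleˣ => |(a⁻¹ : Adeleˣ).1.1|) ⁻¹' Set.Ioo 1 2
  have hO : IsOpen O := isOpen_unitIdeles.inter (isOpen_Ioo.preimage
    (continuous_fst.comp (Units.continuous_val.comp continuous_inv)).abs)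
  have hsub : O ⊆ torusBox := by
    rintro a ⟨h, h1, h2⟩
    simp only [fst_inv, abs_inv] at h1 h2
    exact ⟨h, h1.le, h2.le⟩
  have hne : O.Nonempty := by
    refine ⟨(ideleOf (Units.mk0 (3 / 2) (by norm_num)) 1)⁻¹, unitIdeles.inv_mem ⟨Zhat.one_mem, ?_⟩, ?_⟩
    · change (((1 : FinAdeleˣ)⁻¹ : FinAdeleˣ) : FinAdele) ∈ Zhat
      rw [inv_one]; exact Zhat.one_mem
    · rw [Set.mem_preimage, inv_inv, ideleOf_val]
      norm_num [abs_of_pos]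
  exact fun h => (hO.measure_pos da hne).ne' (measure_mono_null hsub h)

theorem measure_torusBox_ne_top (da : Measure Adeleˣ) [da.IsHaarMeasure] : da torusBox ≠ ⊤ := by
  -- The two signs of the real component give the inverses of `unitBox` and their negatives.
  have hc : IsCompact ((fun a : Adeleˣ => a⁻¹) '' unitBox ∪ (fun a : Adeleˣ => -1 * a⁻¹) '' unitBox) :=
    (isCompact_unitBox.image continuous_inv).union
      (isCompact_unitBox.image ((continuous_const_mul _).comp continuous_inv))
  refine ((measure_mono ?_).trans_lt hc.measure_lt_top).ne
  rintro a ⟨h, h1, h2⟩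
  have ha : (a : Adele).1 ≠ 0 := (realUnit a).ne_zero
  rcases lt_or_gt_of_ne ha with hneg | hpos
  · right
    refine ⟨-1 * a⁻¹, ⟨⟨?_, ?_⟩, ?_, ?_⟩, by simp⟩
    · change 0 < (-1 : ℝ) * (a⁻¹ : Adeleˣ).1.1
      rw [fst_inv]
      have := inv_lt_zero.2 hneg
      linarith
    · refine unitIdeles.mul_mem ⟨?_, ?_⟩ (unitIdeles.inv_mem h)
      · exact Zhat.neg_mem Zhat.one_mem
      · rw [inv_neg, inv_one]; exact Zhat.neg_mem Zhat.one_mem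
    · change 1 ≤ (-1 : ℝ) * (a⁻¹ : Adeleˣ).1.1
      rw [fst_inv]
      rw [abs_of_neg hneg, inv_neg] at h1
      linarith
    · change (-1 : ℝ) * (a⁻¹ : Adeleˣ).1.1 ≤ 2
      rw [fst_inv]
      rw [abs_of_neg hneg, inv_neg] at h2
      linarith
  · left
    rw [abs_of_pos hpos] at h1 h2
    refine ⟨a⁻¹, ⟨posIdeles.inv_mem ⟨hpos, h⟩, ?_, ?_⟩, inv_inv a⟩
    · rw [fst_inv]; exact h1
    · rw [fst_inv]; exact h2

/-- On each `D(𝔸)`-coset the set is a translate of `torusBox`, so its measure does not depend on the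
coset. -/
theorem measure_torusD_mul_mem_boxH (da : Measure Adeleˣ) [da.IsHaarMeasure] (h : H1) :
    da {a | torusD a * h ∈ boxH} = da torusBox := by
  obtain ⟨a₀, h1, h2⟩ := exists_torus_normalization h.rep.2
  rw [← measure_preimage_mul da a₀⁻¹ torusBox]
  congr 1
  ext a
  rw [Set.mem_ofPred_eq, torusD_mul_mem_boxH, Set.mem_preimage]
  have e : diagOne Adele a * h.rep.2 = diagOne Adele (a₀⁻¹ * a) * (diagOne Adele a₀ * h.rep.2) := by
    rw [← mul_assoc, ← map_mul, mul_assoc, mul_comm a, inv_mul_cancel_left]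
  rw [e]
  set b := a₀⁻¹ * a
  unfold cuspBox torusBox
  rw [Set.mem_ofPred_eq, Set.mem_ofPred_eq, invIm_diagOne_mul', h1, mul_one, and_comm,
    mem_unitIdeles_iff_vnorm]
  refine and_congr_left fun _ => forall_congr' fun v => ?_
  rw [rowSq_diagOne_mul, detNorm_mul, h2 v, detNorm_diagOne]
  constructor
  · intro hb
    exact mul_right_cancel₀ (detNorm_ne_zero v (diagOne Adele a₀ * h.rep.2)) (by rw [one_mul]; exact hb.symm)
  · intro hb
    rw [hb, one_mul]

/-- A weight on `H₁(𝔸)` with integral `1` over all `D(𝔸)`-cosets. -/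
noncomputable def weight (da : Measure Adeleˣ) (h : H1) : ℝ≥0∞ :=
  boxH.indicator (fun _ => (da torusBox)⁻¹) h

theorem measurable_weight (da : Measure Adeleˣ) : Measurable (weight da) :=
  measurable_const.indicator isClosed_boxH.measurableSet

theorem weight_lt_top (da : Measure Adeleˣ) [da.IsHaarMeasure] (h : H1) : weight da h < ⊤ := by
  unfold weight
  by_cases hh : h ∈ boxH
  · rw [Set.indicator_of_mem hh]
    exact ENNReal.inv_lt_top.2 (pos_iff_ne_zero.2 (measure_torusBox_ne_zero da))
  · rw [Set.indicator_of_notMem hh]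
    exact ENNReal.zero_lt_top

theorem lintegral_weight (da : Measure Adeleˣ) [da.IsHaarMeasure] (h : H1) :
    ∫⁻ a, weight da (torusD a * h) ∂da = 1 := by
  have hm : MeasurableSet {a | torusD a * h ∈ boxH} :=
    (isClosed_boxH.preimage (continuous_torusD.mul continuous_const)).measurableSet
  have e : (fun a => weight da (torusD a * h)) =
      {a | torusD a * h ∈ boxH}.indicator fun _ => (da torusBox)⁻¹ := rfl
  rw [e, lintegral_indicator hm, lintegral_const, Measure.restrict_apply_univ,
    measure_torusD_mul_mem_boxH]
  exact ENNReal.inv_mul_cancel (measure_torusBox_ne_zero da) (measure_torusBox_ne_top da)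

end CuspBox

/-! ### The action of `H₁` on `V²` -/

section Action

/-- The two diagonal idempotents. -/
abbrev idemFst (R : Type*) [CommRing R] : Matrix (Fin 2) (Fin 2) R := !![1, 0; 0, 0]

abbrev idemSnd (R : Type*) [CommRing R] : Matrix (Fin 2) (Fin 2) R := !![0, 0; 0, 1]

/-- `x ↦ h₁⁻¹ x h₂` on `V(R)²`. -/
def actInv {R : Type*} [CommRing R] (h : GL2 R × GL2 R) (x : V2 R) : V2 R :=
  fun k => h.1⁻¹.val * x k * h.2.val

theorem actInv_mul {R : Type*} [CommRing R] (g h : GL2 R × GL2 R) (x : V2 R) :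
    actInv (g * h) x = actInv h (actInv g x) := by
  funext k
  simp only [actInv, Prod.fst_mul, Prod.snd_mul, _root_.mul_inv_rev, Units.val_mul, Matrix.mul_assoc]

theorem actInv_one {R : Type*} [CommRing R] (x : V2 R) : actInv (1 : GL2 R × GL2 R) x = x := by
  funext k
  simp [actInv]

theorem actInv_scalar (z : Adeleˣ) (x : V2 Adele) : actInv (scalarGL z, scalarGL z) x = x := by
  funext k
  have h : x k * (scalarGL z).val = (scalarGL z).val * x k := by
    refine Matrix.ext fun i j => ?_
    change (x k * Matrix.scalar (Fin 2) (z : Adele)) i j = (Matrix.scalar (Fin 2) (z : Adele) * x k) i j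
    rw [Matrix.scalar_apply, Matrix.mul_diagonal, Matrix.diagonal_mul, mul_comm]
  rw [actInv, Matrix.mul_assoc, h, ← Matrix.mul_assoc, Units.inv_mul, Matrix.one_mul]

theorem actInv_scalar_mul (z : Adeleˣ) (g g' : GL2 Adele) (x : V2 Adele) :
    actInv (scalarGL z * g, scalarGL z * g') x = actInv (g, g') x := by
  have := actInv_mul (scalarGL z, scalarGL z) (g, g') x
  rwa [actInv_scalar] at this

theorem continuous_actInv : Continuous fun t : (GL2 Adele × GL2 Adele) × V2 Adele => actInv t.1 t.2 := by
  refine continuous_pi fun k => ?_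
  refine Continuous.matrix_mul (Continuous.matrix_mul ?_ ?_) ?_
  · exact Units.continuous_val.comp (continuous_inv.comp (continuous_fst.comp continuous_fst))
  · exact (continuous_apply k).comp continuous_snd
  · exact Units.continuous_val.comp (continuous_snd.comp continuous_fst)

theorem actInv_fst (h : GL2 Adele × GL2 Adele) (x : V2 Adele) (k i j : Fin 2) :
    (actInv h x k i j).1 =
      ((realPart h.1)⁻¹.val * (x k).map Prod.fst * (realPart h.2).val) i j := by
  have : ((actInv h x k).map (RingHom.fst ℝ FinAdele)) =
      (realPart h.1)⁻¹.val * (x k).map Prod.fst * (realPart h.2).val := by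
    rw [actInv, Matrix.map_mul, Matrix.map_mul, ← map_inv]
    rfl
  exact congrFun (congrFun this i) j

theorem actInv_snd (h : GL2 Adele × GL2 Adele) (x : V2 Adele) (k i j : Fin 2) :
    (actInv h x k i j).2 =
      ((finPart h.1)⁻¹.val * (x k).map Prod.snd * (finPart h.2).val) i j := by
  have : ((actInv h x k).map (RingHom.snd ℝ FinAdele)) =
      (finPart h.1)⁻¹.val * (x k).map Prod.snd * (finPart h.2).val := by
    rw [actInv, Matrix.map_mul, Matrix.map_mul, ← map_inv]
    rfl
  exact congrFun (congrFun this i) j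

theorem inv_val_of_det_eq_one {R : Type*} [CommRing R] {g : GL2 R} (h : g.val.det = 1) :
    g⁻¹.val = !![g.val 1 1, -g.val 0 1; -g.val 1 0, g.val 0 0] := by
  have h1 : g.val.adjugate * g.val = 1 := by rw [Matrix.adjugate_mul, h, one_smul]
  rw [← Matrix.adjugate_fin_two]
  calc g⁻¹.val = g.val.adjugate * g.val * g⁻¹.val := by rw [h1, Matrix.one_mul]
    _ = _ := by rw [Matrix.mul_assoc, Units.mul_inv, Matrix.mul_one]

theorem add_projections {R : Type*} [CommRing R] (g h : Matrix (Fin 2) (Fin 2) R) :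
    g * !![1, 0; 0, 0] * h + g * !![0, 0; 0, 1] * h = g * h := by
  rw [← Matrix.add_mul, ← Matrix.mul_add]
  have : (!![1, 0; 0, 0] + !![0, 0; 0, 1] : Matrix (Fin 2) (Fin 2) R) = 1 := by
    ext i j
    fin_cases i <;> fin_cases j <;> simp
  rw [this, Matrix.mul_one]

theorem det_inv_mul_eq_one {R : Type*} [CommRing R] {g h : GL2 R} (hdet : g.val.det = h.val.det) :
    (g⁻¹ * h).val.det = 1 := by
  rw [Units.val_mul, Matrix.det_mul, ← hdet, ← Matrix.det_mul, Units.inv_mul, Matrix.det_one]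

end Action

/-! ### Absolute convergence of the unfolded integral -/

section Unfolded

/-- The two images add up to `u = g⁻¹h`, of determinant one, so `u` and `u⁻¹` have entries at most
`2X`. Then `u⁻¹` times the first image is `h⁻¹ e₁₁ h`, whose entries are products of an entry of the
top row and one of the bottom row of `h`, up to sign. As the bottom row has length between `1` and
`√2`, the top row is bounded too, and `g = h u⁻¹` follows. -/
theorem realHeight_mul_le_of_projections {g h : GL2 ℝ} (hdet : g.val.det = h.val.det)
    (h1 : |h.val.det| = 1) (hI : 1 ≤ invIm h) (hI' : invIm h ≤ 2) {X : ℝ} (hX : 1 ≤ X)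
    (hA : ∀ i j, |(g⁻¹.val * idemFst ℝ * h.val) i j| ≤ X)
    (hB : ∀ i j, |(g⁻¹.val * idemSnd ℝ * h.val) i j| ≤ X) :
    realHeight g * realHeight h ≤ 1000000 * X ^ 5 := by
  set A := g⁻¹.val * idemFst ℝ * h.val with hAdef
  set B := g⁻¹.val * idemSnd ℝ * h.val with hBdef
  set u := g⁻¹ * h with hu
  have huv : u.val = A + B := by rw [hAdef, hBdef, add_projections, hu, Units.val_mul]
  have hue : ∀ i j, |u.val i j| ≤ 2 * X := fun i j => by
    rw [huv, Matrix.add_apply]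
    exact (abs_add_le _ _).trans (by linarith [hA i j, hB i j])
  have hui := inv_val_of_det_eq_one (det_inv_mul_eq_one hdet)
  rw [← hu] at hui
  have hue' : ∀ i j, |u⁻¹.val i j| ≤ 2 * X := fun i j => by
    rw [hui]
    fin_cases i <;> fin_cases j <;> simp [hue]
  have hht : realHeight u ≤ 16 * X := by
    have := realHeight_le_of_entries hue hue'
    linarith
  have hconj : u⁻¹.val * A = h⁻¹.val * idemFst ℝ * h.val := by
    rw [hAdef, hu, _root_.mul_inv_rev, inv_inv, Units.val_mul, ← Matrix.mul_assoc, ← Matrix.mul_assoc,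
      Matrix.mul_assoc h⁻¹.val, Units.mul_inv, Matrix.mul_one]
  have hce : ∀ i j, |(h⁻¹.val * idemFst ℝ * h.val) i j| ≤ 4 * X ^ 2 := fun i j => by
    rw [← hconj, Matrix.mul_apply, Fin.sum_univ_two]
    refine (abs_add_le _ _).trans ?_
    rw [abs_mul, abs_mul]
    have := mul_le_mul (hue' i 0) (hA 0 j) (abs_nonneg _) (by linarith)
    have := mul_le_mul (hue' i 1) (hA 1 j) (abs_nonneg _) (by linarith)
    nlinarith
  have hrow : 1 ≤ h.val 1 0 ^ 2 + h.val 1 1 ^ 2 ∧ h.val 1 0 ^ 2 + h.val 1 1 ^ 2 ≤ 2 := by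
    unfold invIm at hI hI'
    rw [h1, div_one] at hI hI'
    exact ⟨hI, hI'⟩
  rw [inv_val_fin_two] at hce
  have hdi : |(h.val.det)⁻¹| = 1 := by rw [abs_inv, h1, inv_one]
  have hd0 : (h.val.det)⁻¹ ^ 2 = 1 := by rw [← sq_abs, hdi, one_pow]
  set δ := (h.val.det)⁻¹
  set a := h.val 0 0 with ha
  set b := h.val 0 1 with hb
  set c := h.val 1 0 with hc
  set d := h.val 1 1 with hd
  have hent : ∀ q : ℝ, |δ * q| ≤ 4 * X ^ 2 → q ^ 2 ≤ 16 * X ^ 4 := by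
    intro q hq
    have : (δ * q) ^ 2 ≤ (4 * X ^ 2) ^ 2 := by
      rw [← sq_abs]; exact pow_le_pow_left₀ (abs_nonneg _) hq 2
    rw [mul_pow, hd0] at this
    nlinarith
  have e00 : (d * a) ^ 2 ≤ 16 * X ^ 4 := by
    refine hent _ ?_
    have := hce 0 0
    simp [Matrix.mul_apply, Fin.sum_univ_two, mul_assoc] at this
    rw [abs_mul, abs_mul]
    exact this
  have e01 : (d * b) ^ 2 ≤ 16 * X ^ 4 := by
    refine hent _ ?_
    have := hce 0 1
    simp [Matrix.mul_apply, Fin.sum_univ_two, mul_assoc] at this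
    rw [abs_mul, abs_mul]
    exact this
  have e10 : (c * a) ^ 2 ≤ 16 * X ^ 4 := by
    refine hent _ ?_
    have := hce 1 0
    simp [Matrix.mul_apply, Fin.sum_univ_two, mul_assoc] at this
    rw [abs_mul, abs_mul]
    exact this
  have e11 : (c * b) ^ 2 ≤ 16 * X ^ 4 := by
    refine hent _ ?_
    have := hce 1 1
    simp [Matrix.mul_apply, Fin.sum_univ_two, mul_assoc] at this
    rw [abs_mul, abs_mul]
    exact this
  have hX2 : 1 ≤ X ^ 2 := one_le_pow₀ hX
  have hbound : ∀ q : ℝ, q ^ 2 ≤ 32 * X ^ 4 → |q| ≤ 6 * X ^ 2 := fun q hq => by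
    refine abs_le_of_sq_le_sq (by nlinarith) (by positivity)
  -- Here `a² ≤ (c² + d²) a² = (ca)² + (da)² ≤ 32 X⁴`, and similarly for `b`.
  have ha6 : |a| ≤ 6 * X ^ 2 := hbound a (by nlinarith [mul_le_mul_of_nonneg_right hrow.1 (sq_nonneg a)])
  have hb6 : |b| ≤ 6 * X ^ 2 := hbound b (by nlinarith [mul_le_mul_of_nonneg_right hrow.1 (sq_nonneg b)])
  have hX4 : 1 ≤ X ^ 4 := one_le_pow₀ hX
  have hc6 : |c| ≤ 6 * X ^ 2 := hbound c (by nlinarith [sq_nonneg d])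
  have hd6 : |d| ≤ 6 * X ^ 2 := hbound d (by nlinarith [sq_nonneg c])
  have hth : realHeight h ≤ 48 * X ^ 2 := by
    have := realHeight_le_of_entries (x := h) (B := 6 * X ^ 2)
      (fun i j => by fin_cases i <;> fin_cases j <;> assumption)
      (fun i j => by
        rw [inv_val_fin_two]
        fin_cases i <;> fin_cases j <;> simp [abs_mul] <;> rw [← abs_inv, hdi, one_mul] <;> assumption)
    linarith
  have hg : g = h * u⁻¹ := by rw [hu]; group
  have htg : realHeight g ≤ 16 * (48 * X ^ 2 * (16 * X)) := by
    rw [hg]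
    refine (realHeight_mul_le _ _).trans ?_
    rw [realHeight_inv]
    have := realHeight_nonneg u
    gcongr
  calc _ ≤ (16 * (48 * X ^ 2 * (16 * X))) * (48 * X ^ 2) :=
        mul_le_mul htg hth (realHeight_nonneg _) (by positivity)
    _ = 589824 * X ^ 5 := by ring
    _ ≤ _ := by
        have : 0 ≤ X ^ 5 := by positivity
        linarith

theorem mul_entries_mem_Zhat {n m : ℕ} {A B : Matrix (Fin 2) (Fin 2) FinAdele}
    (hA : ∀ i j, algebraMap ℚ FinAdele (n : ℚ) * A i j ∈ Zhat)
    (hB : ∀ i j, algebraMap ℚ FinAdele (m : ℚ) * B i j ∈ Zhat) (i j : Fin 2) :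
    algebraMap ℚ FinAdele ((n * m : ℕ) : ℚ) * (A * B) i j ∈ Zhat := by
  rw [Matrix.mul_apply, Finset.mul_sum]
  refine Zhat.sum_mem fun l _ => ?_
  have := Zhat.mul_mem (hA i l) (hB l j)
  convert this using 1
  rw [Nat.cast_mul, map_mul]; ring

/-- The same argument at the finite places: with `h = n(b) k`, conjugating `h⁻¹ e₁₁ h` by `k` gives
the matrix with rows `(1, b)` and `(0, 0)`. So `n²` is a denominator of `b`. -/
theorem mem_denomSet_of_projections {g h k : GL2 FinAdele} {b : FinAdele} {n : ℕ}
    (hdet : g.val.det = h.val.det) (hk : k ∈ GLZhat) (hh : h = unip b * k)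
    (hA : ∀ i j, algebraMap ℚ FinAdele (n : ℚ) * (g⁻¹.val * idemFst FinAdele * h.val) i j ∈ Zhat)
    (hB : ∀ i j, algebraMap ℚ FinAdele (n : ℚ) * (g⁻¹.val * idemSnd FinAdele * h.val) i j ∈ Zhat) :
    g ∈ denomSet (n * n * n) ∧ h ∈ denomSet (n * n * n) := by
  set A := g⁻¹.val * idemFst FinAdele * h.val with hAdef
  set B := g⁻¹.val * idemSnd FinAdele * h.val with hBdef
  set u := g⁻¹ * h with hu
  have huv : u.val = A + B := by rw [hAdef, hBdef, add_projections, hu, Units.val_mul]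
  have hue : ∀ i j, algebraMap ℚ FinAdele (n : ℚ) * u.val i j ∈ Zhat := fun i j => by
    rw [huv, Matrix.add_apply, mul_add]
    exact Zhat.add_mem (hA i j) (hB i j)
  have hui := inv_val_of_det_eq_one (det_inv_mul_eq_one hdet)
  rw [← hu] at hui
  have hue' : ∀ i j, algebraMap ℚ FinAdele (n : ℚ) * u⁻¹.val i j ∈ Zhat := fun i j => by
    rw [hui]
    fin_cases i <;> fin_cases j
    · exact hue 1 1
    · change _ * -(u.val 0 1) ∈ Zhat
      rw [mul_neg]; exact Zhat.neg_mem (hue 0 1)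
    · change _ * -(u.val 1 0) ∈ Zhat
      rw [mul_neg]; exact Zhat.neg_mem (hue 1 0)
    · exact hue 0 0
  have hconj : u⁻¹.val * A = h⁻¹.val * idemFst FinAdele * h.val := by
    rw [hAdef, hu, _root_.mul_inv_rev, inv_inv, Units.val_mul, ← Matrix.mul_assoc, ← Matrix.mul_assoc,
      Matrix.mul_assoc h⁻¹.val, Units.mul_inv, Matrix.mul_one]
  have hce := mul_entries_mem_Zhat hue' hA
  rw [hconj] at hce
  have hk1 : ∀ i j, algebraMap ℚ FinAdele ((1 : ℕ) : ℚ) * k.val i j ∈ Zhat := fun i j => by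
    rw [Nat.cast_one, map_one, one_mul]; exact hk.1 i j
  have hk2 : ∀ i j, algebraMap ℚ FinAdele ((1 : ℕ) : ℚ) * k⁻¹.val i j ∈ Zhat := fun i j => by
    rw [Nat.cast_one, map_one, one_mul]; exact hk.2 i j
  have e : k.val * (h⁻¹.val * idemFst FinAdele * h.val) * k⁻¹.val = !![1, b; 0, 0] := by
    have e1 : k.val * h⁻¹.val = (unip b)⁻¹.val := by
      rw [← Units.val_mul, hh, _root_.mul_inv_rev, mul_inv_cancel_left]
    have e2 : h.val * k⁻¹.val = (unip b).val := by
      rw [← Units.val_mul, hh, mul_inv_cancel_right]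
    calc _ = (k.val * h⁻¹.val) * idemFst FinAdele * (h.val * k⁻¹.val) := by simp only [Matrix.mul_assoc]
      _ = _ := by
          rw [e1, e2, unip_inv_val, unip_val]
          refine Matrix.ext fun i j => ?_
          fin_cases i <;> fin_cases j <;> simp [Matrix.mul_apply, Fin.sum_univ_two]
  have hb := mul_entries_mem_Zhat (mul_entries_mem_Zhat hk1 hce) hk2 0 1
  rw [e, one_mul, mul_one] at hb
  have hb' : algebraMap ℚ FinAdele ((n * n : ℕ) : ℚ) * b ∈ Zhat := hb
  have hun : unip b ∈ denomSet (n * n) := by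
    have h1 := natCast_mem_Zhat (n * n)
    constructor
    · intro i j
      rw [unip_val]
      fin_cases i <;> fin_cases j
      · change _ * (1 : FinAdele) ∈ Zhat
        rwa [mul_one]
      · exact hb'
      · change _ * (0 : FinAdele) ∈ Zhat
        rw [mul_zero]; exact Zhat.zero_mem
      · change _ * (1 : FinAdele) ∈ Zhat
        rwa [mul_one]
    · intro i j
      rw [unip_inv_val]
      fin_cases i <;> fin_cases j
      · change _ * (1 : FinAdele) ∈ Zhat
        rwa [mul_one]
      · change _ * -b ∈ Zhat
        rw [mul_neg]; exact Zhat.neg_mem hb'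
      · change _ * (0 : FinAdele) ∈ Zhat
        rw [mul_zero]; exact Zhat.zero_mem
      · change _ * (1 : FinAdele) ∈ Zhat
        rwa [mul_one]
  have hh2 : h ∈ denomSet (n * n) := by
    have := mul_mem_denomSet hun (GLZhat_subset_denomSet 1 hk)
    rwa [mul_one, ← hh] at this
  refine ⟨?_, ?_⟩
  · have hg : g = h * u⁻¹ := by rw [hu]; group
    rw [hg]
    exact mul_mem_denomSet hh2 (inv_mem_denomSet ⟨hue, hue'⟩)
  · have := mul_mem_denomSet hh2 (GLZhat_subset_denomSet n GLZhat.one_mem)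
    rwa [mul_one] at this

theorem finPart_scalar_mul_val (z : Adeleˣ) (g : GL2 Adele) :
    (finPart (scalarGL z * g)).val = (z : Adele).2 • (finPart g).val := by
  refine Matrix.ext fun i j => ?_
  exact congrArg Prod.snd (scalarGL_val_apply z g i j)

theorem realPart_scalar_mul_val (z : Adeleˣ) (g : GL2 Adele) :
    (realPart (scalarGL z * g)).val = (z : Adele).1 • (realPart g).val := by
  refine Matrix.ext fun i j => ?_
  exact congrArg Prod.fst (scalarGL_val_apply z g i j)

end Unfolded

/-! ### Normalized representatives and the majorant of the unfolded integral. -/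

section Unfolded

theorem unip_mul_diagOne_val {R : Type*} [CommRing R] (α δ : Rˣ) (β : R) :
    (unip (β * (δ⁻¹ : Rˣ)) * diagOne R (α * δ⁻¹)).val = ((δ⁻¹ : Rˣ) : R) • !![(α : R), β; 0, (δ : R)] := by
  rw [Units.val_mul, unip_val, diagOne_val]
  refine Matrix.ext fun i j => ?_
  fin_cases i <;> fin_cases j <;> simp [Matrix.mul_apply, Fin.sum_univ_two, mul_comm]

theorem finPart_scalar_mul_eq {z : Adeleˣ} {g : GL2 Adele} {α δ : FinAdeleˣ} {β : FinAdele}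
    {k : GL2 FinAdele} (hz : (z : Adele).2 = (δ⁻¹ : FinAdeleˣ))
    (hgk : (finPart g).val = !![(α : FinAdele), β; 0, (δ : FinAdele)] * k.val) :
    finPart (scalarGL z * g) = unip (β * (δ⁻¹ : FinAdeleˣ)) * (diagOne FinAdele (α * δ⁻¹) * k) := by
  refine Units.ext ?_
  rw [finPart_scalar_mul_val, hgk, ← mul_assoc, Units.val_mul, unip_mul_diagOne_val, Matrix.smul_mul, hz]

theorem abs_det_realPart_scalar_mul {z : Adeleˣ} {g : GL2 Adele}
    (hz : (z : Adele).1 = (Real.sqrt |(realPart g).val.det|)⁻¹) :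
    |(realPart (scalarGL z * g)).val.det| = 1 := by
  have hD : 0 < |(realPart g).val.det| :=
    abs_pos.2 (Matrix.GeneralLinearGroup.det (realPart g)).ne_zero
  rw [realPart_scalar_mul_val, Matrix.det_smul, Fintype.card_fin, hz, abs_mul,
      inv_pow, Real.sq_sqrt hD.le, abs_inv, abs_abs]
  exact inv_mul_cancel₀ hD.ne'

/-- For the Iwasawa diagonal `(α, δ)` the condition at a prime reads `|δ|² = |α δ|`, hence `|α| =
|δ|`. -/
theorem mem_unitIdeles_of_mem_cuspBox {g : GL2 Adele} (hg : g ∈ cuspBox) {α δ : FinAdeleˣ}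
    {β : FinAdele} {k : GL2 FinAdele} (hk : k ∈ GLZhat)
    (hgk : (finPart g).val = !![(α : FinAdele), β; 0, (δ : FinAdele)] * k.val)
    (hdet : (finPart g).val.det = (α * δ : FinAdeleˣ)) : ideleOf 1 (α * δ⁻¹) ∈ unitIdeles := by
  rw [mem_unitIdeles_iff_vnorm]
  intro v
  have h1 := hg.2 v
  rw [rowSq_of_iwasawa hk hgk, detNorm, ← det_finPart, hdet, Units.val_mul, FinAdele.mul_apply,
    vnorm_mul] at h1
  change vnorm v (((α : FinAdele) * (δ⁻¹ : FinAdeleˣ)) v) = 1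
  rw [FinAdele.mul_apply, vnorm_mul]
  have h2 := vnorm_finite_idele δ v
  have hx : vnorm v ((δ : FinAdele) v) ≠ 0 := fun h => by
    rw [h, zero_mul] at h2; exact zero_ne_one h2
  have h3 : vnorm v ((δ : FinAdele) v) = vnorm v ((α : FinAdele) v) :=
    mul_right_cancel₀ hx (by rw [← h1, sq])
  rw [← h3]; exact h2

/-- The scalar has real component `|det|^{-1/2}` and finite component `δ⁻¹`. The remaining diagonal
entry `α δ⁻¹` is a unit and is absorbed in `k`. -/
theorem exists_normalized_of_mem_cuspBox {g : GL2 Adele} (hg : g ∈ cuspBox) :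
    ∃ z : Adeleˣ, |(realPart (scalarGL z * g)).val.det| = 1 ∧
      ∃ b, ∃ k ∈ GLZhat, finPart (scalarGL z * g) = unip b * k := by
  obtain ⟨α, δ, β, k, hk, hgk, hdet⟩ := exists_iwasawa_entries (finPart g)
  have hD : 0 < |(realPart g).val.det| :=
    abs_pos.2 (Matrix.GeneralLinearGroup.det (realPart g)).ne_zero
  have hr : (Real.sqrt |(realPart g).val.det|)⁻¹ ≠ 0 := inv_ne_zero (Real.sqrt_pos.2 hD).ne'
  have hu := mem_unitIdeles_of_mem_cuspBox hg hk hgk hdet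
  obtain ⟨z, hz⟩ : ∃ z, z = ideleOf (Units.mk0 _ hr) δ⁻¹ := ⟨_, rfl⟩
  exact ⟨z, abs_det_realPart_scalar_mul (by rw [hz]; rfl), _, _,
    GLZhat.mul_mem (diagOne_mem_GLZhat hu) hk, finPart_scalar_mul_eq (by rw [hz]; rfl) hgk⟩

theorem pointP_map_fst (k : Fin 2) : (pointP k).map Prod.fst =
    ![idemFst ℝ, idemSnd ℝ] k := by
  ext i j
  fin_cases k <;> fin_cases i <;> fin_cases j <;> rfl

theorem pointP_map_snd (k : Fin 2) : (pointP k).map Prod.snd =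
    ![idemFst FinAdele, idemSnd FinAdele] k := by
  refine Matrix.ext fun i j => ?_
  fin_cases k <;> fin_cases i <;> fin_cases j <;> rfl

/-- `∫ |φ(diag(a, 1) g) κ(a)| dˣa` over the positive ideles. -/
noncomputable def torusNorm (da : Measure Adeleˣ) (φ : GL2 Adele → ℂ) (κ : Adeleˣ → ℂ) (g : GL2 Adele) :
    ℝ≥0∞ := ∫⁻ a in (posIdeles : Set Adeleˣ), ‖φ (diagOne Adele a * g) * κ a‖ₑ ∂da

theorem IsDecaying.torusNorm_scalar_mul {χ : Adeleˣ →* ℂˣ} {φ : GL2 Adele → ℂ} (hφ : IsDecaying χ φ)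
    (da : Measure Adeleˣ) (κ : Adeleˣ → ℂ) (z : Adeleˣ) (g : GL2 Adele) :
    torusNorm da φ κ (scalarGL z * g) = ‖(χ z : ℂ)‖ₑ * torusNorm da φ κ g := by
  rw [torusNorm, torusNorm, ← lintegral_const_mul' _ _ enorm_ne_top]
  refine lintegral_congr fun a => ?_
  rw [← mul_assoc, ← scalarGL_mul_comm, mul_assoc, hφ.central, mul_assoc, enorm_mul]

/-- Where `f(h⁻¹P)` does not vanish, the denominators of a normalized representative are bounded and
the product of its heights is `O(X⁵)`, with `X` the size of `h⁻¹P`. The torus integrals grow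
polynomially in the heights, and `f` decays in `X` faster than any power. -/
theorem exists_unfolded_majorant (da : Measure Adeleˣ) [da.IsHaarMeasure] (dh : Measure H1)
    [dh.IsHaarMeasure] {χ₁ χ₂ : Adeleˣ →* ℂˣ} (hχ : χ₁ * χ₂ = 1) {φ₁ φ₂ : GL2 Adele → ℂ}
    (hφ₁ : IsDecaying χ₁ φ₁) (hφ₂ : IsDecaying χ₂ φ₂) {κ₁ κ₂ : Adeleˣ → ℂ} (hκ₁ : IsModerate κ₁)
    (hκ₂ : IsModerate κ₂) {f : V2 Adele → ℂ} (hf : IsRapid f) :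
    ∃ Φ : H1 → ℝ≥0∞, Measurable Φ ∧ (∀ h ∈ boxH, ‖f (actInv h.rep pointP)‖ₑ *
      (torusNorm da φ₁ κ₁ h.rep.1 * torusNorm da φ₂ κ₂ h.rep.2) ≤ Φ h) ∧ ∫⁻ h, Φ h ∂dh < ⊤ := by
  obtain ⟨n, hn, hsupp⟩ := hf.support
  have hm : n * n * n ≠ 0 := mul_ne_zero (mul_ne_zero hn hn) hn
  obtain ⟨N₁, C₁, hC₁, hN₁⟩ := hφ₁.hasDecay.exists_lintegral_torus_le (da := da) hφ₁.left_invariant hκ₁ hm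
  obtain ⟨N₂, C₂, hC₂, hN₂⟩ := hφ₂.hasDecay.exists_lintegral_torus_le (da := da) hφ₂.left_invariant hκ₂ hm
  -- `N₁ + N₂` pays for the torus integrals and `18` for integrability over `H₁(𝔸)`; the decay order
  -- `5N` reflects the bound `O(X⁵)` for the heights.
  obtain ⟨N, hNdef⟩ : ∃ N, N = N₁ + N₂ + 18 := ⟨_, rfl⟩
  obtain ⟨C, hC, hdec⟩ := hf.decay (5 * N)
  set F : GL2 Adele × GL2 Adele → ℝ≥0∞ := fun g =>
    ‖f (actInv g pointP)‖ₑ * (torusNorm da φ₁ κ₁ g.1 * torusNorm da φ₂ κ₂ g.2) with hF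
  have hFinv : ∀ z g g', F (scalarGL z * g, scalarGL z * g') = F (g, g') := by
    intro z g g'
    have h1 : ‖(χ₁ z : ℂ)‖ₑ * ‖(χ₂ z : ℂ)‖ₑ = 1 := by
      rw [← enorm_mul, ← Units.val_mul, ← MonoidHom.mul_apply, hχ]
      simp
    simp only [hF]
    rw [actInv_scalar_mul, hφ₁.torusNorm_scalar_mul, hφ₂.torusNorm_scalar_mul, mul_mul_mul_comm, h1, one_mul]
  have key : ∀ h, boxH.indicator (fun h => F h.rep) h = 0 ∨ ∃ p : PairsEqDet Adele, H1.mk p = h ∧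
      (finPart p.1.1 ∈ denomSet (n * n * n) ∧ finPart p.1.2 ∈ denomSet (n * n * n)) ∧
      boxH.indicator (fun h => F h.rep) h ≤ ENNReal.ofReal
        (C * C₁ * C₂ * 1000000 ^ N * ((realHeight (realPart p.1.1) * realHeight (realPart p.1.2)) ^ 18)⁻¹) := by
    intro h
    by_cases hbox : h ∈ boxH
    swap
    · exact Or.inl (Set.indicator_of_notMem hbox _)
    rw [Set.indicator_of_mem hbox]
    by_cases hf0 : f (actInv h.rep pointP) = 0
    · left
      simp [hF, hf0]
    right
    obtain ⟨q, hq, hqh⟩ := exists_mk_eq h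
    have hbq : q.1.2 ∈ cuspBox := by rw [hq]; exact hbox
    obtain ⟨z, hz1, b, k, hk, hz2⟩ := exists_normalized_of_mem_cuspBox hbq
    set p := diagPair Adele (scalarGL z) * q with hp
    have hp1 : p.1.1 = scalarGL z * q.1.1 := rfl
    have hp2 : p.1.2 = scalarGL z * q.1.2 := rfl
    have hmk : H1.mk p = h := by rw [hp, mk_scalar_mul, hqh]
    have hFp : F h.rep = F p.1 := by rw [← hmk, rep_mk_of_invariant hFinv]
    have hact : actInv p.1 pointP = actInv h.rep pointP := by
      have := actInv_scalar_mul z q.1.1 q.1.2 pointP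
      rw [← hq]; exact this
    have hdet : p.1.1.val.det = p.1.2.val.det := congrArg Units.val p.2
    have hdetr : (realPart p.1.1).val.det = (realPart p.1.2).val.det := by
      have := congrArg Prod.fst hdet
      rw [Matrix.det_fin_two, Matrix.det_fin_two] at this ⊢
      exact this
    have hdetf : (finPart p.1.1).val.det = (finPart p.1.2).val.det := by
      rw [det_finPart, det_finPart, hdet]
    have hs := hsupp _ hf0
    rw [← hact] at hs
    simp only [actInv_snd, pointP_map_snd] at hs
    have hden := mem_denomSet_of_projections hdetf hk (by rw [hp2]; exact hz2) (hs 0) (hs 1)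
    refine ⟨p, hmk, hden, ?_⟩
    rw [hFp]
    set X := sizeV (actInv p.1 pointP) with hX
    have hX1 : 1 ≤ X := one_le_sizeV _
    have hr := abs_le_sizeV (actInv p.1 pointP)
    simp only [actInv_fst, pointP_map_fst] at hr
    have hbp : p.1.2 ∈ cuspBox := by rw [hp2, scalar_mul_mem_cuspBox]; exact hbq
    have hht := realHeight_mul_le_of_projections hdetr (by rw [hp2]; exact hz1) hbp.1.1 hbp.1.2 hX1 (hr 0) (hr 1)
    have i1 := hN₁ (realPart p.1.1) _ hden.1
    have i2 := hN₂ (realPart p.1.2) _ hden.2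
    rw [glProd_realPart_finPart] at i1 i2
    have hfx := hdec (actInv p.1 pointP)
    rw [← hX] at hfx
    set r₁ := realHeight (realPart p.1.1)
    set r₂ := realHeight (realPart p.1.2)
    have hr₁ : 2 ≤ r₁ := two_le_realHeight _
    have hr₂ : 2 ≤ r₂ := two_le_realHeight _
    have hr12 : 1 ≤ r₁ * r₂ := by nlinarith
    have hXN : (X ^ (5 * N))⁻¹ ≤ 1000000 ^ N * ((r₁ * r₂) ^ N)⁻¹ := by
      rw [← div_eq_mul_inv, le_div_iff₀ (by positivity), inv_mul_le_iff₀ (by positivity)]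
      calc (r₁ * r₂) ^ N ≤ (1000000 * X ^ 5) ^ N := pow_le_pow_left₀ (by positivity) hht N
        _ = _ := by rw [mul_pow, ← pow_mul]; ring
    calc F p.1 ≤ ENNReal.ofReal (C * (X ^ (5 * N))⁻¹) *
          (ENNReal.ofReal (C₁ * r₁ ^ N₁) * ENNReal.ofReal (C₂ * r₂ ^ N₂)) := by
          refine mul_le_mul' ?_ (mul_le_mul' i1 i2)
          rw [← ofReal_norm]
          exact ENNReal.ofReal_le_ofReal hfx
      _ = ENNReal.ofReal (C * (X ^ (5 * N))⁻¹ * ((C₁ * r₁ ^ N₁) * (C₂ * r₂ ^ N₂))) := by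
          rw [← ENNReal.ofReal_mul (by positivity), ← ENNReal.ofReal_mul (by positivity)]
      _ ≤ _ := by
          refine ENNReal.ofReal_le_ofReal ?_
          have e1 : r₁ ^ N₁ * r₂ ^ N₂ ≤ (r₁ * r₂) ^ (N₁ + N₂) := by
            rw [mul_pow]
            refine mul_le_mul ?_ ?_ (by positivity) (by positivity)
            · exact pow_le_pow_right₀ (by linarith) (Nat.le_add_right _ _)
            · exact pow_le_pow_right₀ (by linarith) (Nat.le_add_left _ _)
          calc C * (X ^ (5 * N))⁻¹ * ((C₁ * r₁ ^ N₁) * (C₂ * r₂ ^ N₂))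
              = C * C₁ * C₂ * (X ^ (5 * N))⁻¹ * (r₁ ^ N₁ * r₂ ^ N₂) := by ring
            _ ≤ C * C₁ * C₂ * (1000000 ^ N * ((r₁ * r₂) ^ N)⁻¹) * (r₁ * r₂) ^ (N₁ + N₂) := by gcongr
            _ = _ := by
                have : (r₁ * r₂) ^ N = (r₁ * r₂) ^ (N₁ + N₂) * (r₁ * r₂) ^ 18 := by rw [hNdef, pow_add]
                rw [this, _root_.mul_inv]
                have h0 : (r₁ * r₂) ^ (N₁ + N₂) ≠ 0 := by positivity
                field_simp
  obtain ⟨Φ, hΦ, hle, hfin⟩ := exists_majorant_of_height_bound dh hm key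
  refine ⟨Φ, hΦ, fun h hh => ?_, hfin⟩
  have := hle h
  rwa [Set.indicator_of_mem hh] at this

end Unfolded

/-! ### Rational points of `H₁` -/

section Rational

theorem algebraMap_adele_injective : Function.Injective (algebraMap ℚ Adele) :=
  (algebraMap ℚ Adele).injective

/-- Rational pairs as adelic pairs. -/
noncomputable def ratPair : PairsEqDet ℚ →* PairsEqDet Adele :=
  ((ratGL.prodMap ratGL).comp (PairsEqDet ℚ).subtype).codRestrict (PairsEqDet Adele) fun δ => by
    have h : Matrix.GeneralLinearGroup.det δ.1.1 = Matrix.GeneralLinearGroup.det δ.1.2 := δ.2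
    change Matrix.GeneralLinearGroup.det (ratGL δ.1.1) = Matrix.GeneralLinearGroup.det (ratGL δ.1.2)
    refine Units.ext ?_
    have h' : δ.1.1.val.det = δ.1.2.val.det := congrArg Units.val h
    change (δ.1.1.val.map (algebraMap ℚ Adele)).det = (δ.1.2.val.map (algebraMap ℚ Adele)).det
    rw [← RingHom.mapMatrix_apply, ← RingHom.mapMatrix_apply, ← RingHom.map_det, ← RingHom.map_det, h']

theorem ratPair_fst (δ : PairsEqDet ℚ) : (ratPair δ).1.1 = ratGL δ.1.1 := rfl

theorem ratPair_snd (δ : PairsEqDet ℚ) : (ratPair δ).1.2 = ratGL δ.1.2 := rfl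

/-- Rational pairs as elements of `H₁(𝔸)`. -/
noncomputable def ratH1 : PairsEqDet ℚ →* H1 := H1.mk.comp ratPair

theorem det_ratGL (γ : GL2 ℚ) : (ratGL γ).val.det = algebraMap ℚ Adele γ.val.det := by
  change (γ.val.map (algebraMap ℚ Adele)).det = _
  rw [← RingHom.mapMatrix_apply, ← RingHom.map_det]

theorem exists_ratPair_of_eq {p : PairsEqDet Adele} {γ γ' : GL2 ℚ} (h : p.1 = (ratGL γ, ratGL γ')) :
    ∃ δ : PairsEqDet ℚ, δ.1 = (γ, γ') ∧ ratPair δ = p := by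
  have hp : p.1.1.val.det = p.1.2.val.det := congrArg Units.val p.2
  rw [h, det_ratGL, det_ratGL] at hp
  exact ⟨⟨(γ, γ'), Units.ext (algebraMap_adele_injective hp)⟩, rfl, Subtype.ext h.symm⟩

theorem mem_H1rat {h : H1} : h ∈ H1rat ↔ ∃ δ, ratH1 δ = h := by
  constructor
  · rintro ⟨p, ⟨⟨γ, γ'⟩, hγ⟩, rfl⟩
    obtain ⟨δ, -, hδ⟩ := exists_ratPair_of_eq (p := p) (γ := γ) (γ' := γ') hγ.symm
    exact ⟨δ, by rw [← hδ]; rfl⟩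
  · rintro ⟨δ, rfl⟩
    exact ⟨ratPair δ, ⟨δ.1, rfl⟩, rfl⟩

theorem ratH1_mem (δ : PairsEqDet ℚ) : ratH1 δ ∈ H1rat := mem_H1rat.2 ⟨δ, rfl⟩

instance : Countable (GL2 ℚ) :=
  have : Countable (Matrix (Fin 2) (Fin 2) ℚ) := inferInstanceAs (Countable (Fin 2 → Fin 2 → ℚ))
  Units.val_injective.countable

instance : Countable (PairsEqDet ℚ) := Subtype.countable

instance : Countable H1rat :=
  Function.Surjective.countable (f := fun δ : PairsEqDet ℚ => (⟨ratH1 δ, ratH1_mem δ⟩ : H1rat))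
    fun ⟨h, hh⟩ => by
      obtain ⟨δ, rfl⟩ := mem_H1rat.1 hh
      exact ⟨δ, rfl⟩

/-- Rational points of `V²` as adelic points. -/
noncomputable def ratV (M : V2 ℚ) : V2 Adele := fun k => (M k).map (algebraMap ℚ Adele)

theorem actInv_ratV (δ : GL2 ℚ × GL2 ℚ) (M : V2 ℚ) :
    actInv (ratGL δ.1, ratGL δ.2) (ratV M) = ratV (actInv δ M) := by
  funext k
  simp only [actInv, ratV, Matrix.map_mul, ← map_inv]
  rfl

instance : Countable (V2 ℚ) := inferInstanceAs (Countable (Fin 2 → Fin 2 → Fin 2 → ℚ))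

/-- The action of a pair on `V(R)²` as a bijection. -/
def actEquiv {R : Type*} [CommRing R] (δ : GL2 R × GL2 R) : V2 R ≃ V2 R where
  toFun := actInv δ
  invFun := actInv δ⁻¹
  left_inv M := by rw [← actInv_mul, mul_inv_cancel, actInv_one]
  right_inv M := by rw [← actInv_mul, inv_mul_cancel, actInv_one]

end Rational

/-! ### Reduction theory for `SL(2, ℤ)` -/

section Reduction

/-- `x` lies in the standard fundamental domain. -/
def IsReduced (x : GL2 ℝ) : Prop :=
  x.val 1 0 ^ 2 + x.val 1 1 ^ 2 ≤ x.val 0 0 ^ 2 + x.val 0 1 ^ 2 ∧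
    2 * |x.val 0 0 * x.val 1 0 + x.val 0 1 * x.val 1 1| ≤ x.val 1 0 ^ 2 + x.val 1 1 ^ 2

/-- With `s` and `t` the squared lengths of the bottom and top rows, `s t = 1 + (ac + bd)²`.
Reducedness bounds the square by `s² / 4 ≤ s t / 4`, so `s t ≤ 4 / 3`. The squared height is at most
`128 t`, and `128 · 4 / 3 < 171`. -/
theorem IsReduced.invIm_mul_le {x : GL2 ℝ} (h : IsReduced x) (hdet : x.val.det = 1) :
    invIm x * realHeight x ^ 2 ≤ 171 := by
  obtain ⟨h1, h2⟩ := h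
  have hi := inv_val_of_det_eq_one hdet
  rw [Matrix.det_fin_two] at hdet
  have hI : invIm x = x.val 1 0 ^ 2 + x.val 1 1 ^ 2 := by
    rw [invIm, Matrix.det_fin_two, hdet, abs_one, div_one]
  rw [hI]
  set a := x.val 0 0
  set b := x.val 0 1
  set c := x.val 1 0
  set d := x.val 1 1
  set s := c ^ 2 + d ^ 2
  set t := a ^ 2 + b ^ 2
  have hs : 0 ≤ s := by positivity
  have hst : s * t = 1 + (a * c + b * d) ^ 2 := by
    rw [← one_pow 2, ← hdet]; ring
  have h3 : (a * c + b * d) ^ 2 ≤ s ^ 2 / 4 := by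
    have := pow_le_pow_left₀ (by positivity) h2 2
    rw [mul_pow, sq_abs] at this
    linarith
  have h4 : s * t ≤ 4 / 3 := by nlinarith
  have hm : ∀ q : ℝ, q ^ 2 ≤ 2 * t → |q| ≤ Real.sqrt (2 * t) := fun q hq => Real.abs_le_sqrt hq
  have hht : realHeight x ≤ 8 * Real.sqrt (2 * t) := by
    have ha : |a| ≤ Real.sqrt (2 * t) := hm a (by nlinarith [sq_nonneg b, sq_nonneg a])
    have hb : |b| ≤ Real.sqrt (2 * t) := hm b (by nlinarith [sq_nonneg b, sq_nonneg a])
    have hc : |c| ≤ Real.sqrt (2 * t) := hm c (by nlinarith [sq_nonneg c, sq_nonneg d])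
    have hd : |d| ≤ Real.sqrt (2 * t) := hm d (by nlinarith [sq_nonneg c, sq_nonneg d])
    refine realHeight_le_of_entries ?_ ?_
    · intro i j
      fin_cases i <;> fin_cases j <;> assumption
    · intro i j
      rw [hi]
      fin_cases i <;> fin_cases j <;> simp [-Real.sqrt_mul, -Real.sqrt_mul'] <;> assumption
  have hsq : realHeight x ^ 2 ≤ 128 * t := by
    have := pow_le_pow_left₀ (realHeight_nonneg x) hht 2
    rw [mul_pow, Real.sq_sqrt (by positivity)] at this
    linarith
  nlinarith [mul_le_mul_of_nonneg_left hsq hs]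

/-- Apply the fundamental domain of `SL₂(ℤ)` to `z = x · i` in the upper half plane. After
multiplication by the squared length of the bottom row, `|z| ≥ 1` and `|Re z| ≤ 1/2` become the two
inequalities. -/
theorem exists_isReduced (x : GL2 ℝ) (hx : 0 < x.val.det) : ∃ σ : GL2 ℚ, σ.val.det = 1 ∧
    ratGLFin σ ∈ GLZhat ∧ IsReduced (ratGLReal σ * x) := by
  set a := x.val 0 0 with ha
  set b := x.val 0 1 with hb
  set c := x.val 1 0 with hc
  set d := x.val 1 1 with hd
  have hdet : 0 < a * d - b * c := by rw [Matrix.det_fin_two] at hx; exact hx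
  have hden : ((c : ℂ) * Complex.I + d) ≠ 0 := by
    intro h
    have h1 := congrArg Complex.re h
    have h2 := congrArg Complex.im h
    simp at h1 h2
    rw [h1, h2] at hdet
    simp at hdet
  have him : 0 < (((a : ℂ) * Complex.I + b) / ((c : ℂ) * Complex.I + d)).im := by
    rw [Complex.div_im]
    have hn : 0 < Complex.normSq ((c : ℂ) * Complex.I + d) := Complex.normSq_pos.2 hden
    simp only [Complex.add_re, Complex.mul_re, Complex.ofReal_re, Complex.I_re, Complex.ofReal_im,
      Complex.I_im, Complex.add_im, Complex.mul_im]
    rw [← sub_div]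
    refine div_pos ?_ hn
    ring_nf
    ring_nf at hdet
    linarith
  set z : UpperHalfPlane := ⟨_, him⟩ with hz
  obtain ⟨g, hg⟩ := ModularGroup.exists_smul_mem_fd z
  set σ : GL2 ℚ := glOfDet (g 0 0 : ℚ) (g 0 1) (g 1 0) (g 1 1) 1 (by
    have := g.det_coe
    rw [Matrix.det_fin_two] at this
    rw [Units.val_one]
    exact_mod_cast this) with hσ
  have hσdet : σ.val.det = 1 := by
    rw [hσ, glOfDet_val, Matrix.det_fin_two_of]
    have := g.det_coe
    rw [Matrix.det_fin_two] at this
    exact_mod_cast this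
  refine ⟨σ, hσdet, ?_, ?_⟩
  · refine mem_GLZhat_of_int ?_ ?_
    · intro i j
      refine ⟨g i j, ?_⟩
      fin_cases i <;> fin_cases j <;> rfl
    · rw [inv_val_of_det_eq_one hσdet]
      intro i j
      fin_cases i <;> fin_cases j
      · exact ⟨g 1 1, rfl⟩
      · exact ⟨-g 0 1, by push_cast; rfl⟩
      · exact ⟨-g 1 0, by push_cast; rfl⟩
      · exact ⟨g 0 0, rfl⟩
  · have e : ∀ i j, (ratGLReal σ * x).val i j = g i 0 * x.val 0 j + g i 1 * x.val 1 j := by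
      intro i j
      rw [Units.val_mul, Matrix.mul_apply, Fin.sum_univ_two]
      have h : ∀ i l, (ratGLReal σ).val i l = (g i l : ℝ) := by
        intro i l
        change algebraMap ℚ ℝ (σ.val i l) = _
        rw [hσ, glOfDet_val]
        fin_cases i <;> fin_cases l <;> simp
      rw [h, h]
    set a' := (ratGLReal σ * x).val 0 0 with ha'
    set b' := (ratGLReal σ * x).val 0 1 with hb'
    set c' := (ratGLReal σ * x).val 1 0 with hc'
    set d' := (ratGLReal σ * x).val 1 1 with hd'
    have hcoe : ((g • z : UpperHalfPlane) : ℂ) = ((a' : ℂ) * Complex.I + b') / ((c' : ℂ) * Complex.I + d') := by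
      rw [UpperHalfPlane.coe_specialLinearGroup_apply]
      have hz' : ((z : UpperHalfPlane) : ℂ) = ((a : ℂ) * Complex.I + b) / ((c : ℂ) * Complex.I + d) := rfl
      rw [hz']
      have h1 : ∀ r s : ℂ, r * (((a : ℂ) * Complex.I + b) / ((c : ℂ) * Complex.I + d)) + s =
          (r * ((a : ℂ) * Complex.I + b) + s * ((c : ℂ) * Complex.I + d)) / ((c : ℂ) * Complex.I + d) := by
        intro r s
        rw [eq_div_iff hden, add_mul, mul_assoc, div_mul_cancel₀ _ hden]
      rw [h1, h1, div_div_div_cancel_right₀ hden, ha', hb', hc', hd', e, e, e, e]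
      simp only [algebraMap_int_eq, eq_intCast, Complex.ofReal_intCast]
      push_cast
      congr 1 <;> ring
    have hn : 0 < c' ^ 2 + d' ^ 2 := by
      by_contra hcon
      have h1 : c' = 0 := by nlinarith [sq_nonneg c', sq_nonneg d']
      have h2 : d' = 0 := by nlinarith [sq_nonneg c', sq_nonneg d']
      have : (ratGLReal σ * x).val.det ≠ 0 := (Matrix.GeneralLinearGroup.det (ratGLReal σ * x)).ne_zero
      apply this
      rw [Matrix.det_fin_two, ← hc', ← hd', h1, h2]; ring
    have hns : ∀ p q : ℝ, Complex.normSq ((p : ℂ) * Complex.I + q) = p ^ 2 + q ^ 2 := fun p q => by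
      rw [Complex.normSq_apply]; simp; ring
    constructor
    · have h1 := hg.1
      rw [hcoe, Complex.normSq_div, hns, hns, le_div_iff₀ hn, one_mul] at h1
      exact h1
    · have h2 := hg.2
      have hre : (g • z : UpperHalfPlane).re = (a' * c' + b' * d') / (c' ^ 2 + d' ^ 2) := by
        have := congrArg Complex.re hcoe
        rw [Complex.div_re, hns] at this
        rw [← UpperHalfPlane.coe_re, this, ← add_div]
        simp
        ring
      rw [hre, abs_div, abs_of_pos hn, div_le_iff₀ hn] at h2
      linarith

/-- Representatives for `H₁(ℚ) \ H₁(𝔸)`. -/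
structure IsReducedPair (p : PairsEqDet Adele) : Prop where
  fin_fst : finPart p.1.1 ∈ GLZhat
  fin_snd : finPart p.1.2 ∈ GLZhat
  det_fst : (realPart p.1.1).val.det = 1
  det_snd : (realPart p.1.2).val.det = 1
  red_fst : IsReduced (realPart p.1.1)
  red_snd : IsReduced (realPart p.1.2)

theorem det_mem_posIdeles {g : GL2 Adele} (h1 : 0 < (realPart g).val.det) (h2 : finPart g ∈ GLZhat) :
    Matrix.GeneralLinearGroup.det g ∈ posIdeles := by
  obtain ⟨h3, h4⟩ := det_mem_of_mem_GLZhat h2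
  refine ⟨?_, ?_, ?_⟩
  · rw [Matrix.det_fin_two] at h1
    change 0 < g.val.det.1
    rw [Matrix.det_fin_two]
    exact h1
  · rw [det_finPart] at h3
    exact h3
  · rw [← map_inv, det_finPart] at h4
    rw [← map_inv]
    exact h4

theorem IsReduced.smul {x y : GL2 ℝ} (h : IsReduced x) (r : ℝ) (hy : y.val = r • x.val) : IsReduced y := by
  obtain ⟨h1, h2⟩ := h
  unfold IsReduced
  simp only [hy, Matrix.smul_apply, smul_eq_mul]
  constructor
  · nlinarith [mul_le_mul_of_nonneg_left h1 (sq_nonneg r)]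
  · have e : r * x.val 0 0 * (r * x.val 1 0) + r * x.val 0 1 * (r * x.val 1 1) =
        r ^ 2 * (x.val 0 0 * x.val 1 0 + x.val 0 1 * x.val 1 1) := by ring
    rw [e, abs_mul, abs_of_nonneg (sq_nonneg r)]
    nlinarith [mul_le_mul_of_nonneg_left h2 (sq_nonneg r)]

theorem det_realPart (g : GL2 Adele) : (realPart g).val.det = (g.val.det).1 := by
  rw [Matrix.det_fin_two, Matrix.det_fin_two]
  rfl

theorem exists_reduced_mul (g : GL2 Adele) : ∃ γ : GL2 ℚ, 0 < (realPart (ratGL γ * g)).val.det ∧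
    finPart (ratGL γ * g) ∈ GLZhat ∧ IsReduced (realPart (ratGL γ * g)) := by
  obtain ⟨γ, h1, h2⟩ := exists_ratGL_mul g
  obtain ⟨σ, hσ, hσf, hred⟩ := exists_isReduced _ h1
  have e1 : realPart (ratGL (σ * γ) * g) = ratGLReal σ * realPart (ratGL γ * g) := by
    rw [map_mul ratGL, mul_assoc, map_mul realPart, ratGL_eq σ, realPart_glProd]
  have e2 : finPart (ratGL (σ * γ) * g) = ratGLFin σ * finPart (ratGL γ * g) := by
    rw [map_mul ratGL, mul_assoc, map_mul finPart, ratGL_eq σ, finPart_glProd]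
  refine ⟨σ * γ, ?_, ?_, ?_⟩
  · rw [e1, Units.val_mul, Matrix.det_mul]
    have : (ratGLReal σ).val.det = 1 := by
      change (σ.val.map (algebraMap ℚ ℝ)).det = 1
      rw [← RingHom.mapMatrix_apply, ← RingHom.map_det, hσ, map_one]
    rw [this, one_mul]
    exact h1
  · rw [e2]
    exact GLZhat.mul_mem hσf h2
  · rw [e1]
    exact hred

theorem exists_reduced_pair (h : H1) : ∃ γ : H1rat, ∃ p, IsReducedPair p ∧ H1.mk p = γ * h := by
  obtain ⟨q, -, rfl⟩ := exists_mk_eq h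
  obtain ⟨γ, hd, hf, hr⟩ := exists_reduced_mul q.1.1
  obtain ⟨γ', hd', hf', hr'⟩ := exists_reduced_mul q.1.2
  have hq : Matrix.GeneralLinearGroup.det q.1.1 = Matrix.GeneralLinearGroup.det q.1.2 := q.2
  -- The two components are reduced independently. Both determinants land in `posIdeles` and differ
  -- by a rational factor, which must be `1`; so the reducing pair does belong to `H₁(ℚ)`.
  have hdet : Matrix.GeneralLinearGroup.det γ = Matrix.GeneralLinearGroup.det γ' := by
    have h1 := posIdeles.mul_mem (det_mem_posIdeles hd hf) (posIdeles.inv_mem (det_mem_posIdeles hd' hf'))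
    have h2 : ∀ δ : GL2 ℚ, Matrix.GeneralLinearGroup.det (ratGL δ) = ratIdele (Matrix.GeneralLinearGroup.det δ) :=
      fun δ => Units.ext (det_ratGL δ)
    rw [map_mul, map_mul, hq, _root_.mul_inv_rev, mul_assoc, mul_inv_cancel_left, h2, h2, ← map_inv, ← map_mul] at h1
    have := ratIdele_mem_posIdeles h1
    rwa [mul_inv_eq_one] at this
  set δ : PairsEqDet ℚ := ⟨(γ, γ'), hdet⟩
  set s := ratPair δ * q with hs
  have hs1 : s.1.1 = ratGL γ * q.1.1 := rfl
  have hs2 : s.1.2 = ratGL γ' * q.1.2 := rfl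
  rw [← hs1] at hd hf hr
  rw [← hs2] at hd' hf' hr'
  have hsd : (realPart s.1.1).val.det = (realPart s.1.2).val.det := by
    rw [det_realPart, det_realPart]
    exact congrArg (fun a : Adeleˣ => (a : Adele).1) s.2
  set D := (realPart s.1.1).val.det with hD
  have hrne : (Real.sqrt D)⁻¹ ≠ 0 := inv_ne_zero (Real.sqrt_pos.2 hd).ne'
  -- A real scalar normalizes both determinants to `1` without touching the finite components or
  -- reducedness.
  obtain ⟨z, hz⟩ : ∃ z, z = ideleOf (Units.mk0 _ hrne) 1 := ⟨_, rfl⟩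
  have hz1 : (z : Adele).1 = (Real.sqrt D)⁻¹ := by rw [hz]; rfl
  have hz2 : (z : Adele).2 = 1 := by rw [hz]; rfl
  have hfin : ∀ g : GL2 Adele, finPart (scalarGL z * g) = finPart g := fun g => by
    refine Units.ext ?_
    rw [finPart_scalar_mul_val, hz2, one_smul]
  have hrd : ∀ g : GL2 Adele, (realPart g).val.det = D → (realPart (scalarGL z * g)).val.det = 1 := fun g hg => by
    rw [realPart_scalar_mul_val, Matrix.det_smul, Fintype.card_fin, hz1, hg, inv_pow, Real.sq_sqrt hd.le,
      inv_mul_cancel₀ hd.ne']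
  refine ⟨⟨ratH1 δ, ratH1_mem δ⟩, diagPair Adele (scalarGL z) * s, ?_, ?_⟩
  · exact ⟨by change finPart (scalarGL z * s.1.1) ∈ _; rwa [hfin],
      by change finPart (scalarGL z * s.1.2) ∈ _; rwa [hfin], hrd _ rfl, hrd _ hsd.symm,
      hr.smul _ (realPart_scalar_mul_val z s.1.1), hr'.smul _ (realPart_scalar_mul_val z s.1.2)⟩
  · rw [mk_scalar_mul, hs, map_mul]
    rfl

end Reduction

/-! ### Absolute convergence of the theta integral -/

section ThetaSum

theorem tsum_finTwo_mul {A : Type*} (g : A → ℝ≥0∞) :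
    ∑' m : Fin 2 → A, g (m 0) * g (m 1) = (∑' a, g a) ^ 2 := by
  rw [← (finTwoArrowEquiv A).symm.tsum_eq, ENNReal.tsum_prod', sq, ← ENNReal.tsum_mul_right]
  refine tsum_congr fun a => ?_
  rw [← ENNReal.tsum_mul_left]
  rfl

theorem tsum_lattice (G : ℤ → ℝ≥0∞) :
    ∑' m : Fin 2 → Fin 2 → Fin 2 → ℤ, ∏ k, ∏ i, ∏ j, G (m k i j) = (∑' a, G a) ^ 8 := by
  have h1 := tsum_finTwo_mul G
  have h2 := tsum_finTwo_mul fun m : Fin 2 → ℤ => G (m 0) * G (m 1)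
  have h3 := tsum_finTwo_mul fun m : Fin 2 → Fin 2 → ℤ => G (m 0 0) * G (m 0 1) * (G (m 1 0) * G (m 1 1))
  simp only [Fin.prod_univ_two]
  rw [h3, h2, h1, ← pow_mul, ← pow_mul]

theorem tsum_inv_sq_lt_top (n : ℕ) (hn : n ≠ 0) :
    ∑' t : ℤ, ENNReal.ofReal (((1 + |((t / n : ℚ) : ℝ)|) ^ 2)⁻¹) < ⊤ := by
  have hn' : (1 : ℝ) ≤ n := by exact_mod_cast Nat.one_le_iff_ne_zero.2 hn
  have hs : Summable fun t : ℤ => (n : ℝ) ^ 2 * (((1 + |(t : ℝ)|) ^ 2)⁻¹) := by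
    refine Summable.mul_left _ ?_
    have h0 : Summable fun k : ℕ => ((1 + (k : ℝ)) ^ 2)⁻¹ := by
      have := (summable_nat_add_iff 1).2 (Real.summable_nat_pow_inv.2 one_lt_two)
      simpa [add_comm] using this
    refine Summable.of_nat_of_neg ?_ ?_ <;> simpa using h0
  have hle : ∀ t : ℤ, ENNReal.ofReal (((1 + |((t / n : ℚ) : ℝ)|) ^ 2)⁻¹) ≤
      ENNReal.ofReal ((n : ℝ) ^ 2 * (((1 + |(t : ℝ)|) ^ 2)⁻¹)) := by
    intro t
    refine ENNReal.ofReal_le_ofReal ?_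
    rw [← div_eq_mul_inv, le_div_iff₀ (by positivity), inv_mul_le_iff₀ (by positivity), ← mul_pow]
    refine pow_le_pow_left₀ (by positivity) ?_ 2
    push_cast
    rw [abs_div, Nat.abs_cast, add_mul, div_mul_cancel₀ _ (by positivity)]
    linarith
  refine (ENNReal.tsum_le_tsum hle).trans_lt ?_
  rw [← ENNReal.ofReal_tsum_of_nonneg (fun t => by positivity) hs]
  exact ENNReal.ofReal_lt_top

theorem actInv_inv_actInv {R : Type*} [CommRing R] (p : GL2 R × GL2 R) (x : V2 R) :
    actInv p⁻¹ (actInv p x) = x := by rw [← actInv_mul, mul_inv_cancel, actInv_one]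

/-- Each coordinate of `x` is a sum of four products, and there are eight coordinates; `33 = 1 + 8 ·
4`. -/
theorem sizeV_le_of_actInv (p : GL2 Adele × GL2 Adele) (x : V2 Adele) :
    sizeV x ≤ 33 * (realHeight (realPart p.1) * realHeight (realPart p.2)) * sizeV (actInv p x) := by
  set r₁ := realHeight (realPart p.1)
  set r₂ := realHeight (realPart p.2)
  set y := actInv p x with hy
  have hr₁ : 2 ≤ r₁ := two_le_realHeight _
  have hr₂ : 2 ≤ r₂ := two_le_realHeight _
  have hX : 1 ≤ sizeV y := one_le_sizeV y
  have hb : ∀ k i j, |(x k i j).1| ≤ 4 * (r₁ * r₂ * sizeV y) := by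
    intro k i j
    have hx : x = actInv p⁻¹ y := (actInv_inv_actInv p x).symm
    rw [hx, actInv_fst, Matrix.mul_apply, Fin.sum_univ_two, Matrix.mul_apply, Matrix.mul_apply,
      Fin.sum_univ_two, Fin.sum_univ_two]
    have e1 : ∀ a, |(realPart p⁻¹.1)⁻¹.val i a| ≤ r₁ := fun a => by
      rw [Prod.fst_inv, map_inv, inv_inv]
      exact abs_le_realHeight _ _ _
    have e2 : ∀ a, |(realPart p⁻¹.2).val a j| ≤ r₂ := fun a => by
      rw [Prod.snd_inv, map_inv]
      exact abs_inv_le_realHeight _ _ _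
    have e3 : ∀ a b, |((y k).map Prod.fst) a b| ≤ sizeV y := fun a b => abs_le_sizeV y k a b
    have e4 : ∀ a b, |(realPart p⁻¹.1)⁻¹.val i a * ((y k).map Prod.fst) a b * (realPart p⁻¹.2).val b j| ≤
        r₁ * r₂ * sizeV y := fun a b => by
      rw [abs_mul, abs_mul]
      calc _ ≤ r₁ * sizeV y * r₂ := by
            refine mul_le_mul (mul_le_mul (e1 a) (e3 a b) (abs_nonneg _) (by linarith)) (e2 b)
              (abs_nonneg _) (by positivity)
        _ = _ := by ring
    rw [add_mul, add_mul]
    refine (abs_add_le _ _).trans ?_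
    have := abs_add_le ((realPart p⁻¹.1)⁻¹.val i 0 * ((y k).map Prod.fst) 0 0 * (realPart p⁻¹.2).val 0 j)
      ((realPart p⁻¹.1)⁻¹.val i 1 * ((y k).map Prod.fst) 1 0 * (realPart p⁻¹.2).val 0 j)
    have := abs_add_le ((realPart p⁻¹.1)⁻¹.val i 0 * ((y k).map Prod.fst) 0 1 * (realPart p⁻¹.2).val 1 j)
      ((realPart p⁻¹.1)⁻¹.val i 1 * ((y k).map Prod.fst) 1 1 * (realPart p⁻¹.2).val 1 j)
    linarith [e4 0 0, e4 0 1, e4 1 0, e4 1 1]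
  have h1 := sizeV_le hb
  have h2 : 1 ≤ r₁ * r₂ * sizeV y := by
    have : 1 ≤ r₁ * r₂ := by nlinarith
    nlinarith
  linarith

theorem inv_sizeV_actInv_le (p : GL2 Adele × GL2 Adele) (x : V2 Adele) (N : ℕ) :
    (sizeV (actInv p x) ^ N)⁻¹ ≤
      (33 * (realHeight (realPart p.1) * realHeight (realPart p.2))) ^ N * (sizeV x ^ N)⁻¹ := by
  have hX := one_le_sizeV (actInv p x)
  have hY := one_le_sizeV x
  rw [← div_eq_mul_inv, le_div_iff₀ (by positivity), inv_mul_le_iff₀ (by positivity), ← mul_pow]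
  refine pow_le_pow_left₀ (by positivity) ?_ N
  rw [mul_comm]
  exact sizeV_le_of_actInv p x

/-- Two powers of decay for each of the eight coordinates make the lattice sum a product of
convergent one-dimensional sums. -/
theorem inv_sizeV_pow_le (x : V2 Adele) :
    (sizeV x ^ 16)⁻¹ ≤ ∏ k, ∏ i, ∏ j, ((1 + |(x k i j).1|) ^ 2)⁻¹ := by
  have hY := one_le_sizeV x
  have : (sizeV x ^ 16)⁻¹ = ∏ _k : Fin 2, ∏ _i : Fin 2, ∏ _j : Fin 2, (sizeV x ^ 2)⁻¹ := by
    simp only [Finset.prod_const, Finset.card_univ, Fintype.card_fin, inv_pow]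
    rw [← pow_mul, ← pow_mul, ← pow_mul]
  rw [this]
  refine Finset.prod_le_prod (fun _ _ => by positivity) fun k _ =>
    Finset.prod_le_prod (fun _ _ => by positivity) fun i _ =>
      Finset.prod_le_prod (fun _ _ => by positivity) fun j _ => ?_
  exact inv_anti₀ (by positivity) (pow_le_pow_left₀ (by positivity) (one_add_abs_le_sizeV x k i j) 2)

theorem ratV_fst (M : V2 ℚ) (k i j : Fin 2) : (ratV M k i j).1 = ((M k i j : ℚ) : ℝ) := rfl

/-- A pair in `GL₂(Ẑ)` neither creates nor removes denominators. -/
theorem exists_int_of_actInv_mem {p : GL2 Adele × GL2 Adele} (h1 : finPart p.1 ∈ GLZhat)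
    (h2 : finPart p.2 ∈ GLZhat) {M : V2 ℚ} {n : ℕ}
    (h : ∀ k i j, algebraMap ℚ FinAdele (n : ℚ) * (actInv p (ratV M) k i j).2 ∈ Zhat) (k i j : Fin 2) :
    ∃ t : ℤ, (t : ℚ) = n * M k i j := by
  rw [← rat_mem_Zhat_iff, map_mul]
  change _ * (ratV M k i j).2 ∈ Zhat
  rw [← actInv_inv_actInv p (ratV M), actInv_snd]
  have k1 : ∀ i j, algebraMap ℚ FinAdele ((1 : ℕ) : ℚ) * (finPart p⁻¹.1)⁻¹.val i j ∈ Zhat := fun i j => by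
    rw [Nat.cast_one, map_one, one_mul, Prod.fst_inv, map_inv, inv_inv]
    exact h1.1 i j
  have k2 : ∀ i j, algebraMap ℚ FinAdele ((1 : ℕ) : ℚ) * (finPart p⁻¹.2).val i j ∈ Zhat := fun i j => by
    rw [Nat.cast_one, map_one, one_mul, Prod.snd_inv, map_inv]
    exact h2.2 i j
  have := mul_entries_mem_Zhat (mul_entries_mem_Zhat k1 (h k)) k2 i j
  rw [one_mul, mul_one] at this
  exact this

/-- For a pair that is integral at the primes, only `M` in a fixed lattice `(1/n) ℤ⁸` contribute.
Decay of order `16` makes the lattice sum converge, at the price of the sixteenth power of the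
heights. -/
theorem IsRapid.exists_theta_bound {f : V2 Adele → ℂ} (hf : IsRapid f) : ∃ C : ℝ, 0 ≤ C ∧
    ∀ p : GL2 Adele × GL2 Adele, finPart p.1 ∈ GLZhat → finPart p.2 ∈ GLZhat →
      ∑' M : V2 ℚ, ‖f (actInv p (ratV M))‖ₑ ≤
        ENNReal.ofReal (C * (realHeight (realPart p.1) * realHeight (realPart p.2)) ^ 16) := by
  obtain ⟨n, hn, hsupp⟩ := hf.support
  obtain ⟨C, hC, hdec⟩ := hf.decay 16
  set G : ℤ → ℝ≥0∞ := fun t => ENNReal.ofReal (((1 + |((t / n : ℚ) : ℝ)|) ^ 2)⁻¹) with hG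
  have hGfin : ∑' t, G t < ⊤ := tsum_inv_sq_lt_top n hn
  set S := ∑' t, G t
  refine ⟨C * 33 ^ 16 * (S ^ 8).toReal, by positivity, fun p h1 h2 => ?_⟩
  set r := realHeight (realPart p.1) * realHeight (realPart p.2)
  have hr : 0 < r := by
    have := two_le_realHeight (realPart p.1)
    have := two_le_realHeight (realPart p.2)
    positivity
  set ι : (Fin 2 → Fin 2 → Fin 2 → ℤ) → V2 ℚ := fun m k => Matrix.of fun i j => (m k i j : ℚ) / n with hι
  have hn' : (n : ℚ) ≠ 0 := by exact_mod_cast hn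
  have hinj : Function.Injective ι := by
    intro m m' h
    funext k i j
    have : (m k i j : ℚ) / n = (m' k i j : ℚ) / n := congrFun (congrFun (congrFun h k) i) j
    rw [div_left_inj' hn'] at this
    exact_mod_cast this
  have hrange : Function.support (fun M : V2 ℚ => ‖f (actInv p (ratV M))‖ₑ) ⊆ Set.range ι := by
    intro M hM
    have hM' : f (actInv p (ratV M)) ≠ 0 := fun h => hM (by simp [h])
    choose t ht using exists_int_of_actInv_mem h1 h2 (hsupp _ hM')
    refine ⟨t, ?_⟩
    funext k
    ext i j
    change (t k i j : ℚ) / n = M k i j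
    rw [ht, mul_div_cancel_left₀ _ hn']
  rw [← hinj.tsum_eq hrange]
  have hterm : ∀ m, ‖f (actInv p (ratV (ι m)))‖ₑ ≤
      ENNReal.ofReal (C * 33 ^ 16 * r ^ 16) * ∏ k, ∏ i, ∏ j, G (m k i j) := by
    intro m
    have hGp : ∏ k, ∏ i, ∏ j, G (m k i j) =
        ENNReal.ofReal (∏ k, ∏ i, ∏ j, ((1 + |(((m k i j : ℚ) / n : ℚ) : ℝ)|) ^ 2)⁻¹) := by
      rw [ENNReal.ofReal_prod_of_nonneg fun k _ => by positivity]
      refine Finset.prod_congr rfl fun k _ => ?_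
      rw [ENNReal.ofReal_prod_of_nonneg fun k _ => by positivity]
      refine Finset.prod_congr rfl fun i _ => ?_
      rw [ENNReal.ofReal_prod_of_nonneg fun k _ => by positivity]
    rw [hGp, ← ENNReal.ofReal_mul (by positivity), ← ofReal_norm]
    refine ENNReal.ofReal_le_ofReal ?_
    refine (hdec _).trans ?_
    have hprod := inv_sizeV_pow_le (ratV (ι m))
    simp only [ratV_fst] at hprod
    calc C * (sizeV (actInv p (ratV (ι m))) ^ 16)⁻¹
        ≤ C * ((33 * r) ^ 16 * (sizeV (ratV (ι m)) ^ 16)⁻¹) :=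
          mul_le_mul_of_nonneg_left (inv_sizeV_actInv_le p _ 16) hC
      _ = C * 33 ^ 16 * r ^ 16 * (sizeV (ratV (ι m)) ^ 16)⁻¹ := by rw [mul_pow]; ring
      _ ≤ _ := mul_le_mul_of_nonneg_left hprod (by positivity)
  refine (ENNReal.tsum_le_tsum hterm).trans ?_
  rw [ENNReal.tsum_mul_left, tsum_lattice]
  have hS : S ^ 8 = ENNReal.ofReal (S ^ 8).toReal := (ENNReal.ofReal_toReal (ENNReal.pow_ne_top hGfin.ne)).symm
  change _ * S ^ 8 ≤ _
  rw [hS, ← ENNReal.ofReal_mul (by positivity), ENNReal.toReal_ofReal ENNReal.toReal_nonneg]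
  refine ENNReal.ofReal_le_ofReal (le_of_eq ?_)
  ring

end ThetaSum

/-! ### Integrability of the theta integrand on `H₁(ℚ)\H₁(𝔸)`. -/

section ThetaIntegral

theorem rep_rat_mul_of_invariant {β : Type*} {F : GL2 Adele × GL2 Adele → β}
    (hF : ∀ z g g', F (scalarGL z * g, scalarGL z * g') = F (g, g'))
    (hrat : ∀ (δ : PairsEqDet ℚ) g, F (ratGL δ.1.1 * g.1, ratGL δ.1.2 * g.2) = F g) (γ : H1rat) (h : H1) :
    F (H1.rep (γ * h)) = F h.rep := by
  obtain ⟨γ, hγ⟩ := γ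
  obtain ⟨δ, rfl⟩ := mem_H1rat.1 hγ
  change F (H1.rep (H1.mk (ratPair δ) * h)) = _
  rw [rep_mul_of_invariant hF]
  exact hrat δ h.rep

/-- The sum of the absolute values of the terms of the theta integrand. -/
noncomputable def thetaNorm (f : V2 Adele → ℂ) (φ₁ φ₂ : GL2 Adele → ℂ) (g : GL2 Adele × GL2 Adele) : ℝ≥0∞ :=
  (∑' M : V2 ℚ, ‖f (actInv g (ratV M))‖ₑ) * (‖φ₁ g.1‖ₑ * ‖φ₂ g.2‖ₑ)

variable {χ₁ χ₂ : Adeleˣ →* ℂˣ} {φ₁ φ₂ : GL2 Adele → ℂ} {f : V2 Adele → ℂ}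

theorem mul_scalar_mul (hχ : χ₁ * χ₂ = 1) (hφ₁ : IsDecaying χ₁ φ₁) (hφ₂ : IsDecaying χ₂ φ₂) (z : Adeleˣ)
    (g g' : GL2 Adele) : φ₁ (scalarGL z * g) * φ₂ (scalarGL z * g') = φ₁ g * φ₂ g' := by
  have h1 : (χ₁ z : ℂ) * (χ₂ z : ℂ) = 1 := by
    rw [← Units.val_mul, ← MonoidHom.mul_apply, hχ]
    simp
  rw [hφ₁.central, hφ₂.central, mul_mul_mul_comm, h1, one_mul]

theorem thetaNorm_scalar_mul (hχ : χ₁ * χ₂ = 1) (hφ₁ : IsDecaying χ₁ φ₁) (hφ₂ : IsDecaying χ₂ φ₂)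
    (z : Adeleˣ) (g g' : GL2 Adele) :
    thetaNorm f φ₁ φ₂ (scalarGL z * g, scalarGL z * g') = thetaNorm f φ₁ φ₂ (g, g') := by
  simp only [thetaNorm, actInv_scalar_mul, ← enorm_mul, mul_scalar_mul hχ hφ₁ hφ₂]

theorem actInv_rat_mul (δ : GL2 ℚ × GL2 ℚ) (g : GL2 Adele × GL2 Adele) (M : V2 ℚ) :
    actInv (ratGL δ.1 * g.1, ratGL δ.2 * g.2) (ratV M) = actInv g (ratV (actInv δ M)) := by
  rw [← actInv_ratV, ← actInv_mul]
  rfl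

theorem thetaNorm_rat_mul (hφ₁ : IsDecaying χ₁ φ₁) (hφ₂ : IsDecaying χ₂ φ₂) (δ : PairsEqDet ℚ)
    (g : GL2 Adele × GL2 Adele) :
    thetaNorm f φ₁ φ₂ (ratGL δ.1.1 * g.1, ratGL δ.1.2 * g.2) = thetaNorm f φ₁ φ₂ g := by
  simp only [thetaNorm, actInv_rat_mul, hφ₁.left_invariant, hφ₂.left_invariant]
  congr 1
  exact (actEquiv δ.1).tsum_eq fun M => ‖f (actInv g (ratV M))‖ₑ

/-- On reduced pairs `invIm` is at most a constant over the squared height, so the decay of both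
cusp forms dominates the polynomial growth of the theta series in both variables. -/
theorem lintegral_thetaNorm_lt_top {dh : Measure H1} [dh.IsHaarMeasure] {dθ : Measure (RightCosets H1rat)}
    (hdθ : IsDiscreteQuotientMeasure H1rat dh dθ) (hχ : χ₁ * χ₂ = 1) (hφ₁ : IsDecaying χ₁ φ₁)
    (hφ₂ : IsDecaying χ₂ φ₂) (hf : IsRapid f) :
    ∫⁻ x : RightCosets H1rat, thetaNorm f φ₁ φ₂ x.out.rep ∂dθ < ⊤ := by
  obtain ⟨C, hC, hb⟩ := hf.exists_theta_bound
  obtain ⟨N₁, hN₁⟩ := hφ₁.hasDecay 1 one_ne_zero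
  obtain ⟨N₂, hN₂⟩ := hφ₂.hasDecay 1 one_ne_zero
  -- `16` pays for the theta series, `N₁` and `N₂` for the moderate growth of the cusp forms, `18`
  -- for integrability over `H₁(𝔸)`.
  obtain ⟨K, hK⟩ : ∃ K, K = 16 + N₁ + N₂ + 18 := ⟨_, rfl⟩
  obtain ⟨C₁, hC₁, hb₁⟩ := hN₁ K
  obtain ⟨C₂, hC₂, hb₂⟩ := hN₂ K
  set S : Set H1 := {h | ∃ p, IsReducedPair p ∧ H1.mk p = h}
  have key : ∀ h, S.indicator (fun h => thetaNorm f φ₁ φ₂ h.rep) h = 0 ∨ ∃ p : PairsEqDet Adele, H1.mk p = h ∧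
      (finPart p.1.1 ∈ denomSet 1 ∧ finPart p.1.2 ∈ denomSet 1) ∧
      S.indicator (fun h => thetaNorm f φ₁ φ₂ h.rep) h ≤ ENNReal.ofReal
        (C * C₁ * C₂ * (171 ^ K * 171 ^ K) *
          ((realHeight (realPart p.1.1) * realHeight (realPart p.1.2)) ^ 18)⁻¹) := by
    intro h
    by_cases hS : h ∈ S
    swap
    · exact Or.inl (Set.indicator_of_notMem hS _)
    right
    obtain ⟨p, hp, hph⟩ := hS
    rw [Set.indicator_of_mem (show h ∈ S from ⟨p, hp, hph⟩)]
    have hd1 := GLZhat_subset_denomSet 1 hp.fin_fst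
    have hd2 := GLZhat_subset_denomSet 1 hp.fin_snd
    refine ⟨p, hph, ⟨hd1, hd2⟩, ?_⟩
    have e : thetaNorm f φ₁ φ₂ h.rep = thetaNorm f φ₁ φ₂ p.1 := by
      rw [← hph]
      exact rep_mk_of_invariant (thetaNorm_scalar_mul hχ hφ₁ hφ₂) p
    rw [e]
    have i1 := hb₁ (realPart p.1.1) _ hd1
    have i2 := hb₂ (realPart p.1.2) _ hd2
    rw [glProd_realPart_finPart] at i1 i2
    have i3 := hb p.1 hp.fin_fst hp.fin_snd
    have j1 := hp.red_fst.invIm_mul_le hp.det_fst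
    have j2 := hp.red_snd.invIm_mul_le hp.det_snd
    have hI1 := invIm_nonneg (realPart p.1.1)
    have hI2 := invIm_nonneg (realPart p.1.2)
    set r₁ := realHeight (realPart p.1.1)
    set r₂ := realHeight (realPart p.1.2)
    set I₁ := invIm (realPart p.1.1)
    set I₂ := invIm (realPart p.1.2)
    have hr₁ : 2 ≤ r₁ := two_le_realHeight _
    have hr₂ : 2 ≤ r₂ := two_le_realHeight _
    have bound : ∀ I r : ℝ, 0 ≤ I → 2 ≤ r → I * r ^ 2 ≤ 171 → I ^ K ≤ 171 ^ K * (r ^ K)⁻¹ := by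
      intro I r hI hr h
      rw [← div_eq_mul_inv, le_div_iff₀ (by positivity), ← mul_pow]
      refine pow_le_pow_left₀ (by positivity) (le_trans ?_ h) K
      refine mul_le_mul_of_nonneg_left ?_ hI
      nlinarith
    have k1 := bound I₁ r₁ hI1 hr₁ j1
    have k2 := bound I₂ r₂ hI2 hr₂ j2
    calc thetaNorm f φ₁ φ₂ p.1 ≤ ENNReal.ofReal (C * (r₁ * r₂) ^ 16) *
          (ENNReal.ofReal (C₁ * r₁ ^ N₁ * I₁ ^ K) * ENNReal.ofReal (C₂ * r₂ ^ N₂ * I₂ ^ K)) := by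
          refine mul_le_mul' i3 (mul_le_mul' ?_ ?_)
          · rw [← ofReal_norm]; exact ENNReal.ofReal_le_ofReal i1
          · rw [← ofReal_norm]; exact ENNReal.ofReal_le_ofReal i2
      _ = ENNReal.ofReal (C * (r₁ * r₂) ^ 16 * ((C₁ * r₁ ^ N₁ * I₁ ^ K) * (C₂ * r₂ ^ N₂ * I₂ ^ K))) := by
          rw [← ENNReal.ofReal_mul (by positivity), ← ENNReal.ofReal_mul (by positivity)]
      _ ≤ _ := by
          refine ENNReal.ofReal_le_ofReal ?_
          calc C * (r₁ * r₂) ^ 16 * ((C₁ * r₁ ^ N₁ * I₁ ^ K) * (C₂ * r₂ ^ N₂ * I₂ ^ K))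
              ≤ C * (r₁ * r₂) ^ 16 * ((C₁ * (r₁ * r₂) ^ N₁ * (171 ^ K * (r₁ ^ K)⁻¹)) *
                (C₂ * (r₁ * r₂) ^ N₂ * (171 ^ K * (r₂ ^ K)⁻¹))) := by
                gcongr
                · nlinarith
                · nlinarith
            _ = C * C₁ * C₂ * (171 ^ K * 171 ^ K) *
                ((r₁ * r₂) ^ (16 + N₁ + N₂) * ((r₁ * r₂) ^ K)⁻¹) := by
                rw [mul_pow r₁ r₂ K, mul_inv (r₁ ^ K), pow_add, pow_add]
                ring
            _ = _ := by
                congr 1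
                rw [hK, pow_add _ (16 + N₁ + N₂), mul_inv]
                have : (r₁ * r₂) ^ (16 + N₁ + N₂) ≠ 0 := by positivity
                field_simp
  obtain ⟨Φ, hΦ, hle, hfin⟩ := exists_majorant_of_height_bound dh one_ne_zero key
  refine (hdθ.lintegral_le (F := fun h => thetaNorm f φ₁ φ₂ h.rep) (S := S) ?_ hΦ ?_ ?_).trans_lt hfin
  · exact rep_rat_mul_of_invariant (thetaNorm_scalar_mul hχ hφ₁ hφ₂) (thetaNorm_rat_mul hφ₁ hφ₂)
  · intro h
    obtain ⟨γ, p, hp, hph⟩ := exists_reduced_pair h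
    exact ⟨γ, p, hp, hph⟩
  · intro h hh
    have := hle h
    rwa [Set.indicator_of_mem hh] at this

end ThetaIntegral

/-! ### The Weil representation on the Siegel parabolic subgroup -/

section Weil

/-- `similitude` is a chosen witness; a nonzero entry of `J` shows that it is determined. -/
theorem similitude_eq {R : Type*} [CommRing R] {g : GSp4 R} {ν : Rˣ}
    (h : g.val.valᵀ * Matrix.J (Fin 2) R * g.val.val = (ν : R) • Matrix.J (Fin 2) R) :
    similitude g = ν := by
  have h' : g.val.valᵀ * Matrix.J (Fin 2) R * g.val.val =
      ((similitude g : Rˣ) : R) • Matrix.J (Fin 2) R := g.2.choose_spec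
  rw [h] at h'
  have := congrFun (congrFun h' (Sum.inr 0)) (Sum.inl 0)
  simp [Matrix.J] at this
  exact Units.ext this.symm

theorem unipU_mul_torusT_val {R : Type*} [CommRing R] (u v w : R) (y : Rˣ) :
    (unipU u v w * torusT y).val.val =
      Matrix.fromBlocks !![(y : R), 0; 0, 1] (!![u, w; w, v] * !![1, 0; 0, (y : R)]) 0 !![1, 0; 0, (y : R)] := by
  change Matrix.fromBlocks 1 !![u, w; w, v] 0 1 * Matrix.fromBlocks !![(y : R), 0; 0, 1] 0 0 !![1, 0; 0, (y : R)] = _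
  rw [Matrix.fromBlocks_multiply]
  simp only [Matrix.one_mul, Matrix.mul_zero, Matrix.zero_mul, add_zero, zero_add]

theorem similitude_unipU_mul_torusT {R : Type*} [CommRing R] (u v w : R) (y : Rˣ) :
    similitude (unipU u v w * torusT y) = y := by
  refine similitude_eq ?_
  rw [unipU_mul_torusT_val]
  have h (a b c d : R) : (!![a, b; c, d])ᵀ = !![a, c; b, d] := by
    ext i j
    fin_cases i <;> fin_cases j <;> rfl
  rw [Matrix.J, Matrix.fromBlocks_transpose, Matrix.fromBlocks_multiply, Matrix.fromBlocks_multiply,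
    Matrix.fromBlocks_smul, h, h]
  congr 1
  · simp
  · ext i j
    fin_cases i <;> fin_cases j <;> simp
  · ext i j
    fin_cases i <;> fin_cases j <;> simp
  · ext i j
    fin_cases i <;> fin_cases j <;> simp [Matrix.mul_apply, Fin.sum_univ_two, mul_comm]

theorem bilin_self {R : Type*} [CommRing R] (x : Matrix (Fin 2) (Fin 2) R) : bilin x x = 2 * x.det := by
  simp [bilin, Matrix.det_fin_two]
  ring

theorem bilin_comm {R : Type*} [CommRing R] (x x' : Matrix (Fin 2) (Fin 2) R) : bilin x x' = bilin x' x := by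
  simp [bilin, Matrix.det_fin_two]
  ring

/-- After removing `diag(1, y)` the element lies in the Siegel parabolic subgroup with `A = diag(y,
1)` and `b = X`. The factor `|det A|² = |y|²` cancels `|ν(h)|⁻² = |y|⁻²`. -/
theorem weil_unipU_mul_torusT (ψ : AddChar Adele Circle) (f : V2 Adele → ℂ) (u v w : Adele) (y : Adeleˣ)
    {h : GL2 Adele × GL2 Adele}
    (hh : Matrix.GeneralLinearGroup.det h.1 * (Matrix.GeneralLinearGroup.det h.2)⁻¹ = y) (x : V2 Adele) :
    weil ψ (unipU u v w * torusT y) h f x =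
      (ψ (u * (x 0).det + v * (x 1).det + w * bilin (x 0) (x 1)) : ℂ) *
        f (actInv h ![(y : Adele) • x 0, x 1]) := by
  have hg : (unipU u v w * torusT y).val.val *
      Matrix.fromBlocks 1 0 0 ((((similitude (unipU u v w * torusT y))⁻¹ : Adeleˣ) : Adele) • 1) =
      Matrix.fromBlocks !![(y : Adele), 0; 0, 1]
        (!![u, w; w, v] * !![1, 0; 0, (y : Adele)] * (((y⁻¹ : Adeleˣ) : Adele) • 1)) 0
        (!![1, 0; 0, (y : Adele)] * (((y⁻¹ : Adeleˣ) : Adele) • 1)) := by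
    rw [unipU_mul_torusT_val, similitude_unipU_mul_torusT, Matrix.fromBlocks_multiply]
    simp only [Matrix.mul_one, Matrix.mul_zero, add_zero, zero_add]
  -- This is `b = B ᵗA`; the entries of `y` cancel and `X` remains.
  have hB : !![u, w; w, v] * !![1, 0; 0, (y : Adele)] * (((y⁻¹ : Adeleˣ) : Adele) • 1) *
      !![(y : Adele), 0; 0, 1]ᵀ = !![u, w; w, v] := by
    have hT : !![(y : Adele), 0; 0, 1]ᵀ = !![(y : Adele), 0; 0, 1] := by
      refine Matrix.ext fun i j => ?_
      fin_cases i <;> fin_cases j <;> rfl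
    have hD : !![1, 0; 0, (y : Adele)] * !![(y : Adele), 0; 0, 1] = (y : Adele) • 1 := by
      refine Matrix.ext fun i j => ?_
      fin_cases i <;> fin_cases j <;> simp
    rw [hT, Matrix.mul_smul, Matrix.mul_one, Matrix.smul_mul, Matrix.mul_assoc, hD, Matrix.mul_smul,
      smul_smul, Units.inv_mul, one_smul, Matrix.mul_one]
  rw [weil, hg, weilSp, if_pos (Matrix.toBlocks_fromBlocks₂₁ _ _ _ _), Matrix.toBlocks_fromBlocks₁₁,
    Matrix.toBlocks_fromBlocks₁₂, hB]
  have htr : (1 / 2 : ℚ) • (!![u, w; w, v] * gramV x).trace =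
      u * (x 0).det + v * (x 1).det + w * bilin (x 0) (x 1) := by
    have : (!![u, w; w, v] * gramV x).trace =
        (2 : ℚ) • (u * (x 0).det + v * (x 1).det + w * bilin (x 0) (x 1)) := by
      rw [Matrix.trace_fin_two, Matrix.mul_apply, Matrix.mul_apply, Fin.sum_univ_two, Fin.sum_univ_two]
      simp only [gramV, Matrix.of_apply, Matrix.cons_val', Matrix.cons_val_zero, Matrix.cons_val_one,
        bilin_self, bilin_comm (x 1) (x 0), ofNat_smul_eq_nsmul, Matrix.cons_val_fin_one]
      rw [two_nsmul]
      ring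
    rw [this, smul_smul]
    norm_num
  rw [htr, mul_assoc]
  congr 1
  have hdet : (!![(y : Adele), 0; 0, 1]).det = y := by simp [Matrix.det_fin_two]
  have hx : (fun j => ∑ i, (!![(y : Adele), 0; 0, 1] : Matrix (Fin 2) (Fin 2) Adele) i j • x i) =
      ![(y : Adele) • x 0, x 1] := by
    funext j
    fin_cases j <;> simp
  rw [hdet, hx, opL]
  have hab : adeleAbs ((Matrix.GeneralLinearGroup.det h.1 / Matrix.GeneralLinearGroup.det h.2 : Adeleˣ) : Adele) =
      adeleAbs y := by rw [div_eq_mul_inv, hh]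
  rw [hab, ← mul_assoc, ← Complex.ofReal_mul]
  have h1 : adeleAbs y ^ 2 * adeleAbs y ^ (-2 : ℤ) = 1 := by
    have := adeleAbs_ne_zero y
    rw [_root_.zpow_neg]
    exact mul_inv_cancel₀ (pow_ne_zero 2 this)
  rw [h1, Complex.ofReal_one, one_mul]
  rfl

/-- The matrices `y diag(y, 1)⁻¹ = diag(1, y)` and `diag(y, 1)⁻¹`. -/
noncomputable def twistGL (y : Adeleˣ) : Fin 2 → GL2 Adele :=
  ![scalarGL y * (diagOne Adele y)⁻¹, (diagOne Adele y)⁻¹]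

/-- A factor `diag(y, 1)` on the right of `h₁` acts from the left on the transformed point. Hence
`y` can be shifted into the Schwartz function, and what remains is a theta integrand on `H₁(𝔸)`. -/
theorem actInv_mul_diagOne (g : GL2 Adele × GL2 Adele) (y : Adeleˣ) (x : V2 Adele) :
    actInv (g.1 * diagOne Adele y, g.2) ![(y : Adele) • x 0, x 1] =
      fun k => (twistGL y k).val * actInv g x k := by
  funext k
  have hs : ∀ A : Matrix (Fin 2) (Fin 2) Adele, (scalarGL y).val * A = (y : Adele) • A := fun A => by
    change Matrix.scalar (Fin 2) (y : Adele) * A = _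
    rw [Matrix.scalar_apply, ← Matrix.smul_eq_diagonal_mul]
  fin_cases k
  · change (g.1 * diagOne Adele y)⁻¹.val * ((y : Adele) • x 0) * g.2.val =
      (scalarGL y * (diagOne Adele y)⁻¹).val * (g.1⁻¹.val * x 0 * g.2.val)
    rw [Units.val_mul, Matrix.mul_assoc (scalarGL y).val, hs, _root_.mul_inv_rev, Units.val_mul,
      Matrix.mul_smul, Matrix.smul_mul]
    simp only [Matrix.mul_assoc]
  · change (g.1 * diagOne Adele y)⁻¹.val * x 1 * g.2.val =
      (diagOne Adele y)⁻¹.val * (g.1⁻¹.val * x 1 * g.2.val)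
    rw [_root_.mul_inv_rev, Units.val_mul]
    simp only [Matrix.mul_assoc]

theorem IsRapid.mul_left {f : V2 Adele → ℂ} (hf : IsRapid f) (g : Fin 2 → GL2 Adele) :
    IsRapid fun x => f fun k => (g k).val * x k where
  continuous := hf.continuous.comp (continuous_pi fun k =>
    Continuous.matrix_mul continuous_const (continuous_apply k))
  support := by
    obtain ⟨n, hn, h⟩ := hf.support
    obtain ⟨m₀, hm₀, hg₀⟩ := exists_mem_denomSet (finPart (g 0))
    obtain ⟨m₁, hm₁, hg₁⟩ := exists_mem_denomSet (finPart (g 1))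
    have hg : ∀ k, finPart (g k) ∈ denomSet (m₀ * m₁) := by
      intro k
      fin_cases k
      · simpa using mul_mem_denomSet hg₀ (GLZhat_subset_denomSet m₁ GLZhat.one_mem)
      · simpa using mul_mem_denomSet (GLZhat_subset_denomSet m₀ GLZhat.one_mem) hg₁
    refine ⟨m₀ * m₁ * n, mul_ne_zero (mul_ne_zero hm₀ hm₁) hn, fun x hx k i j => ?_⟩
    have h1 := mul_entries_mem_Zhat (hg k).2
      (B := ((g k).val * x k).map Prod.snd) (fun i j => h _ hx k i j) i j
    have e : (finPart (g k))⁻¹.val * ((g k).val * x k).map Prod.snd = (x k).map Prod.snd := by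
      have : ((g k)⁻¹.val * ((g k).val * x k)).map (RingHom.snd ℝ FinAdele) =
          (finPart (g k))⁻¹.val * ((g k).val * x k).map Prod.snd := by
        rw [Matrix.map_mul, ← map_inv]
        rfl
      rw [← this, ← Matrix.mul_assoc, Units.inv_mul, Matrix.one_mul]
      rfl
    rw [e] at h1
    exact h1
  decay N := by
    obtain ⟨C, hC, h⟩ := hf.decay N
    set r := realHeight (realPart (g 0)) + realHeight (realPart (g 1)) with hr
    have h0 := two_le_realHeight (realPart (g 0))
    have h1 := two_le_realHeight (realPart (g 1))
    have hrk : ∀ k, realHeight (realPart (g k)) ≤ r := fun k => by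
      fin_cases k
      · change realHeight (realPart (g 0)) ≤ r; linarith
      · change realHeight (realPart (g 1)) ≤ r; linarith
    refine ⟨C * (17 * r) ^ N, by positivity, fun x => ?_⟩
    set y : V2 Adele := fun k => (g k).val * x k with hy
    have hX := one_le_sizeV x
    have hY := one_le_sizeV y
    have hxy : sizeV x ≤ 17 * r * sizeV y := by
      have : ∀ k i j, |(x k i j).1| ≤ 2 * (r * sizeV y) := by
        intro k i j
        have e : (x k i j).1 = ∑ l, (realPart (g k))⁻¹.val i l * (y k l j).1 := by
          have e1 : x k = (g k)⁻¹.val * y k := by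
            rw [hy]
            simp only
            rw [← Matrix.mul_assoc, Units.inv_mul, Matrix.one_mul]
          have e2 : (x k).map (RingHom.fst ℝ FinAdele) = (realPart (g k))⁻¹.val * (y k).map Prod.fst := by
            rw [e1, Matrix.map_mul, ← map_inv]
            rfl
          exact congrFun (congrFun e2 i) j
        rw [e, Fin.sum_univ_two]
        have e3 : ∀ l, |(realPart (g k))⁻¹.val i l * (y k l j).1| ≤ r * sizeV y := fun l => by
          rw [abs_mul]
          exact mul_le_mul ((abs_inv_le_realHeight _ _ _).trans (hrk k)) (abs_le_sizeV _ _ _ _)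
            (abs_nonneg _) (by positivity)
        exact (abs_add_le _ _).trans (by linarith [e3 0, e3 1])
      have h2 := sizeV_le this
      have : 1 ≤ r * sizeV y := by nlinarith
      linarith
    refine (h y).trans ?_
    rw [mul_assoc]
    refine mul_le_mul_of_nonneg_left ?_ hC
    rw [← div_eq_mul_inv, le_div_iff₀ (by positivity), inv_mul_le_iff₀ (by positivity), ← mul_pow, mul_comm]
    exact pow_le_pow_left₀ (by positivity) hxy N

end Weil

/-! ### Fourier expansion of the theta integral -/

section Fourier

variable {χ₁ χ₂ : Adeleˣ →* ℂˣ} {φ₁ φ₂ : GL2 Adele → ℂ} {f : V2 Adele → ℂ}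

/-- `(det M₀, det M₁, (M₀, M₁))`. -/
def gramT (M : V2 ℚ) : ℚ × ℚ × ℚ := ((M 0).det, (M 1).det, bilin (M 0) (M 1))

theorem det_actInv {δ : GL2 ℚ × GL2 ℚ} (h : δ.1.val.det = δ.2.val.det) (A : Matrix (Fin 2) (Fin 2) ℚ) :
    (δ.1⁻¹.val * A * δ.2.val).det = A.det := by
  rw [Matrix.det_mul, Matrix.det_mul, mul_right_comm, ← h, ← Matrix.det_mul, Units.inv_mul, Matrix.det_one,
    one_mul]

theorem gramT_actInv (δ : PairsEqDet ℚ) (M : V2 ℚ) : gramT (actInv δ.1 M) = gramT M := by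
  have h : δ.1.1.val.det = δ.1.2.val.det := congrArg Units.val δ.2
  simp only [gramT, actInv, bilin, ← Matrix.add_mul, ← Matrix.mul_add, det_actInv h]

/-- `u t₀ + v t₁ + w t₂`. -/
noncomputable def pairing (t : ℚ × ℚ × ℚ) (u v w : Adele) : Adele :=
  u * algebraMap ℚ Adele t.1 + v * algebraMap ℚ Adele t.2.1 + w * algebraMap ℚ Adele t.2.2

/-- The term of the theta integrand that belongs to `M`. -/
noncomputable def thetaTerm (f : V2 Adele → ℂ) (φ₁ φ₂ : GL2 Adele → ℂ) (M : V2 ℚ) (g : GL2 Adele × GL2 Adele) :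
    ℂ := f (actInv g (ratV M)) * (φ₁ g.1 * φ₂ g.2)

theorem tsum_enorm_thetaTerm (g : GL2 Adele × GL2 Adele) :
    ∑' M, ‖thetaTerm f φ₁ φ₂ M g‖ₑ = thetaNorm f φ₁ φ₂ g := by
  simp only [thetaTerm, thetaNorm, enorm_mul, ENNReal.tsum_mul_right]

theorem thetaTerm_scalar_mul (hχ : χ₁ * χ₂ = 1) (hφ₁ : IsDecaying χ₁ φ₁) (hφ₂ : IsDecaying χ₂ φ₂) (M : V2 ℚ)
    (z : Adeleˣ) (g g' : GL2 Adele) :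
    thetaTerm f φ₁ φ₂ M (scalarGL z * g, scalarGL z * g') = thetaTerm f φ₁ φ₂ M (g, g') := by
  simp only [thetaTerm, actInv_scalar_mul, mul_scalar_mul hχ hφ₁ hφ₂]

theorem thetaTerm_rat_mul (hφ₁ : IsDecaying χ₁ φ₁) (hφ₂ : IsDecaying χ₂ φ₂) (M : V2 ℚ) (δ : GL2 ℚ × GL2 ℚ)
    (g : GL2 Adele × GL2 Adele) :
    thetaTerm f φ₁ φ₂ M (ratGL δ.1 * g.1, ratGL δ.2 * g.2) = thetaTerm f φ₁ φ₂ (actInv δ M) g := by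
  simp only [thetaTerm, actInv_rat_mul, hφ₁.left_invariant, hφ₂.left_invariant]

theorem continuous_thetaTerm (hf : IsRapid f) (hφ₁ : IsDecaying χ₁ φ₁) (hφ₂ : IsDecaying χ₂ φ₂) (M : V2 ℚ) :
    Continuous (thetaTerm f φ₁ φ₂ M) :=
  (hf.continuous.comp (continuous_actInv.comp (continuous_id.prodMk continuous_const))).mul
    ((hφ₁.continuous.comp continuous_fst).mul (hφ₂.continuous.comp continuous_snd))

theorem measurable_thetaTerm_rep (hχ : χ₁ * χ₂ = 1) (hf : IsRapid f) (hφ₁ : IsDecaying χ₁ φ₁)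
    (hφ₂ : IsDecaying χ₂ φ₂) (M : V2 ℚ) : Measurable fun h : H1 => thetaTerm f φ₁ φ₂ M h.rep :=
  (continuous_rep_of_invariant' (continuous_thetaTerm hf hφ₁ hφ₂ M)
    (thetaTerm_scalar_mul hχ hφ₁ hφ₂ M)).measurable

/-- The theta integrand, with Fourier variables `u, v, w`. -/
noncomputable def thetaSeries (ψ : AddChar Adele Circle) (f : V2 Adele → ℂ) (φ₁ φ₂ : GL2 Adele → ℂ)
    (u v w : Adele) (g : GL2 Adele × GL2 Adele) : ℂ :=
  ∑' M, (ψ (pairing (gramT M) u v w) : ℂ) * thetaTerm f φ₁ φ₂ M g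

/-- The partial sum over the `M` with given Gram matrix. -/
noncomputable def fiberSum (f : V2 Adele → ℂ) (φ₁ φ₂ : GL2 Adele → ℂ) (t : ℚ × ℚ × ℚ)
    (g : GL2 Adele × GL2 Adele) : ℂ :=
  ∑' M : {M // gramT M = t}, thetaTerm f φ₁ φ₂ M g

theorem thetaSeries_scalar_mul (hχ : χ₁ * χ₂ = 1) (hφ₁ : IsDecaying χ₁ φ₁) (hφ₂ : IsDecaying χ₂ φ₂)
    (ψ : AddChar Adele Circle) (u v w : Adele) (z : Adeleˣ) (g g' : GL2 Adele) :
    thetaSeries ψ f φ₁ φ₂ u v w (scalarGL z * g, scalarGL z * g') = thetaSeries ψ f φ₁ φ₂ u v w (g, g') := by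
  simp only [thetaSeries, thetaTerm_scalar_mul hχ hφ₁ hφ₂]

theorem fiberSum_scalar_mul (hχ : χ₁ * χ₂ = 1) (hφ₁ : IsDecaying χ₁ φ₁) (hφ₂ : IsDecaying χ₂ φ₂)
    (t : ℚ × ℚ × ℚ) (z : Adeleˣ) (g g' : GL2 Adele) :
    fiberSum f φ₁ φ₂ t (scalarGL z * g, scalarGL z * g') = fiberSum f φ₁ φ₂ t (g, g') := by
  simp only [fiberSum, thetaTerm_scalar_mul hχ hφ₁ hφ₂]

theorem thetaSeries_rat_mul (hφ₁ : IsDecaying χ₁ φ₁) (hφ₂ : IsDecaying χ₂ φ₂) (ψ : AddChar Adele Circle)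
    (u v w : Adele) (δ : PairsEqDet ℚ) (g : GL2 Adele × GL2 Adele) :
    thetaSeries ψ f φ₁ φ₂ u v w (ratGL δ.1.1 * g.1, ratGL δ.1.2 * g.2) = thetaSeries ψ f φ₁ φ₂ u v w g := by
  simp only [thetaSeries, thetaTerm_rat_mul hφ₁ hφ₂]
  refine Eq.trans (tsum_congr fun M => ?_) ((actEquiv δ.1).tsum_eq fun M =>
    (ψ (pairing (gramT M) u v w) : ℂ) * thetaTerm f φ₁ φ₂ M g)
  change _ = (ψ (pairing (gramT (actInv δ.1 M)) u v w) : ℂ) * _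
  rw [gramT_actInv]
  rfl

theorem fiberSum_rat_mul (hφ₁ : IsDecaying χ₁ φ₁) (hφ₂ : IsDecaying χ₂ φ₂) (t : ℚ × ℚ × ℚ)
    (δ : PairsEqDet ℚ) (g : GL2 Adele × GL2 Adele) :
    fiberSum f φ₁ φ₂ t (ratGL δ.1.1 * g.1, ratGL δ.1.2 * g.2) = fiberSum f φ₁ φ₂ t g := by
  simp only [fiberSum, thetaTerm_rat_mul hφ₁ hφ₂]
  exact ((actEquiv δ.1).subtypeEquiv fun M => by
    change _ ↔ gramT (actInv δ.1 M) = t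
    rw [gramT_actInv]).tsum_eq fun M : {M // gramT M = t} => thetaTerm f φ₁ φ₂ M g

theorem measurable_thetaSeries_rep (hχ : χ₁ * χ₂ = 1) (hf : IsRapid f) (hφ₁ : IsDecaying χ₁ φ₁)
    (hφ₂ : IsDecaying χ₂ φ₂) (ψ : AddChar Adele Circle) (u v w : Adele) :
    Measurable fun h : H1 => thetaSeries ψ f φ₁ φ₂ u v w h.rep :=
  Measurable.tsum fun M => (measurable_thetaTerm_rep hχ hf hφ₁ hφ₂ M).const_mul _

theorem measurable_fiberSum_rep (hχ : χ₁ * χ₂ = 1) (hf : IsRapid f) (hφ₁ : IsDecaying χ₁ φ₁)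
    (hφ₂ : IsDecaying χ₂ φ₂) (t : ℚ × ℚ × ℚ) : Measurable fun h : H1 => fiberSum f φ₁ φ₂ t h.rep :=
  Measurable.tsum fun M => measurable_thetaTerm_rep hχ hf hφ₁ hφ₂ M

theorem measurable_thetaNorm_rep (hχ : χ₁ * χ₂ = 1) (hf : IsRapid f) (hφ₁ : IsDecaying χ₁ φ₁)
    (hφ₂ : IsDecaying χ₂ φ₂) : Measurable fun h : H1 => thetaNorm f φ₁ φ₂ h.rep := by
  simp only [← tsum_enorm_thetaTerm]
  exact Measurable.tsum fun M => (measurable_thetaTerm_rep hχ hf hφ₁ hφ₂ M).enorm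

theorem enorm_tsum_le {ι : Type*} (a : ι → ℂ) : ‖∑' i, a i‖ₑ ≤ ∑' i, ‖a i‖ₑ := by
  by_cases h : ∑' i, ‖a i‖ₑ = ⊤
  · rw [h]; exact le_top
  · have hs : Summable fun i => ‖a i‖ := by
      have := ENNReal.summable_toReal h
      simpa using this
    rw [← ofReal_norm, ← ENNReal.ofReal_toReal h]
    refine ENNReal.ofReal_le_ofReal ((norm_tsum_le_tsum_norm hs).trans (le_of_eq ?_))
    rw [ENNReal.tsum_toReal_eq fun i => enorm_ne_top]
    simp

theorem enorm_circle (z : Circle) : ‖(z : ℂ)‖ₑ = 1 := by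
  rw [← ofReal_norm, Circle.norm_coe, ENNReal.ofReal_one]

theorem enorm_thetaSeries_le (ψ : AddChar Adele Circle) (u v w : Adele) (g : GL2 Adele × GL2 Adele) :
    ‖thetaSeries ψ f φ₁ φ₂ u v w g‖ₑ ≤ thetaNorm f φ₁ φ₂ g := by
  rw [← tsum_enorm_thetaTerm]
  refine (enorm_tsum_le _).trans (ENNReal.tsum_le_tsum fun M => le_of_eq ?_)
  rw [enorm_mul, enorm_circle, one_mul]

theorem tsum_enorm_fiberSum_le (g : GL2 Adele × GL2 Adele) :
    ∑' t, ‖fiberSum f φ₁ φ₂ t g‖ₑ ≤ thetaNorm f φ₁ φ₂ g := by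
  rw [← tsum_enorm_thetaTerm, ← (Equiv.sigmaFiberEquiv gramT).tsum_eq, ENNReal.tsum_sigma']
  exact ENNReal.tsum_le_tsum fun t => enorm_tsum_le _

/-- The character depends on `M` only through its Gram data, so absolute convergence permits
grouping by fibers. -/
theorem thetaSeries_eq_tsum_fiberSum (ψ : AddChar Adele Circle) (u v w : Adele) {g : GL2 Adele × GL2 Adele}
    (hg : thetaNorm f φ₁ φ₂ g ≠ ⊤) :
    thetaSeries ψ f φ₁ φ₂ u v w g = ∑' t, (ψ (pairing t u v w) : ℂ) * fiberSum f φ₁ φ₂ t g := by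
  rw [← tsum_enorm_thetaTerm] at hg
  have hs : Summable fun M => ‖(ψ (pairing (gramT M) u v w) : ℂ) * thetaTerm f φ₁ φ₂ M g‖ := by
    have := ENNReal.summable_toReal hg
    simpa [Circle.norm_coe] using this
  have hs' : Summable fun M => (ψ (pairing (gramT M) u v w) : ℂ) * thetaTerm f φ₁ φ₂ M g := hs.of_norm
  have hs'' := (Equiv.sigmaFiberEquiv gramT).summable_iff.2 hs'
  refine ((Equiv.sigmaFiberEquiv gramT).tsum_eq fun M =>
    (ψ (pairing (gramT M) u v w) : ℂ) * thetaTerm f φ₁ φ₂ M g).symm.trans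
    ((Summable.tsum_sigma hs'').trans (tsum_congr fun t => ?_))
  rw [fiberSum, ← tsum_mul_left]
  refine tsum_congr fun M => ?_
  change (ψ (pairing (gramT M.1) u v w) : ℂ) * thetaTerm f φ₁ φ₂ M.1 g = _
  rw [M.2]

variable {dh : Measure H1} [dh.IsHaarMeasure] {dθ : Measure (RightCosets H1rat)}

theorem integrable_thetaSeries (hdθ : IsDiscreteQuotientMeasure H1rat dh dθ) (hχ : χ₁ * χ₂ = 1)
    (hφ₁ : IsDecaying χ₁ φ₁) (hφ₂ : IsDecaying χ₂ φ₂) (hf : IsRapid f) (ψ : AddChar Adele Circle)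
    (u v w : Adele) :
    Integrable (fun x : RightCosets H1rat => thetaSeries ψ f φ₁ φ₂ u v w x.out.rep) dθ := by
  refine ⟨(measurable_out_of_invariant (F := fun h : H1 => thetaSeries ψ f φ₁ φ₂ u v w h.rep)
    (measurable_thetaSeries_rep hχ hf hφ₁ hφ₂ ψ u v w)
    (rep_rat_mul_of_invariant (thetaSeries_scalar_mul hχ hφ₁ hφ₂ ψ u v w)
      (thetaSeries_rat_mul hφ₁ hφ₂ ψ u v w))).aestronglyMeasurable, ?_⟩
  exact (lintegral_mono fun x => enorm_thetaSeries_le ψ u v w _).trans_lt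
    (lintegral_thetaNorm_lt_top hdθ hχ hφ₁ hφ₂ hf)

/-- The Fourier coefficients of the theta integral. -/
noncomputable def thetaCoeff (dθ : Measure (RightCosets H1rat)) (f : V2 Adele → ℂ) (φ₁ φ₂ : GL2 Adele → ℂ)
    (t : ℚ × ℚ × ℚ) : ℂ := ∫ x : RightCosets H1rat, fiberSum f φ₁ φ₂ t x.out.rep ∂dθ

theorem measurable_fiberSum_out (hχ : χ₁ * χ₂ = 1)
    (hφ₁ : IsDecaying χ₁ φ₁) (hφ₂ : IsDecaying χ₂ φ₂) (hf : IsRapid f) (t : ℚ × ℚ × ℚ) :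
    Measurable fun x : RightCosets H1rat => fiberSum f φ₁ φ₂ t x.out.rep :=
  measurable_out_of_invariant (F := fun h : H1 => fiberSum f φ₁ φ₂ t h.rep)
    (measurable_fiberSum_rep hχ hf hφ₁ hφ₂ t)
    (rep_rat_mul_of_invariant (fiberSum_scalar_mul hχ hφ₁ hφ₂ t) (fiberSum_rat_mul hφ₁ hφ₂ t))

theorem tsum_lintegral_fiberSum_lt_top (hdθ : IsDiscreteQuotientMeasure H1rat dh dθ) (hχ : χ₁ * χ₂ = 1)
    (hφ₁ : IsDecaying χ₁ φ₁) (hφ₂ : IsDecaying χ₂ φ₂) (hf : IsRapid f) :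
    ∑' t, ∫⁻ x : RightCosets H1rat, ‖fiberSum f φ₁ φ₂ t x.out.rep‖ₑ ∂dθ < ⊤ := by
  rw [← lintegral_tsum fun t => (measurable_fiberSum_out hχ hφ₁ hφ₂ hf t).enorm.aemeasurable]
  exact (lintegral_mono fun x => tsum_enorm_fiberSum_le _).trans_lt
    (lintegral_thetaNorm_lt_top hdθ hχ hφ₁ hφ₂ hf)

theorem summable_thetaCoeff (hdθ : IsDiscreteQuotientMeasure H1rat dh dθ) (hχ : χ₁ * χ₂ = 1)
    (hφ₁ : IsDecaying χ₁ φ₁) (hφ₂ : IsDecaying χ₂ φ₂) (hf : IsRapid f) :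
    ∑' t, ‖thetaCoeff dθ f φ₁ φ₂ t‖ₑ < ⊤ :=
  (ENNReal.tsum_le_tsum fun _ => enorm_integral_le_lintegral_enorm _).trans_lt
    (tsum_lintegral_fiberSum_lt_top hdθ hχ hφ₁ hφ₂ hf)

/-- Sum and integral may be exchanged because `thetaNorm` dominates the sum of the absolute values
of all fiber sums. This is the Fourier expansion of the theta lift in `(u, v, w)`, absolutely
convergent. -/
theorem integral_thetaSeries (hdθ : IsDiscreteQuotientMeasure H1rat dh dθ) (hχ : χ₁ * χ₂ = 1)
    (hφ₁ : IsDecaying χ₁ φ₁) (hφ₂ : IsDecaying χ₂ φ₂) (hf : IsRapid f) (ψ : AddChar Adele Circle)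
    (u v w : Adele) :
    ∫ x : RightCosets H1rat, thetaSeries ψ f φ₁ φ₂ u v w x.out.rep ∂dθ =
      ∑' t, (ψ (pairing t u v w) : ℂ) * thetaCoeff dθ f φ₁ φ₂ t := by
  have hae : ∀ᵐ x : RightCosets H1rat ∂dθ, thetaNorm f φ₁ φ₂ x.out.rep < ⊤ :=
    ae_lt_top (measurable_out_of_invariant (F := fun h : H1 => thetaNorm f φ₁ φ₂ h.rep)
      (measurable_thetaNorm_rep hχ hf hφ₁ hφ₂)
      (rep_rat_mul_of_invariant (thetaNorm_scalar_mul hχ hφ₁ hφ₂) (thetaNorm_rat_mul hφ₁ hφ₂)))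
      (lintegral_thetaNorm_lt_top hdθ hχ hφ₁ hφ₂ hf).ne
  have hcongr : (fun x : RightCosets H1rat => thetaSeries ψ f φ₁ φ₂ u v w x.out.rep) =ᵐ[dθ]
      fun x => ∑' t, (ψ (pairing t u v w) : ℂ) * fiberSum f φ₁ φ₂ t x.out.rep := by
    filter_upwards [hae] with x hx using thetaSeries_eq_tsum_fiberSum ψ u v w hx.ne
  rw [integral_congr_ae hcongr, integral_tsum
    (fun t => ((measurable_fiberSum_out hχ hφ₁ hφ₂ hf t).const_mul _).aestronglyMeasurable)]
  · refine tsum_congr fun t => ?_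
    rw [integral_const_mul]
    rfl
  · simp only [enorm_mul, enorm_circle, one_mul]
    exact (tsum_lintegral_fiberSum_lt_top hdθ hχ hφ₁ hφ₂ hf).ne

end Fourier

/-! ### Characters of `ℚ \ 𝔸` -/

section Characters

variable {ψ : AddChar Adele Circle}

/-- `x ↦ ψ(q x)` on `ℚ \ 𝔸`. -/
noncomputable def ratChar (ψ : AddChar Adele Circle) (q : ℚ) (x : AdeleModRat) : ℂ :=
  (ψ (Quotient.out x * algebraMap ℚ Adele q) : ℂ)

theorem addChar_add_rat (hrat : ∀ q : ℚ, ψ (algebraMap ℚ Adele q) = 1) (q r : ℚ) (t : Adele) :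
    ψ ((t + algebraMap ℚ Adele r) * algebraMap ℚ Adele q) = ψ (t * algebraMap ℚ Adele q) := by
  rw [add_mul, ← map_mul, AddChar.map_add_eq_mul, hrat, mul_one]

theorem measurable_ratChar (hψ : Continuous ψ) (hrat : ∀ q : ℚ, ψ (algebraMap ℚ Adele q) = 1) (q : ℚ) :
    Measurable (ratChar ψ q) :=
  measurable_comp_out (f := fun t : Adele => (ψ (t * algebraMap ℚ Adele q) : ℂ))
    (continuous_subtype_val.comp (hψ.comp (continuous_id.mul continuous_const))).measurable
    fun t r => by rw [addChar_add_rat hrat]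

theorem ratChar_add (hrat : ∀ q : ℚ, ψ (algebraMap ℚ Adele q) = 1) (q : ℚ) (x : AdeleModRat) (t : Adele) :
    ratChar ψ q (x + (t : AdeleModRat)) = ratChar ψ q x * (ψ (t * algebraMap ℚ Adele q) : ℂ) := by
  obtain ⟨s, rfl⟩ := QuotientAddGroup.mk_surjective x
  obtain ⟨r, hr⟩ := out_sub_mem (s + t)
  obtain ⟨r', hr'⟩ := out_sub_mem s
  have h1 : ratChar ψ q ((s + t : Adele) : AdeleModRat) = ψ ((s + t) * algebraMap ℚ Adele q) := by
    rw [ratChar, hr, addChar_add_rat hrat]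
  have h2 : ratChar ψ q (s : AdeleModRat) = ψ (s * algebraMap ℚ Adele q) := by
    rw [ratChar, hr', addChar_add_rat hrat]
  rw [← QuotientAddGroup.mk_add, h1, h2, add_mul, AddChar.map_add_eq_mul, Circle.coe_mul]

theorem ratChar_zero (x : AdeleModRat) : ratChar ψ 0 x = 1 := by
  rw [ratChar, map_zero, mul_zero, AddChar.map_zero_eq_one, Circle.coe_one]

theorem enorm_ratChar (q : ℚ) (x : AdeleModRat) : ‖ratChar ψ q x‖ₑ = 1 := enorm_circle _

/-- Orthogonality: for `q ≠ 0`, translation by `s / q` with `ψ(s) ≠ 1` multiplies the integral by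
`ψ(s)`. -/
theorem integral_ratChar (hne : ψ ≠ 1)
    (hrat : ∀ q : ℚ, ψ (algebraMap ℚ Adele q) = 1) (dx : Measure AdeleModRat) [dx.IsAddHaarMeasure]
    [IsProbabilityMeasure dx] (q : ℚ) : ∫ x, ratChar ψ q x ∂dx = if q = 0 then 1 else 0 := by
  split_ifs with hq
  · subst hq
    simp only [ratChar_zero]
    simp
  · obtain ⟨s, hs⟩ := AddChar.ne_one_iff.1 hne
    have ht : ψ (s * algebraMap ℚ Adele q⁻¹ * algebraMap ℚ Adele q) ≠ 1 := by
      rw [mul_assoc, ← map_mul, inv_mul_cancel₀ hq, map_one, mul_one]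
      exact hs
    have h := integral_add_right_eq_self (μ := dx) (ratChar ψ q) ((s * algebraMap ℚ Adele q⁻¹ : Adele) : AdeleModRat)
    simp only [ratChar_add hrat] at h
    rw [integral_mul_const] at h
    have h' : (∫ x, ratChar ψ q x ∂dx) *
        ((ψ (s * algebraMap ℚ Adele q⁻¹ * algebraMap ℚ Adele q) : ℂ) - 1) = 0 := by
      rw [mul_sub, h, mul_one, sub_self]
    refine (mul_eq_zero.1 h').resolve_right fun h0 => ht ?_
    exact Circle.ext (by rw [Circle.coe_one]; exact sub_eq_zero.1 h0)

end Characters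

/-! ### The Bessel coefficient of the theta lift -/

section BesselCoefficient

variable {χ₁ χ₂ : Adeleˣ →* ℂˣ} {φ₁ φ₂ : GL2 Adele → ℂ} {f : V2 Adele → ℂ}
variable {dh : Measure H1} [dh.IsHaarMeasure] {dθ : Measure (RightCosets H1rat)}

/-- The action of the matrices `twistGL y` on functions on `V(𝔸)²`. -/
noncomputable def twistFun (f : V2 Adele → ℂ) (y : Adeleˣ) (x : V2 Adele) : ℂ :=
  f fun k => (twistGL y k).val * x k

/-- Right translation by `diag(y, 1)`. -/
noncomputable def translate (φ : GL2 Adele → ℂ) (y : Adeleˣ) (g : GL2 Adele) : ℂ := φ (g * diagOne Adele y)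

theorem IsRapid.twistFun (hf : IsRapid f) (y : Adeleˣ) : IsRapid (twistFun f y) := hf.mul_left _

theorem IsDecaying.translate (hφ₁ : IsDecaying χ₁ φ₁) (y : Adeleˣ) : IsDecaying χ₁ (translate φ₁ y) :=
  hφ₁.mul_right _

theorem det_diagOne (y : Adeleˣ) : Matrix.GeneralLinearGroup.det (diagOne Adele y) = y := by
  refine Units.ext ?_
  change (diagOne Adele y).val.det = _
  rw [diagOne_val, Matrix.det_fin_two]
  simp

theorem rational_det (M : V2 ℚ) (k : Fin 2) : (ratV M k).det = algebraMap ℚ Adele (M k).det :=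
  ((algebraMap ℚ Adele).map_det (M k)).symm

theorem bilin_ratV (M : V2 ℚ) : bilin (ratV M 0) (ratV M 1) = algebraMap ℚ Adele (bilin (M 0) (M 1)) := by
  have : ratV M 0 + ratV M 1 = (M 0 + M 1).map (algebraMap ℚ Adele) :=
    (Matrix.map_add _ (map_add (algebraMap ℚ Adele)) (M 0) (M 1)).symm
  rw [bilin, bilin, this, rational_det, rational_det, map_sub, map_sub]
  congr 2
  exact ((algebraMap ℚ Adele).map_det (M 0 + M 1)).symm

/-- Writing the first component of `c(g)` as `(h¹ diag(y, 1)⁻¹) diag(y, 1)` makes the pair `(h¹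
diag(y, 1)⁻¹, h²)` an element of `H₁(𝔸)`. The choice of `c` thus amounts to a right translation,
invisible after integration. -/
theorem thetaIntegrand_eq (hχ : χ₁ * χ₂ = 1) (hφ₁ : IsDecaying χ₁ φ₁) (hφ₂ : IsDecaying χ₂ φ₂)
    (ψ : AddChar Adele Circle) {c : GSp4 Adele → GL2 Adele × GL2 Adele}
    (hc : ∀ g, Matrix.GeneralLinearGroup.det (c g).1 * (Matrix.GeneralLinearGroup.det (c g).2)⁻¹
      = similitude g) (u v w : Adele) (y : Adeleˣ) : ∃ k : H1, ∀ h : H1,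
    thetaIntegrand ψ c φ₁ φ₂ f (unipU u v w * torusT y) h =
      thetaSeries ψ (twistFun f y) (translate φ₁ y) φ₂ u v w (h * k).rep := by
  obtain ⟨p₀, hp₀⟩ : ∃ p, p = c (unipU u v w * torusT y) := ⟨_, rfl⟩
  have hc' := hc (unipU u v w * torusT y)
  rw [similitude_unipU_mul_torusT, ← hp₀] at hc'
  have hp : (p₀.1 * (diagOne Adele y)⁻¹, p₀.2) ∈ PairsEqDet Adele := by
    change Matrix.GeneralLinearGroup.det (p₀.1 * (diagOne Adele y)⁻¹) = Matrix.GeneralLinearGroup.det p₀.2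
    rw [map_mul, map_inv, det_diagOne, ← hc', _root_.mul_inv_rev, inv_inv, mul_left_comm, mul_inv_cancel, mul_one]
  refine ⟨H1.mk ⟨_, hp⟩, fun h => ?_⟩
  obtain ⟨q, hq, -⟩ := exists_mk_eq h
  have hdet : Matrix.GeneralLinearGroup.det h.rep.1 = Matrix.GeneralLinearGroup.det h.rep.2 := by
    rw [← hq]; exact q.2
  rw [rep_mul_of_invariant' (F := thetaSeries ψ (twistFun f y) (translate φ₁ y) φ₂ u v w)
    (thetaSeries_scalar_mul hχ (hφ₁.translate y) hφ₂ ψ u v w), thetaIntegrand, ← hp₀, thetaKernel]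
  have hh : Matrix.GeneralLinearGroup.det (h.rep * p₀).1 * (Matrix.GeneralLinearGroup.det (h.rep * p₀).2)⁻¹ = y := by
    rw [Prod.fst_mul, Prod.snd_mul, map_mul, map_mul, hdet, _root_.mul_inv_rev, mul_comm (Matrix.GeneralLinearGroup.det h.rep.2),
      mul_assoc, mul_comm _ (Matrix.GeneralLinearGroup.det h.rep.2)⁻¹, mul_inv_cancel_left, hc']
  rw [thetaSeries, mul_assoc, ← tsum_mul_right]
  refine tsum_congr fun M => ?_
  change weil ψ (unipU u v w * torusT y) (h.rep * p₀) f (ratV M) * _ = _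
  have hG : h.rep * p₀ = (h.rep.1 * (p₀.1 * (diagOne Adele y)⁻¹) * diagOne Adele y, h.rep.2 * p₀.2) := by
    refine Prod.ext ?_ rfl
    rw [Prod.fst_mul, mul_assoc, inv_mul_cancel_right]
  rw [weil_unipU_mul_torusT ψ f u v w y hh, rational_det, rational_det, bilin_ratV, mul_assoc, thetaTerm, hG,
    actInv_mul_diagOne (h.rep.1 * (p₀.1 * (diagOne Adele y)⁻¹), h.rep.2 * p₀.2)]
  have h1 : h.rep.1 * p₀.1 = h.rep.1 * (p₀.1 * (diagOne Adele y)⁻¹) * diagOne Adele y := by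
    rw [mul_assoc, inv_mul_cancel_right]
  rw [h1]
  rfl

variable [dh.IsMulRightInvariant]

theorem integrable_thetaIntegrand (hdθ : IsDiscreteQuotientMeasure H1rat dh dθ) (hχ : χ₁ * χ₂ = 1)
    (hφ₁ : IsDecaying χ₁ φ₁) (hφ₂ : IsDecaying χ₂ φ₂) (hf : IsRapid f)
    (ψ : AddChar Adele Circle) {c : GSp4 Adele → GL2 Adele × GL2 Adele}
    (hc : ∀ g, Matrix.GeneralLinearGroup.det (c g).1 * (Matrix.GeneralLinearGroup.det (c g).2)⁻¹
      = similitude g) (u v w : Adele) (y : Adeleˣ) :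
    Integrable (fun h : RightCosets H1rat =>
      thetaIntegrand ψ c φ₁ φ₂ f (unipU u v w * torusT y) h.out) dθ := by
  obtain ⟨k, hk⟩ := thetaIntegrand_eq (f := f) hχ hφ₁ hφ₂ ψ hc u v w y
  simp only [hk]
  have h := (hdθ.map_mul_right k).integrable_comp_of_integrable
    (integrable_thetaSeries hdθ hχ (hφ₁.translate y) hφ₂ (hf.twistFun y) ψ u v w)
  refine h.congr (Filter.Eventually.of_forall fun x => ?_)
  exact out_rmk_of_invariant (F := fun h : H1 =>
    thetaSeries ψ (twistFun f y) (translate φ₁ y) φ₂ u v w h.rep)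
    (rep_rat_mul_of_invariant (thetaSeries_scalar_mul hχ (hφ₁.translate y) hφ₂ ψ u v w)
      (thetaSeries_rat_mul (hφ₁.translate y) hφ₂ ψ u v w)) _

theorem thetaLift_eq (hdθ : IsDiscreteQuotientMeasure H1rat dh dθ) (hχ : χ₁ * χ₂ = 1)
    (hφ₁ : IsDecaying χ₁ φ₁) (hφ₂ : IsDecaying χ₂ φ₂) (hf : IsRapid f)
    (ψ : AddChar Adele Circle) {c : GSp4 Adele → GL2 Adele × GL2 Adele}
    (hc : ∀ g, Matrix.GeneralLinearGroup.det (c g).1 * (Matrix.GeneralLinearGroup.det (c g).2)⁻¹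
      = similitude g) (u v w : Adele) (y : Adeleˣ) :
    thetaLift ψ dθ c φ₁ φ₂ f (unipU u v w * torusT y) =
      ∑' t, (ψ (pairing t u v w) : ℂ) * thetaCoeff dθ (twistFun f y) (translate φ₁ y) φ₂ t := by
  obtain ⟨k, hk⟩ := thetaIntegrand_eq (f := f) hχ hφ₁ hφ₂ ψ hc u v w y
  simp only [thetaLift, hk]
  rw [← integral_thetaSeries hdθ hχ (hφ₁.translate y) hφ₂ (hf.twistFun y) ψ u v w]
  exact hdθ.integral_comp_mul_right k
    (measurable_thetaSeries_rep hχ (hf.twistFun y) (hφ₁.translate y) hφ₂ ψ u v w)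
    (rep_rat_mul_of_invariant (thetaSeries_scalar_mul hχ (hφ₁.translate y) hφ₂ ψ u v w)
      (thetaSeries_rat_mul (hφ₁.translate y) hφ₂ ψ u v w))

/-- The factor `ψ⁻¹(w)` shifts the third frequency by `-1`. -/
theorem unipIntegrand_eq (hdθ : IsDiscreteQuotientMeasure H1rat dh dθ) (hχ : χ₁ * χ₂ = 1)
    (hφ₁ : IsDecaying χ₁ φ₁) (hφ₂ : IsDecaying χ₂ φ₂) (hf : IsRapid f)
    (ψ : AddChar Adele Circle) {c : GSp4 Adele → GL2 Adele × GL2 Adele}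
    (hc : ∀ g, Matrix.GeneralLinearGroup.det (c g).1 * (Matrix.GeneralLinearGroup.det (c g).2)⁻¹
      = similitude g) (y : Adeleˣ) :
    unipIntegrand ψ (thetaLift ψ dθ c φ₁ φ₂ f) (torusT y) = fun x =>
      ∑' t : ℚ × ℚ × ℚ, thetaCoeff dθ (twistFun f y) (translate φ₁ y) φ₂ t *
        (ratChar ψ t.1 x.1 * (ratChar ψ t.2.1 x.2.1 * ratChar ψ (t.2.2 - 1) x.2.2)) := by
  funext x
  rw [unipIntegrand, thetaLift_eq hdθ hχ hφ₁ hφ₂ hf ψ hc, ← tsum_mul_right]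
  refine tsum_congr fun t => ?_
  rw [mul_comm _ (thetaCoeff _ _ _ _ _), mul_assoc]
  congr 1
  simp only [ratChar, pairing, ← Circle.coe_mul, ← AddChar.map_neg_eq_inv, ← AddChar.map_add_eq_mul]
  congr 2
  rw [map_sub, map_one]
  ring

theorem integrable_unipIntegrand (hdθ : IsDiscreteQuotientMeasure H1rat dh dθ) (hχ : χ₁ * χ₂ = 1)
    (hφ₁ : IsDecaying χ₁ φ₁) (hφ₂ : IsDecaying χ₂ φ₂) (hf : IsRapid f)
    {ψ : AddChar Adele Circle} (hψ : Continuous ψ) (hrat : ∀ q : ℚ, ψ (algebraMap ℚ Adele q) = 1)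
    {c : GSp4 Adele → GL2 Adele × GL2 Adele}
    (hc : ∀ g, Matrix.GeneralLinearGroup.det (c g).1 * (Matrix.GeneralLinearGroup.det (c g).2)⁻¹
      = similitude g) (dx : Measure AdeleModRat) [IsProbabilityMeasure dx] (y : Adeleˣ) :
    Integrable (unipIntegrand ψ (thetaLift ψ dθ c φ₁ φ₂ f) (torusT y)) (dx.prod (dx.prod dx)) := by
  rw [unipIntegrand_eq hdθ hχ hφ₁ hφ₂ hf ψ hc]
  refine ⟨(Measurable.tsum fun t => ((measurable_ratChar hψ hrat _).comp measurable_fst |>.mul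
    (((measurable_ratChar hψ hrat _).comp (measurable_fst.comp measurable_snd)).mul
      ((measurable_ratChar hψ hrat _).comp (measurable_snd.comp measurable_snd)))).const_mul _).aestronglyMeasurable,
    ?_⟩
  refine (lintegral_mono fun x => (enorm_tsum_le _).trans (le_of_eq ?_)).trans_lt
    (show ∫⁻ _, ∑' t, ‖thetaCoeff dθ (twistFun f y) (translate φ₁ y) φ₂ t‖ₑ ∂(dx.prod (dx.prod dx)) < ⊤ from ?_)
  · simp only [enorm_mul, enorm_ratChar, mul_one]
  · rw [lintegral_const, measure_univ, mul_one]
    exact summable_thetaCoeff hdθ hχ (hφ₁.translate y) hφ₂ (hf.twistFun y)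

/-- Termwise integration of the absolutely convergent expansion; orthogonality leaves the frequency
`(0, 0, 1)`. -/
theorem unipCoeff_eq (hdθ : IsDiscreteQuotientMeasure H1rat dh dθ) (hχ : χ₁ * χ₂ = 1)
    (hφ₁ : IsDecaying χ₁ φ₁) (hφ₂ : IsDecaying χ₂ φ₂) (hf : IsRapid f)
    {ψ : AddChar Adele Circle} (hψ : Continuous ψ) (hne : ψ ≠ 1) (hrat : ∀ q : ℚ, ψ (algebraMap ℚ Adele q) = 1)
    {c : GSp4 Adele → GL2 Adele × GL2 Adele}
    (hc : ∀ g, Matrix.GeneralLinearGroup.det (c g).1 * (Matrix.GeneralLinearGroup.det (c g).2)⁻¹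
      = similitude g) (dx : Measure AdeleModRat) [dx.IsAddHaarMeasure] [IsProbabilityMeasure dx] (y : Adeleˣ) :
    unipCoeff ψ dx (thetaLift ψ dθ c φ₁ φ₂ f) (torusT y) =
      thetaCoeff dθ (twistFun f y) (translate φ₁ y) φ₂ (0, 0, 1) := by
  rw [unipCoeff, unipIntegrand_eq hdθ hχ hφ₁ hφ₂ hf ψ hc, integral_tsum]
  · have hterm : ∀ t : ℚ × ℚ × ℚ, ∫ x : AdeleModRat × AdeleModRat × AdeleModRat,
        thetaCoeff dθ (twistFun f y) (translate φ₁ y) φ₂ t *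
        (ratChar ψ t.1 x.1 * (ratChar ψ t.2.1 x.2.1 * ratChar ψ (t.2.2 - 1) x.2.2)) ∂(dx.prod (dx.prod dx)) =
        thetaCoeff dθ (twistFun f y) (translate φ₁ y) φ₂ t * ((if t.1 = 0 then 1 else 0) *
          ((if t.2.1 = 0 then 1 else 0) * if t.2.2 - 1 = 0 then 1 else 0)) := by
      intro t
      rw [integral_const_mul, integral_prod_mul (ratChar ψ t.1)
        (fun x : AdeleModRat × AdeleModRat => ratChar ψ t.2.1 x.1 * ratChar ψ (t.2.2 - 1) x.2),
        integral_prod_mul, integral_ratChar hne hrat, integral_ratChar hne hrat, integral_ratChar hne hrat]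
    simp only [hterm]
    rw [tsum_eq_single (0, 0, 1)]
    · simp
    · rintro ⟨a, b, c⟩ h
      simp only [mul_ite, mul_one, mul_zero, sub_eq_zero, ite_eq_right_iff]
      rintro rfl rfl rfl
      exact absurd rfl h
  · exact fun t => (((measurable_ratChar hψ hrat _).comp measurable_fst |>.mul
      (((measurable_ratChar hψ hrat _).comp (measurable_fst.comp measurable_snd)).mul
        ((measurable_ratChar hψ hrat _).comp (measurable_snd.comp measurable_snd)))).const_mul _).aestronglyMeasurable
  · simp only [enorm_mul, enorm_ratChar, mul_one, lintegral_const, measure_univ]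
    exact (summable_thetaCoeff hdθ hχ (hφ₁.translate y) hφ₂ (hf.twistFun y)).ne

end BesselCoefficient

/-! ### The orbit of the base point -/

section Orbit

/-- The base point, over `ℚ`. -/
def ratPoint : V2 ℚ := ![idemFst ℚ, idemSnd ℚ]

theorem ratV_ratPoint : ratV ratPoint = pointP := by
  funext k
  refine Matrix.ext fun i j => ?_
  fin_cases k <;> fin_cases i <;> fin_cases j <;>
    first
      | exact map_one (algebraMap ℚ Adele)
      | exact map_zero (algebraMap ℚ Adele)

theorem gramT_ratPoint : gramT ratPoint = (0, 0, 1) := by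
  simp [gramT, ratPoint, bilin, Matrix.det_fin_two]

/-- The hypotheses say that `A` has eigenvalues `0` and `1`, equivalently determinant `0` and trace
`1`. The rows of `g` are left eigenvectors, for `1` and for `0` respectively. -/
theorem exists_conj_idemFst {A : Matrix (Fin 2) (Fin 2) ℚ} (h0 : A.det = 0) (h1 : (1 - A).det = 0) :
    ∃ g : GL2 ℚ, g.val * A = idemFst ℚ * g.val := by
  obtain ⟨a, ha⟩ : ∃ a, a = A 0 0 := ⟨_, rfl⟩
  obtain ⟨b, hb⟩ : ∃ b, b = A 0 1 := ⟨_, rfl⟩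
  obtain ⟨c, hc⟩ : ∃ c, c = A 1 0 := ⟨_, rfl⟩
  obtain ⟨d, hd⟩ : ∃ d, d = A 1 1 := ⟨_, rfl⟩
  have hA : A = !![a, b; c, d] := by
    rw [ha, hb, hc, hd]; exact Matrix.eta_fin_two A
  have e0 : a * d - b * c = 0 := by rw [Matrix.det_fin_two, ← ha, ← hb, ← hc, ← hd] at h0; exact h0
  have e1 : (1 - a) * (1 - d) - b * c = 0 := by
    rw [Matrix.det_fin_two] at h1
    simp only [Matrix.sub_apply, ← ha, ← hb, ← hc, ← hd] at h1
    simpa using h1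
  have e2 : a + d = 1 := by linear_combination e0 - e1
  rw [hA]
  -- The general choice, with first row that of `A`, has determinant `a`; when `a = 0` the second
  -- row `(c, d)` with `d = 1` serves instead.
  by_cases h : a = 0
  · have hd1 : d = 1 := by rw [h, zero_add] at e2; exact e2
    have hbc : b * c = 0 := by rw [h] at e0; linear_combination -e0
    refine ⟨glOfDet c d d (-b) (-1) (by rw [hd1]; push_cast; linear_combination -hbc), ?_⟩
    change !![c, d; d, -b] * !![a, b; c, d] = !![1, 0; 0, 0] * !![c, d; d, -b]
    rw [h, hd1]
    simp only [Matrix.mul_fin_two]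
    congr 1
    ext i j
    have h' := mul_eq_zero.1 hbc
    fin_cases i <;> fin_cases j <;> simp <;> tauto
  · refine ⟨glOfDet a b (-c) a (Units.mk0 a h) (by
      rw [Units.val_mk0]; linear_combination a * e2 - e0), ?_⟩
    change !![a, b; -c, a] * !![a, b; c, d] = !![1, 0; 0, 0] * !![a, b; -c, a]
    simp only [Matrix.mul_fin_two]
    congr 1
    ext i j
    fin_cases i <;> fin_cases j <;> simp
    · linear_combination a * e2 - e0
    · linear_combination b * e2
    · ring
    · linear_combination e0

/-- `N = M₀ + M₁` has determinant `(M₀, M₁) = 1`. If `g` diagonalizes the idempotent `M₀ N⁻¹`, then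
it diagonalizes the complementary one `M₁ N⁻¹`, and `(g, g N)` carries the base point to `M`. -/
theorem exists_actInv_ratPoint_eq {M : V2 ℚ} (hM : gramT M = (0, 0, 1)) :
    ∃ δ : PairsEqDet ℚ, actInv δ.1 ratPoint = M := by
  have h0 : (M 0).det = 0 := congrArg Prod.fst hM
  have h1 : (M 1).det = 0 := congrArg (fun t => t.2.1) hM
  have h2 : bilin (M 0) (M 1) = 1 := congrArg (fun t => t.2.2) hM
  have hN : (M 0 + M 1).det = 1 := by
    rw [bilin, h0, h1, sub_zero, sub_zero] at h2; exact h2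
  obtain ⟨N, hNv⟩ : ∃ N : GL2 ℚ, N.val = M 0 + M 1 :=
    ⟨Matrix.GeneralLinearGroup.mkOfDetNeZero _ (by rw [hN]; exact one_ne_zero), rfl⟩
  have hA : 1 - M 0 * N⁻¹.val = M 1 * N⁻¹.val := by
    rw [sub_eq_iff_eq_add, ← Matrix.add_mul, add_comm, ← hNv, Units.mul_inv]
  obtain ⟨g, hg⟩ := exists_conj_idemFst (A := M 0 * N⁻¹.val) (by rw [Matrix.det_mul, h0, zero_mul])
    (by rw [hA, Matrix.det_mul, h1, zero_mul])
  have hg0 : g⁻¹.val * idemFst ℚ * (g * N).val = M 0 := by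
    rw [Units.val_mul, Matrix.mul_assoc, ← Matrix.mul_assoc (idemFst ℚ), ← hg, Matrix.mul_assoc g.val,
      Matrix.mul_assoc (M 0), Units.inv_mul, Matrix.mul_one, ← Matrix.mul_assoc, Units.inv_mul, Matrix.one_mul]
  have hg1 : g⁻¹.val * idemSnd ℚ * (g * N).val = M 1 := by
    have := add_projections g⁻¹.val (g * N).val
    rw [hg0, Units.val_mul, ← Matrix.mul_assoc g⁻¹.val, Units.inv_mul, Matrix.one_mul, hNv] at this
    rw [← hNv] at this
    have h' := add_left_cancel (this.trans hNv)
    rwa [Units.val_mul]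
  refine ⟨⟨(g, g * N), ?_⟩, ?_⟩
  · refine Units.ext ?_
    change g.val.det = (g.val * N.val).det
    rw [Matrix.det_mul, hNv, hN, mul_one]
  · funext k
    fin_cases k
    · exact hg0
    · exact hg1

/-- Fixing both idempotents means fixing their sum `1`, so the two components agree. Commuting with
`e₁₁` makes the common matrix diagonal, hence a scalar times some `diag(a, 1)`. -/
theorem ratH1_eq_torusD {δ : PairsEqDet ℚ} (h : actInv δ.1 ratPoint = ratPoint) :
    ∃ q : ratIdeles, ratH1 δ = torusD q := by
  have h0 : δ.1.1⁻¹.val * idemFst ℚ * δ.1.2.val = idemFst ℚ := congrFun h 0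
  have h1 : δ.1.1⁻¹.val * idemSnd ℚ * δ.1.2.val = idemSnd ℚ := congrFun h 1
  have h12 : δ.1.2 = δ.1.1 := by
    have := add_projections δ.1.1⁻¹.val δ.1.2.val
    rw [h0, h1] at this
    have h2 : δ.1.1⁻¹ * δ.1.2 = 1 := by
      refine Units.ext ?_
      rw [Units.val_mul, ← this, Units.val_one, Matrix.one_fin_two]
      ext i j
      fin_cases i <;> fin_cases j <;> simp
    rwa [inv_mul_eq_one, eq_comm] at h2
  obtain ⟨g, hg⟩ : ∃ g, g = δ.1.1 := ⟨_, rfl⟩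
  rw [h12, ← hg] at h0
  have hcomm : idemFst ℚ * g.val = g.val * idemFst ℚ := by
    conv_rhs => rw [← h0]
    rw [Matrix.mul_assoc, ← Matrix.mul_assoc g.val, Units.mul_inv, Matrix.one_mul]
  have hb : g.val 0 1 = 0 := by
    have := congrFun (congrFun hcomm 0) 1
    simpa [Matrix.mul_apply, Fin.sum_univ_two] using this
  have hc : g.val 1 0 = 0 := by
    have := congrFun (congrFun hcomm 1) 0
    simpa [Matrix.mul_apply, Fin.sum_univ_two, eq_comm] using this
  have hdet : g.val 0 0 * g.val 1 1 ≠ 0 := by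
    have := (Matrix.GeneralLinearGroup.det g).ne_zero
    change g.val.det ≠ 0 at this
    rwa [Matrix.det_fin_two, hb, zero_mul, sub_zero] at this
  obtain ⟨d, hd⟩ : ∃ d : ℚˣ, (d : ℚ) = g.val 1 1 := ⟨Units.mk0 _ (right_ne_zero_of_mul hdet), rfl⟩
  obtain ⟨a, ha⟩ : ∃ a : ℚˣ, (a : ℚ) = g.val 0 0 := ⟨Units.mk0 _ (left_ne_zero_of_mul hdet), rfl⟩
  refine ⟨⟨ratIdele (d⁻¹ * a), mem_ratIdeles.2 ⟨_, rfl⟩⟩, ?_⟩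
  have key : ratGL g = scalarGL (ratIdele d) * diagOne Adele (ratIdele (d⁻¹ * a)) := by
    refine Units.ext (Matrix.ext fun i j => ?_)
    rw [scalarGL_val_apply, diagOne_val]
    change algebraMap ℚ Adele (g.val i j) = algebraMap ℚ Adele d * _
    fin_cases i <;> fin_cases j
    · change algebraMap ℚ Adele (g.val 0 0) = algebraMap ℚ Adele d * algebraMap ℚ Adele ((d⁻¹ * a : ℚˣ) : ℚ)
      rw [← map_mul, ← Units.val_mul, mul_inv_cancel_left, ha]
    · change algebraMap ℚ Adele (g.val 0 1) = algebraMap ℚ Adele d * 0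
      rw [hb, map_zero, mul_zero]
    · change algebraMap ℚ Adele (g.val 1 0) = algebraMap ℚ Adele d * 0
      rw [hc, map_zero, mul_zero]
    · change algebraMap ℚ Adele (g.val 1 1) = algebraMap ℚ Adele d * 1
      rw [mul_one, hd]
  rw [torusD_eq, ← mk_scalar_mul (ratIdele d), ← map_mul, ← key]
  change H1.mk (ratPair δ) = _
  congr 1
  refine Subtype.ext (Prod.ext ?_ ?_)
  · rw [ratPair_fst, diagPair_fst, hg]
  · rw [ratPair_snd, diagPair_snd, h12, hg]

theorem torusD_injective : Function.Injective torusD := by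
  refine (injective_iff_map_eq_one torusD).2 fun a ha => ?_
  have h := (QuotientGroup.eq_one_iff _).1 (show ((diagPair Adele (diagOne Adele a) : PairsEqDet Adele) :
    PairsEqDet Adele ⧸ scalarPairs Adele) = 1 from ha)
  obtain ⟨z, hz⟩ := h
  have h1 : scalarGL z * 1 = diagOne Adele a := by
    rw [mul_one]
    exact congrArg (fun p : PairsEqDet Adele => p.1.1) hz
  have h00 := congrArg (fun g : GL2 Adele => g.val 0 0) h1
  have h11 := congrArg (fun g : GL2 Adele => g.val 1 1) h1
  simp only [scalarGL_val_apply, diagOne_val] at h00 h11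
  have e00 : (z : Adele) * 1 = a := h00
  have e11 : (z : Adele) * 1 = 1 := h11
  exact Units.ext (e00.symm.trans e11)

theorem torusD_mem_H1rat (q : ratIdeles) : torusD q ∈ H1rat := by
  obtain ⟨_, r, rfl⟩ := q
  refine mem_H1rat.2 ⟨diagPair ℚ (diagOne ℚ r), ?_⟩
  change H1.mk _ = H1.mk (diagPair Adele (diagOne Adele (ratIdele r)))
  congr 1
  refine Subtype.ext (Prod.ext ?_ ?_)
  · exact (diagOne_ratIdele r).symm
  · exact (diagOne_ratIdele r).symm

theorem actInv_diagOne_pointP (a : Adeleˣ) : actInv (diagOne Adele a, diagOne Adele a) pointP = pointP := by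
  have h : ∀ x y : Adele, (diagOne Adele a)⁻¹.val * !![x, 0; 0, y] * (diagOne Adele a).val = !![x, 0; 0, y] := by
    intro x y
    rw [diagOne_val, diagOne_inv_val, Matrix.mul_fin_two, Matrix.mul_fin_two]
    simp only [mul_zero, zero_mul, add_zero, zero_add, mul_one, one_mul]
    rw [mul_right_comm, Units.inv_mul, one_mul]
  funext k
  fin_cases k
  · exact h 1 0
  · exact h 0 1

theorem actInv_torusD_mul (a : Adeleˣ) (h : H1) :
    actInv (H1.rep (torusD a * h)) pointP = actInv h.rep pointP := by
  rw [torusD_eq, rep_mul_of_invariant (F := fun g => actInv g pointP) fun z g g' => actInv_scalar_mul z g g' _]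
  change actInv ((diagOne Adele a, diagOne Adele a) * h.rep) pointP = _
  rw [actInv_mul, actInv_diagOne_pointP]

theorem exists_ratH1 (γ : H1rat) : ∃ δ, ratH1 δ = γ := mem_H1rat.1 γ.2

/-- The point of the rational orbit that belongs to `γ`. -/
noncomputable def orbitPoint (γ : H1rat) : V2 ℚ := actInv (exists_ratH1 γ).choose.1 ratPoint

theorem actInv_ratH1_rep (δ : PairsEqDet ℚ) :
    actInv (H1.rep (ratH1 δ)) pointP = ratV (actInv δ.1 ratPoint) := by
  have := rep_mk_of_invariant (F := fun g => actInv g pointP) (fun z g g' => actInv_scalar_mul z g g' _) (ratPair δ)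
  rw [← actInv_ratV, ratV_ratPoint]
  exact this

theorem ratV_injective : Function.Injective ratV := fun M M' h => by
  funext k
  refine Matrix.ext fun i j => algebraMap_adele_injective ?_
  exact congrFun (congrFun (congrFun h k) i) j

theorem ratV_orbitPoint (γ : H1rat) : ratV (orbitPoint γ) = actInv (H1.rep γ) pointP := by
  have h := (exists_ratH1 γ).choose_spec
  rw [← h, actInv_ratH1_rep, orbitPoint]

theorem gramT_orbitPoint (γ : H1rat) : gramT (orbitPoint γ) = (0, 0, 1) := by
  rw [orbitPoint, gramT_actInv, gramT_ratPoint]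

theorem orbitPoint_ratH1 (δ : PairsEqDet ℚ) : orbitPoint ⟨ratH1 δ, ratH1_mem δ⟩ = actInv δ.1 ratPoint :=
  ratV_injective (by rw [ratV_orbitPoint, actInv_ratH1_rep])

/-- The stabilizer of the base point acts simply transitively on the fibers of `orbitPoint`. -/
theorem exists_fiberEquiv {M : V2 ℚ} (hM : gramT M = (0, 0, 1)) : ∃ γ₀ : H1rat,
    ∃ e : ratIdeles ≃ {γ : H1rat // orbitPoint γ = M}, ∀ q, ((e q).1 : H1) = torusD q * γ₀ := by
  obtain ⟨δ, hδ⟩ := exists_actInv_ratPoint_eq hM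
  have hmem : ∀ q : ratIdeles, torusD q * ratH1 δ ∈ H1rat := fun q =>
    H1rat.mul_mem (torusD_mem_H1rat q) (ratH1_mem δ)
  have horb : ∀ q : ratIdeles, orbitPoint ⟨_, hmem q⟩ = M := fun q =>
    ratV_injective (by rw [ratV_orbitPoint, actInv_torusD_mul, actInv_ratH1_rep, hδ])
  refine ⟨⟨ratH1 δ, ratH1_mem δ⟩, Equiv.ofBijective (fun q => ⟨⟨_, hmem q⟩, horb q⟩) ⟨?_, ?_⟩, fun q => rfl⟩
  · intro q q' h
    have h' : torusD q * ratH1 δ = torusD q' * ratH1 δ := congrArg (fun x => (x.1 : H1)) h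
    exact Subtype.ext (torusD_injective (mul_right_cancel h'))
  · rintro ⟨⟨γ, hγ⟩, h⟩
    obtain ⟨δ', rfl⟩ := mem_H1rat.1 hγ
    rw [orbitPoint_ratH1] at h
    obtain ⟨q, hq⟩ := ratH1_eq_torusD (δ := δ' * δ⁻¹) (by
      change actInv (δ'.1 * δ.1⁻¹) ratPoint = ratPoint
      rw [actInv_mul, h, ← hδ, actInv_inv_actInv])
    refine ⟨q, Subtype.ext (Subtype.ext ?_)⟩
    change torusD q * ratH1 δ = ratH1 δ'
    rw [← hq, ← map_mul, inv_mul_cancel_right]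

end Orbit

/-! ### Unfolding -/

section Unfold

variable {χ₁ χ₂ : Adeleˣ →* ℂˣ} {φ₁ φ₂ : GL2 Adele → ℂ} {f : V2 Adele → ℂ}
variable {dh : Measure H1} [dh.IsHaarMeasure] {dθ : Measure (RightCosets H1rat)}

theorem thetaTerm_ratPoint_mul (hχ : χ₁ * χ₂ = 1) (hφ₁ : IsDecaying χ₁ φ₁) (hφ₂ : IsDecaying χ₂ φ₂)
    (γ : H1rat) (h : H1) :
    thetaTerm f φ₁ φ₂ ratPoint (H1.rep (γ * h)) = thetaTerm f φ₁ φ₂ (orbitPoint γ) h.rep := by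
  have hδ := (exists_ratH1 γ).choose_spec
  rw [orbitPoint, ← thetaTerm_rat_mul hφ₁ hφ₂]
  conv_lhs => rw [← hδ]
  exact rep_mul_of_invariant (thetaTerm_scalar_mul hχ hφ₁ hφ₂ ratPoint) (ratPair _) h

/-- The elements that lead to `M` form one `D(ℚ)`-coset, and the weights add up to `1` on each of
them. -/
theorem tsum_fiber_weight {W : H1 → ℝ≥0∞} (hW : ∀ h, ∑' q : ratIdeles, W (torusD q * h) = 1)
    (M : {M // gramT M = (0, 0, 1)}) (h : H1) :
    ∑' γ : {γ : H1rat // orbitPoint γ = M}, W (γ.1 * h) = 1 := by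
  obtain ⟨γ₀, e, he⟩ := exists_fiberEquiv M.2
  rw [← e.tsum_eq, ← hW (γ₀ * h)]
  refine tsum_congr fun q => ?_
  rw [he, mul_assoc]

/-- The points of the rational orbit, with the elements that lead to them. -/
noncomputable def orbitEquiv : (Σ M : {M // gramT M = (0, 0, 1)}, {γ : H1rat // orbitPoint γ = M}) ≃ H1rat where
  toFun x := x.2.1
  invFun γ := ⟨⟨orbitPoint γ, gramT_orbitPoint γ⟩, ⟨γ, rfl⟩⟩
  left_inv := by
    rintro ⟨⟨M, hM⟩, ⟨γ, hγ⟩⟩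
    change orbitPoint γ = M at hγ
    subst hγ
    rfl
  right_inv _ := rfl

/-- Grouping the sum over `H₁(ℚ)` by orbit points, each point `M` of the orbit counts with total
weight `1`. -/
theorem tsum_enorm_weight (hχ : χ₁ * χ₂ = 1) (hφ₁ : IsDecaying χ₁ φ₁) (hφ₂ : IsDecaying χ₂ φ₂)
    {W : H1 → ℝ≥0∞} (hW : ∀ h, ∑' q : ratIdeles, W (torusD q * h) = 1) (h : H1) :
    ∑' γ : H1rat, W (γ * h) * ‖thetaTerm f φ₁ φ₂ ratPoint (H1.rep (γ * h))‖ₑ ≤ thetaNorm f φ₁ φ₂ h.rep := by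
  rw [← orbitEquiv.tsum_eq, ENNReal.tsum_sigma', ← tsum_enorm_thetaTerm]
  calc _ = ∑' M : {M // gramT M = (0, 0, 1)}, ‖thetaTerm f φ₁ φ₂ M h.rep‖ₑ := by
        refine tsum_congr fun M => ?_
        rw [← one_mul ‖thetaTerm f φ₁ φ₂ M h.rep‖ₑ, ← tsum_fiber_weight hW M h, ← ENNReal.tsum_mul_right]
        refine tsum_congr fun γ => ?_
        change W (γ.1 * h) * ‖thetaTerm f φ₁ φ₂ ratPoint (H1.rep (γ.1 * h))‖ₑ = _
        rw [thetaTerm_ratPoint_mul hχ hφ₁ hφ₂, γ.2]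
    _ ≤ _ := ENNReal.tsum_comp_le_tsum_of_injective Subtype.val_injective
      fun M => ‖thetaTerm f φ₁ φ₂ M h.rep‖ₑ

theorem weight_ne_top {W : H1 → ℝ≥0∞} (hW : ∀ h, ∑' q : ratIdeles, W (torusD q * h) = 1) (h : H1) : W h ≠ ⊤ := by
  have := ENNReal.le_tsum (f := fun q : ratIdeles => W (torusD q * h)) 1
  rw [hW, OneMemClass.coe_one, map_one, one_mul] at this
  exact (this.trans_lt ENNReal.one_lt_top).ne

theorem enorm_toReal_smul {w : ℝ≥0∞} (hw : w ≠ ⊤) (z : ℂ) : ‖w.toReal • z‖ₑ = w * ‖z‖ₑ := by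
  rw [enorm_smul, Real.enorm_of_nonneg ENNReal.toReal_nonneg, ENNReal.ofReal_toReal hw]

theorem tsum_weight_smul (hχ : χ₁ * χ₂ = 1) (hφ₁ : IsDecaying χ₁ φ₁) (hφ₂ : IsDecaying χ₂ φ₂)
    {W : H1 → ℝ≥0∞} (hW : ∀ h, ∑' q : ratIdeles, W (torusD q * h) = 1) {h : H1}
    (hh : thetaNorm f φ₁ φ₂ h.rep ≠ ⊤) :
    ∑' γ : H1rat, (W (γ * h)).toReal • thetaTerm f φ₁ φ₂ ratPoint (H1.rep (γ * h)) =
      fiberSum f φ₁ φ₂ (0, 0, 1) h.rep := by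
  have hs : Summable fun γ : H1rat => (W (γ * h)).toReal • thetaTerm f φ₁ φ₂ ratPoint (H1.rep (γ * h)) := by
    refine Summable.of_norm ?_
    have := ENNReal.summable_toReal ((tsum_enorm_weight (f := f) hχ hφ₁ hφ₂ hW h).trans_lt hh.lt_top).ne
    refine this.congr fun γ => ?_
    rw [← enorm_toReal_smul (weight_ne_top hW _), toReal_enorm]
  refine (orbitEquiv.tsum_eq fun γ : H1rat =>
    (W (γ * h)).toReal • thetaTerm f φ₁ φ₂ ratPoint (H1.rep (γ * h))).symm.trans
    ((Summable.tsum_sigma (orbitEquiv.summable_iff.2 hs)).trans (tsum_congr fun M => ?_))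
  have h1 : ∑' γ : {γ : H1rat // orbitPoint γ = M}, (W (γ.1 * h)).toReal = 1 := by
    rw [← ENNReal.tsum_toReal_eq fun γ => weight_ne_top hW _, tsum_fiber_weight hW, ENNReal.toReal_one]
  have h2 : Summable fun γ : {γ : H1rat // orbitPoint γ = M} => (W (γ.1 * h)).toReal :=
    ENNReal.summable_toReal (by rw [tsum_fiber_weight hW]; exact ENNReal.one_ne_top)
  rw [← one_smul ℝ (thetaTerm f φ₁ φ₂ M h.rep), ← h1, ← h2.tsum_smul_const]
  refine tsum_congr fun γ => ?_
  change (W (γ.1 * h)).toReal • thetaTerm f φ₁ φ₂ ratPoint (H1.rep (γ.1 * h)) = _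
  rw [thetaTerm_ratPoint_mul hχ hφ₁ hφ₂, γ.2]

theorem lintegral_weight_mul_lt_top (hdθ : IsDiscreteQuotientMeasure H1rat dh dθ) (hχ : χ₁ * χ₂ = 1)
    (hφ₁ : IsDecaying χ₁ φ₁) (hφ₂ : IsDecaying χ₂ φ₂) (hf : IsRapid f) {W : H1 → ℝ≥0∞} (hWm : Measurable W)
    (hW : ∀ h, ∑' q : ratIdeles, W (torusD q * h) = 1) :
    ∫⁻ h, W h * ‖thetaTerm f φ₁ φ₂ ratPoint h.rep‖ₑ ∂dh < ⊤ := by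
  rw [← hdθ (fun h => W h * ‖thetaTerm f φ₁ φ₂ ratPoint h.rep‖ₑ)
    (hWm.mul (measurable_thetaTerm_rep hχ hf hφ₁ hφ₂ _).enorm)]
  exact (lintegral_mono fun x => tsum_enorm_weight hχ hφ₁ hφ₂ hW _).trans_lt
    (lintegral_thetaNorm_lt_top hdθ hχ hφ₁ hφ₂ hf)

/-- The unfolding step: the sum over the orbit is a weighted sum over `H₁(ℚ)`, which combines with
the integral over `H₁(ℚ)\H₁(𝔸)`. The weight `W` replaces a fundamental domain for `D(ℚ)`. -/
theorem thetaCoeff_eq_integral (hdθ : IsDiscreteQuotientMeasure H1rat dh dθ) (hχ : χ₁ * χ₂ = 1)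
    (hφ₁ : IsDecaying χ₁ φ₁) (hφ₂ : IsDecaying χ₂ φ₂) (hf : IsRapid f) {W : H1 → ℝ≥0∞} (hWm : Measurable W)
    (hW : ∀ h, ∑' q : ratIdeles, W (torusD q * h) = 1) :
    thetaCoeff dθ f φ₁ φ₂ (0, 0, 1) = ∫ h, (W h).toReal • thetaTerm f φ₁ φ₂ ratPoint h.rep ∂dh := by
  have hm : Measurable fun h : H1 => (W h).toReal • thetaTerm f φ₁ φ₂ ratPoint h.rep :=
    hWm.ennreal_toReal.smul (measurable_thetaTerm_rep hχ hf hφ₁ hφ₂ _)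
  have hi : Integrable (fun h : H1 => (W h).toReal • thetaTerm f φ₁ φ₂ ratPoint h.rep) dh := by
    refine ⟨hm.aestronglyMeasurable, ?_⟩
    refine lt_of_eq_of_lt (lintegral_congr fun h => ?_)
      (lintegral_weight_mul_lt_top hdθ hχ hφ₁ hφ₂ hf hWm hW)
    exact enorm_toReal_smul (weight_ne_top hW h) _
  rw [← hdθ.integral_sum hm hi, thetaCoeff]
  refine integral_congr_ae ?_
  have hae : ∀ᵐ x : RightCosets H1rat ∂dθ, thetaNorm f φ₁ φ₂ x.out.rep < ⊤ :=
    ae_lt_top (measurable_out_of_invariant (F := fun h : H1 => thetaNorm f φ₁ φ₂ h.rep)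
      (measurable_thetaNorm_rep hχ hf hφ₁ hφ₂)
      (rep_rat_mul_of_invariant (thetaNorm_scalar_mul hχ hφ₁ hφ₂) (thetaNorm_rat_mul hφ₁ hφ₂)))
      (lintegral_thetaNorm_lt_top hdθ hχ hφ₁ hφ₂ hf).ne
  filter_upwards [hae] with x hx
  exact (tsum_weight_smul hχ hφ₁ hφ₂ hW hx.ne).symm

end Unfold

/-! ### Conjugation of the first component by `diag(y, 1)` -/

section Conjugation

theorem conjPair_mem (y : Adeleˣ) (p : PairsEqDet Adele) :
    (diagOne Adele y * p.1.1 * (diagOne Adele y)⁻¹, p.1.2) ∈ PairsEqDet Adele := by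
  change Matrix.GeneralLinearGroup.det (diagOne Adele y * p.1.1 * (diagOne Adele y)⁻¹) =
    Matrix.GeneralLinearGroup.det p.1.2
  have hp : Matrix.GeneralLinearGroup.det p.1.1 = Matrix.GeneralLinearGroup.det p.1.2 := p.2
  rw [map_mul, map_mul, map_inv, mul_right_comm, mul_inv_cancel, one_mul, hp]

/-- `(h₁, h₂) ↦ (d h₁ d⁻¹, h₂)` with `d = diag(y, 1)`, on pairs. -/
noncomputable def conjPair (y : Adeleˣ) : PairsEqDet Adele →* PairsEqDet Adele where
  toFun p := ⟨_, conjPair_mem y p⟩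
  map_one' := Subtype.ext (Prod.ext (by
    change diagOne Adele y * 1 * (diagOne Adele y)⁻¹ = 1
    rw [mul_one, mul_inv_cancel]) rfl)
  map_mul' p q := Subtype.ext (Prod.ext (by
    change diagOne Adele y * (p.1.1 * q.1.1) * (diagOne Adele y)⁻¹ =
      diagOne Adele y * p.1.1 * (diagOne Adele y)⁻¹ * (diagOne Adele y * q.1.1 * (diagOne Adele y)⁻¹)
    group) rfl)

theorem conjPair_scalar (y : Adeleˣ) : scalarPairs Adele ≤ (scalarPairs Adele).comap (conjPair y) := by
  rintro _ ⟨z, rfl⟩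
  refine ⟨z, Subtype.ext (Prod.ext ?_ rfl)⟩
  change scalarGL z = diagOne Adele y * scalarGL z * (diagOne Adele y)⁻¹
  rw [← scalarGL_mul_comm, mul_inv_cancel_right]

/-- `(h₁, h₂) ↦ (d h₁ d⁻¹, h₂)` with `d = diag(y, 1)`. -/
noncomputable def conjH (y : Adeleˣ) : H1 →* H1 :=
  QuotientGroup.map (scalarPairs Adele) (scalarPairs Adele) (conjPair y) (conjPair_scalar y)

theorem conjH_mk (y : Adeleˣ) (p : PairsEqDet Adele) : conjH y (H1.mk p) = H1.mk (conjPair y p) := rfl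

theorem continuous_conjH (y : Adeleˣ) : Continuous (conjH y) := by
  refine isOpenQuotientMap_H1mk.isQuotientMap.continuous_iff.2 ?_
  change Continuous fun p => H1.mk (conjPair y p)
  refine continuous_H1mk.comp (Continuous.subtype_mk (Continuous.prodMk ?_ ?_) _)
  · exact (continuous_const.mul (continuous_fst.comp continuous_subtype_val)).mul continuous_const
  · exact continuous_snd.comp continuous_subtype_val

theorem conjH_conjH (y z : Adeleˣ) (h : H1) : conjH y (conjH z h) = conjH (y * z) h := by
  obtain ⟨p, rfl⟩ := H1mk_surjective h
  rw [conjH_mk, conjH_mk, conjH_mk]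
  congr 1
  refine Subtype.ext (Prod.ext ?_ rfl)
  change diagOne Adele y * (diagOne Adele z * p.1.1 * (diagOne Adele z)⁻¹) * (diagOne Adele y)⁻¹ =
    diagOne Adele (y * z) * p.1.1 * (diagOne Adele (y * z))⁻¹
  rw [map_mul, _root_.mul_inv_rev]
  simp only [mul_assoc]

theorem conjH_one (h : H1) : conjH 1 h = h := by
  obtain ⟨p, rfl⟩ := H1mk_surjective h
  rw [conjH_mk]
  congr 1
  refine Subtype.ext (Prod.ext ?_ rfl)
  change diagOne Adele 1 * p.1.1 * (diagOne Adele 1)⁻¹ = p.1.1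
  rw [map_one, one_mul, inv_one, mul_one]

/-- `conjH y` as an automorphism of the topological group. -/
noncomputable def conjEquiv (y : Adeleˣ) : H1 ≃ₜ* H1 where
  toFun := conjH y
  invFun := conjH y⁻¹
  left_inv h := by rw [conjH_conjH, inv_mul_cancel, conjH_one]
  right_inv h := by rw [conjH_conjH, mul_inv_cancel, conjH_one]
  map_mul' := map_mul _
  continuous_toFun := continuous_conjH y
  continuous_invFun := continuous_conjH y⁻¹

/-- `diag(y, 1)` alone does not define an element of `H₁`, but `diag(y², 1)` divided by the scalar
`y` has determinant `1`. Hence the square of the automorphism is inner. -/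
theorem exists_conjH_sq (y : Adeleˣ) : ∃ k : H1, ∀ h, conjH y (conjH y h) = k * h * k⁻¹ := by
  have hk : ((scalarGL y)⁻¹ * (diagOne Adele y * diagOne Adele y), (1 : GL2 Adele)) ∈ PairsEqDet Adele := by
    change Matrix.GeneralLinearGroup.det ((scalarGL y)⁻¹ * (diagOne Adele y * diagOne Adele y)) =
      Matrix.GeneralLinearGroup.det 1
    have hs : Matrix.GeneralLinearGroup.det (scalarGL y) = y * y := by
      refine Units.ext ?_
      change (Matrix.scalar (Fin 2) (y : Adele)).det = _
      rw [Matrix.scalar_apply, Matrix.det_diagonal, Fin.prod_univ_two, Units.val_mul]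
    rw [map_mul, map_inv, map_mul, det_diagOne, hs, map_one, inv_mul_cancel]
  refine ⟨H1.mk ⟨_, hk⟩, fun h => ?_⟩
  obtain ⟨p, rfl⟩ := H1mk_surjective h
  rw [conjH_conjH, conjH_mk]
  refine (congrArg H1.mk ?_).trans (show H1.mk (⟨_, hk⟩ * p * ⟨_, hk⟩⁻¹) = _ by rw [map_mul, map_mul, map_inv])
  refine Subtype.ext (Prod.ext ?_ ?_)
  · change diagOne Adele (y * y) * p.1.1 * (diagOne Adele (y * y))⁻¹ =
      (scalarGL y)⁻¹ * (diagOne Adele y * diagOne Adele y) * p.1.1 *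
        ((scalarGL y)⁻¹ * (diagOne Adele y * diagOne Adele y))⁻¹
    rw [← map_mul, _root_.mul_inv_rev, inv_inv, ← scalarGL_mul_comm]
    have e : ∀ s D g : GL2 Adele, s⁻¹ * D * g * (s * D⁻¹) = s⁻¹ * (D * g * s) * D⁻¹ := fun s D g => by group
    rw [e, ← scalarGL_mul_comm, inv_mul_cancel_left]
  · change p.1.2 = 1 * p.1.2 * 1⁻¹
    rw [one_mul, inv_one, mul_one]

/-- The automorphism scales Haar measure by some `c`. Its square is inner and the measure is
bi-invariant, so `c² = 1`, and `c ≥ 0` gives `c = 1`. -/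
theorem measurePreserving_conjH (dh : Measure H1) [dh.IsHaarMeasure] [dh.IsMulRightInvariant] (y : Adeleˣ) :
    MeasurePreserving (conjH y) dh dh := by
  have hm : Measurable (conjH y) := (continuous_conjH y).measurable
  refine ⟨hm, ?_⟩
  obtain ⟨k, hk⟩ := exists_conjH_sq y
  have hsq : (dh.map (conjH y)).map (conjH y) = dh := by
    rw [Measure.map_map hm hm]
    have : conjH y ∘ conjH y = (fun h => h * k⁻¹) ∘ fun h => k * h := funext hk
    rw [this, ← Measure.map_map (measurable_mul_const _) (measurable_const_mul _), map_mul_left_eq_self,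
      map_mul_right_eq_self]
  obtain ⟨c, hc⟩ : ∃ c, c = mulEquivHaarChar (conjEquiv y) := ⟨_, rfl⟩
  have h1 : c • dh.map (conjH y) = dh := by rw [hc]; exact mulEquivHaarChar_smul_map dh (conjEquiv y)
  have h2 : c • dh = dh.map (conjH y) := by
    have := congrArg (fun m => m.map (conjH y)) h1
    simp only [Measure.map_smul, hsq] at this
    exact this
  have h3 : (c * c) • dh = dh := by rw [mul_smul, h2, h1]
  -- Evaluation on a compact neighbourhood, whose measure is neither zero nor infinite.
  have h4 : c * c = 1 := by
    obtain ⟨K, hK, hK1⟩ := exists_compact_mem_nhds (1 : H1)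
    have h0 : dh K ≠ 0 := (Measure.measure_pos_of_mem_nhds dh hK1).ne'
    have := congrArg (fun m => m K) h3
    simp only [Measure.smul_apply] at this
    rw [ENNReal.smul_def, smul_eq_mul] at this
    have h5 := (ENNReal.mul_eq_right h0 hK.measure_lt_top.ne).1 this
    exact_mod_cast h5
  have h5 : c = 1 := by
    exact (pow_eq_one_iff_of_nonneg zero_le two_ne_zero).1 ((sq c).trans h4)
  rw [← h2, h5, one_smul]

/-- The weight depends only on the second component, which the automorphism fixes. -/
theorem weight_conjH (da : Measure Adeleˣ) (y : Adeleˣ) (h : H1) : weight da (conjH y h) = weight da h := by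
  obtain ⟨p, rfl⟩ := H1mk_surjective h
  have : conjH y (H1.mk p) ∈ boxH ↔ H1.mk p ∈ boxH := by
    rw [conjH_mk, mk_mem_boxH, mk_mem_boxH]
    rfl
  by_cases hp : H1.mk p ∈ boxH
  · rw [weight, weight, Set.indicator_of_mem hp, Set.indicator_of_mem (this.2 hp)]
  · rw [weight, weight, Set.indicator_of_notMem hp, Set.indicator_of_notMem (mt this.1 hp)]

end Conjugation

/-! ### The coefficient as an integral over `D(ℚ) \ H₁(𝔸)` -/

section Coefficient

variable {χ₁ χ₂ : Adeleˣ →* ℂˣ} {φ₁ φ₂ : GL2 Adele → ℂ} {f : V2 Adele → ℂ}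
variable (da : Measure Adeleˣ)

/-- A weight whose translates under `D(ℚ)` sum to one. -/
noncomputable def ratWeight (h : H1) : ℝ≥0∞ :=
  ∫⁻ a in (posIdeles : Set Adeleˣ), weight da (torusD a⁻¹ * h) ∂da

theorem measurable_weight_torusD : Measurable fun t : H1 × Adeleˣ => weight da (torusD t.2⁻¹ * t.1) :=
  (measurable_weight da).comp (((continuous_torusD.comp (continuous_inv.comp continuous_snd)).mul
    continuous_fst).measurable)

theorem measurable_weight_torusD_inv (h : H1) : Measurable fun a : Adeleˣ => weight da (torusD a⁻¹ * h) :=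
  (measurable_weight da).comp (((continuous_torusD.comp continuous_inv).mul continuous_const).measurable)

theorem measurable_weight_torusD_left (h : H1) : Measurable fun a : Adeleˣ => weight da (torusD a * h) :=
  (measurable_weight da).comp ((continuous_torusD.mul continuous_const).measurable)

variable [da.IsHaarMeasure]

instance isInvInvariant_idele : da.IsInvInvariant := Measure.IsHaarMeasure.isInvInvariant_of_regular da

theorem measurePreserving_inv_posIdeles :
    MeasurePreserving (fun a : Adeleˣ => a⁻¹) (da.restrict (posIdeles : Set Adeleˣ))
      (da.restrict (posIdeles : Set Adeleˣ)) := by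
  have h := (Measure.measurePreserving_inv da).restrict_preimage isOpen_posIdeles.measurableSet
  have : (Inv.inv : Adeleˣ → Adeleˣ) ⁻¹' (posIdeles : Set Adeleˣ) = posIdeles := by
    ext a
    exact posIdeles.inv_mem_iff
  rw [this] at h
  exact h

theorem measurePreserving_mul_posIdeles {b : Adeleˣ} (hb : b ∈ posIdeles) :
    MeasurePreserving (fun a : Adeleˣ => a * b) (da.restrict (posIdeles : Set Adeleˣ))
      (da.restrict (posIdeles : Set Adeleˣ)) := by
  have h := (measurePreserving_mul_right da b).restrict_preimage isOpen_posIdeles.measurableSet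
  have : (fun a : Adeleˣ => a * b) ⁻¹' (posIdeles : Set Adeleˣ) = posIdeles := by
    ext a
    exact posIdeles.mul_mem_cancel_right hb
  rw [this] at h
  exact h

theorem measurable_ratWeight : Measurable (ratWeight da) :=
  (measurable_weight_torusD da).lintegral_prod_right'

/-- The rational translates of `posIdeles` tile the ideles, so the sum becomes the integral of
`weight` over all of `D(𝔸)`, which is `1`. -/
theorem tsum_ratWeight (h : H1) : ∑' q : ratIdeles, ratWeight da (torusD q * h) = 1 := by
  have hm := measurable_weight_torusD_left da h
  have hU : MeasurableSet (posIdeles : Set Adeleˣ) := isOpen_posIdeles.measurableSet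
  have hI : Measurable ((posIdeles : Set Adeleˣ).indicator (1 : Adeleˣ → ℝ≥0∞)) := measurable_one.indicator hU
  have hterm : ∀ q : ratIdeles, ratWeight da (torusD q * h) =
      ∫⁻ a, (posIdeles : Set Adeleˣ).indicator (1 : Adeleˣ → ℝ≥0∞) ((q⁻¹ : ratIdeles) * a) *
        weight da (torusD a * h) ∂da := by
    intro q
    rw [ratWeight, (measurePreserving_inv_posIdeles da).lintegral_comp
      (f := fun a => weight da (torusD a * (torusD q * h)))
      ((measurable_weight da).comp ((continuous_torusD.mul continuous_const).measurable)),
      ← lintegral_indicator hU, ← lintegral_mul_left_eq_self _ ((q⁻¹ : ratIdeles) : Adeleˣ)]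
    refine lintegral_congr fun a => ?_
    have ha : torusD ((q⁻¹ : ratIdeles) * a) * (torusD q * h) = torusD a * h := by
      rw [← mul_assoc, ← map_mul, mul_right_comm, InvMemClass.coe_inv, inv_mul_cancel, one_mul]
    by_cases h' : ((q⁻¹ : ratIdeles) : Adeleˣ) * a ∈ (posIdeles : Set Adeleˣ)
    · rw [Set.indicator_of_mem h', Set.indicator_of_mem h', ha, Pi.one_apply, one_mul]
    · rw [Set.indicator_of_notMem h', Set.indicator_of_notMem h', zero_mul]
  simp only [hterm]
  have hqm : ∀ q : ratIdeles, AEMeasurable (fun a => (posIdeles : Set Adeleˣ).indicator (1 : Adeleˣ → ℝ≥0∞)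
      ((q⁻¹ : ratIdeles) * a) * weight da (torusD a * h)) da := fun q =>
    ((hI.comp (measurable_const_mul _)).mul hm).aemeasurable
  rw [← lintegral_tsum hqm]
  simp only [ENNReal.tsum_mul_right]
  rw [← lintegral_weight da h]
  refine lintegral_congr fun a => ?_
  have := (Equiv.inv ratIdeles).tsum_eq fun q : ratIdeles =>
    (posIdeles : Set Adeleˣ).indicator (1 : Adeleˣ → ℝ≥0∞) (q * a)
  rw [sum_indicator_posIdeles] at this
  change ∑' q : ratIdeles, (posIdeles : Set Adeleˣ).indicator (1 : Adeleˣ → ℝ≥0∞) ((q⁻¹ : ratIdeles) * a) = 1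
    at this
  rw [this, one_mul]

/-- The integrand of the unfolded integral. -/
noncomputable def unfoldedTerm (f : V2 Adele → ℂ) (φ₁ φ₂ : GL2 Adele → ℂ) (b a : Adeleˣ)
    (g : GL2 Adele × GL2 Adele) : ℂ :=
  f (actInv g pointP) * (φ₁ (diagOne Adele b * g.1) * φ₂ (diagOne Adele a * g.2))

theorem unfoldedTerm_scalar_mul (hχ : χ₁ * χ₂ = 1) (hφ₁ : IsDecaying χ₁ φ₁) (hφ₂ : IsDecaying χ₂ φ₂)
    (b a z : Adeleˣ) (g g' : GL2 Adele) :
    unfoldedTerm f φ₁ φ₂ b a (scalarGL z * g, scalarGL z * g') = unfoldedTerm f φ₁ φ₂ b a (g, g') := by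
  simp only [unfoldedTerm, actInv_scalar_mul]
  rw [← mul_assoc (diagOne Adele b), ← scalarGL_mul_comm, ← mul_assoc (diagOne Adele a), ← scalarGL_mul_comm,
    mul_assoc, mul_assoc, mul_scalar_mul hχ hφ₁ hφ₂]

theorem continuous_unfoldedTerm (hχ : χ₁ * χ₂ = 1) (hφ₁ : IsDecaying χ₁ φ₁) (hφ₂ : IsDecaying χ₂ φ₂)
    (hf : IsRapid f) :
    Continuous fun t : (Adeleˣ × Adeleˣ) × H1 => unfoldedTerm f φ₁ φ₂ t.1.1 t.1.2 t.2.rep := by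
  refine continuous_rep_of_invariant (F := fun t : Adeleˣ × Adeleˣ => unfoldedTerm f φ₁ φ₂ t.1 t.2) ?_
    fun t z g g' => unfoldedTerm_scalar_mul hχ hφ₁ hφ₂ t.1 t.2 z g g'
  refine (hf.continuous.comp (continuous_actInv.comp (continuous_snd.prodMk continuous_const))).mul
    ((hφ₁.continuous.comp ?_).mul (hφ₂.continuous.comp ?_))
  · exact (continuous_diagOne.comp (continuous_fst.comp continuous_fst)).mul (continuous_fst.comp continuous_snd)
  · exact (continuous_diagOne.comp (continuous_snd.comp continuous_fst)).mul (continuous_snd.comp continuous_snd)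

/-- The scalar on `e₁₁` is `(ay)⁻¹ y a = 1`. -/
theorem actInv_diagOne_smul_pointP (a y : Adeleˣ) :
    actInv (diagOne Adele (a * y), diagOne Adele a) ![(y : Adele) • pointP 0, pointP 1] = pointP := by
  have h0 : (diagOne Adele (a * y))⁻¹.val * ((y : Adele) • !![1, 0; 0, 0]) * (diagOne Adele a).val =
      !![1, 0; 0, 0] := by
    rw [diagOne_val, diagOne_inv_val, Matrix.mul_smul, Matrix.smul_mul, Matrix.mul_fin_two, Matrix.mul_fin_two]
    simp only [mul_zero, zero_mul, add_zero, mul_one]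
    have e : (y : Adele) * (((a * y)⁻¹ : Adeleˣ) * (a : Adele)) = 1 := by
      rw [← Units.val_mul, ← Units.val_mul, _root_.mul_inv_rev, inv_mul_cancel_right, mul_inv_cancel, Units.val_one]
    refine Matrix.ext fun i j => ?_
    fin_cases i <;> fin_cases j
    · exact e
    · exact mul_zero _
    · exact mul_zero _
    · exact mul_zero _
  have h1 : (diagOne Adele (a * y))⁻¹.val * !![0, 0; 0, 1] * (diagOne Adele a).val = !![0, 0; 0, 1] := by
    rw [diagOne_val, diagOne_inv_val, Matrix.mul_fin_two, Matrix.mul_fin_two]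
    simp only [mul_zero, zero_mul, add_zero, zero_add, mul_one]
  funext k
  fin_cases k
  · exact h0
  · exact h1

/-- Conjugation cancels the twist of `f` by `y`; what is left of `y` is the shift of the torus
variable of `φ₁` from `a` to `ay`. -/
theorem thetaTerm_torusD_mul_conjH (hχ : χ₁ * χ₂ = 1) (hφ₁ : IsDecaying χ₁ φ₁) (hφ₂ : IsDecaying χ₂ φ₂)
    (a y : Adeleˣ) (h : H1) :
    thetaTerm (twistFun f y) (translate φ₁ y) φ₂ ratPoint (H1.rep (torusD a * conjH y h)) =
      unfoldedTerm f φ₁ φ₂ (a * y) a h.rep := by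
  obtain ⟨p, hp, rfl⟩ := exists_mk_eq h
  rw [← hp, conjH_mk, torusD_eq, ← map_mul,
    rep_mk_of_invariant (thetaTerm_scalar_mul hχ (hφ₁.translate y) hφ₂ ratPoint), thetaTerm, ratV_ratPoint]
  have h1 : (diagPair Adele (diagOne Adele a) * conjPair y p).1.1 * diagOne Adele y =
      diagOne Adele (a * y) * p.1.1 := by
    change diagOne Adele a * (diagOne Adele y * p.1.1 * (diagOne Adele y)⁻¹) * diagOne Adele y = _
    rw [map_mul]
    group
  have h2 : (diagPair Adele (diagOne Adele a) * conjPair y p).1.2 = diagOne Adele a * p.1.2 := rfl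
  rw [twistFun, ← actInv_mul_diagOne, translate, h1, h2, unfoldedTerm]
  congr 2
  change actInv ((diagOne Adele (a * y), diagOne Adele a) * p.1) _ = _
  rw [actInv_mul, actInv_diagOne_smul_pointP]

theorem ratWeight_toReal (hh : H1) : (ratWeight da hh).toReal =
    ∫ a in (posIdeles : Set Adeleˣ), (weight da (torusD a⁻¹ * hh)).toReal ∂da :=
  (integral_toReal (measurable_weight_torusD_inv da hh).aemeasurable
    (Filter.Eventually.of_forall fun _ => weight_lt_top da _)).symm

variable {dh : Measure H1}

theorem integrable_weight_torusD_smul {E : H1 → ℂ} (hE : Measurable E)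
    (hfin : ∫⁻ h, ratWeight da h * ‖E h‖ₑ ∂dh < ⊤) :
    Integrable (Function.uncurry fun (h : H1) (a : Adeleˣ) => (weight da (torusD a⁻¹ * h)).toReal • E h)
      (dh.prod (da.restrict (posIdeles : Set Adeleˣ))) := by
  have hm : Measurable (Function.uncurry fun (h : H1) (a : Adeleˣ) =>
      (weight da (torusD a⁻¹ * h)).toReal • E h) :=
    (measurable_weight_torusD da).ennreal_toReal.smul (hE.comp measurable_fst)
  refine ⟨hm.aestronglyMeasurable, ?_⟩
  rw [hasFiniteIntegral_iff_enorm, lintegral_prod _ hm.enorm.aemeasurable]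
  have hin : ∀ h : H1, ∫⁻ a in (posIdeles : Set Adeleˣ),
      ‖(weight da (torusD a⁻¹ * h)).toReal • E h‖ₑ ∂da = ratWeight da h * ‖E h‖ₑ := fun h => by
    simp only [enorm_toReal_smul (weight_lt_top da _).ne]
    rw [lintegral_mul_const _ (measurable_weight_torusD_inv da h), ratWeight]
  simp only [Function.uncurry_apply_pair, hin]
  exact hfin

variable [dh.IsHaarMeasure] [dh.IsMulRightInvariant] {dθ : Measure (RightCosets H1rat)}

/-- Insert the definition of `ratWeight` and exchange the integrals; then translate by `torusD a`
and apply `conjH y`, both of which preserve `dh`. This realizes fibring over `D(𝔸)\H₁(𝔸)` with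
fibers `D(ℚ)\D(𝔸)`. -/
theorem integral_ratWeight_smul {E : H1 → ℂ} (hE : Measurable E)
    (hfin : ∫⁻ h, ratWeight da h * ‖E h‖ₑ ∂dh < ⊤) (y : Adeleˣ) :
    ∫ h, (ratWeight da h).toReal • E h ∂dh = ∫ a in (posIdeles : Set Adeleˣ),
      ∫ h, (weight da h).toReal • E (torusD a * conjH y h) ∂dh ∂da := by
  have h1 : ∀ h : H1, (ratWeight da h).toReal • E h =
      ∫ a in (posIdeles : Set Adeleˣ), (weight da (torusD a⁻¹ * h)).toReal • E h ∂da := fun h => by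
    rw [integral_smul_const, ratWeight_toReal]
  simp only [h1]
  rw [integral_integral_swap (integrable_weight_torusD_smul da hE hfin)]
  refine integral_congr_ae (Filter.Eventually.of_forall fun a => ?_)
  simp only
  rw [← integral_mul_left_eq_self (μ := dh) (fun h => (weight da (torusD a⁻¹ * h)).toReal • E h) (torusD a),
    ← (measurePreserving_conjH dh y).integral_comp (conjEquiv y).toHomeomorph.measurableEmbedding]
  refine integral_congr_ae (Filter.Eventually.of_forall fun h => ?_)
  simp only
  rw [← mul_assoc (torusD a⁻¹), ← map_mul, inv_mul_cancel, map_one, one_mul, weight_conjH]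

theorem thetaCoeff_eq_unfolded (hdθ : IsDiscreteQuotientMeasure H1rat dh dθ) (hχ : χ₁ * χ₂ = 1)
    (hφ₁ : IsDecaying χ₁ φ₁) (hφ₂ : IsDecaying χ₂ φ₂) (hf : IsRapid f) (y : Adeleˣ) :
    thetaCoeff dθ (twistFun f y) (translate φ₁ y) φ₂ (0, 0, 1) =
      ∫ a in (posIdeles : Set Adeleˣ),
        ∫ h, (weight da h).toReal • unfoldedTerm f φ₁ φ₂ (a * y) a h.rep ∂dh ∂da := by
  have hφ₁' := hφ₁.translate y
  have hf' := hf.twistFun y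
  rw [thetaCoeff_eq_integral hdθ hχ hφ₁' hφ₂ hf' (measurable_ratWeight da) (tsum_ratWeight da),
    integral_ratWeight_smul da (measurable_thetaTerm_rep hχ hf' hφ₁' hφ₂ ratPoint)
    (lintegral_weight_mul_lt_top hdθ hχ hφ₁' hφ₂ hf' (measurable_ratWeight da) (tsum_ratWeight da)) y]
  simp only [thetaTerm_torusD_mul_conjH hχ hφ₁ hφ₂]

end Coefficient

/-! ### The unfolded integral -/

section Final

variable {χ₁ χ₂ : Adeleˣ →* ℂˣ} {φ₁ φ₂ : GL2 Adele → ℂ} {f : V2 Adele → ℂ} {κ₁ κ₂ : Adeleˣ → ℂ}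
variable (da : Measure Adeleˣ)

/-- Haar measure on the positive ideles. -/
noncomputable abbrev posMeasure : Measure Adeleˣ := da.restrict (posIdeles : Set Adeleˣ)

/-- The weighted integrand of the unfolded integral, as a function of both torus variables. -/
noncomputable def unfoldedKernel (f : V2 Adele → ℂ) (φ₁ φ₂ : GL2 Adele → ℂ) (κ₁ κ₂ : Adeleˣ → ℂ)
    (t : (Adeleˣ × Adeleˣ) × H1) : ℂ :=
  (weight da t.2).toReal • (unfoldedTerm f φ₁ φ₂ t.1.2 t.1.1 t.2.rep * (κ₁ t.1.2 * κ₂ t.1.1))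

/-- The product of the two torus integrals. -/
noncomputable def unfoldedProduct (f : V2 Adele → ℂ) (φ₁ φ₂ : GL2 Adele → ℂ) (κ₁ κ₂ : Adeleˣ → ℂ)
    (g : GL2 Adele × GL2 Adele) : ℂ :=
  ∫ p : Adeleˣ × Adeleˣ, unfoldedTerm f φ₁ φ₂ p.2 p.1 g * (κ₁ p.2 * κ₂ p.1) ∂((posMeasure da).prod (posMeasure da))

theorem measurable_unfoldedTerm_mul (hχ : χ₁ * χ₂ = 1) (hφ₁ : IsDecaying χ₁ φ₁) (hφ₂ : IsDecaying χ₂ φ₂)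
    (hf : IsRapid f) (hκ₁ : Continuous κ₁) (hκ₂ : Continuous κ₂) :
    Measurable fun t : (Adeleˣ × Adeleˣ) × H1 =>
      unfoldedTerm f φ₁ φ₂ t.1.2 t.1.1 t.2.rep * (κ₁ t.1.2 * κ₂ t.1.1) := by
  have h1 : Continuous fun t : (Adeleˣ × Adeleˣ) × H1 => unfoldedTerm f φ₁ φ₂ t.1.2 t.1.1 t.2.rep :=
    (continuous_unfoldedTerm hχ hφ₁ hφ₂ hf).comp ((continuous_swap.comp continuous_fst).prodMk continuous_snd)
  exact (h1.mul ((hκ₁.comp (continuous_snd.comp continuous_fst)).mul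
    (hκ₂.comp (continuous_fst.comp continuous_fst)))).measurable

theorem measurable_unfoldedKernel (hχ : χ₁ * χ₂ = 1) (hφ₁ : IsDecaying χ₁ φ₁) (hφ₂ : IsDecaying χ₂ φ₂)
    (hf : IsRapid f) (hκ₁ : Continuous κ₁) (hκ₂ : Continuous κ₂) :
    Measurable (unfoldedKernel da f φ₁ φ₂ κ₁ κ₂) :=
  ((measurable_weight da).comp measurable_snd).ennreal_toReal.smul
    (measurable_unfoldedTerm_mul hχ hφ₁ hφ₂ hf hκ₁ hκ₂)

theorem continuous_torus_mul {φ : GL2 Adele → ℂ} {κ : Adeleˣ → ℂ} (hφ : Continuous φ) (hκ : Continuous κ)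
    (g : GL2 Adele) : Continuous fun a => φ (diagOne Adele a * g) * κ a :=
  (hφ.comp (continuous_diagOne.mul continuous_const)).mul hκ

theorem unfoldedProduct_scalar_mul (hχ : χ₁ * χ₂ = 1) (hφ₁ : IsDecaying χ₁ φ₁) (hφ₂ : IsDecaying χ₂ φ₂)
    (z : Adeleˣ) (g g' : GL2 Adele) :
    unfoldedProduct da f φ₁ φ₂ κ₁ κ₂ (scalarGL z * g, scalarGL z * g') =
      unfoldedProduct da f φ₁ φ₂ κ₁ κ₂ (g, g') := by
  simp only [unfoldedProduct, unfoldedTerm_scalar_mul hχ hφ₁ hφ₂]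

/-- The Bessel integrand, in unfolded form. -/
noncomputable def besselUnfolded (dh : Measure H1) (f : V2 Adele → ℂ) (φ₁ φ₂ : GL2 Adele → ℂ) (κ₁ : Adeleˣ → ℂ)
    (y : Adeleˣ) : ℂ :=
  (∫ a in (posIdeles : Set Adeleˣ),
    ∫ h, (weight da h).toReal • unfoldedTerm f φ₁ φ₂ (a * y) a h.rep ∂dh ∂da) * κ₁ y

variable {dh : Measure H1}

theorem besselUnfolded_rat_mul (hφ₁ : IsDecaying χ₁ φ₁) (hκ₁ : IsModerate κ₁) (q : ratIdeles) (y : Adeleˣ) :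
    besselUnfolded da dh f φ₁ φ₂ κ₁ (q * y) = besselUnfolded da dh f φ₁ φ₂ κ₁ y := by
  have h : ∀ (a : Adeleˣ) g, unfoldedTerm f φ₁ φ₂ (a * (q * y)) a g = unfoldedTerm f φ₁ φ₂ (a * y) a g := by
    intro a g
    obtain ⟨_, r, rfl⟩ := q
    rw [unfoldedTerm, unfoldedTerm, mul_left_comm a]
    have e : diagOne Adele (ratIdele r * (a * y)) * g.1 = ratGL (diagOne ℚ r) * (diagOne Adele (a * y) * g.1) := by
      rw [map_mul, diagOne_ratIdele, mul_assoc]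
    have e' := hφ₁.left_invariant (diagOne ℚ r) (diagOne Adele (a * y) * g.1)
    rw [← e] at e'
    exact congrArg (fun z => f (actInv g pointP) * (z * φ₂ (diagOne Adele a * g.2))) e'
  simp only [besselUnfolded, h, hκ₁.rat_mul]

/-- The relation `κ₁(ya) κ₂(a) = κ₁(y)` distributes the character over the two torus variables `ya`
and `a`. -/
theorem besselUnfolded_eq (hmul : ∀ a y, κ₁ (y * a) * κ₂ a = κ₁ y) (y : Adeleˣ) :
    besselUnfolded da dh f φ₁ φ₂ κ₁ y = ∫ a in (posIdeles : Set Adeleˣ),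
      ∫ h, unfoldedKernel da f φ₁ φ₂ κ₁ κ₂ ((a, y * a), h) ∂dh ∂da := by
  simp only [besselUnfolded, unfoldedKernel, hmul]
  rw [← integral_mul_const]
  refine integral_congr_ae (Filter.Eventually.of_forall fun a => ?_)
  simp only
  rw [← integral_mul_const]
  simp only [smul_mul_assoc, mul_comm y a]

variable [da.IsHaarMeasure]

theorem lintegral_enorm_unfoldedTerm (hφ₁ : IsDecaying χ₁ φ₁) (hφ₂ : IsDecaying χ₂ φ₂) (hκ₁ : Continuous κ₁)
    (hκ₂ : Continuous κ₂) (g : GL2 Adele × GL2 Adele) :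
    ∫⁻ p : Adeleˣ × Adeleˣ, ‖unfoldedTerm f φ₁ φ₂ p.2 p.1 g * (κ₁ p.2 * κ₂ p.1)‖ₑ
      ∂((posMeasure da).prod (posMeasure da)) =
      ‖f (actInv g pointP)‖ₑ * (torusNorm da φ₁ κ₁ g.1 * torusNorm da φ₂ κ₂ g.2) := by
  have e : ∀ p : Adeleˣ × Adeleˣ, ‖unfoldedTerm f φ₁ φ₂ p.2 p.1 g * (κ₁ p.2 * κ₂ p.1)‖ₑ =
      ‖f (actInv g pointP)‖ₑ * (‖φ₂ (diagOne Adele p.1 * g.2) * κ₂ p.1‖ₑ *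
        ‖φ₁ (diagOne Adele p.2 * g.1) * κ₁ p.2‖ₑ) := fun p => by
    simp only [unfoldedTerm, enorm_mul]
    ring
  have m₁ := (continuous_torus_mul hφ₁.continuous hκ₁ g.1).measurable.enorm
  have m₂ := (continuous_torus_mul hφ₂.continuous hκ₂ g.2).measurable.enorm
  simp only [e]
  rw [lintegral_const_mul' _ _ enorm_ne_top, lintegral_prod_mul m₂.aemeasurable m₁.aemeasurable]
  exact congrArg _ (mul_comm _ _)

variable [dh.IsHaarMeasure]

/-- With the torus variables integrated first, the product of the two torus norms appears, and on
the support of the weight the majorant applies. -/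
theorem integrable_unfoldedKernel (hχ : χ₁ * χ₂ = 1) (hφ₁ : IsDecaying χ₁ φ₁) (hφ₂ : IsDecaying χ₂ φ₂)
    (hf : IsRapid f) (hκ₁ : IsModerate κ₁) (hκ₂ : IsModerate κ₂) :
    Integrable (unfoldedKernel da f φ₁ φ₂ κ₁ κ₂) (((posMeasure da).prod (posMeasure da)).prod dh) := by
  have hm := measurable_unfoldedKernel da hχ hφ₁ hφ₂ hf hκ₁.continuous hκ₂.continuous
  refine ⟨hm.aestronglyMeasurable, ?_⟩
  rw [hasFiniteIntegral_iff_enorm, lintegral_prod_symm _ hm.enorm.aemeasurable]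
  obtain ⟨Φ, hΦm, hΦ, hΦfin⟩ := exists_unfolded_majorant da dh hχ hφ₁ hφ₂ hκ₁ hκ₂ hf
  have hin : ∀ h : H1, ∫⁻ p : Adeleˣ × Adeleˣ, ‖unfoldedKernel da f φ₁ φ₂ κ₁ κ₂ (p, h)‖ₑ
      ∂((posMeasure da).prod (posMeasure da)) ≤ (da torusBox)⁻¹ * Φ h := fun h => by
    simp only [unfoldedKernel, enorm_toReal_smul (weight_lt_top da h).ne]
    rw [lintegral_const_mul' _ _ (weight_lt_top da h).ne,
      lintegral_enorm_unfoldedTerm da hφ₁ hφ₂ hκ₁.continuous hκ₂.continuous]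
    by_cases hb : h ∈ boxH
    · rw [weight, Set.indicator_of_mem hb]
      exact mul_le_mul_right (hΦ h hb) _
    · rw [weight, Set.indicator_of_notMem hb, zero_mul]
      exact zero_le
  refine (lintegral_mono hin).trans_lt ?_
  rw [lintegral_const_mul _ hΦm]
  exact ENNReal.mul_lt_top (ENNReal.inv_lt_top.2 (measure_torusBox_ne_zero da).bot_lt) hΦfin

theorem unfoldedProduct_eq (g : GL2 Adele × GL2 Adele) :
    unfoldedProduct da f φ₁ φ₂ κ₁ κ₂ g = f (actInv g pointP) *
      ((∫ b in (posIdeles : Set Adeleˣ), φ₁ (diagOne Adele b * g.1) * κ₁ b ∂da) *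
        ∫ a in (posIdeles : Set Adeleˣ), φ₂ (diagOne Adele a * g.2) * κ₂ a ∂da) := by
  have e : ∀ p : Adeleˣ × Adeleˣ, unfoldedTerm f φ₁ φ₂ p.2 p.1 g * (κ₁ p.2 * κ₂ p.1) =
      f (actInv g pointP) * ((φ₂ (diagOne Adele p.1 * g.2) * κ₂ p.1) *
        (φ₁ (diagOne Adele p.2 * g.1) * κ₁ p.2)) := fun p => by
    simp only [unfoldedTerm]
    ring
  simp only [unfoldedProduct, e]
  rw [integral_const_mul, integral_prod_mul (fun a => φ₂ (diagOne Adele a * g.2) * κ₂ a)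
    (fun b => φ₁ (diagOne Adele b * g.1) * κ₁ b), mul_comm (∫ a, φ₂ _ * _ ∂_)]

theorem measurable_unfoldedProduct_rep (hχ : χ₁ * χ₂ = 1) (hφ₁ : IsDecaying χ₁ φ₁) (hφ₂ : IsDecaying χ₂ φ₂)
    (hf : IsRapid f) (hκ₁ : Continuous κ₁) (hκ₂ : Continuous κ₂) :
    Measurable fun h : H1 => unfoldedProduct da f φ₁ φ₂ κ₁ κ₂ h.rep :=
  (measurable_unfoldedTerm_mul hχ hφ₁ hφ₂ hf hκ₁ hκ₂).stronglyMeasurable.integral_prod_left'.measurable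

theorem integrable_weight_smul_unfoldedProduct (hχ : χ₁ * χ₂ = 1) (hφ₁ : IsDecaying χ₁ φ₁)
    (hφ₂ : IsDecaying χ₂ φ₂) (hf : IsRapid f) (hκ₁ : IsModerate κ₁) (hκ₂ : IsModerate κ₂) :
    Integrable (fun h : H1 => (weight da h).toReal • unfoldedProduct da f φ₁ φ₂ κ₁ κ₂ h.rep) dh := by
  refine (integrable_unfoldedKernel da hχ hφ₁ hφ₂ hf hκ₁ hκ₂).integral_prod_right.congr
    (Filter.Eventually.of_forall fun h => ?_)
  simp only [unfoldedKernel, integral_smul, unfoldedProduct]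

theorem integral_unfoldedKernel (hχ : χ₁ * χ₂ = 1) (hφ₁ : IsDecaying χ₁ φ₁)
    (hφ₂ : IsDecaying χ₂ φ₂) (hf : IsRapid f) (hκ₁ : IsModerate κ₁) (hκ₂ : IsModerate κ₂) :
    ∫ t, unfoldedKernel da f φ₁ φ₂ κ₁ κ₂ t ∂(((posMeasure da).prod (posMeasure da)).prod dh) =
      ∫ h, (weight da h).toReal • unfoldedProduct da f φ₁ φ₂ κ₁ κ₂ h.rep ∂dh := by
  rw [integral_prod_symm _ (integrable_unfoldedKernel da hχ hφ₁ hφ₂ hf hκ₁ hκ₂)]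
  simp only [unfoldedKernel, integral_smul, unfoldedProduct]

/-- For fixed `a` in the group `posIdeles`, the map `b ↦ ba` preserves Haar measure restricted to
that group. This is the substitution that decouples the two zeta integrals. -/
theorem measurePreserving_shear (dh : Measure H1) [dh.IsHaarMeasure] :
    MeasurePreserving (fun t : (Adeleˣ × Adeleˣ) × H1 => ((t.1.1, t.1.2 * t.1.1), t.2))
      (((posMeasure da).prod (posMeasure da)).prod dh) (((posMeasure da).prod (posMeasure da)).prod dh) := by
  have h : MeasurePreserving (fun p : Adeleˣ × Adeleˣ => (p.1, p.2 * p.1))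
      ((posMeasure da).prod (posMeasure da)) ((posMeasure da).prod (posMeasure da)) := by
    refine (MeasurePreserving.id (posMeasure da)).skew_product
      (g := fun a b : Adeleˣ => b * a) (continuous_snd.mul continuous_fst).measurable ?_
    refine (ae_restrict_iff' isOpen_posIdeles.measurableSet).2 (Filter.Eventually.of_forall fun a ha => ?_)
    exact (measurePreserving_mul_posIdeles da ha).map_eq
  exact h.prod (MeasurePreserving.id dh)

theorem measurable_besselUnfolded (hχ : χ₁ * χ₂ = 1) (hφ₁ : IsDecaying χ₁ φ₁)
    (hφ₂ : IsDecaying χ₂ φ₂) (hf : IsRapid f) (hκ₁ : Continuous κ₁) :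
    Measurable (besselUnfolded da dh f φ₁ φ₂ κ₁) := by
  have h1 : Continuous fun t : (Adeleˣ × Adeleˣ) × H1 => unfoldedTerm f φ₁ φ₂ (t.1.2 * t.1.1) t.1.2 t.2.rep :=
    (continuous_unfoldedTerm hχ hφ₁ hφ₂ hf).comp
      ((((continuous_snd.comp continuous_fst).mul (continuous_fst.comp continuous_fst)).prodMk
        (continuous_snd.comp continuous_fst)).prodMk continuous_snd)
  have h2 : Measurable fun t : (Adeleˣ × Adeleˣ) × H1 =>
      (weight da t.2).toReal • unfoldedTerm f φ₁ φ₂ (t.1.2 * t.1.1) t.1.2 t.2.rep :=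
    ((measurable_weight da).comp measurable_snd).ennreal_toReal.smul h1.measurable
  have h3 : StronglyMeasurable fun y : Adeleˣ => ∫ a in (posIdeles : Set Adeleˣ),
      ∫ h, (weight da h).toReal • unfoldedTerm f φ₁ φ₂ (a * y) a h.rep ∂dh ∂da :=
    (h2.stronglyMeasurable.integral_prod_right' (ν := dh)).integral_prod_right' (ν := posMeasure da)
  exact h3.measurable.mul hκ₁.measurable

theorem integrableOn_besselUnfolded (hχ : χ₁ * χ₂ = 1) (hφ₁ : IsDecaying χ₁ φ₁)
    (hφ₂ : IsDecaying χ₂ φ₂) (hf : IsRapid f) (hκ₁ : IsModerate κ₁) (hκ₂ : IsModerate κ₂)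
    (hmul : ∀ a y, κ₁ (y * a) * κ₂ a = κ₁ y) :
    IntegrableOn (besselUnfolded da dh f φ₁ φ₂ κ₁) (posIdeles : Set Adeleˣ) da := by
  have hK := (measurePreserving_shear da dh).integrable_comp_of_integrable
    (integrable_unfoldedKernel da hχ hφ₁ hφ₂ hf hκ₁ hκ₂)
  refine hK.integral_prod_left.integral_prod_right.congr (Filter.Eventually.of_forall fun y => ?_)
  exact (besselUnfolded_eq da hmul y).symm

theorem integral_besselUnfolded (hχ : χ₁ * χ₂ = 1) (hφ₁ : IsDecaying χ₁ φ₁)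
    (hφ₂ : IsDecaying χ₂ φ₂) (hf : IsRapid f) (hκ₁ : IsModerate κ₁) (hκ₂ : IsModerate κ₂)
    (hmul : ∀ a y, κ₁ (y * a) * κ₂ a = κ₁ y) :
    ∫ y in (posIdeles : Set Adeleˣ), besselUnfolded da dh f φ₁ φ₂ κ₁ y ∂da =
      ∫ h, (weight da h).toReal • unfoldedProduct da f φ₁ φ₂ κ₁ κ₂ h.rep ∂dh := by
  have hi := integrable_unfoldedKernel da (dh := dh) hχ hφ₁ hφ₂ hf hκ₁ hκ₂
  have hS := measurePreserving_shear da dh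
  have hK := hS.integrable_comp_of_integrable hi
  rw [← integral_unfoldedKernel da hχ hφ₁ hφ₂ hf hκ₁ hκ₂]
  have h1 : ∫ t, unfoldedKernel da f φ₁ φ₂ κ₁ κ₂ t ∂(((posMeasure da).prod (posMeasure da)).prod dh) =
      ∫ t : (Adeleˣ × Adeleˣ) × H1, unfoldedKernel da f φ₁ φ₂ κ₁ κ₂ ((t.1.1, t.1.2 * t.1.1), t.2)
        ∂(((posMeasure da).prod (posMeasure da)).prod dh) := by
    conv_lhs => rw [← hS.map_eq]
    exact integral_map hS.measurable.aemeasurable (by rw [hS.map_eq]; exact hi.aestronglyMeasurable)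
  -- The variables are integrated in the order `h`, `a`, `y`, as in `besselUnfolded_eq`.
  refine Eq.trans ?_ (((integral_prod _ hK).trans (integral_prod_symm _ hK.integral_prod_left)).symm.trans h1.symm)
  exact integral_congr_ae (Filter.Eventually.of_forall fun y => besselUnfolded_eq da hmul y)

end Final

/-! ### Torus integrals over the idele class group -/

section TorusIntegral

variable {da : Measure Adeleˣ} {dc : Measure (RightCosets ratIdeles)}
variable {χ : Adeleˣ →* ℂˣ} {φ : GL2 Adele → ℂ} {κ : Adeleˣ → ℂ}

theorem integral_torus (hdc : IsDiscreteQuotientMeasure ratIdeles da dc) (hφ : IsDecaying χ φ)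
    (hκ : IsModerate κ) (g : GL2 Adele) :
    ∫ a : RightCosets ratIdeles, φ (diagOne Adele a.out * g) * κ a.out ∂dc =
      ∫ a in (posIdeles : Set Adeleˣ), φ (diagOne Adele a * g) * κ a ∂da :=
  hdc.integral_eq_setIntegral_posIdeles (F := fun a => φ (diagOne Adele a * g) * κ a)
    (continuous_torus_mul hφ.continuous hκ.continuous g).measurable
    (torus_mul_rat_mul hφ.left_invariant hκ g)

variable [da.IsHaarMeasure]

theorem integrable_torus (hdc : IsDiscreteQuotientMeasure ratIdeles da dc) (hφ : IsDecaying χ φ)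
    (hκ : IsModerate κ) (g : GL2 Adele) :
    Integrable (fun a : RightCosets ratIdeles => φ (diagOne Adele a.out * g) * κ a.out) dc :=
  (hdc.integrable_iff_integrableOn_posIdeles (F := fun a => φ (diagOne Adele a * g) * κ a)
    (continuous_torus_mul hφ.continuous hκ.continuous g).measurable
    (torus_mul_rat_mul hφ.left_invariant hκ g)).2
    (hφ.hasDecay.integrableOn_torus hφ.continuous hφ.left_invariant hκ g)

/-- Invariance of the measure on the idele class group under translation by `b`. -/
theorem integral_torus_diagOne_mul (hdc : IsDiscreteQuotientMeasure ratIdeles da dc) (hφ : IsDecaying χ φ)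
    (hκ : IsModerate κ) (hκm : ∀ a b, κ (a * b) = κ a * κ b) (b : Adeleˣ) (g : GL2 Adele) :
    (∫ a : RightCosets ratIdeles, φ (diagOne Adele a.out * (diagOne Adele b * g)) * κ a.out ∂dc) * κ b =
      ∫ a : RightCosets ratIdeles, φ (diagOne Adele a.out * g) * κ a.out ∂dc := by
  rw [← hdc.integral_comp_mul_right b (F := fun a => φ (diagOne Adele a * g) * κ a)
    (continuous_torus_mul hφ.continuous hκ.continuous g).measurable
    (torus_mul_rat_mul hφ.left_invariant hκ g), ← integral_mul_const]
  refine integral_congr_ae (Filter.Eventually.of_forall fun a => ?_)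
  simp only [hκm, map_mul, mul_assoc]

end TorusIntegral

/-! ### The quasi-characters of the two torus integrals -/

section QuasiCharacters

variable {μ : Adeleˣ →* ℂˣ}

/-- `μ |·|^{-1/2}`. -/
noncomputable def charFst (μ : Adeleˣ →* ℂˣ) (a : Adeleˣ) : ℂ :=
  (μ a : ℂ) * ((adeleAbs a ^ (-(1 / 2) : ℝ) : ℝ) : ℂ)

/-- `μ⁻¹ |·| |·|^{-1/2}`. -/
noncomputable def charSnd (μ : Adeleˣ →* ℂˣ) (a : Adeleˣ) : ℂ :=
  ((μ a)⁻¹ : ℂˣ) * (adeleAbs a : ℂ) * ((adeleAbs a ^ (-(1 / 2) : ℝ) : ℝ) : ℂ)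

theorem isModerate_charFst (hμ : Continuous μ) (hμr : ∀ a ∈ ratIdeles, μ a = 1) : IsModerate (charFst μ) :=
  (IsModerate.of_character hμ hμr).mul isModerate_abs_rpow

theorem isModerate_charSnd (hμ : Continuous μ) (hμr : ∀ a ∈ ratIdeles, μ a = 1) : IsModerate (charSnd μ) :=
  ((IsModerate.of_character (μ := μ⁻¹) (continuous_inv.comp hμ)
    fun a ha => by rw [MonoidHom.inv_apply, hμr a ha, inv_one]).mul isModerate_abs).mul isModerate_abs_rpow

theorem adeleAbs_rpow_mul (a b : Adeleˣ) : adeleAbs ((a * b : Adeleˣ) : Adele) ^ (-(1 / 2) : ℝ) =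
    adeleAbs a ^ (-(1 / 2) : ℝ) * adeleAbs b ^ (-(1 / 2) : ℝ) := by
  rw [adeleAbs_mul, Real.mul_rpow (adeleAbs_nonneg _) (adeleAbs_nonneg _)]

theorem charFst_mul (a b : Adeleˣ) : charFst μ (a * b) = charFst μ a * charFst μ b := by
  simp only [charFst, map_mul, adeleAbs_rpow_mul]
  push_cast
  ring

theorem charSnd_mul (a b : Adeleˣ) : charSnd μ (a * b) = charSnd μ a * charSnd μ b := by
  simp only [charSnd, map_mul, adeleAbs_rpow_mul, _root_.mul_inv]
  rw [adeleAbs_mul]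
  push_cast
  ring

/-- The exponents of the norm add up to `-1/2 + 1 - 1/2 = 0`. -/
theorem charFst_mul_charSnd (a : Adeleˣ) : charFst μ a * charSnd μ a = 1 := by
  have h1 : adeleAbs a ^ (-(1 / 2) : ℝ) * adeleAbs a * adeleAbs a ^ (-(1 / 2) : ℝ) = 1 := by
    have h0 := adeleAbs_pos a
    rw [mul_right_comm, ← Real.rpow_add h0]
    norm_num
    rw [Real.rpow_neg_one, inv_mul_cancel₀ h0.ne']
  have h2 : (μ a : ℂ) * ((μ a)⁻¹ : ℂˣ) = 1 := by rw [← Units.val_mul, mul_inv_cancel, Units.val_one]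
  calc charFst μ a * charSnd μ a = (μ a : ℂ) * ((μ a)⁻¹ : ℂˣ) *
        ((adeleAbs a ^ (-(1 / 2) : ℝ) * adeleAbs a * adeleAbs a ^ (-(1 / 2) : ℝ) : ℝ) : ℂ) := by
        simp only [charFst, charSnd]
        push_cast
        ring
    _ = 1 := by rw [h1, h2, Complex.ofReal_one, mul_one]

theorem charFst_mul_mul_charSnd (a y : Adeleˣ) : charFst μ (y * a) * charSnd μ a = charFst μ y := by
  rw [charFst_mul, mul_assoc, charFst_mul_charSnd, mul_one]

theorem zetaIntegrand_fst (φ : GL2 Adele → ℂ) (h : GL2 Adele) (a : Adeleˣ) :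
    zetaIntegrand φ h (fun a => (μ a : ℂ)) a = φ (diagOne Adele a * h) * charFst μ a := by
  rw [zetaIntegrand, charFst, mul_assoc]

theorem zetaIntegrand_snd (φ : GL2 Adele → ℂ) (h : GL2 Adele) (a : Adeleˣ) :
    zetaIntegrand φ h (fun a => ((μ a)⁻¹ : ℂˣ) * (adeleAbs a : ℂ)) a = φ (diagOne Adele a * h) * charSnd μ a := by
  rw [zetaIntegrand, charSnd, mul_assoc]

theorem opL_rep (h : H1) (f : V2 Adele → ℂ) (x : V2 Adele) : opL h.rep f x = f (actInv h.rep x) := by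
  obtain ⟨p, hp, -⟩ := exists_mk_eq h
  have hdet : Matrix.GeneralLinearGroup.det h.rep.1 = Matrix.GeneralLinearGroup.det h.rep.2 := by
    rw [← hp]; exact p.2
  have h1 : adeleAbs ((1 : Adeleˣ) : Adele) = 1 := adeleAbs_one
  rw [opL, hdet, div_self', h1, _root_.one_zpow, Complex.ofReal_one, one_mul]
  rfl

variable {da : Measure Adeleˣ} [da.IsHaarMeasure] {dc : Measure (RightCosets ratIdeles)}
variable {χ₁ χ₂ : Adeleˣ →* ℂˣ} {φ₁ φ₂ : GL2 Adele → ℂ} {f : V2 Adele → ℂ}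

theorem unfoldedProduct_eq_class (hdc : IsDiscreteQuotientMeasure ratIdeles da dc) (hφ₁ : IsDecaying χ₁ φ₁)
    (hφ₂ : IsDecaying χ₂ φ₂) (hμ : Continuous μ) (hμr : ∀ a ∈ ratIdeles, μ a = 1) (g : GL2 Adele × GL2 Adele) :
    unfoldedProduct da f φ₁ φ₂ (charFst μ) (charSnd μ) g = f (actInv g pointP) *
      ((∫ a : RightCosets ratIdeles, φ₁ (diagOne Adele a.out * g.1) * charFst μ a.out ∂dc) *
        ∫ a : RightCosets ratIdeles, φ₂ (diagOne Adele a.out * g.2) * charSnd μ a.out ∂dc) := by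
  rw [unfoldedProduct_eq, integral_torus hdc hφ₁ (isModerate_charFst hμ hμr),
    integral_torus hdc hφ₂ (isModerate_charSnd hμ hμr)]

theorem unfoldedIntegrand_eq (hdc : IsDiscreteQuotientMeasure ratIdeles da dc) (hφ₁ : IsDecaying χ₁ φ₁)
    (hφ₂ : IsDecaying χ₂ φ₂) (hμ : Continuous μ) (hμr : ∀ a ∈ ratIdeles, μ a = 1) (h : H1) :
    unfoldedIntegrand dc φ₁ φ₂ f μ h = unfoldedProduct da f φ₁ φ₂ (charFst μ) (charSnd μ) h.rep := by
  rw [unfoldedProduct_eq_class hdc hφ₁ hφ₂ hμ hμr, unfoldedIntegrand, opL_rep, mul_comm]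
  simp only [zetaJL, zetaIntegrand_fst, zetaIntegrand_snd]

/-- The two torus integrals transform by inverse characters and `P` is fixed by `D(𝔸)`. Hence the
right-hand side is well defined on `D(𝔸)\H₁(𝔸)`. -/
theorem unfoldedProduct_torusD_mul (hdc : IsDiscreteQuotientMeasure ratIdeles da dc) (hχ : χ₁ * χ₂ = 1)
    (hφ₁ : IsDecaying χ₁ φ₁) (hφ₂ : IsDecaying χ₂ φ₂) (hμ : Continuous μ) (hμr : ∀ a ∈ ratIdeles, μ a = 1)
    (b : Adeleˣ) (h : H1) :
    unfoldedProduct da f φ₁ φ₂ (charFst μ) (charSnd μ) (H1.rep (torusD b * h)) =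
      unfoldedProduct da f φ₁ φ₂ (charFst μ) (charSnd μ) h.rep := by
  have hp : actInv (diagOne Adele b * h.rep.1, diagOne Adele b * h.rep.2) pointP = actInv h.rep pointP := by
    change actInv ((diagOne Adele b, diagOne Adele b) * h.rep) pointP = _
    rw [actInv_mul, actInv_diagOne_pointP]
  rw [torusD_eq, rep_mul_of_invariant (unfoldedProduct_scalar_mul da hχ hφ₁ hφ₂), diagPair_fst, diagPair_snd,
    unfoldedProduct_eq_class hdc hφ₁ hφ₂ hμ hμr, unfoldedProduct_eq_class hdc hφ₁ hφ₂ hμ hμr, hp,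
    ← integral_torus_diagOne_mul hdc hφ₁ (isModerate_charFst hμ hμr) charFst_mul b h.rep.1,
    ← integral_torus_diagOne_mul hdc hφ₂ (isModerate_charSnd hμ hμr) charSnd_mul b h.rep.2,
    mul_mul_mul_comm, charFst_mul_charSnd, mul_one]

end QuasiCharacters

end ThetaBessel

/-! ### The proposition. -/

theorem mainTheorem4
    -- a non-trivial continuous character of `ℚ \ 𝔸`
    (ψ : AddChar Adele Circle) (hψ_cont : Continuous ψ) (hψ_ne : ψ ≠ 1)
    (hψ_rat : ∀ q : ℚ, ψ (algebraMap ℚ Adele q) = 1)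
    -- measures on `ℚ \ 𝔸`, `𝔸ˣ`, `ℚˣ \ 𝔸ˣ`, `H₁(𝔸)`, `H₁(ℚ) \ H₁(𝔸)` and `D(𝔸) \ H₁(𝔸)`
    (dx : Measure AdeleModRat) [dx.IsAddHaarMeasure] [IsProbabilityMeasure dx]
    (da : Measure Adeleˣ) [da.IsHaarMeasure]
    (dc : Measure (RightCosets ratIdeles)) (hdc : IsDiscreteQuotientMeasure ratIdeles da dc)
    (dh : Measure H1) [dh.IsHaarMeasure] [dh.IsMulRightInvariant]
    (dθ : Measure (RightCosets H1rat)) (hdθ : IsDiscreteQuotientMeasure H1rat dh dθ)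
    (dm : Measure (RightCosets torusD.range)) (hdm : IsQuotientMeasure torusD da dh dm)
    -- cusp forms with inverse central characters
    (χ₁ χ₂ : Adeleˣ →* ℂˣ) (hχ : χ₁ * χ₂ = 1)
    (φ₁ φ₂ : GL2 Adele → ℂ) (hφ₁ : IsCuspForm dx χ₁ φ₁) (hφ₂ : IsCuspForm dx χ₂ φ₂)
    -- a Bruhat-Schwartz function
    (f : V2 Adele → ℂ) (hf : f ∈ SchwartzBruhat)
    -- a Hecke character
    (μ : Adeleˣ →* ℂˣ) (hμ_cont : Continuous μ) (hμ_rat : ∀ a ∈ ratIdeles, μ a = 1)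
    -- a choice of `(h¹, h²)` with `det h¹ (det h²)⁻¹ = ν(g)`
    (c : GSp4 Adele → GL2 Adele × GL2 Adele)
    (hc : ∀ g, Matrix.GeneralLinearGroup.det (c g).1 * (Matrix.GeneralLinearGroup.det (c g).2)⁻¹
      = similitude g) :
    -- the integrals that occur converge absolutely
    (∀ u v w y, Integrable
      (fun h : RightCosets H1rat => thetaIntegrand ψ c φ₁ φ₂ f (unipU u v w * torusT y) h.out) dθ) ∧
    (∀ y, Integrable (unipIntegrand ψ (thetaLift ψ dθ c φ₁ φ₂ f) (torusT y))
      (dx.prod (dx.prod dx))) ∧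
    Integrable (fun y : RightCosets ratIdeles => besselIntegrand ψ dx
      (fun y => (μ y : ℂ) * ((adeleAbs y ^ (-(1 / 2) : ℝ) : ℝ) : ℂ)) 1
      (thetaLift ψ dθ c φ₁ φ₂ f) y.out) dc ∧
    (∀ h, Integrable (fun a : RightCosets ratIdeles =>
      zetaIntegrand φ₁ h (fun a => (μ a : ℂ)) a.out) dc) ∧
    (∀ h, Integrable (fun a : RightCosets ratIdeles =>
      zetaIntegrand φ₂ h (fun a => ((μ a)⁻¹ : ℂˣ) * (adeleAbs a : ℂ)) a.out) dc) ∧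
    Integrable (fun h : RightCosets torusD.range =>
      unfoldedIntegrand dc φ₁ φ₂ f μ h.out) dm ∧
    -- and the two sides agree
    besselSplit ψ dx dc (fun y => (μ y : ℂ) * ((adeleAbs y ^ (-(1 / 2) : ℝ) : ℝ) : ℂ)) 1
        (thetaLift ψ dθ c φ₁ φ₂ f)
      = ∫ h, unfoldedIntegrand dc φ₁ φ₂ f μ h.out ∂dm := by
  have hφ₁' := hφ₁.isDecaying
  have hφ₂' := hφ₂.isDecaying
  have hf' := isRapid_of_mem hf
  have hκ₁ := isModerate_charFst hμ_cont hμ_rat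
  have hκ₂ := isModerate_charSnd hμ_cont hμ_rat
  -- Fourier coefficient, unfolding along the orbit and fibring over `D(𝔸)` are combined into one
  -- formula for the Bessel integrand.
  have hbessel : ∀ y, besselIntegrand ψ dx
      (fun y => (μ y : ℂ) * ((adeleAbs y ^ (-(1 / 2) : ℝ) : ℝ) : ℂ)) 1
      (thetaLift ψ dθ c φ₁ φ₂ f) y = besselUnfolded da dh f φ₁ φ₂ (charFst μ) y := fun y => by
    rw [besselIntegrand, mul_one,
      unipCoeff_eq hdθ hχ hφ₁' hφ₂' hf' hψ_cont hψ_ne hψ_rat hc dx y,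
      thetaCoeff_eq_unfolded da hdθ hχ hφ₁' hφ₂' hf' y]
    rfl
  have hbm : Measurable (besselUnfolded da dh f φ₁ φ₂ (charFst μ)) :=
    measurable_besselUnfolded da hχ hφ₁' hφ₂' hf' hκ₁.continuous
  have hbinv : ∀ (q : ratIdeles) y, besselUnfolded da dh f φ₁ φ₂ (charFst μ) (q * y) =
      besselUnfolded da dh f φ₁ φ₂ (charFst μ) y := besselUnfolded_rat_mul da hφ₁' hκ₁
  -- The integral over `D(𝔸)\H₁(𝔸)` becomes a weighted integral over `H₁(𝔸)`, the form in which the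
  -- two sides are compared.
  have hw := eq_map_withDensity_of_quotient hdm (measurable_weight da) (lintegral_weight da)
  have hum : Measurable fun h : H1 => unfoldedProduct da f φ₁ φ₂ (charFst μ) (charSnd μ) h.rep :=
    measurable_unfoldedProduct_rep da hχ hφ₁' hφ₂' hf' hκ₁.continuous hκ₂.continuous
  have huinv : ∀ (γ : torusD.range) (h : H1),
      unfoldedProduct da f φ₁ φ₂ (charFst μ) (charSnd μ) (H1.rep (γ * h)) =
        unfoldedProduct da f φ₁ φ₂ (charFst μ) (charSnd μ) h.rep := by
    rintro ⟨_, b, rfl⟩ h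
    exact unfoldedProduct_torusD_mul hdc hχ hφ₁' hφ₂' hμ_cont hμ_rat b h
  have hunf : ∀ h, unfoldedIntegrand dc φ₁ φ₂ f μ h =
      unfoldedProduct da f φ₁ φ₂ (charFst μ) (charSnd μ) h.rep :=
    unfoldedIntegrand_eq hdc hφ₁' hφ₂' hμ_cont hμ_rat
  refine ⟨integrable_thetaIntegrand hdθ hχ hφ₁' hφ₂' hf' ψ hc,
    integrable_unipIntegrand hdθ hχ hφ₁' hφ₂' hf' hψ_cont hψ_rat hc dx, ?_, fun h => ?_, fun h => ?_, ?_, ?_⟩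
  · simp only [hbessel]
    exact (hdc.integrable_iff_integrableOn_posIdeles hbm hbinv).2
      (integrableOn_besselUnfolded da hχ hφ₁' hφ₂' hf' hκ₁ hκ₂ charFst_mul_mul_charSnd)
  · simp only [zetaIntegrand_fst]
    exact integrable_torus hdc hφ₁' hκ₁ h
  · simp only [zetaIntegrand_snd]
    exact integrable_torus hdc hφ₂' hκ₂ h
  · simp only [hunf]
    rw [hw]
    exact (integrable_map_rmk_iff (measurable_weight da) (weight_lt_top da) hum huinv).2
      (integrable_weight_smul_unfoldedProduct da hχ hφ₁' hφ₂' hf' hκ₁ hκ₂)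
  · simp only [besselSplit, hbessel, hunf]
    rw [hdc.integral_eq_setIntegral_posIdeles hbm hbinv,
      integral_besselUnfolded da hχ hφ₁' hφ₂' hf' hκ₁ hκ₂ charFst_mul_mul_charSnd]
    rw [hw]
    exact (integral_map_rmk (measurable_weight da) (weight_lt_top da) hum huinv).symm
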